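/- Let $M_\bullet$ be a semi-simplicial monoid acting semi-simplicially from the right on a semi-simplicial set $X_\bullet$. Write $|-|$ for the geometric realisation of semi-simplicial sets and spaces (no degeneracies are used), and let $X_\bullet/\!\!/M_\bullet$ be the semi-simplicial space whose space of $p$-simplices is the geometric realisation of the simplicial bar construction $B(X_p,M_p,*)$ with $q$-simplices $X_p\times M_p^q$. Put $BM_\bullet=*_\bullet/\!\!/M_\bullet$, where $*_\bullet$ is the semi-simplicial point. There are maps $X_\bullet\to X_\bullet/\!\!/M_\bullet$ (inclusion of bar degree $0$) and $X_\bullet/\!\!/M_\bullet\to BM_\bullet$ (induced by $X_\bullet\to *_\bullet$), and the composite $|X_\bullet|\to|BM_\bullet|$ factors as $|X_\bullet|\to|{*_\bullet}|\xrightarrow{\,j\,}|BM_\bullet|$, where $j$ is the inclusion of bar degree $0$ of $BM_\bullet$. Suppose that the semi-simplicial sets underlying $M_\bullet$ and $X_\bullet$ admit degeneracies, i.e. each is isomorphic to the semi-simplicial set underlying some simplicial set (no compatibility with the monoid structure or the action is required). Suppose also that $M_\bullet$ acts on $X_\bullet$ by equivalences: there is a continuous map $\mu\colon|X_\bullet|\times|M_\bullet|\to|X_\bullet|$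 whose composite with the map $|X_\bullet\times M_\bullet|\to|X_\bullet|\times|M_\bullet|$ induced by the projections is homotopic to the realisation of the action $X_\bullet\times M_\bullet\to X_\bullet$, and such that $\mu(-,m)\colon|X_\bullet|\to|X_\bullet|$ is a weak homotopy equivalence for every $m\in|M_\bullet|$. (As $|X_\bullet\times M_\bullet|\to|X_\bullet|\times|M_\bullet|$ is a homotopy equivalence when $X_\bullet$ and $M_\bullet$ admit degeneracies, $\mu$ is, up to homotopy, the realised action precomposed with a homotopy inverse of this map.) Then $$|X_\bullet|\longrightarrow|X_\bullet/\!\!/M_\bullet|\longrightarrow|BM_\bullet|$$ is a quasi-fibration sequence in the sense of a homotopy fibre sequence: the space $|{*_\bullet}|$ is contractible; for every $b\in|BM_\bullet|$ the map $j$ is homotopic to the constant map at $b$; and for every $b\in|BM_\bullet|$ and every homotopy $H$ from $j$ to the constant map at $b$, the map induced by $H$ from $|X_\bullet|$ to the homotopy fibre of $|X_\bullet/\!\!/M_\bullet|\to|BM_\bullet|$ at $b$ is a weak homotopy equivalence. -/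

import Mathlib

open CategoryTheory Opposite Topology

universe u

namespace SemiSimp

/-! ### Weak homotopy equivalences and homotopy fibres -/

section Homotopy

open scoped unitInterval Topology.Homotopy

variable {X Y Z : Type u} [TopologicalSpace X] [TopologicalSpace Y] [TopologicalSpace Z]

/-- The map on sets of path components induced by a continuous map. -/
def zerothHomotopyMap (f : C(X, Y)) : ZerothHomotopy X → ZerothHomotopy Y :=
  ZerothHomotopy.lift (fun x => ZerothHomotopy.mk (f x))
    (fun _ _ p => ZerothHomotopy.sound (p.map f.continuous))

/-- The map on generalised loops induced by a continuous map. -/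
def genLoopMap (f : C(X, Y)) (n : ℕ) (x : X) (p : GenLoop (Fin n) X x) :
    GenLoop (Fin n) Y (f x) :=
  ⟨f.comp p.1, fun y hy => congrArg f (p.2 y hy)⟩

/-- The map `π_n(X, x) → π_n(Y, f x)` induced by a continuous map `f : X → Y`. -/
def homotopyGroupMap (f : C(X, Y)) (n : ℕ) (x : X) :
    HomotopyGroup.Pi n X x → HomotopyGroup.Pi n Y (f x) :=
  Quotient.map (genLoopMap f n x) (fun _ _ h => ContinuousMap.HomotopicRel.comp_continuousMap h f)

/-- A weak homotopy equivalence: a bijection on path components and on all homotopy groups at all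
base points. -/
structure IsWeakEquiv (f : C(X, Y)) : Prop where
  bijective_zerothHomotopy : Function.Bijective (zerothHomotopyMap f)
  bijective_homotopyGroup : ∀ (n : ℕ) (x : X), Function.Bijective (homotopyGroupMap f n x)

/-- The homotopy fibre of `p : X → Y` at `b`: pairs of a point `e` of `X` and a path in `Y` from
`p e` to `b`, topologised as a subspace of the product of `X` with the path space of `Y`
(compact-open topology). -/
def HoFibre (p : C(X, Y)) (b : Y) : Type u :=
  {z : X × C(I, Y) // z.2 0 = p z.1 ∧ z.2 1 = b}

instance (p : C(X, Y)) (b : Y) : TopologicalSpace (HoFibre p b) :=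
  inferInstanceAs (TopologicalSpace {z : X × C(I, Y) // z.2 0 = p z.1 ∧ z.2 1 = b})

variable {F T : Type u} [TopologicalSpace F] [TopologicalSpace T]

/-- Given a commutative square `p ∘ i = j ∘ c` and a homotopy `H` from `j` to the constant map with
value `b`, the induced map from `F` to the homotopy fibre of `p` at `b`; it sends `x` to the
pair of the point `i x` and the path `s ↦ H (s, c x)`. -/
def toHoFibre (i : C(F, X)) (p : C(X, Y)) (c : C(F, T)) (j : C(T, Y))
    (comm : p.comp i = j.comp c) (b : Y) (H : j.Homotopy (ContinuousMap.const T b)) :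
    C(F, HoFibre p b) :=
  let γ : C(T, C(I, Y)) := (H.toContinuousMap.comp ContinuousMap.prodSwap).curry
  { toFun := fun x => ⟨(i x, γ (c x)),
      (H.apply_zero (c x)).trans (DFunLike.congr_fun comm x).symm, H.apply_one (c x)⟩
    continuous_toFun := (i.continuous.prodMk (γ.continuous.comp c.continuous)).subtype_mk _ }

end Homotopy

/-! ### Semi-simplicial objects and geometric realisation -/

/-- Semi-simplicial sets. -/
abbrev SemiSSet := SemiSimplexCategoryᵒᵖ ⥤ Type u

/-- Semi-simplicial monoids. -/
abbrev SemiMon := SemiSimplexCategoryᵒᵖ ⥤ MonCat.{u}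

/-- Semi-simplicial spaces. -/
abbrev SemiTop := SemiSimplexCategoryᵒᵖ ⥤ TopCat.{u}

/-- The disjoint union of the spaces `S_n × Δ^n`. -/
abbrev PreRealisation (S : SemiTop.{u}) : Type u :=
  Σ n : SemiSimplexCategory, S.obj (op n) × stdSimplex ℝ (Fin (n.len + 1))

/-- The gluing relation of the geometric realisation: `(f^* x, t) ∼ (x, f_* t)`. -/
inductive RealisationRel (S : SemiTop.{u}) : PreRealisation S → PreRealisation S → Prop
  | glue {m n : SemiSimplexCategory} (f : m ⟶ n) (x : S.obj (op n))
      (t : stdSimplex ℝ (Fin (m.len + 1))) :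
      RealisationRel S ⟨m, (S.map f.op x, t)⟩
        ⟨n, (x, stdSimplex.map (SemiSimplexCategory.homEquiv f) t)⟩

/-- The geometric realisation of a semi-simplicial space, with the quotient topology. -/
def Realisation (S : SemiTop.{u}) : Type u := Quot (RealisationRel S)

instance (S : SemiTop.{u}) : TopologicalSpace (Realisation S) :=
  inferInstanceAs (TopologicalSpace (Quot (RealisationRel S)))

/-- The map on realisations induced by a map of semi-simplicial spaces. -/
def Realisation.map {S T : SemiTop.{u}} (g : S ⟶ T) : C(Realisation S, Realisation T) where
  toFun := Quot.map (fun z => ⟨z.1, (g.app (op z.1) z.2.1, z.2.2)⟩) (by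
    rintro _ _ ⟨f, x, t⟩
    have h : g.app _ (S.map f.op x) = T.map f.op (g.app _ x) := by
      rw [← ConcreteCategory.comp_apply, g.naturality, ConcreteCategory.comp_apply]
    simp only [h]
    exact RealisationRel.glue f (g.app _ x) t)
  continuous_toFun := by
    refine continuous_quot_lift _ (continuous_quot_mk.comp ?_)
    refine continuous_sigma fun n => continuous_sigmaMk.comp ?_
    exact ((g.app (op n)).hom.continuous.comp continuous_fst).prodMk continuous_snd

lemma Realisation.map_comp {S T U : SemiTop.{u}} (g : S ⟶ T) (h : T ⟶ U) :
    (Realisation.map h).comp (Realisation.map g) = Realisation.map (g ≫ h) := by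
  ext z
  obtain ⟨z, rfl⟩ := Quot.exists_rep z
  rfl

/-- A semi-simplicial set, regarded as a levelwise discrete semi-simplicial space. -/
abbrev disc (X : SemiSSet.{u}) : SemiTop.{u} := X ⋙ TopCat.discrete

/-- The map of levelwise discrete semi-simplicial spaces induced by a semi-simplicial map. -/
abbrev discMap {X Y : SemiSSet.{u}} (f : X ⟶ Y) : disc X ⟶ disc Y :=
  Functor.whiskerRight f TopCat.discrete

/-- A semi-simplicial set admits degeneracies if it is isomorphic to the underlying semi-simplicial
set of a simplicial set. -/
def AdmitsDegeneracies (X : SemiSSet.{u}) : Prop :=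
  ∃ Y : SSet.{u}, Nonempty (SemiSimplexCategory.toSimplexCategory.op ⋙ Y ≅ X)

/-- The underlying semi-simplicial set of a semi-simplicial monoid. -/
abbrev SemiMon.under (M : SemiMon.{u}) : SemiSSet.{u} := M ⋙ forget MonCat.{u}

/-- The levelwise product of two semi-simplicial sets. -/
def prod (X Y : SemiSSet.{u}) : SemiSSet.{u} where
  obj n := X.obj n × Y.obj n
  map f := ↾(fun z => (X.map f z.1, Y.map f z.2))

/-- The first projection. -/
def fst (X Y : SemiSSet.{u}) : prod X Y ⟶ X where
  app n := ↾(fun z : X.obj n × Y.obj n => z.1)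

/-- The second projection. -/
def snd (X Y : SemiSSet.{u}) : prod X Y ⟶ Y where
  app n := ↾(fun z : X.obj n × Y.obj n => z.2)

/-- The semi-simplicial point, a singleton in every degree. -/
def point : SemiSSet.{u} := (Functor.const _).obj PUnit

/-- The unique map to the semi-simplicial point. -/
def toPoint (X : SemiSSet.{u}) : X ⟶ point where
  app _ := ↾(fun _ => PUnit.unit)

/-! ### Actions -/

/-- A right action of a monoid on a set. -/
structure RightAct (X M : Type u) [Monoid M] where
  act : X → M → X
  act_one : ∀ x, act x 1 = x
  act_mul : ∀ x a b, act x (a * b) = act (act x a) b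

/-- A semi-simplicial right action of a semi-simplicial monoid on a semi-simplicial set. -/
structure Action (X : SemiSSet.{u}) (M : SemiMon.{u}) where
  level : ∀ n, RightAct (X.obj n) (M.obj n)
  map_act : ∀ {n m} (f : n ⟶ m) (x : X.obj n) (a : M.obj n),
    X.map f ((level n).act x a) = (level m).act (X.map f x) (M.map f a)

/-- The trivial action on the semi-simplicial point. -/
def trivialAction (M : SemiMon.{u}) : Action point M where
  level _ :=
    { act := fun x _ => x
      act_one := fun _ => rfl
      act_mul := fun _ _ _ => rfl }
  map_act _ _ _ := rfl

/-- The action as a map of semi-simplicial sets `X × M → X`. -/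
def Action.hom {X : SemiSSet.{u}} {M : SemiMon.{u}} (A : Action X M) : prod X M.under ⟶ X where
  app n := ↾(fun z : X.obj n × M.obj n => (A.level n).act z.1 z.2)
  naturality n m f := by
    ext z
    exact (A.map_act f z.1 z.2).symm

/-- The map `|X × Y| → |X| × |Y|` induced by the two projections. -/
def prodComparison (X Y : SemiSSet.{u}) :
    C(Realisation (disc (prod X Y)), Realisation (disc X) × Realisation (disc Y)) :=
  (Realisation.map (discMap (fst X Y))).prodMk (Realisation.map (discMap (snd X Y)))

/-- `μ : |X| × |M| → |X|` is an action map on realisations if its composite with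
`|X × M| → |X| × |M|` is homotopic to the realisation of the action `X × M → X`. If `X` and `M`
admit degeneracies then `|X × M| → |X| × |M|` is a homotopy equivalence, so such a `μ` is the same,
up to homotopy, as the realised action precomposed with a homotopy inverse of that map. -/
def Action.IsActionMap {X : SemiSSet.{u}} {M : SemiMon.{u}} (A : Action X M)
    (μ : C(Realisation (disc X) × Realisation (disc M.under), Realisation (disc X))) : Prop :=
  (μ.comp (prodComparison X M.under)).Homotopic (Realisation.map (discMap A.hom))

/-- `M` acts on `X` by equivalences: for an action map `μ` on realisations, `μ(-, m)` is a weak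
homotopy equivalence for every point `m` of `|M|`. -/
def Action.ByEquivalences {X : SemiSSet.{u}} {M : SemiMon.{u}} (A : Action X M) : Prop :=
  ∃ μ : C(Realisation (disc X) × Realisation (disc M.under), Realisation (disc X)), A.IsActionMap μ ∧
    ∀ m : Realisation (disc M.under),
      IsWeakEquiv (μ.comp ((ContinuousMap.id _).prodMk (ContinuousMap.const _ m)))

/-! ### The bar construction -/

section Bar

/-- For a string `m = (m_1, …, m_q)`, the product `m_{a+1} ⋯ m_b`, for `a ≤ b ≤ q`. -/
def seg {M : Type u} [Monoid M] {q : ℕ} (m : Fin q → M) (a b : ℕ) : M :=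
  (((List.ofFn m).take b).drop a).prod

variable {M N : Type u} [Monoid M] [Monoid N]

lemma seg_self {q : ℕ} (m : Fin q → M) (a : ℕ) : seg m a a = 1 := by
  simp [seg]

lemma seg_succ {q : ℕ} (m : Fin q → M) {a b : ℕ} (h : a ≤ b) (hb : b < q) :
    seg m a (b + 1) = seg m a b * m ⟨b, hb⟩ := by
  have hb' : b < (List.ofFn m).length := by simpa using hb
  unfold seg
  rw [List.take_succ_eq_append_getElem hb', List.drop_append_of_le_length (by simp; omega)]
  simp

lemma seg_mul {q : ℕ} (m : Fin q → M) {a b c : ℕ} (h : a ≤ b) (h' : b ≤ c) (hc : c ≤ q) :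
    seg m a b * seg m b c = seg m a c := by
  induction c, h' using Nat.le_induction with
  | base => simp [seg_self]
  | succ c hbc ih =>
    rw [seg_succ m hbc (by omega), seg_succ m (h.trans hbc) (by omega), ← mul_assoc,
      ih (by omega)]

lemma seg_map (φ : M →* N) {q : ℕ} (m : Fin q → M) (a b : ℕ) :
    seg (fun i => φ (m i)) a b = φ (seg m a b) := by
  simp [seg, map_list_prod, List.map_drop, List.map_take, List.map_ofFn, Function.comp_def]

/-- The effect of an order-preserving map `θ : [r] → [q]` on strings: the `i`-th entry of the result
is the product of the `m_j` with `θ (i - 1) < j ≤ θ i`. -/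
def barStr {q r : ℕ} (θ : Fin (r + 1) →o Fin (q + 1)) (m : Fin q → M) : Fin r → M :=
  fun i => seg m (θ i.castSucc) (θ i.succ)

lemma seg_barStr {q r : ℕ} (θ : Fin (r + 1) →o Fin (q + 1)) (m : Fin q → M)
    (a b : Fin (r + 1)) (h : a ≤ b) : seg (barStr θ m) a b = seg m (θ a) (θ b) := by
  obtain ⟨a, ha⟩ := a
  obtain ⟨b, hb⟩ := b
  have h' : a ≤ b := h
  clear h
  induction b, h' using Nat.le_induction with
  | base => simp [seg_self]
  | succ b hab ih =>
    have e := ih (by omega)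
    simp only at e ⊢
    rw [seg_succ _ hab (by omega), e]
    refine seg_mul m (θ.monotone ?_) (θ.monotone ?_) (Nat.le_of_lt_succ (θ _).2)
    · exact hab
    · exact Nat.le_succ b

/-- The bar construction `B(X, M, *)`: the simplicial set with `q`-simplices `X × M^q` and
`d_0 (x, m_1, …, m_q) = (x m_1, m_2, …, m_q)`,
`d_i (x, m_1, …, m_q) = (x, m_1, …, m_i m_{i+1}, …, m_q)` for `0 < i < q`,
`d_q (x, m_1, …, m_q) = (x, m_1, …, m_{q-1})`, and degeneracies inserting units. -/
def bar {X : Type u} (R : RightAct X M) : SSet.{u} where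
  obj q := X × (Fin q.unop.len → M)
  map {q r} θ := ↾(fun z : X × (Fin q.unop.len → M) =>
    ((R.act z.1 (seg z.2 0 (θ.unop.toOrderHom 0)), barStr θ.unop.toOrderHom z.2) :
      X × (Fin r.unop.len → M)))
  map_id q := by
    refine ConcreteCategory.hom_ext _ _ fun (z : X × (Fin q.unop.len → M)) => ?_
    refine Prod.ext ?_ ?_
    · exact (congrArg (R.act z.1) (seg_self z.2 0)).trans (R.act_one z.1)
    · funext i
      change seg z.2 (i : ℕ) ((i : ℕ) + 1) = z.2 i
      rw [seg_succ z.2 le_rfl i.2, seg_self, one_mul]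
  map_comp {q r s} θ ψ := by
    refine ConcreteCategory.hom_ext _ _ fun (z : X × (Fin q.unop.len → M)) => ?_
    refine Prod.ext ?_ ?_
    · change R.act z.1 (seg z.2 0 (θ.unop.toOrderHom (ψ.unop.toOrderHom 0))) =
        R.act (R.act z.1 (seg z.2 0 (θ.unop.toOrderHom 0)))
          (seg (barStr θ.unop.toOrderHom z.2) ((0 : Fin (r.unop.len + 1)) : ℕ)
            (ψ.unop.toOrderHom 0))
      rw [seg_barStr _ _ _ _ (Fin.zero_le _), ← R.act_mul,
        seg_mul _ (Nat.zero_le _) (θ.unop.toOrderHom.monotone (Fin.zero_le _))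
          (Nat.le_of_lt_succ (Fin.is_lt _))]
    · funext i
      change seg z.2 (θ.unop.toOrderHom (ψ.unop.toOrderHom i.castSucc))
        (θ.unop.toOrderHom (ψ.unop.toOrderHom i.succ)) =
          seg (barStr θ.unop.toOrderHom z.2) (ψ.unop.toOrderHom i.castSucc)
            (ψ.unop.toOrderHom i.succ)
      rw [seg_barStr _ _ _ _ (ψ.unop.toOrderHom.monotone (Fin.castSucc_lt_succ).le)]

/-- The map of bar constructions induced by a map of sets and a compatible map of monoids. -/
def barMap {X Y : Type u} (R : RightAct X M) (S : RightAct Y N) (f : X → Y) (φ : M →* N)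
    (h : ∀ x a, f (R.act x a) = S.act (f x) (φ a)) : bar R ⟶ bar S where
  app q := ↾(fun z : X × (Fin q.unop.len → M) =>
    ((f z.1, fun i => φ (z.2 i)) : Y × (Fin q.unop.len → N)))
  naturality q r θ := by
    ext z
    refine Prod.ext ?_ ?_
    · change f (R.act _ _) = S.act (f z.1) (seg (fun i => φ (z.2 i)) _ _)
      rw [h, seg_map]
    · funext i
      change φ (seg _ _ _) = seg (fun i => φ (z.2 i)) _ _
      rw [seg_map]

end Bar

/-! ### The homotopy quotient -/

/-- The semi-simplicial object in simplicial sets `p ↦ B(X_p, M_p, *)`. -/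
def levelBar {X : SemiSSet.{u}} {M : SemiMon.{u}} (A : Action X M) :
    SemiSimplexCategoryᵒᵖ ⥤ SSet.{u} where
  obj n := bar (A.level n)
  map f := barMap _ _ (fun x => X.map f x) (M.map f).hom (A.map_act f)
  map_id n := by
    ext q z
    refine Prod.ext ?_ ?_
    · change X.map (𝟙 n) z.1 = z.1
      simp
    · funext i
      change M.map (𝟙 n) (z.2 i) = z.2 i
      simp
  map_comp f g := by
    ext q z
    refine Prod.ext ?_ ?_
    · change X.map (f ≫ g) z.1 = X.map g (X.map f z.1)
      simp
    · funext i
      change M.map (f ≫ g) (z.2 i) = M.map g (M.map f (z.2 i))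
      simp

/-- The homotopy quotient `X // M`: the semi-simplicial space whose space of `p`-simplices is the
geometric realisation of the bar construction `B(X_p, M_p, *)`. -/
noncomputable def hoQuot {X : SemiSSet.{u}} {M : SemiMon.{u}} (A : Action X M) : SemiTop.{u} :=
  levelBar A ⋙ SSet.toTop

/-- `BM`, the homotopy quotient of the semi-simplicial point. -/
noncomputable abbrev B (M : SemiMon.{u}) : SemiTop.{u} := hoQuot (trivialAction M)

/-- The map `X // M → BM` induced by `X → *`. -/
noncomputable def hoQuotToB {X : SemiSSet.{u}} {M : SemiMon.{u}} (A : Action X M) : hoQuot A ⟶ B M :=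
  Functor.whiskerRight
    { app := fun n => barMap (A.level n) ((trivialAction M).level n)
        (fun x => (toPoint X).app n x) (MonoidHom.id _) (fun _ _ => rfl)
      naturality := fun _ _ _ => rfl } SSet.toTop

/-- The point of the geometric realisation of a simplicial set given by a vertex. -/
noncomputable def vertex (K : SSet.{u}) (v : K.obj (op (SimplexCategory.mk 0))) :
    SSet.toTop.obj K :=
  TopCat.toSSetObj₀Equiv ((sSetTopAdj.unit.app K).app (op (SimplexCategory.mk 0)) v)

lemma map_vertex {K L : SSet.{u}} (g : K ⟶ L) (v : K.obj (op (SimplexCategory.mk 0))) :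
    SSet.toTop.map g (vertex K v) = vertex L (g.app _ v) := by
  have h := ConcreteCategory.congr_hom
    (NatTrans.congr_app (sSetTopAdj.unit.naturality g) (op (SimplexCategory.mk 0))) v
  exact (congrArg TopCat.toSSetObj₀Equiv h).symm

/-- The point of `|B(X, M, *)|` given by the vertex `x ∈ X = B_0(X, M, *)`. -/
noncomputable def barVertex {X M : Type u} [Monoid M] (R : RightAct X M) (x : X) :
    SSet.toTop.obj (bar R) :=
  vertex (bar R) ((x, Fin.elim0) : X × (Fin 0 → M))

lemma map_barVertex {X Y M N : Type u} [Monoid M] [Monoid N] (R : RightAct X M)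
    (S : RightAct Y N) (f : X → Y) (φ : M →* N) (h : ∀ x a, f (R.act x a) = S.act (f x) (φ a))
    (x : X) : SSet.toTop.map (barMap R S f φ h) (barVertex R x) = barVertex S (f x) := by
  refine (map_vertex _ _).trans (congrArg (vertex (bar S)) ?_)
  exact Prod.ext (α := Y) (β := Fin 0 → N) rfl (Subsingleton.elim _ _)

/-- The inclusion `X → X // M` of the vertices of the bar constructions. -/
noncomputable def inclQuot {X : SemiSSet.{u}} {M : SemiMon.{u}} (A : Action X M) : disc X ⟶ hoQuot A where
  app n := TopCat.ofHom (X := TopCat.discrete.obj (X.obj n))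
    { toFun := fun x => barVertex (A.level n) x
      continuous_toFun := continuous_of_discreteTopology (α := TopCat.discrete.obj (X.obj n)) }
  naturality n m f := by
    ext x
    exact (map_barVertex (A.level n) (A.level m) (fun x => X.map f x) (M.map f).hom
      (A.map_act f) x).symm

lemma incl_comp_toB {X : SemiSSet.{u}} {M : SemiMon.{u}} (A : Action X M) :
    inclQuot A ≫ hoQuotToB A = discMap (toPoint X) ≫ inclQuot (trivialAction M) := by
  ext n x
  exact map_barVertex (A.level n) ((trivialAction M).level n) (fun x => (toPoint X).app n x)
    (MonoidHom.id _) (fun _ _ => rfl) x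

/-- `|X| → |X // M|`, the realisation of `X → X // M`. -/
noncomputable def fibreIncl {X : SemiSSet.{u}} {M : SemiMon.{u}} (A : Action X M) :
    C(Realisation (disc X), Realisation (hoQuot A)) :=
  Realisation.map (inclQuot A)

/-- `|X // M| → |BM|`, the realisation of `X // M → BM`. -/
noncomputable def quotProj {X : SemiSSet.{u}} {M : SemiMon.{u}} (A : Action X M) :
    C(Realisation (hoQuot A), Realisation (B M)) :=
  Realisation.map (hoQuotToB A)

/-- `|X| → |*|`, the realisation of `X → *`. -/
def collapse (X : SemiSSet.{u}) : C(Realisation (disc X), Realisation (disc point.{u})) :=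
  Realisation.map (discMap (toPoint X))

/-- `|*| → |BM|`, the map `|X| → |X // M|` for the trivial action on `X = *`. -/
noncomputable def pointIncl (M : SemiMon.{u}) :
    C(Realisation (disc point.{u}), Realisation (B M)) :=
  fibreIncl (trivialAction M)

/-- The composite `|X| → |X // M| → |BM|` agrees with `|X| → |*| → |BM|`. -/
lemma square_comm {X : SemiSSet.{u}} {M : SemiMon.{u}} (A : Action X M) :
    (quotProj A).comp (fibreIncl A) = (pointIncl M).comp (collapse X) := by
  simp only [quotProj, fibreIncl, pointIncl, collapse]
  rw [Realisation.map_comp, Realisation.map_comp, incl_comp_toB]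

/-- The map from `|X|` to the homotopy fibre of `|X // M| → |BM|` at `b` determined by a homotopy
`H` from `|*| → |BM|` to the constant map at `b`. -/
noncomputable def fibreComparison {X : SemiSSet.{u}} {M : SemiMon.{u}} (A : Action X M)
    (b : Realisation (B M)) (H : (pointIncl M).Homotopy (ContinuousMap.const _ b)) :
    C(Realisation (disc X), HoFibre (quotProj A) b) :=
  toHoFibre (fibreIncl A) (quotProj A) (collapse X) (pointIncl M) (square_comm A) b H

end SemiSimp

/-!
Write `‖-‖` for the realisation of semi-simplicial spaces and `Z` for the bi-semi-simplicial set
`(p, q) ↦ X_p × M_p^q`. The space `|X // M|` is obtained from `Z` by realising first in the direction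
`q` as a simplicial set and then in the direction `p`. The homotopy fibre of `|X // M| → |BM|` is
found by realising in the other order.

* For a simplicial set `K` the map `‖K‖ → |K|` which collapses degenerate simplices is a weak
  equivalence (`weakEq_geom`, by induction over skeleta). A levelwise weak equivalence of
  semi-simplicial spaces induces a weak equivalence of realisations (`Realisation.weakEq_map`), and
  the two ways of realising `Z` agree (`Realisation.swap`). So `|X // M| → |BM|` may be replaced by
  the realisation of the map of semi-simplicial spaces `q ↦ (‖X × M^q‖ → ‖M^q‖)`.
* If the face maps of a map of semi-simplicial spaces `E → B` induce weak equivalences of the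
  levelwise homotopy fibres, then the homotopy fibres of `E_n → B_n` and `‖E‖ → ‖B‖` agree
  (`Realisation.weakEq_map_slice`).
* As `X` and `M` admit degeneracies, the homotopy fibre of `‖X × M^q‖ → ‖M^q‖` is `‖X‖`
  (`Realisation.weakEq_prodFibre`). In terms of this identification a face map of the direction `q`
  is the action of a semi-simplicial point `* → M` on `‖X‖` (`fibreMap_stringFibre`), which is a weak
  equivalence by hypothesis (`weakEq_actBy`). Degeneracies need not commute with multiplication, so
  that products of degenerate vertices need not be degenerate; this is why the identification is
  stated for arbitrary semi-simplicial points of `M^q`.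
* For `q = 0` this gives the weak equivalence from `|X|` to the homotopy fibre of `|X // M| → |BM|`
  (`weakEq_quotFibre`) for the null-homotopy which contracts `|*|`. Another null-homotopy differs from
  it by transport along a path in `|BM|` (`weakEq_fibreComparison`).

Weak equivalences are handled through the lifting property `WeakEq` for the pairs `(I^n, ∂I^n)`, up to
a homotopy relative to `∂I^n`. It is local on the target (`weakEq_of_cover`), and in a relative form
the same holds for maps of homotopy fibres (`HoFibre.weakEqOn_inside`): this makes the statements on
realisations local. A realisation is covered by the open sets of points `[x, t]` such that no partial
sum of `t` lies in a given finite set of numbers in `(0, 1)`, and each of the clopen pieces of such a set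
is weakly equivalent to the space of simplices of one dimension.
-/

namespace SemiSimp

open scoped unitInterval

/-! ### Cubes and homotopy extension -/

/-- The `n`-dimensional unit cube. -/
abbrev Cub (n : ℕ) := Fin n → I

/-- The boundary of the `n`-dimensional unit cube. -/
abbrev bd (n : ℕ) : Set (Cub n) := Cube.boundary (Fin n)

lemma isClosed_bd (n : ℕ) : IsClosed (bd n) := by
  have : bd n = ⋃ i : Fin n, {y : Cub n | y i = 0 ∨ y i = 1} := by
    ext y; simp [Cube.boundary]
  rw [this]
  refine isClosed_iUnion_of_finite fun i => ?_
  exact (isClosed_eq (continuous_apply i) continuous_const).union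
    (isClosed_eq (continuous_apply i) continuous_const)

/-- A closed subset `A` of `K` such that `K × I` retracts onto `K × {0} ∪ A × I`. -/
def IsCofib {K : Type*} [TopologicalSpace K] (A : Set K) : Prop :=
  IsClosed A ∧ ∃ r : C(K × I, K × I), (∀ z, (r z).2 = 0 ∨ (r z).1 ∈ A) ∧
    (∀ x, r (x, 0) = (x, 0)) ∧ ∀ x ∈ A, ∀ t, r (x, t) = (x, t)

/-- The homotopy extension property, for homotopies given as partially continuous functions. -/
lemma IsCofib.extend_on {K T : Type*} [TopologicalSpace K] [TopologicalSpace T] {A : Set K}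
    (hA : IsCofib A) (F : K × I → T) (hF : ContinuousOn F {z | z.2 = 0 ∨ z.1 ∈ A}) :
    ∃ H : C(K × I, T), (∀ x, H (x, 0) = F (x, 0)) ∧ ∀ x ∈ A, ∀ t, H (x, t) = F (x, t) := by
  obtain ⟨-, r, h1, h2, h3⟩ := hA
  refine ⟨⟨fun z => F (r z), ?_⟩, fun x => ?_, fun x hx t => ?_⟩
  · rw [← continuousOn_univ]
    exact hF.comp r.continuous.continuousOn fun z _ => h1 z
  · simp [h2]
  · simp [h3 x hx]

lemma continuousOn_dite {K T : Type*} [TopologicalSpace K] [TopologicalSpace T] {A : Set K}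
    [∀ x, Decidable (x ∈ A)] (f : A → T) (g : K → T) (hf : Continuous f) :
    ContinuousOn (fun x => if h : x ∈ A then f ⟨x, h⟩ else g x) A := by
  rw [continuousOn_iff_continuous_domRestrict]
  convert hf using 1
  ext ⟨x, hx⟩
  simp [hx]

/-- The homotopy extension property. -/
lemma IsCofib.extend {K T : Type*} [TopologicalSpace K] [TopologicalSpace T] {A : Set K}
    (hA : IsCofib A) (c : C(K, T)) (h : C(A × I, T)) (h0 : ∀ x : A, h (x, 0) = c x) :
    ∃ H : C(K × I, T), (∀ x, H (x, 0) = c x) ∧ ∀ (x : A) (t : I), H (x, t) = h (x, t) := by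
  classical
  let F : K × I → T := fun z => if hz : z.1 ∈ A then h (⟨z.1, hz⟩, z.2) else c z.1
  have hF0 : ∀ x, F (x, 0) = c x := fun x => by
    by_cases hx : x ∈ A
    · simp [F, hx, h0]
    · simp [F, hx]
  have hF : ContinuousOn F ({z | z.2 = 0} ∪ {z | z.1 ∈ A}) := by
    refine ContinuousOn.union_of_isClosed ?_ ?_ (isClosed_eq continuous_snd continuous_const)
      (hA.1.preimage continuous_fst)
    · refine ContinuousOn.congr (f := fun z => c z.1) (by fun_prop) ?_
      rintro ⟨x, t⟩ ht
      obtain rfl : t = 0 := ht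
      exact hF0 x
    · exact continuousOn_dite (A := {z : K × I | z.1 ∈ A})
        (fun z => h (⟨z.1.1, z.2⟩, z.1.2)) (fun z => c z.1) (by fun_prop)
  obtain ⟨H, hH0, hH1⟩ := hA.extend_on F hF
  refine ⟨H, fun x => (hH0 x).trans (hF0 x), fun x t => ?_⟩
  rw [hH1 x x.2]
  simp [F]

lemma IsCofib.of_homeo {K L : Type*} [TopologicalSpace K] [TopologicalSpace L] (e : K ≃ₜ L)
    {A : Set K} {B : Set L} (hAB : ∀ x, e x ∈ B ↔ x ∈ A) (hA : IsCofib A) : IsCofib B := by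
  obtain ⟨h0, r, h1, h2, h3⟩ := hA
  have hB : ∀ y, e.symm y ∈ A ↔ y ∈ B := fun y => by rw [← hAB]; simp
  refine ⟨?_, ⟨fun z => (e (r (e.symm z.1, z.2)).1, (r (e.symm z.1, z.2)).2), by fun_prop⟩,
    fun z => ?_, fun x => ?_, fun x hx t => ?_⟩
  · convert h0.preimage e.symm.continuous using 1
    ext y; exact (hB y).symm
  · exact (h1 (e.symm z.1, z.2)).imp id (hAB _).2
  · simp [h2]
  · simp [h3 _ ((hB x).2 hx)]

/-- The boundary of a cube is a cofibration: project radially from a point above the centre. -/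
lemma isCofib_bd (n : ℕ) : IsCofib (bd n) := by
  let y : Cub n → Fin n → ℝ := fun x i => 2 * (x i : ℝ) - 1
  have hyc : Continuous y := by fun_prop
  let M : Cub n × I → ℝ := fun z => max ‖y z.1‖ ((2 - (z.2 : ℝ)) / 2)
  have hMc : Continuous M := by fun_prop
  have hM0 : ∀ z, 1 / 2 ≤ M z := fun z => le_max_of_le_right (by have := z.2.2.2; linarith)
  have hM0' : ∀ z, M z ≠ 0 := fun z => by have := hM0 z; linarith
  have hy1 : ∀ x i, |y x i| ≤ 1 := fun x i => by
    have h1 := (x i).2.1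
    have h2 := (x i).2.2
    rw [abs_le]; constructor <;> simp only [y] <;> linarith
  have hyn : ∀ x, ‖y x‖ ≤ 1 := fun x => (pi_norm_le_iff_of_nonneg zero_le_one).2 (hy1 x)
  have hM1 : ∀ z, M z ≤ 1 := fun z => max_le (hyn _) (by have := z.2.2.1; linarith)
  have hyM : ∀ z i, |y z.1 i| ≤ M z := fun z i => (norm_le_pi_norm (y z.1) i).trans (le_max_left _ _)
  have hbd : ∀ x ∈ bd n, ‖y x‖ = 1 := by
    rintro x ⟨i, hi⟩
    refine le_antisymm (hyn x) ?_
    refine le_trans ?_ (norm_le_pi_norm (y x) i)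
    rcases hi with hi | hi <;> simp [y, hi]; norm_num
  refine ⟨isClosed_bd n, ⟨fun z => (fun i => ⟨(y z.1 i / M z + 1) / 2, ?_, ?_⟩,
    ⟨2 - (2 - (z.2 : ℝ)) / M z, ?_, ?_⟩), ?_⟩, ?_, ?_, ?_⟩
  · have := (abs_le.1 (hyM z i)).1
    have h := hM0 z
    have : -1 ≤ y z.1 i / M z := by rw [le_div_iff₀ (by linarith)]; linarith
    linarith
  · have := (abs_le.1 (hyM z i)).2
    have h := hM0 z
    have : y z.1 i / M z ≤ 1 := by rw [div_le_iff₀ (by linarith)]; linarith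
    linarith
  · have h := hM0 z
    have : (2 - (z.2 : ℝ)) / M z ≤ 2 := by
      rw [div_le_iff₀ (by linarith)]
      have : (2 - (z.2 : ℝ)) / 2 ≤ M z := le_max_right _ _
      linarith
    linarith
  · have h := hM0 z
    have h2 := z.2.2.1
    have h3 := z.2.2.2
    have : 2 - (z.2 : ℝ) ≤ (2 - (z.2 : ℝ)) / M z := by
      rw [le_div_iff₀ (by linarith)]
      have := hM1 z
      nlinarith
    linarith
  · refine Continuous.prodMk (continuous_pi fun i => Continuous.subtype_mk ?_ _)
      (Continuous.subtype_mk ?_ _)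
    · exact ((((continuous_apply i).comp (hyc.comp continuous_fst)).div₀ hMc hM0').add_const 1).div_const 2
    · exact continuous_const.sub ((continuous_const.sub (by fun_prop)).div₀ hMc hM0')
  · intro z
    rcases le_total ‖y z.1‖ ((2 - (z.2 : ℝ)) / 2) with h | h
    · left
      have hM : M z = (2 - (z.2 : ℝ)) / 2 := max_eq_right h
      have h2 : (2 : ℝ) - z.2 ≠ 0 := by have := z.2.2.2; linarith
      ext
      change 2 - (2 - (z.2 : ℝ)) / M z = 0
      rw [hM]
      field_simp
      ring
    · right
      have hM : M z = ‖y z.1‖ := max_eq_left h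
      have hpos : 0 < ‖y z.1‖ := by have := hM0 z; rw [hM] at this; linarith
      have : ∃ i, |y z.1 i| = ‖y z.1‖ := by
        by_contra hne
        push Not at hne
        have : ‖y z.1‖ < ‖y z.1‖ := (pi_norm_lt_iff hpos).2 fun i =>
          lt_of_le_of_ne (norm_le_pi_norm (y z.1) i) (hne i)
        exact lt_irrefl _ this
      obtain ⟨i, hi⟩ := this
      refine ⟨i, ?_⟩
      rcases le_total 0 (y z.1 i) with h0 | h0
      · right
        rw [abs_of_nonneg h0] at hi
        ext
        change (y z.1 i / M z + 1) / 2 = 1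
        rw [hM, hi, div_self hpos.ne']
        norm_num
      · left
        rw [abs_of_nonpos h0] at hi
        ext
        change (y z.1 i / M z + 1) / 2 = 0
        rw [hM, ← hi, div_neg, div_self]
        · norm_num
        · intro h; rw [h] at hi; simp at hi; exact hpos.ne hi
  · intro x
    have hM : M (x, 0) = 1 := by
      simp only [M]; rw [max_eq_right]
      · norm_num
      · have := hyn x; simpa using this
    refine Prod.ext (funext fun i => Subtype.ext ?_) (Subtype.ext ?_)
    · change (y x i / M (x, 0) + 1) / 2 = x i
      rw [hM]; simp only [y]; ring
    · change 2 - (2 - ((0 : I) : ℝ)) / M (x, 0) = ((0 : I) : ℝ)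
      rw [hM]; simp
  · intro x hx t
    have hM : M (x, t) = 1 := by
      simp only [M]; rw [max_eq_left, hbd x hx]
      rw [hbd x hx]; have := t.2.1; linarith
    refine Prod.ext (funext fun i => Subtype.ext ?_) (Subtype.ext ?_)
    · change (y x i / M (x, t) + 1) / 2 = x i
      rw [hM]; simp only [y]; ring
    · change 2 - (2 - (t : ℝ)) / M (x, t) = t
      rw [hM]; simp

/-- Splitting off the first coordinate of a cube. -/
def cubSplit (n : ℕ) : Cub (n + 1) ≃ₜ Cub n × I where
  toFun x := (fun i => x i.succ, x 0)
  invFun z := Fin.cons z.2 z.1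
  left_inv x := by ext i; refine Fin.cases ?_ (fun i => ?_) i <;> simp
  right_inv z := by ext i <;> simp
  continuous_toFun := by fun_prop
  continuous_invFun := by
    refine continuous_pi fun i => ?_
    refine Fin.cases ?_ (fun i => ?_) i
    · simpa using continuous_snd
    · simp only [Fin.cons_succ]; fun_prop

/-- The boundary of `Cub n × I`. -/
def bdI (n : ℕ) : Set (Cub n × I) := {z | z.1 ∈ bd n ∨ z.2 = 0 ∨ z.2 = 1}

lemma cubSplit_mem {n : ℕ} (x : Cub (n + 1)) : cubSplit n x ∈ bdI n ↔ x ∈ bd (n + 1) := by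
  constructor
  · rintro (⟨i, hi⟩ | h)
    · exact ⟨i.succ, hi⟩
    · exact ⟨0, h⟩
  · rintro ⟨i, hi⟩
    revert hi
    refine Fin.cases (fun h => Or.inr h) (fun i h => Or.inl ⟨i, h⟩) i

lemma isCofib_bdI (n : ℕ) : IsCofib (bdI n) :=
  (isCofib_bd (n + 1)).of_homeo (cubSplit n) cubSplit_mem

/-! ### Concatenation -/

/-- `t ↦ 2t`, truncated. -/
noncomputable def dbl (t : I) : I := Set.projIcc 0 1 zero_le_one (2 * (t : ℝ))

/-- `t ↦ 2t - 1`, truncated. -/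
noncomputable def dbl' (t : I) : I := Set.projIcc 0 1 zero_le_one (2 * (t : ℝ) - 1)

@[fun_prop] lemma continuous_dbl : Continuous dbl := continuous_projIcc.comp (by fun_prop)
@[fun_prop] lemma continuous_dbl' : Continuous dbl' := continuous_projIcc.comp (by fun_prop)

@[simp] lemma dbl_zero : dbl 0 = 0 := by
  simp [dbl]
@[simp] lemma dbl_one : dbl 1 = 1 := by
  rw [dbl, Set.projIcc_of_right_le]; rfl; norm_num
@[simp] lemma dbl'_zero : dbl' 0 = 0 := by
  rw [dbl', Set.projIcc_of_le_left]; rfl; norm_num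
@[simp] lemma dbl'_one : dbl' 1 = 1 := by
  rw [dbl', Set.projIcc_of_right_le]; rfl; norm_num
lemma dbl_of_le {t : I} (h : (1 : ℝ) / 2 ≤ t) : dbl t = 1 := by
  rw [dbl, Set.projIcc_of_right_le]; rfl; linarith
lemma dbl'_of_le {t : I} (h : (t : ℝ) ≤ 1 / 2) : dbl' t = 0 := by
  rw [dbl', Set.projIcc_of_le_left]; rfl; linarith

section Cat

variable {A T T' : Type*} [TopologicalSpace A] [TopologicalSpace T] [TopologicalSpace T']

/-- Concatenation of two homotopies. -/
noncomputable def cat (h₁ h₂ : C(A × I, T)) (H : ∀ x, h₁ (x, 1) = h₂ (x, 0)) : C(A × I, T) where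
  toFun z := if (z.2 : ℝ) ≤ 1 / 2 then h₁ (z.1, dbl z.2) else h₂ (z.1, dbl' z.2)
  continuous_toFun := by
    refine Continuous.if_le (by fun_prop) (by fun_prop) (by fun_prop) (by fun_prop) ?_
    intro z hz
    rw [dbl_of_le hz.ge, dbl'_of_le hz.le, H]

variable {h₁ h₂ : C(A × I, T)} (H : ∀ x, h₁ (x, 1) = h₂ (x, 0))

lemma cat_of_le (x : A) {t : I} (h : (t : ℝ) ≤ 1 / 2) : cat h₁ h₂ H (x, t) = h₁ (x, dbl t) := by
  simp only [cat, ContinuousMap.coe_mk]; rw [if_pos h]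

lemma cat_of_ge (x : A) {t : I} (h : (1 : ℝ) / 2 ≤ t) : cat h₁ h₂ H (x, t) = h₂ (x, dbl' t) := by
  simp only [cat, ContinuousMap.coe_mk]
  split_ifs with h'
  · rw [dbl_of_le h, dbl'_of_le h', H]
  · rfl

@[simp] lemma cat_zero (x : A) : cat h₁ h₂ H (x, 0) = h₁ (x, 0) := by
  rw [cat_of_le H x (by norm_num)]; simp

@[simp] lemma cat_one (x : A) : cat h₁ h₂ H (x, 1) = h₂ (x, 1) := by
  rw [cat_of_ge H x (by norm_num)]; simp

lemma cat_cases {A' : Type*} [TopologicalSpace A'] {k₁ k₂ : C(A' × I, T')}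
    (K : ∀ x, k₁ (x, 1) = k₂ (x, 0)) {x : A} {x' : A'} (R : T → T' → Prop)
    (h1 : ∀ t, R (h₁ (x, t)) (k₁ (x', t))) (h2 : ∀ t, R (h₂ (x, t)) (k₂ (x', t))) (t : I) :
    R (cat h₁ h₂ H (x, t)) (cat k₁ k₂ K (x', t)) := by
  rcases le_total (t : ℝ) (1 / 2) with h | h
  · rw [cat_of_le H x h, cat_of_le K x' h]; exact h1 _
  · rw [cat_of_ge H x h, cat_of_ge K x' h]; exact h2 _

lemma cat_mem {x : A} (R : T → Prop)
    (h1 : ∀ t, R (h₁ (x, t))) (h2 : ∀ t, R (h₂ (x, t))) (t : I) : R (cat h₁ h₂ H (x, t)) :=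
  cat_cases H H (x := x) (x' := x) (fun a _ => R a) h1 h2 t

/-- The reverse of a homotopy. -/
def rev (h : C(A × I, T)) : C(A × I, T) := ⟨fun z => h (z.1, σ z.2), by fun_prop⟩

@[simp] lemma rev_apply (h : C(A × I, T)) (x : A) (t : I) : rev h (x, t) = h (x, σ t) := rfl

end Cat

section Solve

variable {X Y Z W T P K : Type*} [TopologicalSpace X] [TopologicalSpace Y] [TopologicalSpace Z]
  [TopologicalSpace W] [TopologicalSpace T] [TopologicalSpace P] [TopologicalSpace K]

lemma mem_bdI_zero {n : ℕ} (x : Cub n) : (x, (0 : I)) ∈ bdI n := Or.inr (Or.inl rfl)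
lemma mem_bdI_one {n : ℕ} (x : Cub n) : (x, (1 : I)) ∈ bdI n := Or.inr (Or.inr rfl)
lemma mem_bdI_side {n : ℕ} (x : bd n) (t : I) : (x.1, t) ∈ bdI n := Or.inl x.2

/-- A family of maps on the boundary of `Cub n × I` is given by its restrictions to the bottom, the
top and the sides. -/
lemma bdI_glue {n : ℕ} (c₀ c₁ : C(Cub n × P, T)) (ζ : C((bd n × I) × P, T))
    (h₀ : ∀ x p, ζ ((x, 0), p) = c₀ (x, p)) (h₁ : ∀ x p, ζ ((x, 1), p) = c₁ (x, p)) :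
    ∃ b : C(bdI n × P, T), (∀ x p, b (⟨(x, 0), mem_bdI_zero x⟩, p) = c₀ (x, p)) ∧
      (∀ x p, b (⟨(x, 1), mem_bdI_one x⟩, p) = c₁ (x, p)) ∧
      ∀ (x : bd n) t p, b (⟨(x, t), mem_bdI_side x t⟩, p) = ζ ((x, t), p) := by
  classical
  let F : bdI n × P → T := fun z =>
    if h : z.1.1.1 ∈ bd n then ζ ((⟨z.1.1.1, h⟩, z.1.1.2), z.2)
    else if z.1.1.2 = 0 then c₀ (z.1.1.1, z.2) else c₁ (z.1.1.1, z.2)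
  have F0 : ∀ x p, F (⟨(x, 0), mem_bdI_zero x⟩, p) = c₀ (x, p) := fun x p => by
    by_cases hx : x ∈ bd n
    · simp only [F, dif_pos hx, h₀]
    · simp only [F, dif_neg hx, if_true]
  have F1 : ∀ x p, F (⟨(x, 1), mem_bdI_one x⟩, p) = c₁ (x, p) := fun x p => by
    by_cases hx : x ∈ bd n
    · simp only [F, dif_pos hx, h₁]
    · simp only [F, dif_neg hx, one_ne_zero, if_false]
  have Fs : ∀ (x : bd n) t p, F (⟨(x, t), mem_bdI_side x t⟩, p) = ζ ((x, t), p) := fun x t p => by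
    simp only [F, dif_pos x.2]
  refine ⟨⟨F, ?_⟩, F0, F1, Fs⟩
  have hA : ContinuousOn F {z | z.1.1.1 ∈ bd n} :=
    continuousOn_dite (A := {z : bdI n × P | z.1.1.1 ∈ bd n})
      (fun z => ζ ((⟨z.1.1.1.1, z.2⟩, z.1.1.1.2), z.1.2)) _ (by fun_prop)
  have hB : ContinuousOn F {z | z.1.1.2 = 0} := by
    refine ContinuousOn.congr (f := fun z => c₀ (z.1.1.1, z.2)) (by fun_prop) ?_
    rintro ⟨⟨⟨x, t⟩, h⟩, p⟩ ht
    obtain rfl : t = 0 := ht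
    exact F0 x p
  have hC : ContinuousOn F {z | z.1.1.2 = 1} := by
    refine ContinuousOn.congr (f := fun z => c₁ (z.1.1.1, z.2)) (by fun_prop) ?_
    rintro ⟨⟨⟨x, t⟩, h⟩, p⟩ ht
    obtain rfl : t = 1 := ht
    exact F1 x p
  have cB : IsClosed {z : bdI n × P | z.1.1.2 = 0} := isClosed_eq (by fun_prop) (by fun_prop)
  have cC : IsClosed {z : bdI n × P | z.1.1.2 = 1} := isClosed_eq (by fun_prop) (by fun_prop)
  have cA : IsClosed {z : bdI n × P | z.1.1.1 ∈ bd n} := (isClosed_bd n).preimage (by fun_prop)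
  rw [← continuousOn_univ]
  refine ContinuousOn.mono (hA.union_of_isClosed (hB.union_of_isClosed hC cB cC) cA (cB.union cC)) ?_
  rintro ⟨⟨z, h | h | h⟩, p⟩ -
  · exact Or.inl h
  · exact Or.inr (Or.inl h)
  · exact Or.inr (Or.inr h)

/-- Homotopy extension for `Cub n × I` relative to its boundary. -/
lemma fill₃ {n : ℕ} (ξ : C(Cub n × I, T)) (β₀ β₁ : C(Cub n × I, T)) (θ : C((bd n × I) × I, T))
    (h₀ : ∀ x, β₀ (x, 0) = ξ (x, 0)) (h₁ : ∀ x, β₁ (x, 0) = ξ (x, 1))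
    (h : ∀ x t, θ ((x, t), 0) = ξ (x, t)) (k₀ : ∀ x u, θ ((x, 0), u) = β₀ (x, u))
    (k₁ : ∀ x u, θ ((x, 1), u) = β₁ (x, u)) :
    ∃ ξ' : C((Cub n × I) × I, T), (∀ z, ξ' (z, 0) = ξ z) ∧ (∀ x u, ξ' ((x, 0), u) = β₀ (x, u)) ∧
      (∀ x u, ξ' ((x, 1), u) = β₁ (x, u)) ∧
      ∀ (x : bd n) t u, ξ' ((x, t), u) = θ ((x, t), u) := by
  obtain ⟨b, b0, b1, bs⟩ := bdI_glue β₀ β₁ θ k₀ k₁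
  obtain ⟨ξ', e0, e1⟩ := (isCofib_bdI n).extend ξ b (by
    rintro ⟨⟨x, t⟩, hx | hx | hx⟩
    · exact (bs ⟨x, hx⟩ t 0).trans (h _ _)
    · obtain rfl : t = 0 := hx
      exact (b0 x 0).trans (h₀ x)
    · obtain rfl : t = 1 := hx
      exact (b1 x 0).trans (h₁ x))
  exact ⟨ξ', e0, fun x u => (e1 _ u).trans (b0 x u), fun x u => (e1 _ u).trans (b1 x u),
    fun x t u => (e1 _ u).trans (bs x t u)⟩

/-- A homotopy on a cube can be changed on the sides along a homotopy of the sides. -/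
lemma fill {n : ℕ} (ξ : C(Cub n × I, T)) (θ : C((bd n × I) × I, T))
    (h : ∀ x t, θ ((x, t), 0) = ξ (x, t)) (k₀ : ∀ x u, θ ((x, 0), u) = ξ (x, 0))
    (k₁ : ∀ x u, θ ((x, 1), u) = ξ (x, 1)) :
    ∃ ξ' : C(Cub n × I, T), (∀ x, ξ' (x, 0) = ξ (x, 0)) ∧ (∀ x, ξ' (x, 1) = ξ (x, 1)) ∧
      ∀ (x : bd n) t, ξ' (x, t) = θ ((x, t), 1) := by
  obtain ⟨ξ', e0, e1, e2, e3⟩ := fill₃ ξ ⟨fun z => ξ (z.1, 0), by fun_prop⟩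
    ⟨fun z => ξ (z.1, 1), by fun_prop⟩ θ (fun _ => rfl) (fun _ => rfl) h k₀ k₁
  exact ⟨⟨fun z => ξ' (z, 1), by fun_prop⟩, fun x => e1 x 1, fun x => e2 x 1, fun x t => e3 x t 1⟩

/-- A solution of the lifting problem `(a, c)` for `f` relative to `A`: an extension of `a` to `K`
together with a homotopy relative to `A` from `c` to its image. -/
def Solv (A : Set K) (f : C(X, Y)) (a : C(A, X)) (c : C(K, Y)) : Prop :=
  ∃ (a' : C(K, X)) (L : C(K × I, Y)), (∀ x : A, a' x = a x) ∧ (∀ x, L (x, 0) = c x) ∧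
    (∀ x, L (x, 1) = f (a' x)) ∧ ∀ (x : A) t, L (x, t) = c x

/-- A solution of the lifting problem `(a, c)` for `f` up to a homotopy of problems. -/
def Free (A : Set K) (f : C(X, Y)) (a : C(A, X)) (c : C(K, Y)) : Prop :=
  ∃ (a' : C(K, X)) (k : C(A × I, X)) (L : C(K × I, Y)), (∀ x, k (x, 0) = a x) ∧
    (∀ x : A, k (x, 1) = a' x) ∧ (∀ x, L (x, 0) = c x) ∧ (∀ x, L (x, 1) = f (a' x)) ∧
    ∀ (x : A) t, L (x, t) = f (k (x, t))

/-- Weak homotopy equivalences, characterised by lifting problems for cubes; see `WeakEq.isWeakEquiv`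
and `IsWeakEquiv.weakEq`. The cube of dimension `0` accounts for surjectivity on path components. -/
def WeakEq (f : C(X, Y)) : Prop :=
  ∀ n (a : C(bd n, X)) (c : C(Cub n, Y)), (∀ x, f (a x) = c x) → Solv (bd n) f a c

lemma Solv.free {A : Set K} {f : C(X, Y)} {a : C(A, X)} {c : C(K, Y)} (h : ∀ x, f (a x) = c x)
    (H : Solv A f a c) : Free A f a c := by
  obtain ⟨a', L, h1, h2, h3, h4⟩ := H
  exact ⟨a', ⟨fun z => a z.1, by fun_prop⟩, L, fun _ => rfl, fun x => (h1 x).symm, h2, h3,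
    fun x t => (h4 x t).trans (h x).symm⟩

/-- Whether a problem has a free solution depends only on its homotopy class. -/
lemma Free.of_homotopy {A : Set K} {f : C(X, Y)} {a a₁ : C(A, X)} {c c₁ : C(K, Y)}
    (H : Free A f a₁ c₁) (k : C(A × I, X)) (L : C(K × I, Y)) (k0 : ∀ x, k (x, 0) = a x)
    (k1 : ∀ x, k (x, 1) = a₁ x) (L0 : ∀ x, L (x, 0) = c x) (L1 : ∀ x, L (x, 1) = c₁ x)
    (hL : ∀ (x : A) t, L (x, t) = f (k (x, t))) : Free A f a c := by
  obtain ⟨a', k', L', h1, h2, h3, h4, h5⟩ := H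
  refine ⟨a', cat k k' fun x => (k1 x).trans (h1 x).symm,
    cat L L' fun x => (L1 x).trans (h3 x).symm, ?_, ?_, ?_, ?_, ?_⟩
  · simpa using k0
  · simpa using h2
  · simpa using L0
  · simpa using h4
  · intro x t
    exact cat_cases _ _ (fun y x => y = f x) (hL x) (h5 x) t

/-- A homotopy of the boundary values extends to a homotopy of problems. -/
lemma Free.of_homotopy_bd {A : Set K} (hA : IsCofib A) {f : C(X, Y)} {a a₁ : C(A, X)} {c : C(K, Y)}
    (k : C(A × I, X)) (k0 : ∀ x, k (x, 0) = a x) (k1 : ∀ x, k (x, 1) = a₁ x)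
    (h : ∀ x, f (a x) = c x)
    (H : ∀ c₁ : C(K, Y), (∀ x, f (a₁ x) = c₁ x) → Free A f a₁ c₁) : Free A f a c := by
  obtain ⟨L, L0, L1⟩ := hA.extend c (f.comp k) (fun x => by simp [k0, h])
  refine (H ⟨fun x => L (x, 1), by fun_prop⟩ fun x => ?_).of_homotopy k L k0 k1 L0
    (fun _ => rfl) L1
  simp [L1, k1]

/-- The path `t ↦ 2t` up to `1`, followed by its reverse. -/
noncomputable def tent (t : I) : I := dbl t * σ (dbl' t)

@[fun_prop] lemma continuous_tent : Continuous tent := by unfold tent; fun_prop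
@[simp] lemma tent_zero : tent 0 = 0 := by simp [tent]
@[simp] lemma tent_one : tent 1 = 0 := by simp [tent]
lemma tent_of_le {t : I} (h : (t : ℝ) ≤ 1 / 2) : tent t = dbl t := by
  simp [tent, dbl'_of_le h]
lemma tent_of_ge {t : I} (h : (1 : ℝ) / 2 ≤ t) : tent t = σ (dbl' t) := by
  simp [tent, dbl_of_le h]

/-- Free solutions can be made relative to the boundary. -/
lemma Free.solv {n : ℕ} {f : C(X, Y)} {a : C(bd n, X)} {c : C(Cub n, Y)}
    (h : ∀ x, f (a x) = c x) (H : Free (bd n) f a c) : Solv (bd n) f a c := by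
  obtain ⟨a', k, L, h1, h2, h3, h4, h5⟩ := H
  obtain ⟨k', e0, e1⟩ := (isCofib_bd n).extend a' (rev k) (fun x => by simp [h2])
  have H : ∀ x, L (x, 1) = (f.comp k') (x, 0) := fun x => by simp [h4, e0]
  obtain ⟨ξ, f0, f1, f2⟩ := fill (cat L (f.comp k') H)
    ⟨fun z => f (k (z.1.1, tent z.1.2 * σ z.2)), by fun_prop⟩
    (by
        intro x t
        rcases le_total (t : ℝ) (1 / 2) with ht | ht
        · rw [cat_of_le _ _ ht, h5]; simp [tent_of_le ht]
        · rw [cat_of_ge _ _ ht]; simp [tent_of_ge ht, e1])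
    (by
        intro x u
        simp [h3, h1, h])
    (by
        intro x u
        simp [e1])
  refine ⟨⟨fun x => k' (x, 1), by fun_prop⟩, ξ, fun x => ?_, fun x => ?_, fun x => ?_,
    fun x t => ?_⟩
  · simp [e1, h1]
  · simp [f0, h3]
  · simp [f1]
  · simp [f2, h1, h]

lemma WeakEq.of_free {f : C(X, Y)} (H : ∀ n (a : C(bd n, X)) (c : C(Cub n, Y)),
    (∀ x, f (a x) = c x) → Free (bd n) f a c) : WeakEq f :=
  fun n a c h => (H n a c h).solv h

/-- Weak equivalences solve problems on all pairs homeomorphic to a cube and its boundary. -/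
lemma WeakEq.solv_of_homeo {f : C(X, Y)} (hf : WeakEq f) {n : ℕ} (e : Cub n ≃ₜ K) {A : Set K}
    (he : ∀ x, e x ∈ A ↔ x ∈ bd n) (a : C(A, X)) (c : C(K, Y)) (h : ∀ x, f (a x) = c x) :
    Solv A f a c := by
  have he' : ∀ x, e.symm x ∈ bd n ↔ x ∈ A := fun x => by rw [← he]; simp
  obtain ⟨a', L, h1, h2, h3, h4⟩ := hf n ⟨fun x => a ⟨e x, (he x).2 x.2⟩, by fun_prop⟩
    ⟨fun x => c (e x), by fun_prop⟩ (fun x => h _)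
  refine ⟨⟨fun x => a' (e.symm x), by fun_prop⟩, ⟨fun z => L (e.symm z.1, z.2), by fun_prop⟩,
    fun x => ?_, fun x => ?_, fun x => ?_, fun x t => ?_⟩
  · simpa using h1 ⟨e.symm x, (he' x).2 x.2⟩
  · simp [h2]
  · simp [h3]
  · simpa using h4 ⟨e.symm x, (he' x).2 x.2⟩ t

lemma WeakEq.solvI {f : C(X, Y)} (hf : WeakEq f) {n : ℕ} (a : C(bdI n, X)) (c : C(Cub n × I, Y))
    (h : ∀ x, f (a x) = c x) : Solv (bdI n) f a c :=
  hf.solv_of_homeo (cubSplit n) cubSplit_mem a c h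

/-- Homotopies lift along a weak equivalence, relative to their ends and sides. -/
lemma WeakEq.lift_homotopy {f : C(X, Y)} (hf : WeakEq f) {n : ℕ} (c₀ c₁ : C(Cub n, X))
    (ζ : C(bd n × I, X)) (L : C(Cub n × I, Y)) (z0 : ∀ x, ζ (x, 0) = c₀ x)
    (z1 : ∀ x, ζ (x, 1) = c₁ x) (L0 : ∀ x, L (x, 0) = f (c₀ x)) (L1 : ∀ x, L (x, 1) = f (c₁ x))
    (hL : ∀ (x : bd n) t, L (x, t) = f (ζ (x, t))) :
    ∃ (ξ : C(Cub n × I, X)) (Λ : C((Cub n × I) × I, Y)), (∀ x, ξ (x, 0) = c₀ x) ∧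
      (∀ x, ξ (x, 1) = c₁ x) ∧ (∀ (x : bd n) t, ξ (x, t) = ζ (x, t)) ∧ (∀ z, Λ (z, 0) = L z) ∧
      (∀ z, Λ (z, 1) = f (ξ z)) ∧ ∀ z ∈ bdI n, ∀ u, Λ (z, u) = L z := by
  obtain ⟨b, b0, b1, bs⟩ := bdI_glue (P := Unit) ⟨fun z => c₀ z.1, by fun_prop⟩
    ⟨fun z => c₁ z.1, by fun_prop⟩ ⟨fun z => ζ z.1, by fun_prop⟩ (fun x _ => z0 x) (fun x _ => z1 x)
  obtain ⟨ξ, Λ, h1, h2, h3, h4⟩ := hf.solvI ⟨fun z => b (z, ()), by fun_prop⟩ L (by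
    rintro ⟨⟨x, t⟩, hx | hx | hx⟩
    · exact (congrArg f (bs ⟨x, hx⟩ t ())).trans (hL ⟨x, hx⟩ t).symm
    · obtain rfl : t = 0 := hx
      exact (congrArg f (b0 x ())).trans (L0 x).symm
    · obtain rfl : t = 1 := hx
      exact (congrArg f (b1 x ())).trans (L1 x).symm)
  exact ⟨ξ, Λ, fun x => (h1 ⟨_, mem_bdI_zero x⟩).trans (b0 x ()),
    fun x => (h1 ⟨_, mem_bdI_one x⟩).trans (b1 x ()),
    fun x t => (h1 ⟨_, mem_bdI_side x t⟩).trans (bs x t ()), h2, h3, fun z hz u => h4 ⟨z, hz⟩ u⟩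

/-- The associated path fibration of a weak equivalence has the lifting property for cubes. -/
lemma WeakEq.path_lift {f : C(X, Y)} (hf : WeakEq f) {n : ℕ} (x : C(bd n, X)) (y : C(Cub n, Y))
    (ζ : C(bd n × I, Y)) (z0 : ∀ w, ζ (w, 0) = y w) (z1 : ∀ w, ζ (w, 1) = f (x w)) :
    ∃ (x' : C(Cub n, X)) (ξ : C(Cub n × I, Y)), (∀ w : bd n, x' w = x w) ∧
      (∀ w, ξ (w, 0) = y w) ∧ (∀ w, ξ (w, 1) = f (x' w)) ∧
      ∀ (w : bd n) t, ξ (w, t) = ζ (w, t) := by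
  obtain ⟨ζ', e0, e1⟩ := (isCofib_bd n).extend y ζ z0
  obtain ⟨x', L, h1, h2, h3, h4⟩ := hf n x ⟨fun w => ζ' (w, 1), by fun_prop⟩
    (fun w => by simp [e1, z1])
  have H : ∀ w, ζ' (w, 1) = L (w, 0) := fun w => (h2 w).symm
  obtain ⟨ξ, f0, f1, f2⟩ := fill (cat ζ' L H)
    ⟨fun z => ζ (z.1.1, dbl z.1.2 ⊓ (z.1.2 ⊔ σ z.2)), by fun_prop⟩
    (by
        intro w t
        rcases le_total (t : ℝ) (1 / 2) with ht | ht
        · rw [cat_of_le _ _ ht]; simp [e1, unitInterval.le_one']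
        · rw [cat_of_ge _ _ ht, h4]; simp [e1, dbl_of_le ht, unitInterval.le_one'])
    (by
        intro w u
        simp [e0, z0])
    (by
        intro w u
        simp [h3, h1, z1])
  refine ⟨x', ξ, h1, fun w => ?_, fun w => ?_, fun w t => ?_⟩
  · simp [f0, e0]
  · simp [f1, h3]
  · have : t ≤ dbl t := by
      rw [← Subtype.coe_le_coe, dbl, Set.coe_projIcc]
      have h1 := t.2.1
      have h2 := t.2.2
      exact le_max_of_le_right (le_min h2 (by linarith))
    simp [f2, inf_eq_right.2 this]

lemma WeakEq.comp {g : C(Y, Z)} {f : C(X, Y)} (hg : WeakEq g) (hf : WeakEq f) :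
    WeakEq (g.comp f) := by
  intro n a c h
  obtain ⟨b, L, h1, h2, h3, h4⟩ := hg n (f.comp a) c h
  obtain ⟨a', L', k1, k2, k3, k4⟩ := hf n a b (fun x => (h1 x).symm)
  refine ⟨a', cat L (g.comp L') fun x => by simp [h3, k2], k1, ?_, ?_, ?_⟩
  · simp [h2]
  · simp [k3]
  · intro x t
    refine cat_mem _ (fun y => y = c x) (h4 x) (fun t => ?_) t
    simp [k4, h1, ← h]

/-- If `g ∘ f` and `h ∘ g` are weak equivalences then so is `f`. -/
lemma WeakEq.of_comp_comp {f : C(X, Y)} {g : C(Y, Z)} {h : C(Z, W)} (hgf : WeakEq (g.comp f))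
    (hhg : WeakEq (h.comp g)) : WeakEq f := by
  intro n a c hac
  obtain ⟨a', L, h1, h2, h3, h4⟩ := hgf n a (g.comp c) (fun x => by simp [hac])
  obtain ⟨ξ, -, e0, e1, e2, -⟩ := hhg.lift_homotopy c (f.comp a')
    ⟨fun z => c z.1, by fun_prop⟩ (h.comp L) (fun _ => rfl) (fun x => by simp [h1, hac])
    (fun x => by simp [h2]) (fun x => by simp [h3]) (fun x t => by simp [h4])
  exact ⟨a', ξ, h1, e0, e1, e2⟩

/-- A map is a weak equivalence if it has an inverse up to compatible homotopies. -/
lemma WeakEq.of_inverse {f : C(X, Y)} (r : C(Y, X)) (H : C(Y × I, Y)) (h : C(X × I, X))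
    (H0 : ∀ y, H (y, 0) = y) (H1 : ∀ y, H (y, 1) = f (r y)) (h0 : ∀ x, h (x, 0) = x)
    (h1 : ∀ x, h (x, 1) = r (f x)) (hH : ∀ x t, f (h (x, t)) = H (f x, t)) : WeakEq f :=
  .of_free fun n a c hac => ⟨r.comp c, ⟨fun z => h (a z.1, z.2), by fun_prop⟩,
    ⟨fun z => H (c z.1, z.2), by fun_prop⟩, fun x => by simp [h0], fun x => by simp [h1, hac],
    fun x => by simp [H0], fun x => by simp [H1], fun x t => by simp [hH, hac]⟩

lemma WeakEq.of_homeo (e : X ≃ₜ Y) : WeakEq (e : C(X, Y)) :=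
  .of_inverse e.symm ⟨Prod.fst, continuous_fst⟩ ⟨Prod.fst, continuous_fst⟩ (by simp) (by simp)
    (by simp) (by simp) (by simp)

lemma WeakEq.id : WeakEq (ContinuousMap.id X) := .of_homeo (Homeomorph.refl X)

lemma WeakEq.of_comp {f : C(X, Y)} {g : C(Y, Z)} (hg : WeakEq g) (hgf : WeakEq (g.comp f)) :
    WeakEq f :=
  .of_comp_comp (h := ContinuousMap.id Z) hgf hg

lemma WeakEq.of_homotopy (F : C(X × I, Y)) {f g : C(X, Y)} (hf : WeakEq f)
    (F0 : ∀ x, F (x, 0) = f x) (F1 : ∀ x, F (x, 1) = g x) : WeakEq g := by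
  intro n a c h
  obtain ⟨x', ξ, h1, h2, h3, h4⟩ := hf.path_lift a c ⟨fun z => F (a z.1, σ z.2), by fun_prop⟩
    (fun w => by simp [F1, h]) (fun w => by simp [F0])
  have H : ∀ x, ξ (x, 1) = (F.comp (x'.prodMap (ContinuousMap.id I))) (x, 0) := fun x => by
    simp [h3, F0]
  obtain ⟨ξ', f0, f1, f2⟩ := fill (cat ξ _ H)
    ⟨fun z => F (a z.1.1, σ (tent z.1.2 * σ z.2)), by fun_prop⟩
    (by
        intro x t
        rcases le_total (t : ℝ) (1 / 2) with ht | ht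
        · rw [cat_of_le _ _ ht, h4]; simp [tent_of_le ht]
        · rw [cat_of_ge _ _ ht]; simp [tent_of_ge ht, h1])
    (by
        intro x u
        simp [h2, F1, h])
    (by
        intro x u
        simp [F1, h1])
  refine ⟨x', ξ', h1, fun x => ?_, fun x => ?_, fun x t => ?_⟩
  · simp [f0, h2]
  · simp [f1, F1]
  · simp [f2, F1, h]

lemma WeakEq.of_homotopic {f g : C(X, Y)} (hf : WeakEq f) (H : f.Homotopic g) : WeakEq g := by
  obtain ⟨H⟩ := H
  exact hf.of_homotopy ⟨fun z => H (z.2, z.1), by fun_prop⟩ (by simp) (by simp)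

lemma WeakEq.of_homotopic_inverse {f : C(X, Y)} (g : C(Y, X))
    (h : (ContinuousMap.id X).Homotopic (g.comp f))
    (h' : (ContinuousMap.id Y).Homotopic (f.comp g)) : WeakEq f :=
  .of_comp_comp (WeakEq.id.of_homotopic h) (WeakEq.id.of_homotopic h')

end Solve

section Solve

variable {X Y Z W T P K K' : Type*} [TopologicalSpace X] [TopologicalSpace Y] [TopologicalSpace Z]
  [TopologicalSpace W] [TopologicalSpace T] [TopologicalSpace P] [TopologicalSpace K]
  [TopologicalSpace K']

/-- A map on the boundary of `Cub n × I` can be deformed until it is constant on the bottom and the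
sides: this part of the boundary is a retract of the cube, hence contractible. -/
lemma bdI_contract {n : ℕ} (b : C(bdI n, T)) : ∃ k : C(bdI n × I, T), (∀ z, k (z, 0) = b z) ∧
    ∀ z : bdI n, (z.1.1 ∈ bd n ∨ z.1.2 = 0) → k (z, 1) = b ⟨(0, 0), mem_bdI_zero 0⟩ := by
  obtain ⟨-, r, r1, r2, r3⟩ := isCofib_bd n
  let sc : C((Cub n × I) × I, bdI n) :=
    ⟨fun w => ⟨r (fun i => σ w.2 * w.1.1 i, σ w.2 * w.1.2),
      (r1 _).elim (fun h => Or.inr (Or.inl h)) Or.inl⟩, by fun_prop⟩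
  have sc0 : ∀ x t, ((x, t) ∈ bdI n) → (x ∈ bd n ∨ t = 0) → (sc ((x, t), 0)).1 = (x, t) := by
    rintro x t - (h | rfl)
    · simp [sc, r3 x h]
    · simp [sc, r2]
  have sc1 : ∀ z, sc (z, 1) = ⟨(0, 0), mem_bdI_zero 0⟩ := fun z => Subtype.ext <| by
    simp only [sc, ContinuousMap.coe_mk, unitInterval.symm_one, zero_mul]
    exact r2 _
  obtain ⟨H, H0, H1⟩ := (isCofib_bd n).extend ⟨fun x => b ⟨(x, 1), mem_bdI_one x⟩, by fun_prop⟩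
    ⟨fun w => b (sc ((w.1.1, 1), w.2)), by fun_prop⟩
    (fun x => congrArg b (Subtype.ext (sc0 x.1 1 (mem_bdI_one _) (Or.inl x.2))))
  obtain ⟨k, k0, k1, ks⟩ := bdI_glue (P := I) ⟨fun w => b (sc ((w.1, 0), w.2)), by fun_prop⟩ H
    ⟨fun w => b (sc (w.1.map Subtype.val id, w.2)), by fun_prop⟩ (fun _ _ => rfl)
    (fun x p => (H1 x p).symm)
  refine ⟨k, ?_, ?_⟩
  · rintro ⟨⟨x, t⟩, h | h | h⟩
    · exact (ks ⟨x, h⟩ t 0).trans (congrArg b (Subtype.ext (sc0 _ _ (Or.inl h) (Or.inl h))))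
    · obtain rfl : t = 0 := h
      exact (k0 x 0).trans (congrArg b (Subtype.ext (sc0 _ _ (mem_bdI_zero _) (Or.inr rfl))))
    · obtain rfl : t = 1 := h
      exact (k1 x 0).trans (H0 x)
  · rintro ⟨⟨x, t⟩, h'⟩ (h | h)
    · exact (ks ⟨x, h⟩ t 1).trans (congrArg b (sc1 _))
    · obtain rfl : t = 0 := h
      exact (k0 x 1).trans (congrArg b (sc1 _))

lemma Free.of_homeo (e : K ≃ₜ K') {A : Set K} {A' : Set K'} (he : ∀ x, e x ∈ A' ↔ x ∈ A)
    {f : C(X, Y)} {a : C(A, X)} {c : C(K, Y)}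
    (H : Free A' f ⟨fun x => a ⟨e.symm x, (he _).1 (by simp)⟩, by fun_prop⟩
      ⟨fun x => c (e.symm x), by fun_prop⟩) : Free A f a c := by
  obtain ⟨a', k, L, h1, h2, h3, h4, h5⟩ := H
  refine ⟨⟨fun x => a' (e x), by fun_prop⟩, ⟨fun z => k (⟨e z.1, (he _).2 z.1.2⟩, z.2), by fun_prop⟩,
    ⟨fun z => L (e z.1, z.2), by fun_prop⟩, fun x => ?_, fun x => ?_, fun x => ?_, fun x => ?_,
    fun x t => ?_⟩
  · simp [h1]
  · simp [h2]
  · simp [h3]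
  · simp [h4]
  · simpa using h5 ⟨e x, (he _).2 x.2⟩ t

instance : IsEmpty (bd 0) := ⟨fun x => by obtain ⟨_, i, -⟩ := x; exact i.elim0⟩

/-- To recognise a weak equivalence it suffices to solve problems up to homotopy on the cubes
`Cub n × I`, and to see that it meets every path component. -/
lemma WeakEq.of_freeI {f : C(X, Y)} (H0 : ∀ y, ∃ (x : X) (ω : C(I, Y)), ω 0 = y ∧ ω 1 = f x)
    (H : ∀ n (a : C(bdI n, X)) (c : C(Cub n × I, Y)), (∀ x, f (a x) = c x) → Free (bdI n) f a c) :
    WeakEq f := by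
  refine .of_free fun n a c h => ?_
  cases n with
  | zero =>
    obtain ⟨x, ω, w0, w1⟩ := H0 (c 0)
    exact ⟨.const _ x, ⟨fun z => a z.1, by fun_prop⟩, ⟨fun z => ω z.2, by fun_prop⟩,
      fun x => isEmptyElim x, fun x => isEmptyElim x,
      fun x => w0.trans (congrArg c (Subsingleton.elim _ _)), fun _ => w1, fun x => isEmptyElim x⟩
  | succ n =>
    exact .of_homeo (cubSplit n) cubSplit_mem (H n _ _ fun x => h _)

lemma WeakEq.exists_path {f : C(X, Y)} (hf : WeakEq f) (y : Y) :
    ∃ (x : X) (ω : C(I, Y)), ω 0 = y ∧ ω 1 = f x := by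
  obtain ⟨x, L, -, h2, h3, -⟩ := hf 0 ⟨fun x => isEmptyElim x, continuous_of_const fun x => isEmptyElim x⟩
    (.const _ y) (fun x => isEmptyElim x)
  exact ⟨x 0, ⟨fun t => L (0, t), by fun_prop⟩, h2 0, h3 0⟩

/-- If `f` and `g ∘ f` are weak equivalences then so is `g`. -/
lemma WeakEq.of_comp_left {f : C(X, Y)} {g : C(Y, Z)} (hf : WeakEq f) (hgf : WeakEq (g.comp f)) :
    WeakEq g := by
  refine .of_freeI (fun z => ?_) fun n b c h => ?_
  · obtain ⟨x, ω, h⟩ := hgf.exists_path z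
    exact ⟨f x, ω, h⟩
  -- up to homotopy, `b` lifts along `f`
  obtain ⟨k, k0, k1⟩ := bdI_contract b
  obtain ⟨x₀, ω, w0, w1⟩ := hf.exists_path (b ⟨(0, 0), mem_bdI_zero 0⟩)
  obtain ⟨x', ξ, h1, h2, h3, h4⟩ := hf.path_lift (.const _ x₀)
    ⟨fun w => k (⟨(w, 1), mem_bdI_one w⟩, 1), by fun_prop⟩ ⟨fun w => ω w.2, by fun_prop⟩
    (fun w => w0.trans (k1 ⟨(w, 1), mem_bdI_one _⟩ (Or.inl w.2)).symm) (fun _ => w1)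
  obtain ⟨a, a0, a1, as⟩ := bdI_glue (P := Unit) (.const _ x₀) ⟨fun z => x' z.1, by fun_prop⟩
    (.const _ x₀) (fun _ _ => rfl) (fun x _ => (h1 x).symm)
  obtain ⟨l, l0, l1, ls⟩ := bdI_glue (P := I) ⟨fun z => ω z.2, by fun_prop⟩ ξ
    ⟨fun z => ω z.2, by fun_prop⟩ (fun _ _ => rfl) (fun x t => (h4 x t).symm)
  have hl0 : ∀ z, k (z, 1) = l (z, 0) := by
    rintro ⟨⟨x, t⟩, hx | hx | hx⟩
    · exact (k1 _ (Or.inl hx)).trans (w0.symm.trans (ls ⟨x, hx⟩ t 0).symm)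
    · obtain rfl : t = 0 := hx
      exact (k1 _ (Or.inr rfl)).trans (w0.symm.trans (l0 x 0).symm)
    · obtain rfl : t = 1 := hx
      exact (h2 x).symm.trans (l1 x 0).symm
  have hl1 : ∀ z, l (z, 1) = f (a (z, ())) := by
    rintro ⟨⟨x, t⟩, hx | hx | hx⟩
    · exact (ls ⟨x, hx⟩ t 1).trans (w1.trans (congrArg f (as ⟨x, hx⟩ t ()).symm))
    · obtain rfl : t = 0 := hx
      exact (l0 x 1).trans (w1.trans (congrArg f (a0 x ()).symm))
    · obtain rfl : t = 1 := hx
      exact (l1 x 1).trans ((h3 x).trans (congrArg f (a1 x ()).symm))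
  refine .of_homotopy_bd (isCofib_bdI n) (a₁ := ⟨fun z => f (a (z, ())), by fun_prop⟩) (cat k l hl0)
    (fun z => by simp [k0]) (fun z => by simp [hl1]) h fun c₁ hc₁ => ?_
  obtain ⟨a', L, e1, e2, e3, e4⟩ := hgf.solvI ⟨fun z => a (z, ()), by fun_prop⟩ c₁ hc₁
  exact Solv.free hc₁ ⟨f.comp a', L, fun x => by simp [e1], e2, e3, e4⟩

end Solve

/-! ### Comparison with homotopy groups -/

section HomotopyGroups

variable {X Y : Type u} [TopologicalSpace X] [TopologicalSpace Y]

lemma WeakEq.isWeakEquiv {f : C(X, Y)} (hf : WeakEq f) : IsWeakEquiv f where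
  bijective_zerothHomotopy := by
    constructor
    · intro p q
      induction p using Quotient.inductionOn with | h x => ?_
      induction q using Quotient.inductionOn with | h y => ?_
      intro h
      obtain ⟨γ⟩ : Joined (f x) (f y) := Quotient.exact h
      obtain ⟨ξ, -, h0, h1, -⟩ := hf.lift_homotopy (n := 0) (.const _ x) (.const _ y)
        (.const _ x) ⟨fun z => γ z.2, by fun_prop⟩ (fun x => isEmptyElim x) (fun x => isEmptyElim x)
        (fun x => γ.source) (fun x => γ.target) (fun x => isEmptyElim x)
      exact Quotient.sound ⟨⟨⟨fun t => ξ (0, t), by fun_prop⟩, h0 0, h1 0⟩⟩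
    · intro q
      induction q using Quotient.inductionOn with | h y => ?_
      obtain ⟨x, ω, h0, h1⟩ := hf.exists_path y
      exact ⟨Quotient.mk _ x, Quotient.sound ⟨Path.symm ⟨ω, h0, h1⟩⟩⟩
  bijective_homotopyGroup n x := by
    constructor
    · intro p q
      induction p using Quotient.inductionOn with | h p => ?_
      induction q using Quotient.inductionOn with | h q => ?_
      intro h
      obtain ⟨H⟩ : GenLoop.Homotopic (genLoopMap f n x p) (genLoopMap f n x q) := Quotient.exact h
      have H' : ∀ (y : bd n) t, H (t, y) = f x := fun y t =>
        (H.eq_fst t y.2).trans (congrArg f (p.2 y y.2))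
      obtain ⟨ξ, -, h0, h1, h2, -⟩ := hf.lift_homotopy (n := n) p.1 q.1
        (.const _ x) ⟨fun z => H (z.2, z.1), by fun_prop⟩ (fun y => (p.2 y y.2).symm)
        (fun y => (q.2 y y.2).symm) (fun y => H.apply_zero y) (fun y => H.apply_one y)
        (fun y t => H' y t)
      refine Quotient.sound ⟨⟨⟨⟨fun z => ξ (z.2, z.1), by fun_prop⟩, h0, h1⟩, fun t y hy => ?_⟩⟩
      exact (h2 ⟨y, hy⟩ t).trans (p.2 y hy).symm
    · intro q
      induction q using Quotient.inductionOn with | h q => ?_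
      obtain ⟨a, L, h1, h2, h3, h4⟩ := hf n (.const _ x) q.1 (fun y => (q.2 y y.2).symm)
      refine ⟨Quotient.mk _ ⟨a, fun y hy => h1 ⟨y, hy⟩⟩, Quotient.sound ?_⟩
      refine GenLoop.Homotopic.symm ⟨⟨⟨⟨fun z => L (z.2, z.1), by fun_prop⟩, h2, h3⟩, fun t y hy => ?_⟩⟩
      exact h4 ⟨y, hy⟩ t

lemma IsWeakEquiv.weakEq {f : C(X, Y)} (hf : IsWeakEquiv f) : WeakEq f := by
  refine .of_freeI (fun y => ?_) fun n a c h => ?_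
  · obtain ⟨q, hq⟩ := hf.bijective_zerothHomotopy.2 (Quotient.mk _ y)
    induction q using Quotient.inductionOn with | h x => ?_
    obtain ⟨γ⟩ : Joined (f x) y := Quotient.exact hq
    exact ⟨x, γ.symm.toContinuousMap, γ.symm.source, γ.symm.target⟩
  obtain ⟨k, k0, k1⟩ := bdI_contract a
  set x₀ := a ⟨(0, 0), mem_bdI_zero 0⟩ with hx₀
  refine .of_homotopy_bd (isCofib_bdI n) (a₁ := ⟨fun z => k (z, 1), by fun_prop⟩) k k0
    (fun _ => rfl) h fun c₁ hc₁ => ?_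
  -- the boundary values are null-homotopic, by injectivity on `π_n`
  have hc : ∀ (x : Cub n) t (h : x ∈ bd n ∨ t = 0), c₁ (x, t) = f x₀ := fun x t h =>
    (hc₁ ⟨(x, t), h.imp id Or.inl⟩).symm.trans (congrArg f (k1 _ h))
  let p : GenLoop (Fin n) X x₀ :=
    ⟨⟨fun x => k (⟨(x, 1), mem_bdI_one x⟩, 1), by fun_prop⟩, fun x hx => k1 _ (Or.inl hx)⟩
  let q : GenLoop (Fin n) X x₀ := ⟨.const _ x₀, fun _ _ => rfl⟩
  have hpq : GenLoop.Homotopic (genLoopMap f n x₀ p) (genLoopMap f n x₀ q) := by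
    refine ⟨⟨⟨⟨fun z => c₁ (z.2, σ z.1), by fun_prop⟩, fun x => ?_, fun x => ?_⟩, fun t x hx => ?_⟩⟩
    · exact (congrArg (fun t => c₁ (x, t)) unitInterval.symm_zero).trans (hc₁ ⟨(x, 1), mem_bdI_one x⟩).symm
    · exact (congrArg (fun t => c₁ (x, t)) unitInterval.symm_one).trans (hc x 0 (Or.inr rfl))
    · exact (hc x _ (Or.inl hx)).trans (congrArg f (p.2 x hx).symm)
  obtain ⟨H⟩ : GenLoop.Homotopic p q :=
    Quotient.exact ((hf.bijective_homotopyGroup n x₀).1 (Quotient.sound hpq))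
  obtain ⟨l, l0, l1, ls⟩ := bdI_glue (P := I) (.const _ x₀) ⟨fun z => H (z.2, z.1), by fun_prop⟩
    (.const _ x₀) (fun _ _ => rfl)
    (fun x t => ((H.eq_fst t x.2).trans (p.2 x x.2)).symm)
  have hl0 : ∀ z, l (z, 0) = k (z, 1) := by
    rintro ⟨⟨x, t⟩, hx | hx | hx⟩
    · exact (ls ⟨x, hx⟩ t 0).trans (k1 _ (Or.inl hx)).symm
    · obtain rfl : t = 0 := hx
      exact (l0 x 0).trans (k1 _ (Or.inr rfl)).symm
    · obtain rfl : t = 1 := hx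
      exact (l1 x 0).trans (H.apply_zero x)
  have hl1 : ∀ z, l (z, 1) = x₀ := by
    rintro ⟨⟨x, t⟩, hx | hx | hx⟩
    · exact ls ⟨x, hx⟩ t 1
    · obtain rfl : t = 0 := hx
      exact l0 x 1
    · obtain rfl : t = 1 := hx
      exact (l1 x 1).trans (H.apply_one x)
  refine .of_homotopy_bd (isCofib_bdI n) (a₁ := .const _ x₀) l hl0 hl1 hc₁ fun c₂ hc₂ => ?_
  -- the resulting element of `π_(n+1)` has a preimage
  let r : GenLoop (Fin (n + 1)) Y (f x₀) := ⟨⟨fun x => c₂ (cubSplit n x), by fun_prop⟩,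
    fun x hx => (hc₂ ⟨_, (cubSplit_mem x).2 hx⟩).symm⟩
  obtain ⟨s, hs⟩ := (hf.bijective_homotopyGroup (n + 1) x₀).2 (Quotient.mk _ r)
  induction s using Quotient.inductionOn with | h s => ?_
  obtain ⟨H⟩ : GenLoop.Homotopic r (genLoopMap f (n + 1) x₀ s) := Quotient.exact hs.symm
  refine .of_homeo (cubSplit n).symm (A' := bd (n + 1)) (fun x => by rw [← cubSplit_mem]; simp) ?_
  refine Solv.free ?_ ⟨s.1, ⟨fun z => H (z.2, z.1), by fun_prop⟩, fun x => s.2 x x.2,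
    fun x => H.apply_zero x, fun x => H.apply_one x, fun x t => H.eq_fst t x.2⟩
  exact fun x => hc₂ ⟨_, (cubSplit_mem x).2 x.2⟩

end HomotopyGroups

/-! ### Homotopy fibres -/

section Conc

variable {A T T' : Type*}

/-- The path `f` followed by the initial segment of length `d` of the path `g`. -/
noncomputable def concFun (f g : I → T) (d t : I) : T :=
  if (t : ℝ) * (1 + d) ≤ 1 then f (Set.projIcc 0 1 zero_le_one ((t : ℝ) * (1 + d)))
  else g (Set.projIcc 0 1 zero_le_one ((t : ℝ) * (1 + d) - 1))

lemma projIcc_coe (t : I) : Set.projIcc (0 : ℝ) 1 zero_le_one (t : ℝ) = t :=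
  Set.projIcc_val zero_le_one t

@[simp] lemma concFun_zero_left (f g : I → T) (t : I) : concFun f g 0 t = f t := by
  have := t.2.2
  simp [concFun, this]

@[simp] lemma concFun_zero (f g : I → T) (d : I) : concFun f g d 0 = f 0 := by
  simp [concFun]

lemma concFun_one {f g : I → T} (h : f 1 = g 0) (d : I) : concFun f g d 1 = g d := by
  have hd := d.2.1
  simp only [concFun, Set.Icc.coe_one, one_mul]
  split_ifs with h'
  · obtain rfl : d = 0 := Subtype.ext (le_antisymm (show (d : ℝ) ≤ 0 by linarith) hd)
    simpa using h
  · rw [add_sub_cancel_left, projIcc_coe]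

lemma concFun_comp (f g : I → T) (d t : I) (φ : T → T') :
    φ (concFun f g d t) = concFun (φ ∘ f) (φ ∘ g) d t := by
  unfold concFun; split_ifs <;> rfl

variable [TopologicalSpace A] [TopologicalSpace T]

/-- `concFun` for families of paths. -/
noncomputable def conc (f g : C(A × I, T)) (d : C(A, I)) (h : ∀ a, f (a, 1) = g (a, 0)) :
    C(A × I, T) where
  toFun z := concFun (fun t => f (z.1, t)) (fun t => g (z.1, t)) (d z.1) z.2
  continuous_toFun := by
    have hp : Continuous (Set.projIcc (0 : ℝ) 1 zero_le_one) := continuous_projIcc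
    refine Continuous.if_le (by fun_prop) (by fun_prop) (by fun_prop) (by fun_prop) ?_
    intro z hz
    rw [hz, sub_self, Set.projIcc_left, Set.projIcc_right]
    exact h z.1

lemma conc_apply (f g : C(A × I, T)) (d : C(A, I)) (h : ∀ a, f (a, 1) = g (a, 0)) (a : A) (t : I) :
    conc f g d h (a, t) = concFun (fun t => f (a, t)) (fun t => g (a, t)) (d a) t := rfl

end Conc

namespace HoFibre

variable {X Y X' Y' : Type u} [TopologicalSpace X] [TopologicalSpace Y] [TopologicalSpace X']
  [TopologicalSpace Y'] {p : C(X, Y)} {b : Y} {p' : C(X', Y')} {b' : Y'}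
  {A : Type*} [TopologicalSpace A]

/-- The point of the total space underlying a point of a homotopy fibre. -/
def pt (p : C(X, Y)) (b : Y) : C(HoFibre p b, X) :=
  ⟨fun z => z.1.1, continuous_fst.comp continuous_subtype_val⟩

/-- The evaluation of the path in the base underlying a point of a homotopy fibre. -/
def path (p : C(X, Y)) (b : Y) : C(HoFibre p b × I, Y) :=
  ⟨fun z => z.1.1.2 z.2, by
    have : Continuous fun z : HoFibre p b => z.1.2 := continuous_snd.comp continuous_subtype_val
    fun_prop⟩

@[fun_prop] lemma continuous_pt : Continuous (fun z => pt p b z) := (pt p b).continuous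
@[fun_prop] lemma continuous_path : Continuous (fun z => path p b z) := (path p b).continuous

@[simp] lemma path_zero (z : HoFibre p b) : path p b (z, 0) = p (pt p b z) := z.2.1
@[simp] lemma path_one (z : HoFibre p b) : path p b (z, 1) = b := z.2.2

@[ext] lemma ext {z w : HoFibre p b} (h : pt p b z = pt p b w)
    (h' : ∀ t, path p b (z, t) = path p b (w, t)) : z = w :=
  Subtype.ext (Prod.ext h (ContinuousMap.ext h'))

/-- A map to a homotopy fibre given by a map to the total space and a family of paths. -/
def mk (e : C(A, X)) (γ : C(A × I, Y)) (h0 : ∀ a, γ (a, 0) = p (e a)) (h1 : ∀ a, γ (a, 1) = b) :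
    C(A, HoFibre p b) :=
  ⟨fun a => ⟨(e a, γ.curry a), h0 a, h1 a⟩, Continuous.subtype_mk (by fun_prop) _⟩

@[simp] lemma pt_mk (e : C(A, X)) (γ : C(A × I, Y)) (h0 : ∀ a, γ (a, 0) = p (e a))
    (h1 : ∀ a, γ (a, 1) = b) (a : A) : pt p b (mk e γ h0 h1 a) = e a := rfl
@[simp] lemma path_mk (e : C(A, X)) (γ : C(A × I, Y)) (h0 : ∀ a, γ (a, 0) = p (e a))
    (h1 : ∀ a, γ (a, 1) = b) (a : A) (t : I) : path p b (mk e γ h0 h1 a, t) = γ (a, t) := rfl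

/-- The map of homotopy fibres induced by a commutative square. -/
def map (r : C(X, X')) (s : C(Y, Y')) (h : ∀ x, p' (r x) = s (p x)) (hb : s b = b') :
    C(HoFibre p b, HoFibre p' b') :=
  mk (r.comp (pt p b)) (s.comp (path p b)) (fun a => by simp [h]) (fun a => by simp [hb])

@[simp] lemma pt_map (r : C(X, X')) (s : C(Y, Y')) (h : ∀ x, p' (r x) = s (p x)) (hb : s b = b')
    (z : HoFibre p b) : pt p' b' (map r s h hb z) = r (pt p b z) := rfl
@[simp] lemma path_map (r : C(X, X')) (s : C(Y, Y')) (h : ∀ x, p' (r x) = s (p x)) (hb : s b = b')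
    (z : HoFibre p b) (t : I) : path p' b' (map r s h hb z, t) = s (path p b (z, t)) := rfl

/-- Weak equivalences of total spaces and bases induce a weak equivalence of homotopy fibres. -/
lemma weakEq_map {r : C(X, X')} {s : C(Y, Y')} (hr : WeakEq r) (hs : WeakEq s)
    (h : ∀ x, p' (r x) = s (p x)) (hb : s b = b') : WeakEq (map (p := p) (p' := p') r s h hb) := by
  intro n a c hac
  have hc1 : ∀ x, r (pt p b (a x)) = pt p' b' (c x) := fun x => by rw [← hac]; rfl
  have hc2 : ∀ (x : bd n) t, path p' b' (c x, t) = s (path p b (a x, t)) := fun x t => by rw [← hac]; rfl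
  obtain ⟨e, k, h1, h2, h3, h4⟩ := hr n ((pt p b).comp a) ((pt p' b').comp c) hc1
  -- move the starting points of the paths along `k`
  obtain ⟨C, d0, d1, d2, d3⟩ := fill₃ ⟨fun z => path p' b' (c z.1, z.2), by fun_prop⟩
    ⟨fun z => p' (k z), by fun_prop⟩ (.const _ b')
    ⟨fun z => path p' b' (c z.1.1, z.1.2), by fun_prop⟩ (fun x => by simp [h2]) (fun x => by simp)
    (fun x t => rfl) (fun x u => by simp [h4]) (fun x u => by simp)
  -- lift the resulting paths along `s`
  obtain ⟨δ, Λ, l0, l1, l2, l3, l4, l5⟩ := hs.lift_homotopy ⟨fun x => p (e x), by fun_prop⟩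
    (.const _ b) ⟨fun z => path p b (a z.1, z.2), by fun_prop⟩ ⟨fun z => C (z, 1), by fun_prop⟩
    (fun x => by simp [h1]) (fun x => by simp) (fun x => by simp [d1, h3, h])
    (fun x => by simp [d2, hb]) (fun x t => by simp [d3, hc2])
  have l0' : ∀ x, δ (x, 0) = p (e x) := l0
  have l1' : ∀ x, δ (x, 1) = b := l1
  let K₁ : C(Cub n × I, HoFibre p' b') := mk k ⟨fun z => C ((z.1.1, z.2), z.1.2), by fun_prop⟩
    (fun z => by simp [d1]) (fun z => by simp [d2])
  let K₂ : C(Cub n × I, HoFibre p' b') := mk ⟨fun z => r (e z.1), by fun_prop⟩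
    ⟨fun z => Λ ((z.1.1, z.2), z.1.2), by fun_prop⟩
    (fun z => by simp [l5 _ (mem_bdI_zero _), d1, h3])
    (fun z => by simp [l5 _ (mem_bdI_one _), d2])
  have hK : ∀ x, K₁ (x, 1) = K₂ (x, 0) := fun x => by ext <;> simp [K₁, K₂, h3, l3]
  refine ⟨mk e δ l0' l1', cat K₁ K₂ hK, fun x => ?_, fun x => ?_, fun x => ?_, fun x t => ?_⟩
  · ext <;> simp [h1, l2]
  · ext <;> simp [K₁, h2, d0]
  · ext <;> simp [K₂, l4]
  · refine cat_mem _ (fun y => y = c x) (fun t => ?_) (fun t => ?_) t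
    · ext <;> simp [K₁, h4, d3]
    · ext <;> simp [K₂, h1, hc1, l5 _ (mem_bdI_side _ _), d3]

/-- Transport of homotopy fibres along a path in the base. -/
noncomputable def trans (p : C(X, Y)) {b b₁ : Y} (ω : C(I, Y)) (h0 : ω 0 = b) (h1 : ω 1 = b₁) :
    C(HoFibre p b, HoFibre p b₁) :=
  mk (pt p b) (conc (path p b) ⟨fun z => ω z.2, by fun_prop⟩ (.const _ 1) (fun z => by simp [h0]))
    (fun z => by simp [conc_apply]) (fun z => by rw [conc_apply, concFun_one] <;> simp [h0, h1])

lemma path_trans {b₁ : Y} (ω : C(I, Y)) (h0 : ω 0 = b) (h1 : ω 1 = b₁) (z : HoFibre p b) (t : I) :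
    path p b₁ (trans p ω h0 h1 z, t) = concFun (fun t => path p b (z, t)) ω 1 t := rfl

lemma trans_symm_homotopic {b₁ : Y} (ω : C(I, Y)) (h0 : ω 0 = b) (h1 : ω 1 = b₁) (ω' : C(I, Y))
    (h : ∀ t, ω' t = ω (σ t)) (h0' : ω' 0 = b₁) (h1' : ω' 1 = b) :
    (ContinuousMap.id _).Homotopic ((trans p ω' h0' h1').comp (trans p ω h0 h1)) := by
  let c : C(I, Y) := .const _ b
  -- the identity is homotopic to transport along the constant path
  have H₁ : (ContinuousMap.id _).Homotopic (trans p (b := b) (b₁ := b) c rfl rfl) := by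
    refine ⟨⟨mk ⟨fun z => pt p b z.2, by fun_prop⟩
      (conc ⟨fun z => path p b (z.1.2, z.2), by fun_prop⟩ ⟨fun _ => b, by fun_prop⟩ ⟨fun z => z.1, by fun_prop⟩
        (fun z => by simp)) (fun z => by simp [conc_apply])
      (fun z => by rw [conc_apply, concFun_one] <;> simp), fun z => ?_, fun z => ?_⟩⟩
    · ext <;> simp [conc_apply]
    · ext <;> simp [conc_apply, trans]; rfl
  refine H₁.trans ⟨⟨mk ⟨fun z => pt p b z.2, by fun_prop⟩
    (conc (conc ⟨fun z => path p b (z.1.2, z.2), by fun_prop⟩ ⟨fun z => ω z.2, by fun_prop⟩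
      ⟨fun z => z.1, by fun_prop⟩ (fun z => by simp [h0])) ⟨fun z => ω (z.1.1 * σ z.2), by fun_prop⟩
      (.const _ 1)
      (fun z => by rw [conc_apply, concFun_one] <;> simp [h0])) (fun z => by simp [conc_apply])
      (fun z => ?_), fun z => ?_, fun z => ?_⟩⟩
  · rw [conc_apply, concFun_one]
    · simp [h0]
    · rw [conc_apply, concFun_one] <;> simp [h0]
  · ext
    · rfl
    · simp [conc_apply, h0]; rfl
  · ext
    · rfl
    · have hω : (ω' : I → Y) = fun t => ω (1 * σ t) := funext fun t => by rw [h, one_mul]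
      simp only [ContinuousMap.comp_apply, path_trans, hω]
      rfl

lemma weakEq_trans {b₁ : Y} (ω : C(I, Y)) (h0 : ω 0 = b) (h1 : ω 1 = b₁) :
    WeakEq (trans p ω h0 h1) :=
  .of_homotopic_inverse (trans p ⟨fun t => ω (σ t), by fun_prop⟩ (by simp [h1]) (by simp [h0]))
    (trans_symm_homotopic _ _ _ _ (fun _ => rfl) _ _)
    (trans_symm_homotopic _ _ _ _ (fun t => by simp) _ _)

/-- Whether a square induces a weak equivalence of homotopy fibres depends only on the path
component of the point of the base. -/
lemma weakEq_map_of_path {r : C(X, X')} {s : C(Y, Y')} (h : ∀ x, p' (r x) = s (p x)) {b b₁ : Y}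
    (ω : C(I, Y)) (h0 : ω 0 = b) (h1 : ω 1 = b₁) {b' b₁' : Y'} (hb : s b = b') (hb₁ : s b₁ = b₁')
    (H : WeakEq (map (p := p) (p' := p') r s h hb)) :
    WeakEq (map (p := p) (p' := p') r s h hb₁) := by
  refine (weakEq_trans ω h0 h1).of_comp_left ?_
  have : (map (p := p) (p' := p') r s h hb₁).comp (trans p ω h0 h1) =
      (trans p' (s.comp ω) (by simp [h0, hb]) (by simp [h1, hb₁])).comp (map r s h hb) := by
    ext z
    · rfl
    · simp only [ContinuousMap.comp_apply, path_map, path_trans]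
      exact concFun_comp _ _ _ _ s
  rw [this]
  exact (weakEq_trans _ _ _).comp H

end HoFibre

/-! ### Maps built cell by cell on a subdivided cube -/

section Grid

variable {n : ℕ} (N : ℕ)

/-- The open cell of the subdivision of the cube into `N ^ n` small cubes which contains a given
point. An even number `2 * j` in coordinate `i` stands for the equation `N * x i = j`, an odd
number `2 * j + 1` for the inequalities `j < N * x i < j + 1`. -/
noncomputable def cellOf (x : Cub n) (i : Fin n) : ℕ := ⌊(N : ℝ) * x i⌋₊ + ⌈(N : ℝ) * x i⌉₊

/-- The closed cells of the subdivided cube; the encoding is that of `cellOf`. -/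
def cellSet (m : Fin n → ℕ) : Set (Cub n) :=
  {x | ∀ i, ((m i / 2 : ℕ) : ℝ) ≤ N * x i ∧ N * (x i : ℝ) ≤ ((m i + 1) / 2 : ℕ)}

/-- The dimension of a cell. -/
def cellDim (m : Fin n → ℕ) : ℕ := (Finset.univ.filter fun i => m i % 2 = 1).card

/-- The cubes having a given cell as a face. -/
def cellCubes (m : Fin n → ℕ) : Finset (Fin n → ℕ) :=
  Fintype.piFinset fun i => if m i % 2 = 1 then {m i / 2} else {m i / 2, m i / 2 - 1}

lemma floor_add_ceil_div_two {y : ℝ} :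
    (⌊y⌋₊ + ⌈y⌉₊) / 2 = ⌊y⌋₊ ∧ (⌊y⌋₊ + ⌈y⌉₊ + 1) / 2 = ⌈y⌉₊ := by
  have h1 : ⌈y⌉₊ ≤ ⌊y⌋₊ + 1 := Nat.ceil_le_floor_add_one y
  have h2 : ⌊y⌋₊ ≤ ⌈y⌉₊ := Nat.floor_le_ceil y
  omega

lemma mem_cellSet_cellOf (x : Cub n) : x ∈ cellSet N (cellOf N x) := fun i => by
  have h0 : (0 : ℝ) ≤ N * x i := mul_nonneg (Nat.cast_nonneg _) (x i).2.1
  unfold cellOf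
  rw [floor_add_ceil_div_two.1, floor_add_ceil_div_two.2]
  exact ⟨Nat.floor_le h0, Nat.le_ceil _⟩

variable {N}

/-- The cell of a point of a closed cell is a face of the latter. -/
lemma cellOf_cases {m : Fin n → ℕ} {x : Cub n} (h : x ∈ cellSet N m) (i : Fin n) :
    cellOf N x i = m i ∨ m i % 2 = 1 ∧ (cellOf N x i + 1 = m i ∧ N * (x i : ℝ) = (m i / 2 : ℕ) ∨
      cellOf N x i = m i + 1 ∧ N * (x i : ℝ) = (m i / 2 + 1 : ℕ)) := by
  obtain ⟨h1, h2⟩ := h i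
  have h0 : (0 : ℝ) ≤ N * x i := mul_nonneg (Nat.cast_nonneg _) (x i).2.1
  unfold cellOf
  rcases Nat.mod_two_eq_zero_or_one (m i) with hm | hm
  · left
    have e : N * (x i : ℝ) = (m i / 2 : ℕ) := by
      refine le_antisymm (h2.trans ?_) h1
      exact_mod_cast (by omega : (m i + 1) / 2 ≤ m i / 2)
    rw [e, Nat.floor_natCast, Nat.ceil_natCast]
    omega
  · have e2 : (m i + 1) / 2 = m i / 2 + 1 := by omega
    rw [e2] at h2
    rcases h1.eq_or_lt with e | h1
    · right
      refine ⟨hm, Or.inl ⟨?_, e.symm⟩⟩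
      rw [← e, Nat.floor_natCast, Nat.ceil_natCast]
      omega
    rcases h2.eq_or_lt with e | h2
    · right
      refine ⟨hm, Or.inr ⟨?_, e⟩⟩
      rw [e, Nat.floor_natCast, Nat.ceil_natCast]
      omega
    · left
      have f1 : ⌊(N : ℝ) * x i⌋₊ = m i / 2 := by
        rw [Nat.floor_eq_iff h0]
        exact ⟨h1.le, by exact_mod_cast h2⟩
      have f2 : ⌈(N : ℝ) * x i⌉₊ = m i / 2 + 1 := by
        rw [Nat.ceil_eq_iff (by omega)]
        exact ⟨by simpa using h1, h2.le⟩
      omega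

lemma cellDim_lt {m : Fin n → ℕ} {x : Cub n} (h : x ∈ cellSet N m) (hne : cellOf N x ≠ m) :
    cellDim (cellOf N x) < cellDim m := by
  obtain ⟨i, hi⟩ := Function.ne_iff.1 hne
  refine Finset.card_lt_card (Finset.ssubset_iff_of_subset ?_ |>.2 ⟨i, ?_, ?_⟩)
  · intro j hj
    simp only [Finset.mem_filter, Finset.mem_univ, true_and] at hj ⊢
    rcases cellOf_cases h j with h | ⟨h, -⟩
    · rwa [← h]
    · exact h
  · simpa using ((cellOf_cases h i).resolve_left hi).1
  · rcases (cellOf_cases h i).resolve_left hi with ⟨h1, h2 | h2⟩ <;> simp <;> omega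

lemma cellDim_le {m : Fin n → ℕ} {x : Cub n} (h : x ∈ cellSet N m) :
    cellDim (cellOf N x) ≤ cellDim m := by
  by_cases hne : cellOf N x = m
  · rw [hne]
  · exact (cellDim_lt h hne).le

lemma cellDim_le_card (m : Fin n → ℕ) : cellDim m ≤ n :=
  (Finset.card_le_univ _).trans_eq (Fintype.card_fin n)

lemma isClosed_cellSet (m : Fin n → ℕ) : IsClosed (cellSet N m) := by
  have : cellSet N m = ⋂ i, {x | ((m i / 2 : ℕ) : ℝ) ≤ N * x i ∧
      N * (x i : ℝ) ≤ ((m i + 1) / 2 : ℕ)} := by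
    ext; simp [cellSet]
  rw [this]
  refine isClosed_iInter fun i => ?_
  have hc : Continuous fun x : Cub n => (N : ℝ) * x i := by fun_prop
  exact (isClosed_le continuous_const hc).inter (isClosed_le hc continuous_const)

lemma cellSet_subset_of_mem_cellCubes {m q : Fin n → ℕ} (hq : q ∈ cellCubes m) :
    cellSet N m ⊆ cellSet N (fun i => 2 * q i + 1) := by
  intro x hx i
  obtain ⟨h1, h2⟩ := hx i
  have h0 : (0 : ℝ) ≤ N * x i := mul_nonneg (Nat.cast_nonneg _) (x i).2.1
  have := Fintype.mem_piFinset.1 hq i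
  have hle : q i ≤ m i / 2 ∧ (m i + 1) / 2 ≤ q i + 1 := by
    split_ifs at this with hm <;> simp at this <;> omega
  refine ⟨le_trans ?_ h1, h2.trans ?_⟩
  · exact_mod_cast (by omega : (2 * q i + 1) / 2 ≤ m i / 2)
  · exact_mod_cast (by omega : (m i + 1) / 2 ≤ (2 * q i + 1 + 1) / 2)

lemma cellCubes_subset {m : Fin n → ℕ} {x : Cub n} (h : x ∈ cellSet N m) :
    cellCubes m ⊆ cellCubes (cellOf N x) := by
  intro q hq
  refine Fintype.mem_piFinset.2 fun i => ?_
  have := Fintype.mem_piFinset.1 hq i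
  rcases cellOf_cases h i with e | ⟨h1, h2⟩
  · rwa [e]
  · have h3 : cellOf N x i % 2 ≠ 1 := by rcases h2 with h2 | h2 <;> omega
    rw [if_pos h1] at this
    rw [if_neg h3]
    simp at this ⊢
    rcases h2 with h2 | h2 <;> omega

lemma cellCubes_nonempty (m : Fin n → ℕ) : (cellCubes m).Nonempty := by
  refine ⟨fun i => m i / 2, Fintype.mem_piFinset.2 fun i => ?_⟩
  split_ifs <;> simp

/-- The intersection of the labels of the cubes having a given cell as a face. -/
def gridW {Y : Type*} (lab : (Fin n → ℕ) → Set Y) (m : Fin n → ℕ) : Set Y :=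
  {y | ∀ q ∈ cellCubes m, y ∈ lab q}

lemma gridW_mono {Y : Type*} {lab : (Fin n → ℕ) → Set Y} {m : Fin n → ℕ} {x : Cub n}
    (h : x ∈ cellSet N m) : gridW lab (cellOf N x) ⊆ gridW lab m :=
  fun _ hy q hq => hy q (cellCubes_subset h hq)

lemma gridW_mem {Y : Type*} {𝒰 : Set (Set Y)} (h𝒰 : ∀ U ∈ 𝒰, ∀ V ∈ 𝒰, U ∩ V ∈ 𝒰)
    {lab : (Fin n → ℕ) → Set Y} (hlab : ∀ q, lab q ∈ 𝒰) (m : Fin n → ℕ) : gridW lab m ∈ 𝒰 := by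
  have hne := cellCubes_nonempty m
  unfold gridW
  generalize cellCubes m = s at hne ⊢
  induction hne using Finset.Nonempty.cons_induction with
  | singleton a => simpa using hlab a
  | cons a s h hs ih =>
    convert h𝒰 _ (hlab a) _ ih using 1
    ext; simp

open Classical in
/-- A map on a subdivided cube can be constructed by induction over the cells, subject to a
condition `R m x` on its value at the point `x` of the cell `m`. -/
theorem exists_cell_lift {Z : Type*} [TopologicalSpace Z] (hN : 0 < N)
    (R : (Fin n → ℕ) → Cub n → Set Z)
    (hR : ∀ m x, x ∈ cellSet N m → R (cellOf N x) x ⊆ R m x) (g₀ : C(bd n, Z))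
    (hg₀ : ∀ x : bd n, g₀ x ∈ R (cellOf N x) x)
    (hlift : ∀ m k (φ : C(Cub k, Cub n)), (∀ y, φ y ∈ cellSet N m) → ∀ a : C(bd k, Z),
      (∀ y : bd k, a y ∈ R m (φ y)) →
      ∃ a' : C(Cub k, Z), (∀ y : bd k, a' y = a y) ∧ ∀ y, a' y ∈ R m (φ y)) :
    ∃ g : C(Cub n, Z), (∀ x : bd n, g x = g₀ x) ∧ ∀ x, g x ∈ R (cellOf N x) x := by
  have hN' : (0 : ℝ) < N := Nat.cast_pos.2 hN
  let F : ℕ → Set (Cub n) := fun k => {x | x ∈ bd n ∨ cellDim (cellOf N x) < k}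
  -- the points of the skeleta are covered by finitely many closed cells
  have hcell : ∀ x, ∃ m : Fin n → Fin (2 * N + 1), (fun i => (m i : ℕ)) = cellOf N x := fun x => by
    refine ⟨fun i => ⟨cellOf N x i, ?_⟩, rfl⟩
    have h1 : (N : ℝ) * x i ≤ N := mul_le_of_le_one_right hN'.le (x i).2.2
    have h2 : ⌊(N : ℝ) * x i⌋₊ ≤ N := Nat.floor_le_of_le h1
    have h3 : ⌈(N : ℝ) * x i⌉₊ ≤ N := Nat.ceil_le.2 h1
    unfold cellOf; omega
  have hF : ∀ k, IsClosed (F k) := fun k => by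
    have : F k = bd n ∪ ⋃ m : Fin n → Fin (2 * N + 1),
        {x | x ∈ cellSet N (fun i => (m i : ℕ)) ∧ cellDim (fun i => (m i : ℕ)) < k} := by
      ext x
      simp only [F, Set.mem_ofPred_eq, Set.mem_union, Set.mem_iUnion]
      refine or_congr Iff.rfl ⟨fun h => ?_, fun ⟨m, h1, h2⟩ => (cellDim_le h1).trans_lt h2⟩
      obtain ⟨m, hm⟩ := hcell x
      exact ⟨m, by rw [hm]; exact ⟨mem_cellSet_cellOf N x, h⟩⟩
    rw [this]
    refine (isClosed_bd n).union (isClosed_iUnion_of_finite fun m => ?_)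
    by_cases h : cellDim (fun i => (m i : ℕ)) < k
    · simpa [h] using isClosed_cellSet _
    · simp [h]
  suffices H : ∀ k, ∃ g : Cub n → Z, ContinuousOn g (F k) ∧ (∀ x : bd n, g x = g₀ x) ∧
      ∀ x ∈ F k, g x ∈ R (cellOf N x) x by
    obtain ⟨g, h1, h2, h3⟩ := H (n + 1)
    have hu : ∀ x, x ∈ F (n + 1) := fun x => Or.inr (Nat.lt_succ_of_le (cellDim_le_card _))
    refine ⟨⟨g, ?_⟩, h2, fun x => h3 x (hu x)⟩
    rw [← continuousOn_univ]
    exact h1.mono fun x _ => hu x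
  intro k
  induction k with
  | zero =>
    rcases isEmpty_or_nonempty (bd n) with h | ⟨⟨x₀⟩⟩
    · rcases isEmpty_or_nonempty Z with hZ | ⟨⟨z₀⟩⟩
      · -- the value at any point of the cube would be an element of `Z`
        exfalso
        obtain ⟨a', -⟩ := hlift (cellOf N (0 : Cub n)) 0 (.const _ 0)
          (fun _ => mem_cellSet_cellOf N 0)
          ⟨fun x => isEmptyElim x, continuous_of_const fun x => isEmptyElim x⟩
          (fun x => isEmptyElim x)
        exact isEmptyElim (a' 0)
      · refine ⟨fun _ => z₀, continuousOn_const, fun x => isEmptyElim x, ?_⟩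
        rintro x (hx | hx)
        · exact h.elim ⟨x, hx⟩
        · simp at hx
    · refine ⟨fun x => if h : x ∈ bd n then g₀ ⟨x, h⟩ else g₀ x₀, ?_, fun x => by simp, ?_⟩
      · have : F 0 = bd n := by ext; simp [F]
        rw [this]
        exact continuousOn_dite g₀ _ g₀.continuous
      · rintro x (hx | hx)
        · simpa [hx] using hg₀ ⟨x, hx⟩
        · simp at hx
  | succ k ih =>
    obtain ⟨g, g1, g2, g3⟩ := ih
    -- extension over a single closed cell of dimension `k`
    have key : ∀ m : Fin n → ℕ, cellDim m = k → (∀ x, cellOf N x = m → x ∉ bd n) →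
        ∃ g' : Cub n → Z, ContinuousOn g' (cellSet N m) ∧
          (∀ x ∈ cellSet N m, x ∈ F k → g' x = g x) ∧ ∀ x ∈ cellSet N m, g' x ∈ R m x := by
      intro m hm hbd
      let O := {i : Fin n // m i % 2 = 1}
      have hO : Fintype.card O = k := by rw [Fintype.card_subtype]; exact hm
      let e : Fin k ≃ O := (Fintype.equivFinOfCardEq hO).symm
      by_cases hne : ∃ x, x ∈ cellSet N m
      swap
      · push Not at hne
        exact ⟨g, fun x hx => (hne x hx).elim, fun x hx => (hne x hx).elim,
          fun x hx => (hne x hx).elim⟩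
      obtain ⟨x₁, hx₁⟩ := hne
      have hb0 : ∀ i, ((m i / 2 : ℕ) : ℝ) ≤ N := fun i =>
        (hx₁ i).1.trans (mul_le_of_le_one_right hN'.le (x₁ i).2.2)
      by_cases hb : ∀ i, m i % 2 = 1 → m i / 2 + 1 ≤ N
      swap
      · -- such a cell would not contain an interior point of the cube
        push Not at hb
        obtain ⟨i, hi1, hi2⟩ := hb
        have hx : ∀ x ∈ cellSet N m, x ∈ bd n := fun x hx => by
          refine ⟨i, Or.inr (Subtype.ext (le_antisymm (x i).2.2 ?_))⟩
          have h1 := (hx i).1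
          have h2 : (N : ℝ) ≤ (m i / 2 : ℕ) := by exact_mod_cast (by omega : N ≤ m i / 2)
          exact (mul_le_mul_iff_right₀ hN').1 (by simpa using h2.trans h1)
        refine ⟨g, g1.mono fun x h => Or.inl (hx x h), fun _ _ _ => rfl, fun x h => ?_⟩
        exact hR m x h (g3 x (Or.inl (hx x h)))
      let φ : Cub k → Cub n := fun y i => ⟨((m i / 2 : ℕ) +
        (if h : m i % 2 = 1 then (y (e.symm ⟨i, h⟩) : ℝ) else 0)) / N, by
          split_ifs with h
          · have := (y (e.symm ⟨i, h⟩)).2.1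
            positivity
          · positivity, by
          rw [div_le_one hN']
          split_ifs with h
          · have h1 := (y (e.symm ⟨i, h⟩)).2.2
            have h2 : ((m i / 2 : ℕ) : ℝ) + 1 ≤ N := by exact_mod_cast hb i h
            linarith
          · simpa using hb0 i⟩
      have hφv : ∀ y i, (N : ℝ) * (φ y i : ℝ) = (m i / 2 : ℕ) +
          (if h : m i % 2 = 1 then (y (e.symm ⟨i, h⟩) : ℝ) else 0) := fun y i => by
        simp only [φ]; field_simp
      have hφ : Continuous φ := by
        refine continuous_pi fun i => Continuous.subtype_mk ?_ _
        by_cases h : m i % 2 = 1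
        · simp only [h, dif_pos]; fun_prop
        · simp only [h, dif_neg, not_false_eq_true]; fun_prop
      have hφm : ∀ y, φ y ∈ cellSet N m := fun y i => by
        rw [hφv]
        split_ifs with h
        · have h1 := (y (e.symm ⟨i, h⟩)).2
          rw [show (m i + 1) / 2 = m i / 2 + 1 by omega]
          push_cast
          exact ⟨by linarith [h1.1], by linarith [h1.2]⟩
        · rw [show (m i + 1) / 2 = m i / 2 by omega]
          simp
      let ψ : Cub n → Cub k := fun x j =>
        Set.projIcc 0 1 zero_le_one (N * (x (e j).1 : ℝ) - (m (e j).1 / 2 : ℕ))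
      have hψ : Continuous ψ := continuous_pi fun j => continuous_projIcc.comp (by fun_prop)
      have hψv : ∀ x ∈ cellSet N m, ∀ j, (ψ x j : ℝ) = N * (x (e j).1 : ℝ) - (m (e j).1 / 2 : ℕ) := by
        intro x hx j
        have h := hx (e j).1
        rw [show (m (e j).1 + 1) / 2 = m (e j).1 / 2 + 1 by have := (e j).2; omega] at h
        simp only [ψ]
        rw [Set.projIcc_of_mem zero_le_one ⟨by linarith [h.1], by push_cast at h; linarith [h.2]⟩]
      have hφψ : ∀ x ∈ cellSet N m, φ (ψ x) = x := fun x hx => by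
        ext i
        have h := hφv (ψ x) i
        refine mul_left_cancel₀ hN'.ne' (h.trans ?_)
        split_ifs with hi
        · rw [hψv x hx]; simp
        · have h2 := hx i
          rw [show (m i + 1) / 2 = m i / 2 by omega] at h2
          linarith [h2.1, h2.2]
      have hφbd : ∀ y : bd k, φ y ∈ F k := by
        rintro ⟨y, j, hj⟩
        refine Or.inr (lt_of_lt_of_eq (cellDim_lt (hφm y) fun h => ?_) hm)
        have h1 := congrFun h (e j).1
        have h2 := hφv y (e j).1
        have h3 := (e j).2
        simp only [h3, dite_true, Subtype.coe_eta, Equiv.symm_apply_apply] at h2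
        unfold cellOf at h1
        rw [h2] at h1
        rcases hj with hj | hj
        · rw [hj] at h1
          simp only [Set.Icc.coe_zero, add_zero, Nat.floor_natCast, Nat.ceil_natCast] at h1
          omega
        · rw [hj, Set.Icc.coe_one, show ((m (e j).1 / 2 : ℕ) : ℝ) + 1 = (m (e j).1 / 2 + 1 : ℕ) by
            push_cast; rfl, Nat.floor_natCast, Nat.ceil_natCast] at h1
          omega
      obtain ⟨a', a1, a2⟩ := hlift m k ⟨φ, hφ⟩ hφm
        ⟨fun y => g (φ y), by
          have := g1.comp_continuous (f := fun y : bd k => φ y) (by fun_prop) hφbd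
          exact this⟩
        (fun y => hR m _ (hφm y) (g3 _ (hφbd y)))
      refine ⟨fun x => a' (ψ x), (a'.continuous.comp hψ).continuousOn, fun x hx hxF => ?_,
        fun x hx => ?_⟩
      · have hne : cellOf N x ≠ m := fun h => by
          rcases hxF with h' | h'
          · exact hbd x h h'
          · rw [h] at h'; omega
        obtain ⟨i, hi⟩ := Function.ne_iff.1 hne
        obtain ⟨h1, h2⟩ := (cellOf_cases hx i).resolve_left hi
        have hy : ψ x ∈ bd k := by
          refine ⟨e.symm ⟨i, h1⟩, ?_⟩
          have h3 := hψv x hx (e.symm ⟨i, h1⟩)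
          rw [Equiv.apply_symm_apply] at h3
          rcases h2 with ⟨-, h2⟩ | ⟨-, h2⟩
          · left; ext; rw [h3, h2]; simp
          · right; ext; rw [h3, h2]; simp
        exact (a1 ⟨ψ x, hy⟩).trans (congrArg g (hφψ x hx))
      · have := a2 (ψ x)
        simpa [hφψ x hx] using this
    have : Nonempty (Cub n → Z) := ⟨g⟩
    choose! h h1 h2 h3 using key
    let good : (Fin n → ℕ) → Prop := fun m => cellDim m = k ∧ ∀ x, cellOf N x = m → x ∉ bd n
    let g' : Cub n → Z := fun x => if x ∈ F k then g x else h (cellOf N x) x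
    have hgood : ∀ x, x ∈ F (k + 1) → x ∉ F k → good (cellOf N x) := by
      intro x hx hx'
      simp only [F, Set.mem_ofPred_eq, not_or] at hx hx'
      refine ⟨by have := hx.resolve_left hx'.1; omega, fun y hy hyb => hx'.1 ?_⟩
      -- whether a point lies on the boundary of the cube is determined by its cell
      obtain ⟨i, hi⟩ := hyb
      refine ⟨i, ?_⟩
      have hc := congrFun hy i
      have hx0 : (0 : ℝ) ≤ N * x i := mul_nonneg (Nat.cast_nonneg _) (x i).2.1
      have hx1 := mem_cellSet_cellOf N x i
      rw [← hc] at hx1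
      unfold cellOf at hx1
      rw [floor_add_ceil_div_two.1, floor_add_ceil_div_two.2] at hx1
      rcases hi with hi | hi <;> rw [hi] at hx1
      · left; ext
        have h2 := hx1.2
        simp only [Set.Icc.coe_zero, mul_zero, Nat.ceil_zero, Nat.cast_zero] at h2 ⊢
        exact le_antisymm (by by_contra h; push Not at h; nlinarith) (x i).2.1
      · right; ext
        have h2 := hx1.1
        simp only [Set.Icc.coe_one, mul_one, Nat.floor_natCast] at h2 ⊢
        exact le_antisymm (x i).2.2 (by by_contra h; push Not at h; nlinarith)
    have hg' : ∀ x ∈ F k, g' x = g x := fun x hx => if_pos hx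
    have hh : ∀ m, good m → ∀ x ∈ cellSet N m, x ∈ F (k + 1) → g' x = h m x := by
      intro m hm x hx hxF
      by_cases hxk : x ∈ F k
      · rw [hg' x hxk, h2 m hm.1 hm.2 x hx hxk]
      · simp only [g', if_neg hxk]
        by_cases hne : cellOf N x = m
        · rw [hne]
        · exact (hxk (Or.inr (hm.1 ▸ cellDim_lt hx hne))).elim
    refine ⟨g', ?_, fun x => (hg' x (Or.inl x.2)).trans (g2 x), fun x hx => ?_⟩
    · have hcov : F (k + 1) ⊆ F k ∪ ⋃ m : Fin n → Fin (2 * N + 1),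
          {x | x ∈ cellSet N (fun i => (m i : ℕ)) ∩ F (k + 1) ∧ good (fun i => (m i : ℕ))} := by
        intro x hx
        by_cases hxk : x ∈ F k
        · exact Or.inl hxk
        · obtain ⟨m, hm⟩ := hcell x
          refine Or.inr (Set.mem_iUnion.2 ⟨m, ?_⟩)
          rw [hm]
          exact ⟨⟨mem_cellSet_cellOf N x, hx⟩, hgood x hx hxk⟩
      have hcl : ∀ m : Fin n → Fin (2 * N + 1), IsClosed
          {x | x ∈ cellSet N (fun i => (m i : ℕ)) ∩ F (k + 1) ∧ good (fun i => (m i : ℕ))} := by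
        intro m
        by_cases hm : good (fun i => (m i : ℕ))
        · simpa [hm] using (isClosed_cellSet _).inter (hF _)
        · simp [hm]
      refine ContinuousOn.mono (ContinuousOn.union_of_isClosed (g1.congr hg') ?_ (hF k)
        (isClosed_iUnion_of_finite hcl)) hcov
      refine LocallyFinite.continuousOn_iUnion (locallyFinite_of_finite _) hcl fun m => ?_
      by_cases hm : good (fun i => (m i : ℕ))
      · refine ((h1 _ hm.1 hm.2).mono fun x hx => hx.1.1).congr fun x hx => ?_
        exact hh _ hm x hx.1.1 hx.1.2
      · exact fun x hx => (hm hx.2).elim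
    · by_cases hxk : x ∈ F k
      · rw [hg' x hxk]; exact g3 x hxk
      · have hm := hgood x hx hxk
        simp only [g', if_neg hxk]
        exact h3 _ hm.1 hm.2 x (mem_cellSet_cellOf N x)

end Grid

/-! ### Weak equivalences can be detected on open covers -/

section Cover

variable {X Y : Type*} [TopologicalSpace X] [TopologicalSpace Y]

/-- The restriction of a continuous map to subsets of its source and target. -/
def restr (f : C(X, Y)) {A : Set X} {W : Set Y} (h : ∀ x ∈ A, f x ∈ W) : C(A, W) :=
  ⟨fun x => ⟨f x, h x x.2⟩, by fun_prop⟩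

/-- The map `f` restricts to a weak equivalence from `A` to `W`. -/
def WeakEqOn (f : C(X, Y)) (A : Set X) (W : Set Y) : Prop :=
  ∃ h : ∀ x ∈ A, f x ∈ W, WeakEq (restr f h)

variable {n : ℕ} {N : ℕ}

/-- Lifting problems along a weak equivalence can be solved up to homotopy so that the solution and
the homotopy respect the cells of a subdivided cube. -/
lemma exists_adapted_lift (f : C(X, Y)) (hN : 0 < N) (A : (Fin n → ℕ) → Set X)
    (W : (Fin n → ℕ) → Set Y) (hf : ∀ m, WeakEqOn f (A m) (W m))
    (hA : ∀ m x, x ∈ cellSet N m → A (cellOf N x) ⊆ A m)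
    (hW : ∀ m x, x ∈ cellSet N m → W (cellOf N x) ⊆ W m)
    (a : C(bd n, X)) (c : C(Cub n, Y)) (hac : ∀ x, f (a x) = c x)
    (ha : ∀ x : bd n, a x ∈ A (cellOf N x)) (hc : ∀ x, c x ∈ W (cellOf N x)) :
    ∃ (a' : C(Cub n, X)) (L : C(Cub n × I, Y)), (∀ x : bd n, a' x = a x) ∧ (∀ x, L (x, 0) = c x) ∧
      (∀ x, L (x, 1) = f (a' x)) ∧ (∀ (x : bd n) t, L (x, t) = c x) ∧
      (∀ x, a' x ∈ A (cellOf N x)) ∧ ∀ x t, L (x, t) ∈ W (cellOf N x) := by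
  obtain ⟨g, g1, g2⟩ := exists_cell_lift (Z := X × C(I, Y)) hN
    (fun m x => {z | z.1 ∈ A m ∧ z.2 0 = c x ∧ z.2 1 = f z.1 ∧ ∀ t, z.2 t ∈ W m})
    (fun m x hx z hz => ⟨hA m x hx hz.1, hz.2.1, hz.2.2.1, fun t => hW m x hx (hz.2.2.2 t)⟩)
    ⟨fun x => (a x, .const I (c x)), by fun_prop⟩
    (fun x => ⟨ha x, rfl, (hac x).symm, fun t => hc x⟩) (by
      intro m k φ hφ b hb
      obtain ⟨h, hw⟩ := hf m
      obtain ⟨x', ξ, h1, h2, h3, h4⟩ := hw.path_lift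
        ⟨fun y => ⟨(b y).1, (hb y).1⟩, by fun_prop⟩
        ⟨fun y => ⟨c (φ y), hW m _ (hφ y) (hc _)⟩, by fun_prop⟩
        ⟨fun z => ⟨(b z.1).2 z.2, (hb z.1).2.2.2 z.2⟩, by fun_prop⟩
        (fun y => Subtype.ext (hb y).2.1) (fun y => Subtype.ext (hb y).2.2.1)
      let ξ' : C(Cub k × I, Y) := ⟨fun z => ξ z, by fun_prop⟩
      refine ⟨⟨fun y => (x' y, ξ'.curry y), by fun_prop⟩, fun y => Prod.ext ?_ ?_, fun y =>
        ⟨(x' y).2, congrArg Subtype.val (h2 y), congrArg Subtype.val (h3 y), fun t => (ξ (y, t)).2⟩⟩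
      · exact congrArg Subtype.val (h1 y)
      · ext t
        exact congrArg Subtype.val (h4 y t))
  refine ⟨⟨fun x => (g x).1, by fun_prop⟩, ⟨fun z => (g z.1).2 z.2, by fun_prop⟩,
    fun x => congrArg Prod.fst (g1 x), fun x => (g2 x).2.1, fun x => (g2 x).2.2.1, fun x t => ?_,
    fun x => (g2 x).1, fun x => (g2 x).2.2.2⟩
  exact congrArg (fun z : X × C(I, Y) => z.2 t) (g1 x)

/-- Lebesgue's lemma for a homotopy on a subdivided cube. -/
lemma exists_grid (c : C(Cub n × I, Y)) {𝒰 : Set (Set Y)} (ho : ∀ U ∈ 𝒰, IsOpen U)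
    (hcov : ∀ y, ∃ U ∈ 𝒰, y ∈ U) : ∃ N₀ : ℕ, ∀ N, N₀ ≤ N → ∀ (q : Fin n → ℕ) (l : ℕ), ∃ U ∈ 𝒰,
      ∀ x ∈ cellSet N (fun i => 2 * q i + 1), ∀ t : I, (l : ℝ) ≤ N * t → N * (t : ℝ) ≤ l + 1 →
        c (x, t) ∈ U := by
  obtain ⟨δ, hδ, H⟩ := lebesgue_number_lemma_of_metric (s := (Set.univ : Set (Cub n × I)))
    (c := fun U : 𝒰 => c ⁻¹' U) isCompact_univ (fun U => (ho U U.2).preimage c.continuous)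
    (fun z _ => by
      obtain ⟨U, hU, h⟩ := hcov (c z)
      exact Set.mem_iUnion.2 ⟨⟨U, hU⟩, h⟩)
  obtain ⟨N₀, hN₀⟩ := exists_nat_gt (1 / δ)
  refine ⟨N₀, fun N hN q l => ?_⟩
  have hN1 : 1 / δ < N := hN₀.trans_le (Nat.cast_le.2 hN)
  have hNp : (0 : ℝ) < N := (by positivity : 0 < 1 / δ).trans hN1
  have hNδ : 1 < N * δ := by rwa [div_lt_iff₀ hδ] at hN1
  have hclose : ∀ (y y' : I) (j : ℕ), (j : ℝ) ≤ N * y → N * (y : ℝ) ≤ j + 1 → (j : ℝ) ≤ N * y' →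
      N * (y' : ℝ) ≤ j + 1 → dist y y' < δ := fun y y' j h1 h2 h3 h4 => by
    rw [Subtype.dist_eq, Real.dist_eq, abs_sub_lt_iff]
    constructor <;> refine lt_of_mul_lt_mul_left (a := (N : ℝ)) ?_ hNp.le <;> linarith
  by_cases hne : ∃ (x₀ : Cub n) (t₀ : I), x₀ ∈ cellSet N (fun i => 2 * q i + 1) ∧
      (l : ℝ) ≤ N * t₀ ∧ N * (t₀ : ℝ) ≤ l + 1
  · obtain ⟨x₀, t₀, hx₀, ht1, ht2⟩ := hne
    obtain ⟨⟨U, hU⟩, hb⟩ := H (x₀, t₀) trivial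
    refine ⟨U, hU, fun x hx t h1 h2 => hb ?_⟩
    rw [Metric.mem_ball, Prod.dist_eq]
    refine max_lt ((dist_pi_lt_iff hδ).2 fun i => ?_) (hclose _ _ l h1 h2 ht1 ht2)
    have e1 := hx i
    have e2 := hx₀ i
    rw [show (2 * q i + 1) / 2 = q i by omega, show (2 * q i + 1 + 1) / 2 = q i + 1 by omega]
      at e1 e2
    push_cast at e1 e2
    exact hclose _ _ (q i) e1.1 e1.2 e2.1 e2.2
  · obtain ⟨U, hU, -⟩ := hcov (c (0, 0))
    exact ⟨U, hU, fun x hx t h1 h2 => (hne ⟨x, t, hx, h1, h2⟩).elim⟩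

/-- A map is a weak equivalence if it is one over all members of an open cover of the target which
is closed under intersections. -/
theorem weakEq_of_cover (f : C(X, Y)) {𝒰 : Set (Set Y)} (ho : ∀ U ∈ 𝒰, IsOpen U)
    (hcov : ∀ y, ∃ U ∈ 𝒰, y ∈ U) (hcap : ∀ U ∈ 𝒰, ∀ V ∈ 𝒰, U ∩ V ∈ 𝒰)
    (hf : ∀ U ∈ 𝒰, WeakEqOn f (f ⁻¹' U) U) : WeakEq f := by
  intro n a c hac
  obtain ⟨N, H⟩ := exists_grid (c.comp ⟨Prod.fst, continuous_fst⟩) ho hcov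
  replace H := H (N + 1) (Nat.le_succ _)
  choose lab h1 h2 using fun q => H q 0
  have hc : ∀ x, c x ∈ gridW lab (cellOf (N + 1) x) := fun x q hq =>
    h2 q x (cellSet_subset_of_mem_cellCubes hq (mem_cellSet_cellOf _ x)) 0 (by simp) (by simp)
  obtain ⟨a', L, e1, e2, e3, e4, -⟩ := exists_adapted_lift f N.succ_pos
    (fun m => f ⁻¹' gridW lab m) (gridW lab) (fun m => hf _ (gridW_mem hcap h1 m))
    (fun m x hx => Set.preimage_mono (gridW_mono hx)) (fun m x hx => gridW_mono hx) a c hac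
    (fun x => by
      change f (a x) ∈ gridW lab _
      rw [hac]
      exact hc x) hc
  exact ⟨a', L, e1, e2, e3, e4⟩

end Cover

/-! ### Homotopy fibres can be computed locally in the base -/

namespace HoFibre

variable {X Y : Type u} [TopologicalSpace X] [TopologicalSpace Y] {p : C(X, Y)}

/-- The part of a homotopy fibre where the path in the base stays in a given subset. -/
def inside (p : C(X, Y)) (b : Y) (W : Set Y) : Set (HoFibre p b) := {z | ∀ t, path p b (z, t) ∈ W}

/-- The part of a homotopy fibre where the path in the base runs in `V` up to time `θ` and meets the
conditions `R t` from then on. -/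
def head (p : C(X, Y)) (b : Y) (θ : I) (V : Set Y) (R : I → Set Y) : Set (HoFibre p b) :=
  {z | (∀ t ≤ θ, path p b (z, t) ∈ V) ∧ ∀ t, θ ≤ t → path p b (z, t) ∈ R t}

/-- The reparametrisation of the unit interval which waits at `θ` from `θ / 2` on, if `u = 1`; for
`u = 0` it is the identity. -/
noncomputable def wait (θ u t : I) : I :=
  t ⊔ (Set.projIcc 0 1 zero_le_one ((t : ℝ) * (1 + u)) ⊓ θ)

@[fun_prop] lemma continuous_wait (θ : I) : Continuous fun z : I × I => wait θ z.1 z.2 := by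
  have hp : Continuous (Set.projIcc (0 : ℝ) 1 zero_le_one) := continuous_projIcc
  unfold wait
  fun_prop

lemma wait_of_le {θ t : I} (u : I) (h : θ ≤ t) : wait θ u t = t :=
  sup_eq_left.2 (inf_le_right.trans h)

lemma wait_le {θ t : I} (u : I) (h : t ≤ θ) : wait θ u t ≤ θ := sup_le h inf_le_right

@[simp] lemma wait_zero_left (θ t : I) : wait θ 0 t = t := by
  simp [wait]

@[simp] lemma wait_zero_right (θ u : I) : wait θ u 0 = 0 := by
  simp [wait]

lemma wait_one_of_half {θ t : I} (h : (θ : ℝ) ≤ 2 * t) (h' : t ≤ θ) : wait θ 1 t = θ := by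
  refine le_antisymm (wait_le 1 h') (le_sup_of_le_right (le_inf ?_ le_rfl))
  rw [← Subtype.coe_le_coe, Set.coe_projIcc]
  exact le_max_of_le_right (le_min θ.2.2 (by rw [Set.Icc.coe_one]; linarith))

/-- Shrinking the allowed region of the initial part of the path is a weak equivalence, if it is one
for the homotopy fibres at the points which can occur at the end of that initial part. -/
lemma weakEqOn_head {b : Y} {θ : I} (hθ : 0 < θ) {V V' : Set Y} (hV : V' ⊆ V) (R : I → Set Y)
    (H : ∀ z₀ ∈ V', WeakEqOn (.id _) (inside p z₀ V') (inside p z₀ V))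
    (hR : ∀ z ∈ head p b θ V R, path p b (z, θ) ∈ V') :
    WeakEqOn (.id _) (head p b θ V' R) (head p b θ V R) := by
  have hθ' : (0 : ℝ) < θ := hθ
  refine ⟨fun z hz => ⟨fun t ht => hV (hz.1 t ht), hz.2⟩, .of_free fun n a c hac => ?_⟩
  have hac' : ∀ x, (a x : HoFibre p b) = c x := fun x => congrArg Subtype.val (hac x)
  have hc1 : ∀ x, ∀ t ≤ θ, path p b (c x, t) ∈ V := fun x => (c x).2.1
  have hc2 : ∀ x t, θ ≤ t → path p b (c x, t) ∈ R t := fun x => (c x).2.2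
  have hcθ : ∀ x, path p b (c x, θ) ∈ V' := fun x => hR _ (c x).2
  have ha1 : ∀ x : bd n, ∀ t ≤ θ, path p b (c x, t) ∈ V' := fun x t ht => by
    rw [← hac']; exact (a x).2.1 t ht
  -- `τ` is `0` up to time `θ / 2` and `1` from time `θ` on
  let τ : I → I := fun t => Set.projIcc 0 1 zero_le_one ((2 * (t : ℝ) - θ) / θ)
  have hτ : Continuous τ := continuous_projIcc.comp (by fun_prop)
  have hτ0 : ∀ t : I, 2 * (t : ℝ) ≤ θ → τ t = 0 := fun t ht =>
    Set.projIcc_of_le_left _ (div_nonpos_of_nonpos_of_nonneg (by linarith) hθ'.le)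
  have hτ1 : ∀ t, θ ≤ t → τ t = 1 := fun t ht =>
    Set.projIcc_of_right_le _ (by
      have : (θ : ℝ) ≤ t := ht
      rw [le_div_iff₀ hθ']; linarith)
  -- to its value at the origin of the cube, filling the gap during the waiting time
  let sc : (Cub n × I) × I → Cub n := fun z i => σ (dbl' z.1.2 * τ z.2) * z.1.1 i
  have hsc : Continuous sc := by fun_prop
  let Γ : C((Cub n × I) × I, Y) :=
    ⟨fun z => path p b (c (sc z), wait θ (dbl z.1.2) z.2), by
      have := continuous_wait θ
      have h2 : Continuous fun z : (Cub n × I) × I => wait θ (dbl z.1.2) z.2 :=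
        this.comp (f := fun z : (Cub n × I) × I => (dbl z.1.2, z.2)) (by fun_prop)
      fun_prop⟩
  have hsc0 : ∀ x s t, dbl' s * τ t = 0 → sc ((x, s), t) = x := fun x s t h => by
    ext i; simp only [sc, h]; simp
  have hΓ0 : ∀ x s, Γ ((x, s), 0) = p (pt p b (c x)) := fun x s => by
    simp only [Γ, ContinuousMap.coe_mk, wait_zero_right, path_zero]
    rw [hsc0 x s 0 (by rw [hτ0 0 (by simpa using hθ'.le), mul_zero])]
  have hΓ1 : ∀ x s, Γ ((x, s), 1) = b := fun x s => by
    simp only [Γ, ContinuousMap.coe_mk, wait_of_le _ (unitInterval.le_one' (t := θ)), path_one]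
  have hs : ∀ s : I, (s : ℝ) ≤ 1 / 2 ∧ dbl' s = 0 ∨ dbl s = 1 := fun s =>
    (le_total (s : ℝ) (1 / 2)).imp (fun h => ⟨h, dbl'_of_le h⟩) dbl_of_le
  have hΓV : ∀ (V₀ : Set Y) x s t, V' ⊆ V₀ → (∀ t ≤ θ, path p b (c x, t) ∈ V₀) → t ≤ θ →
      Γ ((x, s), t) ∈ V₀ := by
    intro V₀ x s t hV₀ h ht
    simp only [Γ, ContinuousMap.coe_mk]
    rcases hs s with ⟨-, h'⟩ | h'
    · rw [hsc0 x s t (by rw [h', zero_mul])]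
      exact h _ (wait_le _ ht)
    · rcases le_total (2 * (t : ℝ)) θ with h2 | h2
      · rw [hsc0 x s t (by rw [hτ0 t h2, mul_zero])]
        exact h _ (wait_le _ ht)
      · rw [h', wait_one_of_half h2 ht]
        exact hV₀ (hcθ _)
  have hΓR : ∀ x s t, θ ≤ t → Γ ((x, s), t) ∈ R t := fun x s t ht => by
    simp only [Γ, ContinuousMap.coe_mk, wait_of_le _ ht]
    exact hc2 _ t ht
  let D : C(Cub n × I, HoFibre p b) := mk ⟨fun z => pt p b (c z.1), by fun_prop⟩ Γ
    (fun z => hΓ0 z.1 z.2) (fun z => hΓ1 z.1 z.2)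
  have hD : ∀ z, D z ∈ head p b θ V R := fun z =>
    ⟨fun t ht => hΓV V z.1 z.2 t hV (hc1 z.1) ht, fun t ht => hΓR z.1 z.2 t ht⟩
  have hD' : ∀ (x : bd n) s, D (x, s) ∈ head p b θ V' R := fun x s =>
    ⟨fun t ht => hΓV V' x s t le_rfl (ha1 x) ht, fun t ht => hΓR x s t ht⟩
  have hD0 : ∀ x, D (x, 0) = c x := fun x => by
    ext t
    · rfl
    · change Γ ((x, 0), t) = _
      simp only [Γ, ContinuousMap.coe_mk]
      rw [hsc0 x 0 t (by simp)]
      simp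
  -- the initial parts now form a problem over the homotopy fibre at a single point
  let z₀ : Y := path p b (c 0, θ)
  have hlast : ∀ x t, θ ≤ t → Γ ((x, 1), t) = path p b (c 0, t) := fun x t ht => by
    simp only [Γ, ContinuousMap.coe_mk, wait_of_le _ ht]
    have : sc ((x, 1), t) = 0 := by ext i; simp [sc, hτ1 t ht]
    rw [this]
  let c₁ : C(Cub n, HoFibre p z₀) := mk ⟨fun x => pt p b (c x), by fun_prop⟩
    ⟨fun z => Γ ((z.1, 1), θ * z.2), by fun_prop⟩ (fun x => by
      simp only [ContinuousMap.coe_mk, mul_zero]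
      exact hΓ0 x 1) (fun x => by
      simp only [ContinuousMap.coe_mk, mul_one]
      exact hlast x θ le_rfl)
  have hle : ∀ t : I, θ * t ≤ θ := fun t => unitInterval.mul_le_left
  have hc₁ : ∀ x, c₁ x ∈ inside p z₀ V := fun x t => hΓV V x 1 _ hV (hc1 x) (hle t)
  have ha₁ : ∀ x : bd n, c₁ x ∈ inside p z₀ V' := fun x t =>
    hΓV V' x 1 _ le_rfl (ha1 x) (hle t)
  obtain ⟨hH, hW⟩ := H z₀ (hcθ 0)
  obtain ⟨a', L, h1, h2, h3, h4⟩ := hW n ⟨fun x => ⟨c₁ x, ha₁ x⟩, by fun_prop⟩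
    ⟨fun x => ⟨c₁ x, hc₁ x⟩, by fun_prop⟩ (fun x => rfl)
  -- glue the solution to the common remaining part of the paths
  let dv : I → I := fun t => Set.projIcc 0 1 zero_le_one ((t : ℝ) / θ)
  have hdv : Continuous dv := continuous_projIcc.comp (by fun_prop)
  have hdvθ : dv θ = 1 := by simp [dv, div_self hθ'.ne']
  have hdv' : ∀ t ≤ θ, θ * dv t = t := fun t ht => by
    have ht' : (t : ℝ) ≤ θ := ht
    ext
    simp only [dv, Set.Icc.coe_mul]
    rw [Set.projIcc_of_mem zero_le_one ⟨div_nonneg t.2.1 hθ'.le, (div_le_one hθ').2 ht'⟩]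
    field_simp
  let Ψ : C(HoFibre p z₀, HoFibre p b) := mk (pt p z₀)
    ⟨fun z => if z.2 ≤ θ then path p z₀ (z.1, dv z.2) else path p b (c 0, z.2), by
      refine Continuous.if_le (by fun_prop) (by fun_prop) (by fun_prop) (by fun_prop) ?_
      rintro ⟨z, t⟩ (rfl : t = θ)
      simp [hdvθ, z₀]⟩
    (fun z => by simp [dv])
    (fun z => by
      simp only [ContinuousMap.coe_mk]
      split_ifs with h
      · obtain rfl : θ = 1 := le_antisymm unitInterval.le_one' h
        simp [hdvθ, z₀]
      · simp)
  have hΨp : ∀ z t, path p b (Ψ z, t) =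
    if t ≤ θ then path p z₀ (z, dv t) else path p b (c 0, t) := fun z t => rfl
  have hΨ : ∀ V₀ : Set Y, V' ⊆ V₀ → ∀ z ∈ inside p z₀ V₀, Ψ z ∈ head p b θ V₀ R := by
    refine fun V₀ hV₀ z hz => ⟨fun t ht => ?_, fun t ht => ?_⟩
    · rw [hΨp, if_pos ht]; exact hz _
    · rw [hΨp]
      split_ifs with h
      · obtain rfl : t = θ := le_antisymm h ht
        rw [hdvθ, path_one]
        exact hc2 0 t le_rfl
      · exact hc2 0 t ht
  have hΨc : ∀ x, Ψ (c₁ x) = D (x, 1) := fun x => by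
    ext t
    · rfl
    · rw [hΨp]
      change _ = Γ ((x, 1), t)
      split_ifs with h
      · change Γ ((x, 1), θ * dv t) = _
        rw [hdv' t h]
      · rw [hlast x t (le_of_not_ge h)]
  let k : C(bd n × I, head p b θ V' R) := ⟨fun z => ⟨D (z.1, z.2), hD' z.1 z.2⟩, by fun_prop⟩
  let K : C(Cub n × I, head p b θ V R) := ⟨fun z => ⟨D z, hD z⟩, by fun_prop⟩
  refine Free.of_homotopy (a₁ := ⟨fun x => k (x, 1), by fun_prop⟩)
    (c₁ := ⟨fun x => K (x, 1), by fun_prop⟩) ?_ k K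
    (fun x => Subtype.ext ((hD0 x).trans (hac' x).symm)) (fun _ => rfl)
    (fun x => Subtype.ext (hD0 x)) (fun _ => rfl) (fun x t => rfl)
  refine Solv.free (fun _ => rfl) ⟨⟨fun x => ⟨Ψ (a' x), hΨ V' le_rfl _ (a' x).2⟩, by fun_prop⟩,
    ⟨fun z => ⟨Ψ (L z), hΨ V hV _ (L z).2⟩, by fun_prop⟩, fun x => Subtype.ext ?_,
    fun x => Subtype.ext ?_, fun x => Subtype.ext ?_, fun x t => Subtype.ext ?_⟩
  · exact (congrArg (fun z => Ψ z.1) (h1 x)).trans (hΨc x)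
  · exact (congrArg (fun z => Ψ z.1) (h2 x)).trans (hΨc x)
  · exact congrArg (fun z => Ψ z.1) (h3 x)
  · exact (congrArg (fun z => Ψ z.1) (h4 x t)).trans (hΨc x)

end HoFibre

namespace HoFibre

variable {X Y : Type u} [TopologicalSpace X] [TopologicalSpace Y] {p : C(X, Y)}

/-- A deformation of the identity of the cube, preserving the boundary, which pushes a collar of the
boundary into the boundary. -/
noncomputable def collar {n : ℕ} (z : Cub n × I) : Cub n :=
  fun i => Set.projIcc 0 1 zero_le_one ((1 + (z.2 : ℝ)) * z.1 i - z.2 / 2)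

@[fun_prop] lemma continuous_collar {n : ℕ} : Continuous (collar (n := n)) :=
  continuous_pi fun _ => continuous_projIcc.comp (by fun_prop)

lemma collar_zero {n : ℕ} (x : Cub n) : collar (x, 0) = x := by
  ext i; simp [collar]

lemma collar_mem {n : ℕ} {x : Cub n} (hx : x ∈ bd n) (s : I) : collar (x, s) ∈ bd n := by
  obtain ⟨i, hi⟩ := hx
  have hs := s.2.1
  refine ⟨i, hi.imp (fun h => ?_) fun h => ?_⟩
  · simp only [collar, h]
    exact Set.projIcc_of_le_left _ (by rw [Set.Icc.coe_zero]; linarith)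
  · simp only [collar, h]
    exact Set.projIcc_of_right_le _ (by rw [Set.Icc.coe_one]; linarith)

/-- If `N ≥ 4`, the small cubes which meet the boundary are pushed into the boundary. -/
lemma collar_one_mem {n N : ℕ} (hN : 4 ≤ N) {x y : Cub n} (hx : x ∈ bd n) (q : Fin n → ℕ)
    (hq : x ∈ cellSet N (fun i => 2 * q i + 1)) (hy : y ∈ cellSet N (fun i => 2 * q i + 1)) :
    collar (y, 1) ∈ bd n := by
  obtain ⟨i, hi⟩ := hx
  have h1 := hq i
  have h2 := hy i
  rw [show (2 * q i + 1) / 2 = q i by omega, show (2 * q i + 1 + 1) / 2 = q i + 1 by omega] at h1 h2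
  push_cast at h1 h2
  have hN' : (4 : ℝ) ≤ N := by exact_mod_cast hN
  have hy0 := (y i).2.1
  refine ⟨i, hi.imp (fun h => ?_) fun h => ?_⟩
  · rw [h] at h1
    refine Set.projIcc_of_le_left _ ?_
    simp only [Set.Icc.coe_one, Set.Icc.coe_zero, mul_zero] at h1 ⊢
    nlinarith
  · rw [h] at h1
    refine Set.projIcc_of_right_le _ ?_
    simp only [Set.Icc.coe_one, mul_one] at h1 ⊢
    nlinarith

open Classical in
/-- Suppose that the base has an open cover, closed under intersections, such that passing to a
smaller member of the cover does not change the homotopy fibres of the restrictions of `p` to the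
members. Then these are the homotopy fibres of `p`.

A family of paths is subdivided so that each piece lies in a member of the cover. The pieces are
then moved into the given member one after another, starting at the total space: each step
replaces the region allowed for the initial part of the path by its intersection with the next
one. -/
theorem weakEqOn_inside {𝒲 : Set (Set Y)} (ho : ∀ U ∈ 𝒲, IsOpen U) (hcov : ∀ y, ∃ U ∈ 𝒲, y ∈ U)
    (hcap : ∀ U ∈ 𝒲, ∀ V ∈ 𝒲, U ∩ V ∈ 𝒲)
    (HC : ∀ V ∈ 𝒲, ∀ V' ∈ 𝒲, V' ⊆ V → ∀ z₀ ∈ V',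
      WeakEqOn (.id _) (inside p z₀ V') (inside p z₀ V))
    {b : Y} {W : Set Y} (hW : W ∈ 𝒲) (hb : b ∈ W) :
    WeakEqOn (.id _) (inside p b W) Set.univ := by
  refine ⟨fun _ _ => trivial, .of_free fun n a c hac => ?_⟩
  have hac' : ∀ x, (a x : HoFibre p b) = c x := fun x => congrArg Subtype.val (hac x)
  -- push the problem into a collar of the boundary
  refine Free.of_homotopy (a₁ := ⟨fun x => a ⟨collar (x, 1), collar_mem x.2 1⟩, by fun_prop⟩)
    (c₁ := ⟨fun x => c (collar (x, 1)), by fun_prop⟩) ?_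
    ⟨fun z => a ⟨collar (z.1, z.2), collar_mem z.1.2 z.2⟩, by fun_prop⟩
    ⟨fun z => c (collar z), by fun_prop⟩ (fun x => congrArg a (Subtype.ext (collar_zero x.1)))
    (fun _ => rfl) (fun x => congrArg c (collar_zero x)) (fun _ => rfl)
    (fun x t => (hac ⟨collar (x, t), collar_mem x.2 t⟩).symm)
  let d : C(Cub n, HoFibre p b) := ⟨fun x => c (collar (x, 1)), by fun_prop⟩
  have hd : ∀ x, collar (x, 1) ∈ bd n → d x ∈ inside p b W := fun x hx => by
    have := (a ⟨_, hx⟩).2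
    rwa [hac'] at this
  obtain ⟨N₀, hN₀⟩ := exists_grid
    ((path p b).comp (d.prodMap (ContinuousMap.id I))) ho hcov
  obtain ⟨N, hN₀N, hN4⟩ : ∃ N, N₀ ≤ N ∧ 4 ≤ N := ⟨max N₀ 4, le_max_left _ _, le_max_right _ _⟩
  have hN : 0 < N := lt_of_lt_of_le (by norm_num) hN4
  have hN' : (0 : ℝ) < N := Nat.cast_pos.2 hN
  replace hN₀ := hN₀ N hN₀N
  choose lab₀ hlab₀ hlab₀' using hN₀
  let lab : ℕ → (Fin n → ℕ) → Set Y := fun l q =>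
    if N ≤ l ∨ ∃ x ∈ bd n, x ∈ cellSet N (fun i => 2 * q i + 1) then W else lab₀ q l
  have hlab₁ : ∀ l q, (N ≤ l ∨ ∃ x ∈ bd n, x ∈ cellSet N (fun i => 2 * q i + 1)) → lab l q = W :=
    fun l q h => if_pos h
  have hlab : ∀ l q, lab l q ∈ 𝒲 := fun l q => by
    simp only [lab]; split_ifs
    exacts [hW, hlab₀ q l]
  have hlabW : ∀ l (x : bd n), ∀ y ∈ W, y ∈ gridW (lab l) (cellOf N x) := fun l x y hy q hq => by
    have hx := cellSet_subset_of_mem_cellCubes hq (mem_cellSet_cellOf N x.1)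
    rwa [hlab₁ l q (Or.inr ⟨x, x.2, hx⟩)]
  have hdlab : ∀ (l : ℕ) x (t : I), (l : ℝ) ≤ N * t → N * (t : ℝ) ≤ l + 1 →
      path p b (d x, t) ∈ gridW (lab l) (cellOf N x) := fun l x t h1 h2 q hq => by
    have hx := cellSet_subset_of_mem_cellCubes hq (mem_cellSet_cellOf N x)
    simp only [lab]; split_ifs with h
    · rcases h with h | ⟨y, hy, hyq⟩
      · have h3 : (N : ℝ) ≤ l := Nat.cast_le.2 h
        obtain rfl : t = 1 := by
          refine le_antisymm unitInterval.le_one' ?_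
          rw [← Subtype.coe_le_coe, Set.Icc.coe_one]
          exact (mul_le_mul_iff_right₀ hN').1 (by linarith)
        simpa using hb
      · exact hd x (collar_one_mem hN4 hy q hyq hx) t
    · exact hlab₀' q l x hx t h1 h2
  let A : ℕ → (Fin n → ℕ) → Set (HoFibre p b) := fun l m =>
    {z | (∀ t : I, N * (t : ℝ) ≤ l + 1 → path p b (z, t) ∈ gridW (lab l) m) ∧
      ∀ j, l < j → j ≤ N → ∀ t : I, (j : ℝ) ≤ N * t → N * (t : ℝ) ≤ j + 1 →
        path p b (z, t) ∈ gridW (lab j) m}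
  have hdW : ∀ x : bd n, d x ∈ inside p b W := fun x => hd x (collar_mem x.2 1)
  suffices key : ∀ l ≤ N, ∃ (d' : C(Cub n, HoFibre p b)) (L : C(Cub n × I, HoFibre p b)),
      (∀ x, L (x, 0) = d x) ∧ (∀ x, L (x, 1) = d' x) ∧ (∀ (x : bd n) t, L (x, t) = d x) ∧
      ∀ x, d' x ∈ A l (cellOf N x) by
    obtain ⟨d', L, h1, h2, h3, h4⟩ := key N le_rfl
    have h5 : ∀ x, d' x ∈ inside p b W := fun x t => by
      obtain ⟨q, hq⟩ := cellCubes_nonempty (cellOf N x)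
      rw [← hlab₁ N q (Or.inl le_rfl)]
      refine (h4 x).1 t ?_ q hq
      have := mul_le_of_le_one_right hN'.le t.2.2
      linarith
    refine Solv.free (fun x => hac ⟨_, collar_mem x.2 1⟩) ⟨⟨fun x => ⟨d' x, h5 x⟩, by fun_prop⟩,
      ⟨fun z => ⟨L z, trivial⟩, by fun_prop⟩, fun x => Subtype.ext ?_, fun x => Subtype.ext (h1 x),
      fun x => Subtype.ext (h2 x), fun x t => Subtype.ext (h3 x t)⟩
    exact ((h2 x).symm.trans (h3 x 1)).trans (hac' ⟨_, collar_mem x.2 1⟩).symm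
  intro l
  induction l with
  | zero =>
    refine fun _ => ⟨d, ⟨fun z => d z.1, by fun_prop⟩, fun _ => rfl, fun _ => rfl, fun _ _ => rfl,
      fun x => ⟨fun t ht => hdlab 0 x t (by have := t.2.1; simp; positivity) ht,
        fun j _ _ t h1 h2 => hdlab j x t h1 h2⟩⟩
  | succ l ih =>
    intro hl
    obtain ⟨d', L, h1, h2, h3, h4⟩ := ih (Nat.le_of_succ_le hl)
    have hl' : (l : ℝ) + 1 ≤ N := by exact_mod_cast hl
    have hd' : ∀ x : bd n, d' x = d x := fun x => (h2 x).symm.trans (h3 x 1)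
    let θ : I := ⟨((l : ℝ) + 1) / N, by positivity, (div_le_one hN').2 hl'⟩
    have hθ : 0 < θ := Subtype.coe_lt_coe.1 (show (0 : ℝ) < ((l : ℝ) + 1) / N by positivity)
    have hle : ∀ t : I, t ≤ θ ↔ N * (t : ℝ) ≤ l + 1 := fun t => by
      rw [← Subtype.coe_le_coe, le_div_iff₀ hN', mul_comm]
    have hge : ∀ t : I, θ ≤ t ↔ (l : ℝ) + 1 ≤ N * t := fun t => by
      rw [← Subtype.coe_le_coe, div_le_iff₀ hN', mul_comm]
    let R : (Fin n → ℕ) → I → Set Y := fun m t => {y | ∀ j, l < j → j ≤ N → (j : ℝ) ≤ N * t →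
      N * (t : ℝ) ≤ j + 1 → y ∈ gridW (lab j) m}
    have hcast : ∀ j, l < j → (l : ℝ) + 1 ≤ j := fun j hj => by exact_mod_cast hj
    obtain ⟨a', K, e1, e2, e3, e4, e5, e6⟩ := exists_adapted_lift (ContinuousMap.id (HoFibre p b)) hN
      (fun m => head p b θ (gridW (lab l) m ∩ gridW (lab (l + 1)) m) (R m))
      (fun m => head p b θ (gridW (lab l) m) (R m))
      (fun m => weakEqOn_head hθ Set.inter_subset_left _
        (HC _ (gridW_mem hcap (hlab l) m) _ (hcap _ (gridW_mem hcap (hlab l) m) _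
          (gridW_mem hcap (hlab (l + 1)) m)) Set.inter_subset_left)
        (fun z hz => ⟨hz.1 θ le_rfl, hz.2 θ le_rfl (l + 1) l.lt_succ_self hl
          (by push_cast; exact (hge θ).1 le_rfl) (by push_cast; linarith [(hle θ).1 le_rfl])⟩))
      (fun m x hx z hz => ⟨fun t ht => ⟨gridW_mono hx (hz.1 t ht).1, gridW_mono hx (hz.1 t ht).2⟩,
        fun t ht j j1 j2 j3 j4 => gridW_mono hx (hz.2 t ht j j1 j2 j3 j4)⟩)
      (fun m x hx z hz => ⟨fun t ht => gridW_mono hx (hz.1 t ht),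
        fun t ht j j1 j2 j3 j4 => gridW_mono hx (hz.2 t ht j j1 j2 j3 j4)⟩)
      ⟨fun x => d x, by fun_prop⟩ d' (fun x => (hd' x).symm)
      (fun x => ⟨fun t _ => ⟨hlabW _ x _ (hdW x t), hlabW _ x _ (hdW x t)⟩,
        fun t _ j _ _ _ _ => hlabW _ x _ (hdW x t)⟩)
      (fun x => ⟨fun t ht => (h4 x).1 t ((hle t).1 ht),
        fun t _ j j1 j2 j3 j4 => (h4 x).2 j j1 j2 t j3 j4⟩)
    refine ⟨a', cat L K fun x => (h2 x).trans (e2 x).symm, fun x => by simp [h1],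
      fun x => by simp [e3], fun x t => cat_mem _ (fun z => z = d x) (h3 x)
        (fun t => (e4 x t).trans (hd' x)) t, fun x => ⟨fun t ht => ?_, fun j j1 j2 t j3 j4 => ?_⟩⟩
    · push_cast at ht
      rcases le_total t θ with h | h
      · exact ((e5 x).1 t h).2
      · exact (e5 x).2 t h (l + 1) l.lt_succ_self hl (by push_cast; exact (hge t).1 h)
          (by push_cast; exact ht)
    · exact (e5 x).2 t ((hge t).2 (by linarith [hcast j (by omega)])) j (by omega) j2 j3 j4

end HoFibre

/-! ### Points of simplices -/

section Simplex

variable {α β : Type*} [Fintype α] [Fintype β]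

lemma sum_map_mul (f : α → β) (t : stdSimplex ℝ α) (g : β → ℝ) :
    ∑ y, g y * stdSimplex.map f t y = ∑ x, g (f x) * t x := by
  classical
  simp only [stdSimplex.map_coe, FunOnFinite.linearMap_apply_apply, Finset.mul_sum]
  rw [← Finset.sum_fiberwise Finset.univ f]
  refine Finset.sum_congr rfl fun y _ => Finset.sum_congr rfl fun x hx => ?_
  rw [(Finset.mem_filter.1 hx).2]

/-- The point dividing the segment from `s` to `t` in the ratio `v : 1 - v`. -/
def mix (v : I) (s t : stdSimplex ℝ α) : stdSimplex ℝ α :=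
  ⟨fun i => (1 - (v : ℝ)) * s i + v * t i, fun i => by
    have h1 := v.2.1
    have h2 := v.2.2
    have h3 := s.2.1 i
    have h4 := t.2.1 i
    exact add_nonneg (mul_nonneg (by linarith) h3) (mul_nonneg h1 h4), by
    rw [Finset.sum_add_distrib, ← Finset.mul_sum, ← Finset.mul_sum, stdSimplex.sum_eq_one,
      stdSimplex.sum_eq_one]
    ring⟩

lemma mix_apply (v : I) (s t : stdSimplex ℝ α) (i : α) :
    mix v s t i = (1 - (v : ℝ)) * s i + v * t i := rfl

@[simp] lemma mix_zero (s t : stdSimplex ℝ α) : mix 0 s t = s := by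
  ext i; simp [mix_apply]

@[simp] lemma mix_one (s t : stdSimplex ℝ α) : mix 1 s t = t := by
  ext i; simp [mix_apply]

lemma sum_mul_mix (v : I) (s t : stdSimplex ℝ α) (g : α → ℝ) :
    ∑ i, g i * mix v s t i = (1 - (v : ℝ)) * ∑ i, g i * s i + v * ∑ i, g i * t i := by
  rw [Finset.mul_sum, Finset.mul_sum, ← Finset.sum_add_distrib]
  exact Finset.sum_congr rfl fun i _ => by rw [mix_apply]; ring

lemma map_mix (f : α → β) (v : I) (s t : stdSimplex ℝ α) :
    stdSimplex.map f (mix v s t) = mix v (stdSimplex.map f s) (stdSimplex.map f t) := by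
  classical
  ext j
  have h := fun u => sum_map_mul f u (fun y => if y = j then (1 : ℝ) else 0)
  simp only [ite_mul, one_mul, zero_mul, Finset.sum_ite_eq', Finset.mem_univ, if_true] at h
  have h' := sum_mul_mix v s t (fun x => if f x = j then (1 : ℝ) else 0)
  simp only [ite_mul, one_mul, zero_mul] at h'
  rw [mix_apply, h, h, h, h']

lemma continuous_stdSimplex_apply (i : α) : Continuous fun t : stdSimplex ℝ α => t i :=
  (continuous_apply i).comp continuous_subtype_val

@[fun_prop] lemma Continuous.stdSimplex_apply {Z : Type*} [TopologicalSpace Z] {f : Z → stdSimplex ℝ α}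
    (hf : Continuous f) (i : α) : Continuous fun z => f z i :=
  (continuous_stdSimplex_apply i).comp hf

@[fun_prop] lemma Continuous.mix {Z : Type*} [TopologicalSpace Z] {v : Z → I} {s t : Z → stdSimplex ℝ α}
    (hv : Continuous v) (hs : Continuous s) (ht : Continuous t) :
    Continuous fun z => mix (v z) (s z) (t z) :=
  Continuous.subtype_mk (continuous_pi fun i => by fun_prop) _

@[fun_prop] lemma Continuous.stdSimplex_map {Z : Type*} [TopologicalSpace Z] (f : α → β)
    {t : Z → stdSimplex ℝ α} (ht : Continuous t) : Continuous fun z => stdSimplex.map f (t z) :=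
  (stdSimplex.continuous_map f).comp ht

/-- The sum of the first `j` barycentric coordinates. -/
def psum {n : ℕ} (t : stdSimplex ℝ (Fin (n + 1))) (j : ℕ) : ℝ :=
  ∑ i : Fin (n + 1), (if (i : ℕ) < j then (1 : ℝ) else 0) * t i

variable {n m : ℕ}

lemma psum_mono (t : stdSimplex ℝ (Fin (n + 1))) : Monotone (psum t) := by
  intro j j' h
  refine Finset.sum_le_sum fun i _ => mul_le_mul_of_nonneg_right ?_ (t.2.1 i)
  split_ifs with h1 h2
  exacts [le_rfl, (h2 (h1.trans_le h)).elim, zero_le_one, le_rfl]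

lemma psum_zero (t : stdSimplex ℝ (Fin (n + 1))) : psum t 0 = 0 := by simp [psum]

lemma psum_last (t : stdSimplex ℝ (Fin (n + 1))) : psum t (n + 1) = 1 := by
  have : ∀ i : Fin (n + 1), (i : ℕ) < n + 1 := fun i => i.2
  simp [psum, this]

lemma continuous_psum (j : ℕ) : Continuous fun t : stdSimplex ℝ (Fin (n + 1)) => psum t j := by
  unfold psum; fun_prop

/-- When the unit interval is divided into consecutive intervals of lengths `t 0, …, t n`, the
number `c` is an interior point of the interval number `l`. -/
def At (t : stdSimplex ℝ (Fin (n + 1))) (c : ℝ) (l : Fin (n + 1)) : Prop :=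
  psum t l < c ∧ c < psum t (l + 1)

lemma At.le {t : stdSimplex ℝ (Fin (n + 1))} {c c' : ℝ} {l l' : Fin (n + 1)} (h : At t c l)
    (h' : At t c' l') (hc : c ≤ c') : l ≤ l' := by
  by_contra hl
  push Not at hl
  have := psum_mono t (show (l' : ℕ) + 1 ≤ l from hl)
  have h1 := h.1
  have h2 := h'.2
  linarith

lemma At.eq {t : stdSimplex ℝ (Fin (n + 1))} {c : ℝ} {l l' : Fin (n + 1)} (h : At t c l)
    (h' : At t c l') : l = l' :=
  le_antisymm (h.le h' le_rfl) (h'.le h le_rfl)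

lemma isOpen_at (c : ℝ) (l : Fin (n + 1)) : IsOpen {t : stdSimplex ℝ (Fin (n + 1)) | At t c l} :=
  (isOpen_lt (continuous_psum _) continuous_const).inter
    (isOpen_lt continuous_const (continuous_psum _))

lemma At.mix {s t : stdSimplex ℝ (Fin (n + 1))} {c : ℝ} {l : Fin (n + 1)} (h : At s c l)
    (h' : At t c l) (v : I) : At (mix v s t) c l := by
  have e : ∀ j, psum (SemiSimp.mix v s t) j = (1 - (v : ℝ)) * psum s j + v * psum t j := fun j =>
    sum_mul_mix v s t _
  obtain ⟨h1, h2⟩ := h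
  obtain ⟨h3, h4⟩ := h'
  have v0 := v.2.1
  have v1 := v.2.2
  constructor <;> rw [e]
  · rcases v0.eq_or_lt with hv | hv
    · rw [← hv]; linarith
    · nlinarith
  · rcases v0.eq_or_lt with hv | hv
    · rw [← hv]; linarith
    · nlinarith

lemma psum_map (f : Fin (m + 1) → Fin (n + 1)) (t : stdSimplex ℝ (Fin (m + 1))) (j : ℕ) :
    psum (stdSimplex.map f t) j = ∑ i, (if (f i : ℕ) < j then (1 : ℝ) else 0) * t i :=
  sum_map_mul f t _

lemma at_map_iff (f : Fin (m + 1) ↪o Fin (n + 1)) (t : stdSimplex ℝ (Fin (m + 1))) (c : ℝ)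
    (l : Fin (m + 1)) : At (stdSimplex.map f t) c (f l) ↔ At t c l := by
  have h1 : ∀ i, (f i : ℕ) < f l ↔ (i : ℕ) < l := fun i => f.lt_iff_lt
  have h2 : ∀ i, (f i : ℕ) < (f l : ℕ) + 1 ↔ (i : ℕ) < (l : ℕ) + 1 := fun i => by
    rw [Nat.lt_succ_iff, Nat.lt_succ_iff]; exact f.le_iff_le
  simp only [At, psum_map, h1, h2]
  rfl

lemma At.exists_of_map {f : Fin (m + 1) ↪o Fin (n + 1)} {t : stdSimplex ℝ (Fin (m + 1))} {c : ℝ}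
    {l : Fin (n + 1)} (h : At (stdSimplex.map f t) c l) : ∃ k, f k = l := by
  by_contra hk
  push Not at hk
  have h1 : ∀ i, (f i : ℕ) < (l : ℕ) + 1 ↔ (f i : ℕ) < l := fun i => by
    have : (f i : ℕ) ≠ l := fun h => hk i (Fin.ext h)
    omega
  obtain ⟨h2, h3⟩ := h
  rw [psum_map] at h2 h3
  simp only [h1] at h3
  linarith

lemma exists_at {t : stdSimplex ℝ (Fin (n + 1))} {c : ℝ} (h0 : 0 < c) (h1 : c < 1)
    (h : ∀ j ≤ n, psum t j ≠ c) : ∃ l, At t c l := by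
  classical
  have hex : ∃ j, c < psum t j := ⟨n + 1, by rwa [psum_last]⟩
  have hj := Nat.find_spec hex
  have hmin := fun i => Nat.find_min (m := i) hex
  set j := Nat.find hex
  have hj1 : j ≤ n + 1 := Nat.find_le (by rwa [psum_last])
  obtain ⟨i, hi⟩ : ∃ i, j = i + 1 := by
    refine Nat.exists_eq_succ_of_ne_zero fun h => ?_
    rw [h, psum_zero] at hj
    linarith
  refine ⟨⟨i, by omega⟩, lt_of_le_of_ne (not_lt.1 (hmin i (by omega))) (h i (by omega)), ?_⟩
  rw [← hi]; exact hj

/-- If `c` lies in the interval `θ (π c)` of `t` for the members `c` of a set, there is a point `w`,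
with coordinates indexed by the source of `θ`, for which `c` lies in the interval `π c`. -/
lemma exists_weights {C : Finset ℝ} {π : ℝ → Fin (m + 1)} (θ : Fin (m + 1) ↪o Fin (n + 1))
    {t : stdSimplex ℝ (Fin (n + 1))} (h : ∀ c ∈ C, At t c (θ (π c))) :
    ∃ w : stdSimplex ℝ (Fin (m + 1)), ∀ c ∈ C, At w c (π c) := by
  classical
  let lam : Fin (n + 1) → Fin (m + 1) := fun j => (Finset.univ.filter fun i => θ i ≤ j).sup id
  have h1 : ∀ i j, lam j < i → j < θ i := fun i j hl => by
    by_contra hj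
    push Not at hj
    exact hl.not_ge (Finset.le_sup (f := id) (by simpa using hj))
  have h2 : ∀ i j, j ≤ θ i → lam j ≤ i := fun i j hl =>
    Finset.sup_le fun i' hi' => θ.le_iff_le.1 ((Finset.mem_filter.1 hi').2.trans hl)
  refine ⟨stdSimplex.map lam t, fun c hc => ?_⟩
  obtain ⟨h3, h4⟩ := h c hc
  constructor <;> rw [psum_map]
  · refine lt_of_le_of_lt (Finset.sum_le_sum fun j _ => ?_) h3
    refine mul_le_mul_of_nonneg_right ?_ (t.2.1 j)
    split_ifs with h5 h6
    exacts [le_rfl, (h6 (h1 _ _ h5)).elim, zero_le_one, le_rfl]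
  · refine lt_of_lt_of_le h4 (Finset.sum_le_sum fun j _ => ?_)
    refine mul_le_mul_of_nonneg_right ?_ (t.2.1 j)
    split_ifs with h5 h6
    exacts [le_rfl, (h6 (Nat.lt_succ_of_le (h2 _ _ (Nat.lt_succ_iff.1 h5)))).elim, zero_le_one,
      le_rfl]

end Simplex

lemma homEquiv_comp_apply {a b c : SemiSimplexCategory} (f : a ⟶ b) (g : b ⟶ c)
    (i : Fin (a.len + 1)) : SemiSimplexCategory.homEquiv (f ≫ g) i =
      SemiSimplexCategory.homEquiv g (SemiSimplexCategory.homEquiv f i) := by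
  rw [SemiSimplexCategory.homEquiv_comp]; rfl

/-! ### An open cover of the geometric realisation -/

namespace Realisation

variable {S T : SemiTop.{u}}

/-- The point of the realisation with given simplex and barycentric coordinates. -/
def mk {n : SemiSimplexCategory} (x : S.obj (op n)) (t : stdSimplex ℝ (Fin (n.len + 1))) :
    Realisation S := Quot.mk _ ⟨n, (x, t)⟩

lemma mk_map {m n : SemiSimplexCategory} (f : m ⟶ n) (x : S.obj (op n))
    (t : stdSimplex ℝ (Fin (m.len + 1))) :
    mk (S.map f.op x) t = mk x (stdSimplex.map (SemiSimplexCategory.homEquiv f) t) :=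
  Quot.sound (.glue f x t)

lemma exists_rep (z : Realisation S) : ∃ (n : SemiSimplexCategory) (x : S.obj (op n))
    (t : stdSimplex ℝ (Fin (n.len + 1))), z = mk x t := by
  obtain ⟨⟨n, x, t⟩, rfl⟩ := Quot.exists_rep z
  exact ⟨n, x, t, rfl⟩

lemma isQuotientMap_mk : IsQuotientMap (Quot.mk (RealisationRel S)) := isQuotientMap_quot_mk

@[fun_prop] lemma continuous_mk {n : SemiSimplexCategory} {Z : Type*} [TopologicalSpace Z]
    {x : Z → S.obj (op n)} {t : Z → stdSimplex ℝ (Fin (n.len + 1))} (hx : Continuous x)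
    (ht : Continuous t) : Continuous fun z => mk (x z) (t z) :=
  continuous_quot_mk.comp (continuous_sigmaMk.comp (hx.prodMk ht))

@[simp] lemma map_mk (g : S ⟶ T) {n : SemiSimplexCategory} (x : S.obj (op n))
    (t : stdSimplex ℝ (Fin (n.len + 1))) : map g (mk x t) = mk (g.app _ x) t := rfl

lemma isOpen_iff {U : Set (Realisation S)} : IsOpen U ↔ ∀ n : SemiSimplexCategory,
    IsOpen {z : S.obj (op n) × stdSimplex ℝ (Fin (n.len + 1)) | mk z.1 z.2 ∈ U} := by
  refine isQuotientMap_mk.isOpen_preimage.symm.trans ?_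
  rw [isOpen_sigma_iff]
  rfl

/-- Points of the realisation for which no member of `C` is an endpoint of one of the intervals into
which the barycentric coordinates divide the unit interval. -/
def noJump (C : Finset ℝ) : Set (Realisation S) :=
  {z | Quot.lift (fun z : PreRealisation S => ∀ c ∈ C, ∃ l, At z.2.2 c l) (by
    rintro _ _ ⟨f, x, t⟩
    refine propext (forall₂_congr fun c _ => ⟨fun ⟨l, hl⟩ => ⟨_, (at_map_iff _ t c l).2 hl⟩, ?_⟩)
    rintro ⟨l, hl⟩
    obtain ⟨k, rfl⟩ := hl.exists_of_map
    exact ⟨k, (at_map_iff _ t c k).1 hl⟩) z}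

lemma mem_noJump {C : Finset ℝ} {n : SemiSimplexCategory} {x : S.obj (op n)}
    {t : stdSimplex ℝ (Fin (n.len + 1))} : mk x t ∈ noJump C ↔ ∀ c ∈ C, ∃ l, At t c l := Iff.rfl

lemma isOpen_noJump (C : Finset ℝ) : IsOpen (noJump (S := S) C) := by
  refine isOpen_iff.2 fun n => ?_
  have : {z : S.obj (op n) × stdSimplex ℝ (Fin (n.len + 1)) | mk z.1 z.2 ∈ noJump C} =
      ⋂ c ∈ C, ⋃ l, {z | At z.2 c l} := by
    ext z; simp [mem_noJump]
  rw [this]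
  exact isOpen_biInter_finset fun c _ => isOpen_iUnion fun l => (isOpen_at c l).preimage continuous_snd

lemma noJump_inter (C D : Finset ℝ) : noJump (S := S) C ∩ noJump D = noJump (C ∪ D) := by
  ext z
  obtain ⟨n, x, t, rfl⟩ := exists_rep z
  simp only [Set.mem_inter_iff, mem_noJump, Finset.mem_union]
  grind

lemma exists_noJump (z : Realisation S) : ∃ C : Finset ℝ, C.Nonempty ∧ z ∈ noJump C := by
  obtain ⟨n, x, t, rfl⟩ := exists_rep z
  obtain ⟨c, hc, hc'⟩ := (Set.Ioo_infinite (zero_lt_one' ℝ)).exists_notMem_finset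
    ((Finset.range (n.len + 1)).image (psum t))
  refine ⟨{c}, by simp, fun c' hc'' => ?_⟩
  obtain rfl := Finset.mem_singleton.1 hc''
  refine exists_at hc.1 hc.2 fun j hj h => hc' ?_
  rw [← h]
  exact Finset.mem_image_of_mem _ (Finset.mem_range.2 (Nat.lt_succ_of_le hj))

/-- A finite set of numbers sorted into `k + 1` nonempty classes. Only the values of `cls` on the
set matter. -/
structure Sorting where
  nums : Finset ℝ
  k : ℕ
  cls : ℝ → Fin (k + 1)
  surj : ∀ i, ∃ c ∈ nums, cls c = i

/-- The vertices of a simplex whose intervals contain members of the set have positive coordinates,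
so that they belong to each face containing the point. -/
lemma Sorting.exists_factor (P : Sorting) {m n : SemiSimplexCategory} {f : m ⟶ n}
    {θ : .mk P.k ⟶ n} {t : stdSimplex ℝ (Fin (m.len + 1))}
    (h : ∀ c ∈ P.nums, At (stdSimplex.map (SemiSimplexCategory.homEquiv f) t) c
      (SemiSimplexCategory.homEquiv θ (P.cls c))) :
    ∃ θ' : .mk P.k ⟶ m, θ' ≫ f = θ ∧
      ∀ c ∈ P.nums, At t c (SemiSimplexCategory.homEquiv θ' (P.cls c)) := by
  have h3 : ∀ i, ∃ l, SemiSimplexCategory.homEquiv f l = SemiSimplexCategory.homEquiv θ i :=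
    fun i => by
      obtain ⟨c, hc, rfl⟩ := P.surj i
      exact (h c hc).exists_of_map
  choose l hl using h3
  have hm : ∀ i j, l i ≤ l j ↔ i ≤ j := fun i j => by
    rw [← (SemiSimplexCategory.homEquiv f).le_iff_le, hl, hl, OrderEmbedding.le_iff_le]
  refine ⟨SemiSimplexCategory.homEquiv.symm
    ⟨⟨l, fun i j h => le_antisymm ((hm i j).1 h.le) ((hm j i).1 h.ge)⟩, hm _ _⟩, ?_, fun c hc =>
    (at_map_iff (SemiSimplexCategory.homEquiv f) t c _).1 ?_⟩
  · ext i : 2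
    rw [homEquiv_comp_apply, Equiv.apply_symm_apply]
    exact hl i
  · have := h c hc
    rwa [← hl] at this

/-- The simplex `y` is the face of the simplex carrying the point `z` spanned by the vertices whose
intervals contain members of the set, and these vertices sort the set as prescribed. -/
def Carried (P : Sorting) (z : Realisation S) (y : S.obj (op (.mk P.k))) : Prop :=
  Quot.lift (fun z : PreRealisation S => ∃ θ : .mk P.k ⟶ z.1,
      (∀ c ∈ P.nums, At z.2.2 c (SemiSimplexCategory.homEquiv θ (P.cls c))) ∧
        S.map θ.op z.2.1 = y) (by
    rintro _ _ ⟨f, x, t⟩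
    refine propext ⟨?_, ?_⟩
    · rintro ⟨θ, h1, h2⟩
      refine ⟨θ ≫ f, fun c hc => by rw [homEquiv_comp_apply]; exact (at_map_iff _ t c _).2 (h1 c hc), ?_⟩
      rw [← h2]
      simp
    · rintro ⟨θ, h1, h2⟩
      obtain ⟨θ', hθ, h3⟩ := P.exists_factor h1
      refine ⟨θ', h3, ?_⟩
      rw [← h2, ← hθ]
      simp) z

lemma carried_mk {P : Sorting} {n : SemiSimplexCategory} {x : S.obj (op n)}
    {t : stdSimplex ℝ (Fin (n.len + 1))} {y : S.obj (op (.mk P.k))} :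
    Carried P (mk x t) y ↔ ∃ θ : .mk P.k ⟶ n,
      (∀ c ∈ P.nums, At t c (SemiSimplexCategory.homEquiv θ (P.cls c))) ∧ S.map θ.op x = y :=
  Iff.rfl

lemma Sorting.hom_eq (P : Sorting) {n : SemiSimplexCategory} {θ θ' : .mk P.k ⟶ n}
    {t : stdSimplex ℝ (Fin (n.len + 1))}
    (h : ∀ c ∈ P.nums, At t c (SemiSimplexCategory.homEquiv θ (P.cls c)))
    (h' : ∀ c ∈ P.nums, At t c (SemiSimplexCategory.homEquiv θ' (P.cls c))) : θ = θ' := by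
  ext i : 2
  obtain ⟨c, hc, rfl⟩ := P.surj i
  exact (h c hc).eq (h' c hc)

lemma Carried.eq {P : Sorting} {z : Realisation S} {y y' : S.obj (op (.mk P.k))}
    (h : Carried P z y) (h' : Carried P z y') : y = y' := by
  obtain ⟨n, x, t, rfl⟩ := exists_rep z
  obtain ⟨θ, h1, rfl⟩ := h
  obtain ⟨θ', h2, rfl⟩ := h'
  rw [P.hom_eq h1 h2]

lemma Carried.map {P : Sorting} {z : Realisation S} {y : S.obj (op (.mk P.k))}
    (h : Carried P z y) (g : S ⟶ T) : Carried P (map g z) (g.app _ y) := by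
  obtain ⟨n, x, t, rfl⟩ := exists_rep z
  obtain ⟨θ, h1, rfl⟩ := h
  refine ⟨θ, h1, ?_⟩
  change T.map θ.op (g.app _ x) = _
  rw [← ConcreteCategory.comp_apply, ← g.naturality, ConcreteCategory.comp_apply]

/-- The points whose simplex has a face as in `Carried`. -/
def piece (S : SemiTop.{u}) (P : Sorting) : Set (Realisation S) := {z | ∃ y, Carried P z y}

lemma mk_mem_piece {P : Sorting} {n : SemiSimplexCategory} {x : S.obj (op n)}
    {t : stdSimplex ℝ (Fin (n.len + 1))} : mk x t ∈ piece S P ↔ ∃ θ : .mk P.k ⟶ n,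
      ∀ c ∈ P.nums, At t c (SemiSimplexCategory.homEquiv θ (P.cls c)) := by
  simp only [piece, Set.mem_ofPred_eq, carried_mk]
  exact ⟨fun ⟨y, θ, h, _⟩ => ⟨θ, h⟩, fun ⟨θ, h⟩ => ⟨_, θ, h, rfl⟩⟩

lemma map_mem_piece (g : S ⟶ T) {P : Sorting} {z : Realisation S} :
    map g z ∈ piece T P ↔ z ∈ piece S P := by
  obtain ⟨n, x, t, rfl⟩ := exists_rep z
  rw [map_mk, mk_mem_piece, mk_mem_piece]

lemma map_mem_noJump (g : S ⟶ T) {C : Finset ℝ} {z : Realisation S} :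
    map g z ∈ noJump C ↔ z ∈ noJump C := by
  obtain ⟨n, x, t, rfl⟩ := exists_rep z
  rfl

lemma piece_subset_noJump (P : Sorting) : piece S P ⊆ noJump P.nums := fun z hz => by
  obtain ⟨n, x, t, rfl⟩ := exists_rep z
  obtain ⟨θ, h⟩ := mk_mem_piece.1 hz
  exact fun c hc => ⟨_, h c hc⟩

open Classical in
/-- The intervals which contain members of `C` are the classes into which `C` is sorted. -/
lemma exists_piece {C : Finset ℝ} (hC : C.Nonempty) {z : Realisation S} (hz : z ∈ noJump C) :
    ∃ P : Sorting, P.nums = C ∧ z ∈ piece S P := by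
  obtain ⟨n, x, t, rfl⟩ := exists_rep z
  have : ∀ c, ∃ l, c ∈ C → At t c l := fun c => by
    by_cases hc : c ∈ C
    · obtain ⟨l, hl⟩ := hz c hc
      exact ⟨l, fun _ => hl⟩
    · exact ⟨0, fun h => (hc h).elim⟩
  choose l hl using this
  obtain ⟨k, hk⟩ : ∃ k, (C.image l).card = k + 1 :=
    Nat.exists_eq_succ_of_ne_zero (by simpa using hC.ne_empty)
  let θ := (C.image l).orderEmbOfFin hk
  have h : ∀ c, ∃ i, c ∈ C → θ i = l c := fun c => by
    by_cases hc : c ∈ C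
    · have : l c ∈ Set.range θ := by
        rw [Finset.range_orderEmbOfFin]
        exact Finset.mem_image_of_mem l hc
      obtain ⟨i, hi⟩ := this
      exact ⟨i, fun _ => hi⟩
    · exact ⟨0, fun h => (hc h).elim⟩
  choose π hπ using h
  refine ⟨⟨C, k, π, fun i => ?_⟩, rfl, mk_mem_piece.2 ⟨SemiSimplexCategory.homEquiv.symm θ, fun c hc => ?_⟩⟩
  · have : θ i ∈ C.image l := Finset.orderEmbOfFin_mem _ hk i
    obtain ⟨c, hc, h⟩ := Finset.mem_image.1 this
    exact ⟨c, hc, θ.injective ((hπ c hc).trans h)⟩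
  · change At t c (θ (π c))
    rw [hπ c hc]
    exact hl c hc

/-- The relation between the faces attached to a set and to a subset. -/
lemma exists_hom_of_mem_piece {P P' : Sorting} (hP : P.nums ⊆ P'.nums) {z : Realisation S}
    (h : z ∈ piece S P) (h' : z ∈ piece S P') :
    ∃ φ : SemiSimplexCategory.mk P.k ⟶ .mk P'.k,
      ∀ c ∈ P.nums, SemiSimplexCategory.homEquiv φ (P.cls c) = P'.cls c := by
  obtain ⟨n, x, t, rfl⟩ := exists_rep z
  obtain ⟨θ, h1⟩ := mk_mem_piece.1 h
  obtain ⟨θ', h2⟩ := mk_mem_piece.1 h'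
  choose c hc hc' using P.surj
  have h3 : ∀ d ∈ P.nums, SemiSimplexCategory.homEquiv θ' (P'.cls d) =
      SemiSimplexCategory.homEquiv θ (P.cls d) := fun d hd => (h2 d (hP hd)).eq (h1 d hd)
  have h4 : ∀ i, SemiSimplexCategory.homEquiv θ' (P'.cls (c i)) =
      SemiSimplexCategory.homEquiv θ i := fun i => by rw [h3 _ (hc i), hc']
  have hm : ∀ i j, P'.cls (c i) ≤ P'.cls (c j) ↔ i ≤ j := fun i j => by
    rw [← (SemiSimplexCategory.homEquiv θ').le_iff_le, h4, h4, OrderEmbedding.le_iff_le]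
  refine ⟨SemiSimplexCategory.homEquiv.symm ⟨⟨fun i => P'.cls (c i), fun i j h =>
    le_antisymm ((hm i j).1 h.le) ((hm j i).1 h.ge)⟩, hm _ _⟩, fun d hd => ?_⟩
  refine (SemiSimplexCategory.homEquiv θ').injective ((h4 (P.cls d)).trans (h3 d hd).symm)

lemma Carried.of_hom {P P' : Sorting} (hP : P.nums ⊆ P'.nums)
    {φ : SemiSimplexCategory.mk P.k ⟶ .mk P'.k}
    (hφ : ∀ c ∈ P.nums, SemiSimplexCategory.homEquiv φ (P.cls c) = P'.cls c)
    {z : Realisation S} {y : S.obj (op (.mk P'.k))} (h : Carried P' z y) :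
    Carried P z (S.map φ.op y) := by
  obtain ⟨n, x, t, rfl⟩ := exists_rep z
  obtain ⟨θ, h1, rfl⟩ := h
  refine ⟨φ ≫ θ, fun c hc => ?_, by simp⟩
  rw [homEquiv_comp_apply, hφ c hc]
  exact h1 c (hP hc)

lemma piece_subset {P P' : Sorting} (hP : P.nums ⊆ P'.nums) {z : Realisation S}
    (h : z ∈ piece S P) (h' : z ∈ piece S P') : piece S P' ⊆ piece S P := by
  obtain ⟨φ, hφ⟩ := exists_hom_of_mem_piece hP h h'
  exact fun w ⟨y, hy⟩ => ⟨_, hy.of_hom hP hφ⟩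

end Realisation

lemma continuous_sigma_prod {ι : Type*} {A : ι → Type*} {Z W : Type*} [∀ i, TopologicalSpace (A i)]
    [TopologicalSpace Z] [TopologicalSpace W] {f : (Σ i, A i) × Z → W}
    (h : ∀ i, Continuous fun z : A i × Z => f (⟨i, z.1⟩, z.2)) : Continuous f := by
  have : Continuous (f ∘ (Homeomorph.sigmaProdDistrib (X := A) (Y := Z)).symm) :=
    continuous_sigma h
  exact ((Homeomorph.sigmaProdDistrib (X := A) (Y := Z)).symm.comp_continuous_iff').1 this

namespace Realisation

variable {S T : SemiTop.{u}}

/-- The part of the disjoint union of the spaces `S_n × Δ^n` over a piece of the realisation. -/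
abbrev Chart (S : SemiTop.{u}) (P : Sorting) : Type u :=
  Σ n : SemiSimplexCategory, Σ θ : (.mk P.k ⟶ n), S.obj (op n) ×
    {t : stdSimplex ℝ (Fin (n.len + 1)) //
      ∀ c ∈ P.nums, At t c (SemiSimplexCategory.homEquiv θ (P.cls c))}

/-- The projection to a piece of the realisation. -/
def chartMap (S : SemiTop.{u}) (P : Sorting) (z : Chart S P) : piece S P :=
  ⟨mk z.2.2.1 z.2.2.2.1, mk_mem_piece.2 ⟨z.2.1, z.2.2.2.2⟩⟩

lemma isOpen_sorted (P : Sorting) {n : SemiSimplexCategory} (θ : .mk P.k ⟶ n) :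
    IsOpen {t : stdSimplex ℝ (Fin (n.len + 1)) |
      ∀ c ∈ P.nums, At t c (SemiSimplexCategory.homEquiv θ (P.cls c))} := by
  have : {t : stdSimplex ℝ (Fin (n.len + 1)) |
      ∀ c ∈ P.nums, At t c (SemiSimplexCategory.homEquiv θ (P.cls c))} =
      ⋂ c ∈ P.nums, {t | At t c (SemiSimplexCategory.homEquiv θ (P.cls c))} := by
    ext; simp
  rw [this]
  exact isOpen_biInter_finset fun c _ => isOpen_at c _

lemma isOpen_piece (P : Sorting) : IsOpen (piece S P) := by
  refine isOpen_iff.2 fun n => ?_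
  have : {z : S.obj (op n) × stdSimplex ℝ (Fin (n.len + 1)) | mk z.1 z.2 ∈ piece S P} =
      ⋃ θ : .mk P.k ⟶ n, Prod.snd ⁻¹' {t : stdSimplex ℝ (Fin (n.len + 1)) |
        ∀ c ∈ P.nums, At t c (SemiSimplexCategory.homEquiv θ (P.cls c))} := by
    ext z; simp [mk_mem_piece]
  rw [this]
  exact isOpen_iUnion fun θ => (isOpen_sorted P θ).preimage continuous_snd

/-- Since pieces are open, they carry the quotient topology. -/
lemma isQuotientMap_chartMap (P : Sorting) : IsQuotientMap (chartMap S P) := by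
  refine ⟨isCoinducing_iff.2 fun s => ⟨fun hs => ?_, fun hs => hs.preimage ?_⟩, ?_⟩
  rotate_right
  · rintro ⟨z, hz⟩
    obtain ⟨n, x, t, rfl⟩ := exists_rep z
    obtain ⟨θ, h⟩ := mk_mem_piece.1 hz
    exact ⟨⟨n, θ, x, t, h⟩, rfl⟩
  · rw [isOpen_sigma_iff] at hs
    have h : IsOpen (Subtype.val '' s) := by
      refine isOpen_iff.2 fun n => ?_
      have : {z : S.obj (op n) × stdSimplex ℝ (Fin (n.len + 1)) | mk z.1 z.2 ∈ Subtype.val '' s} =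
          ⋃ θ : .mk P.k ⟶ n, Prod.map id Subtype.val ''
            {z | chartMap S P ⟨n, θ, z⟩ ∈ s} := by
        ext ⟨x, t⟩
        simp only [Set.mem_ofPred_eq, Set.mem_image, Set.mem_iUnion]
        constructor
        · rintro ⟨z, hz, h⟩
          obtain ⟨θ, hθ⟩ := mk_mem_piece.1 (h ▸ z.2 : mk x t ∈ piece S P)
          refine ⟨θ, ⟨x, t, hθ⟩, ?_, rfl⟩
          convert hz using 1
          exact Subtype.ext h.symm
        · rintro ⟨θ, ⟨x', t'⟩, hz, h⟩
          obtain ⟨rfl, rfl⟩ := Prod.mk.inj h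
          exact ⟨_, hz, rfl⟩
      rw [this]
      refine isOpen_iUnion fun θ => ?_
      refine (IsOpenMap.id.prodMap (isOpen_sorted P θ).isOpenMap_subtype_val) _ ?_
      exact (isOpen_sigma_iff.1 (hs n)) θ
    convert h.preimage continuous_subtype_val
    exact (Set.preimage_image_eq s Subtype.val_injective).symm
  · refine continuous_sigma fun n => continuous_sigma fun θ => ?_
    exact (continuous_mk continuous_fst (continuous_subtype_val.comp continuous_snd)).subtype_mk _

/-- The retraction of a piece of the realisation to a space of simplices. -/
noncomputable def retr (S : SemiTop.{u}) (P : Sorting) : C(piece S P, S.obj (op (.mk P.k))) where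
  toFun z := z.2.choose
  continuous_toFun := by
    rw [(isQuotientMap_chartMap P).continuous_iff]
    have : (fun z : piece S P => z.2.choose) ∘ chartMap S P = fun z => S.map z.2.1.op z.2.2.1 := by
      ext z
      exact (chartMap S P z).2.choose_spec.eq ⟨z.2.1, z.2.2.2.2, rfl⟩
    rw [this]
    refine continuous_sigma fun n => continuous_sigma fun θ => ?_
    exact (S.map θ.op).hom.continuous.comp continuous_fst

lemma retr_spec (P : Sorting) (z : piece S P) : Carried P z.1 (retr S P z) := z.2.choose_spec

lemma retr_eq {P : Sorting} {z : piece S P} {y : S.obj (op (.mk P.k))} (h : Carried P z.1 y) :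
    retr S P z = y := (retr_spec P z).eq h

open Classical in
/-- Move the barycentric coordinates of the points of a piece towards those of the point `w` of the
face with `P.k + 1` vertices. -/
noncomputable def flow (P : Sorting) (w : stdSimplex ℝ (Fin (P.k + 1))) (v : I) :
    Realisation S → Realisation S :=
  Quot.lift (fun z => if h : ∃ θ : .mk P.k ⟶ z.1,
        ∀ c ∈ P.nums, At z.2.2 c (SemiSimplexCategory.homEquiv θ (P.cls c))
      then mk z.2.1 (mix v z.2.2 (stdSimplex.map (SemiSimplexCategory.homEquiv h.choose) w))
      else mk z.2.1 z.2.2) (by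
    rintro _ _ ⟨f, x, t⟩
    simp only
    split_ifs with h1 h2 h2
    · have e : h1.choose ≫ f = h2.choose := P.hom_eq (t := stdSimplex.map (SemiSimplexCategory.homEquiv f) t)
        (fun c hc => by
          rw [homEquiv_comp_apply]; exact (at_map_iff _ t c _).2 (h1.choose_spec c hc))
        h2.choose_spec
      rw [mk_map, map_mix, stdSimplex.map_comp_apply, ← e]
      rfl
    · obtain ⟨θ, h⟩ := h1
      exact (h2 ⟨θ ≫ f, fun c hc => by
        rw [homEquiv_comp_apply]; exact (at_map_iff _ t c _).2 (h c hc)⟩).elim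
    · obtain ⟨θ, h⟩ := h2
      obtain ⟨θ', -, h'⟩ := P.exists_factor h
      exact (h1 ⟨θ', h'⟩).elim
    · exact mk_map f x t)

lemma flow_mk {P : Sorting} {w : stdSimplex ℝ (Fin (P.k + 1))} {v : I} {n : SemiSimplexCategory}
    {θ : .mk P.k ⟶ n} {x : S.obj (op n)} {t : stdSimplex ℝ (Fin (n.len + 1))}
    (h : ∀ c ∈ P.nums, At t c (SemiSimplexCategory.homEquiv θ (P.cls c))) :
    flow P w v (mk x t) = mk x (mix v t (stdSimplex.map (SemiSimplexCategory.homEquiv θ) w)) := by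
  have h' : ∃ θ : .mk P.k ⟶ n, ∀ c ∈ P.nums, At t c (SemiSimplexCategory.homEquiv θ (P.cls c)) :=
    ⟨θ, h⟩
  refine (dif_pos h').trans ?_
  rw [P.hom_eq h'.choose_spec h]

lemma exists_weights_of_mem_piece {P : Sorting} {z : Realisation S} (hz : z ∈ piece S P) :
    ∃ w : stdSimplex ℝ (Fin (P.k + 1)), ∀ c ∈ P.nums, At w c (P.cls c) := by
  obtain ⟨n, x, t, rfl⟩ := exists_rep z
  obtain ⟨θ, h⟩ := mk_mem_piece.1 hz
  exact exists_weights (SemiSimplexCategory.homEquiv θ) h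

/-- The retraction is a weak equivalence, since its fibres are contracted by `flow`. -/
lemma weakEq_retr (P : Sorting)
    (hP : ∃ w : stdSimplex ℝ (Fin (P.k + 1)), ∀ c ∈ P.nums, At w c (P.cls c)) :
    WeakEq (retr S P) := by
  obtain ⟨w, hw⟩ := hP
  have hwθ : ∀ {n : SemiSimplexCategory} (θ : .mk P.k ⟶ n), ∀ c ∈ P.nums,
      At (stdSimplex.map (SemiSimplexCategory.homEquiv θ) w) c
        (SemiSimplexCategory.homEquiv θ (P.cls c)) :=
    fun θ c hc => (at_map_iff _ w c _).2 (hw c hc)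
  have hflow : ∀ (z : piece S P) v, Carried P (flow P w v z.1) (retr S P z) := by
    rintro ⟨z, hz⟩ v
    obtain ⟨n, x, t, rfl⟩ := exists_rep z
    obtain ⟨θ, h⟩ := mk_mem_piece.1 hz
    rw [flow_mk h, retr_eq (z := ⟨mk x t, hz⟩) ⟨θ, h, rfl⟩]
    exact ⟨θ, fun c hc => (h c hc).mix (hwθ θ c hc) v, rfl⟩
  have h0 : ∀ y : S.obj (op (.mk P.k)), Carried P (mk y w) y := fun y =>
    ⟨𝟙 _, fun c hc => hw c hc, by simp⟩
  have f0 : ∀ z : piece S P, flow P w 0 z.1 = z.1 := by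
    rintro ⟨z, hz⟩
    obtain ⟨n, x, t, rfl⟩ := exists_rep z
    obtain ⟨θ, h⟩ := mk_mem_piece.1 hz
    have e' := flow_mk (w := w) (v := 0) (x := x) h
    rwa [mix_zero] at e'
  have f1 : ∀ z : piece S P, flow P w 1 z.1 = mk (retr S P z) w := by
    rintro ⟨z, hz⟩
    obtain ⟨n, x, t, rfl⟩ := exists_rep z
    obtain ⟨θ, h⟩ := mk_mem_piece.1 hz
    have e : retr S P ⟨mk x t, hz⟩ = S.map θ.op x := retr_eq ⟨θ, h, rfl⟩
    have e' := flow_mk (w := w) (v := 1) (x := x) h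
    rwa [mix_one, ← mk_map θ x w, ← e] at e'
  have hc : Continuous fun z : piece S P × I =>
      (⟨flow P w z.2 z.1.1, _, hflow z.1 z.2⟩ : piece S P) := by
    refine (isQuotientMap_chartMap P).continuous_lift_prod_left ?_
    refine continuous_sigma_prod fun n => continuous_sigma_prod fun θ => ?_
    refine Continuous.subtype_mk ?_ _
    let T := {t : stdSimplex ℝ (Fin (n.len + 1)) //
      ∀ c ∈ P.nums, At t c (SemiSimplexCategory.homEquiv θ (P.cls c))}
    have : Continuous fun z : (S.obj (op n) × T) × I => mk z.1.1 (mix z.2 z.1.2.1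
        (stdSimplex.map (SemiSimplexCategory.homEquiv θ) w)) :=
      continuous_mk (continuous_fst.comp continuous_fst)
        (Continuous.mix continuous_snd
          (continuous_subtype_val.comp (continuous_snd.comp continuous_fst)) continuous_const)
    refine this.congr fun z => ?_
    exact (flow_mk z.1.2.2).symm
  exact .of_inverse ⟨fun y => ⟨mk y w, y, h0 y⟩, by fun_prop⟩ ⟨Prod.fst, continuous_fst⟩
    ⟨_, hc⟩ (fun _ => rfl) (fun y => (retr_eq (h0 y)).symm) (fun z => Subtype.ext (f0 z))
    (fun z => Subtype.ext (f1 z)) (fun z v => retr_eq (hflow z v))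

lemma mem_piece_of_preconnected {K : Type*} [TopologicalSpace K] [PreconnectedSpace K]
    {c : K → Realisation S} (hc : Continuous c) {P : Sorting} (h : ∀ x, c x ∈ noJump P.nums) {x₀ : K}
    (h₀ : c x₀ ∈ piece S P) (x : K) : c x ∈ piece S P := by
  have hP : P.nums.Nonempty := (P.surj 0).imp fun _ h => h.1
  have hcl : IsClopen (c ⁻¹' piece S P) := by
    refine ⟨⟨isOpen_iff_mem_nhds.2 fun y hy => ?_⟩, (isOpen_piece P).preimage hc⟩
    obtain ⟨P', e, hP'⟩ := exists_piece hP (h y)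
    filter_upwards [((isOpen_piece P').preimage hc).mem_nhds hP'] with z hz hz'
    exact hy (piece_subset e.ge hz' hz hP')
  exact (hcl.eq_univ ⟨x₀, h₀⟩).ge (Set.mem_univ x)

/-- The map of pieces induced by a semi-simplicial map. -/
def pieceMap (g : S ⟶ T) (P : Sorting) : C(piece S P, piece T P) :=
  restr (map g) fun _ h => (map_mem_piece g).2 h

lemma retr_pieceMap (g : S ⟶ T) (P : Sorting) (z : piece S P) :
    retr T P (pieceMap g P z) = g.app _ (retr S P z) :=
  retr_eq ((retr_spec P z).map g)

/-- A map of semi-simplicial spaces which is levelwise a weak equivalence is a weak equivalence on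
realisations. -/
theorem weakEq_map (g : S ⟶ T) (hg : ∀ n, WeakEq (g.app n).hom) : WeakEq (map g) := by
  refine weakEq_of_cover _ (𝒰 := {U | ∃ C : Finset ℝ, C.Nonempty ∧ U = noJump C}) ?_ ?_ ?_ ?_
  · rintro _ ⟨C, -, rfl⟩
    exact isOpen_noJump C
  · intro y
    obtain ⟨C, hC, h⟩ := exists_noJump y
    exact ⟨_, ⟨C, hC, rfl⟩, h⟩
  · rintro _ ⟨C, hC, rfl⟩ _ ⟨D, -, rfl⟩
    exact ⟨C ∪ D, hC.mono Finset.subset_union_left, noJump_inter C D⟩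
  · rintro _ ⟨C, hC, rfl⟩
    refine ⟨fun _ h => h, fun n a c hac => ?_⟩
    obtain ⟨P, rfl, h₀⟩ := exists_piece hC (c 0).2
    have hc : ∀ x, (c x).1 ∈ piece T P :=
      mem_piece_of_preconnected (by fun_prop) (fun x => (c x).2) h₀
    have ha : ∀ x, (a x).1 ∈ piece S P := fun x => by
      refine (map_mem_piece g).1 ?_
      have : map g (a x).1 = (c x).1 := congrArg Subtype.val (hac x)
      exact this ▸ hc x
    have hw := exists_weights_of_mem_piece h₀
    have H : WeakEq (pieceMap g P) := by
      refine (weakEq_retr P hw).of_comp ?_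
      have e : (retr T P).comp (pieceMap g P) = (g.app _).hom.comp (retr S P) :=
        ContinuousMap.ext (retr_pieceMap g P)
      exact e ▸ (hg _).comp (weakEq_retr P hw)
    have hac' : ∀ x, map g (a x).1 = (c x).1 := fun x => congrArg Subtype.val (hac x)
    let a₁ : C(bd n, piece S P) := ⟨fun x => ⟨(a x).1, ha x⟩, by fun_prop⟩
    let c₁ : C(Cub n, piece T P) := ⟨fun x => ⟨(c x).1, hc x⟩, by fun_prop⟩
    obtain ⟨a', L, h1, h2, h3, h4⟩ := H n a₁ c₁ (fun x => Subtype.ext (hac' x))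
    exact ⟨⟨fun x => ⟨(a' x).1, (map_mem_noJump g).2 (piece_subset_noJump P (a' x).2)⟩, by fun_prop⟩,
      ⟨fun x => ⟨(L x).1, piece_subset_noJump P (L x).2⟩, by fun_prop⟩,
      fun x => Subtype.ext (Subtype.ext_iff.1 (h1 x) :), fun x => Subtype.ext (Subtype.ext_iff.1 (h2 x) :),
      fun x => Subtype.ext (Subtype.ext_iff.1 (h3 x) :),
      fun x t => Subtype.ext (Subtype.ext_iff.1 (h4 x t) :)⟩

end Realisation

namespace HoFibre

variable {X Y : Type u} [TopologicalSpace X] [TopologicalSpace Y]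

/-- The part of a homotopy fibre whose paths stay in `W` is a homotopy fibre of the restriction to
the part of the total space over `W`. -/
def insideHomeo (f : C(X, Y)) {A : Set X} {W : Set Y} (h : ∀ x, x ∈ A ↔ f x ∈ W) (z₀ : W) :
    inside f z₀.1 W ≃ₜ HoFibre (restr f fun x hx => (h x).1 hx) z₀ where
  toFun := mk (p := restr f fun x hx => (h x).1 hx) (b := z₀) ⟨fun z : inside f z₀.1 W =>
      ⟨pt f z₀ z.1, (h _).2 (by rw [← path_zero]; exact z.2 0)⟩, by fun_prop⟩
    ⟨fun z : inside f z₀.1 W × I => ⟨path f z₀ (z.1.1, z.2), z.1.2 z.2⟩, by fun_prop⟩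
    (fun z => Subtype.ext (path_zero z.1)) (fun z => Subtype.ext (path_one z.1))
  invFun z := ⟨mk (p := f) (b := z₀.1) ⟨fun z => (pt (restr f fun x hx => (h x).1 hx) z₀ z).1, by fun_prop⟩
    ⟨fun z => (path (restr f fun x hx => (h x).1 hx) z₀ z).1, by fun_prop⟩
    (fun z => congrArg Subtype.val (path_zero z)) (fun z => congrArg Subtype.val (path_one z)) z,
    fun t => (path (restr f fun x hx => (h x).1 hx) z₀ (z, t)).2⟩
  left_inv z := rfl
  right_inv z := rfl
  continuous_toFun := ContinuousMap.continuous _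
  continuous_invFun := Continuous.subtype_mk (ContinuousMap.continuous _) _

end HoFibre

namespace Realisation

variable {E B : SemiTop.{u}}

lemma naturality_apply (g : E ⟶ B) {m n : SemiSimplexCategory} (f : m ⟶ n) (x : E.obj (op n)) :
    (g.app (op m)).hom ((E.map f.op).hom x) = (B.map f.op).hom ((g.app (op n)).hom x) := by
  change g.app (op m) (E.map f.op x) = B.map f.op (g.app (op n) x)
  rw [← ConcreteCategory.comp_apply, g.naturality, ConcreteCategory.comp_apply]

/-- The map of levelwise homotopy fibres induced by a morphism of the indexing category. -/
def fibreMap (g : E ⟶ B) {m n : SemiSimplexCategory} (f : m ⟶ n) (b : B.obj (op n)) :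
    C(HoFibre (g.app (op n)).hom b, HoFibre (g.app (op m)).hom (B.map f.op b)) :=
  HoFibre.map (E.map f.op).hom (B.map f.op).hom (naturality_apply g f) rfl

/-- The inclusion of the simplices of a realisation at given barycentric coordinates. -/
def slice (S : SemiTop.{u}) {n : SemiSimplexCategory} (t : stdSimplex ℝ (Fin (n.len + 1))) :
    C(S.obj (op n), Realisation S) := ⟨fun x => mk x t, by fun_prop⟩

lemma inside_noJump (g : E ⟶ B) {P : Sorting} {z₀ : Realisation B} (hz₀ : z₀ ∈ piece B P) :
    HoFibre.inside (map g) z₀ (noJump P.nums) = HoFibre.inside (map g) z₀ (piece B P) := by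
  ext z
  refine ⟨fun h => ?_, fun h t => piece_subset_noJump P (h t)⟩
  refine mem_piece_of_preconnected (x₀ := (1 : I)) ?_ h ?_
  · fun_prop
  · simpa using hz₀

/-- The retractions of the pieces of total space and base, on homotopy fibres. -/
noncomputable def fibreRetr (g : E ⟶ B) (P : Sorting) (z₀ : piece B P) {y : B.obj (op (.mk P.k))}
    (hy : Carried P z₀.1 y) : C(HoFibre.inside (map g) z₀.1 (piece B P),
      HoFibre (g.app (op (.mk P.k))).hom y) :=
  (HoFibre.map (p := pieceMap g P) (retr E P) (retr B P) (fun z => (retr_pieceMap g P z).symm)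
    (retr_eq hy)).comp (⟨HoFibre.insideHomeo (map g) (fun _ => (map_mem_piece g).symm) z₀,
      Homeomorph.continuous _⟩ : C(HoFibre.inside (map g) z₀.1 (piece B P), HoFibre (pieceMap g P) z₀))

lemma pt_mem_piece {g : E ⟶ B} {P : Sorting} {z₀ : Realisation B}
    (z : HoFibre.inside (map g) z₀ (piece B P)) : HoFibre.pt (map g) z₀ z.1 ∈ piece E P :=
  (map_mem_piece g).1 (by rw [← HoFibre.path_zero]; exact z.2 0)

lemma pt_fibreRetr (g : E ⟶ B) (P : Sorting) (z₀ : piece B P) {y : B.obj (op (.mk P.k))}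
    (hy : Carried P z₀.1 y) (z : HoFibre.inside (map g) z₀.1 (piece B P)) :
    HoFibre.pt _ _ (fibreRetr g P z₀ hy z) =
      retr E P ⟨HoFibre.pt (map g) z₀ z.1, pt_mem_piece z⟩ := rfl

lemma path_fibreRetr (g : E ⟶ B) (P : Sorting) (z₀ : piece B P) {y : B.obj (op (.mk P.k))}
    (hy : Carried P z₀.1 y) (z : HoFibre.inside (map g) z₀.1 (piece B P)) (s : I) :
    HoFibre.path _ _ (fibreRetr g P z₀ hy z, s) =
      retr B P ⟨HoFibre.path (map g) z₀ (z.1, s), z.2 s⟩ := rfl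

lemma weakEq_fibreRetr (g : E ⟶ B) (P : Sorting) (z₀ : piece B P) {y : B.obj (op (.mk P.k))}
    (hy : Carried P z₀.1 y) : WeakEq (fibreRetr g P z₀ hy) := by
  have hw := exists_weights_of_mem_piece z₀.2
  exact (HoFibre.weakEq_map (weakEq_retr P hw) (weakEq_retr P hw) _ _).comp
    (.of_homeo (HoFibre.insideHomeo (map g) (fun _ => (map_mem_piece g).symm) z₀))

/-- Passing to a smaller member of the open cover does not change homotopy fibres: up to weak equivalence
they are levelwise homotopy fibres, related by an iterated face map. -/
lemma weakEqOn_inside (g : E ⟶ B)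
    (hg : ∀ {m n : SemiSimplexCategory} (f : m ⟶ n) (b : B.obj (op n)), WeakEq (fibreMap g f b))
    {P P' : Sorting} (hP : P.nums ⊆ P'.nums) {z₀ : Realisation B} (h : z₀ ∈ piece B P)
    (h' : z₀ ∈ piece B P') : WeakEqOn (.id _) (HoFibre.inside (map g) z₀ (piece B P'))
      (HoFibre.inside (map g) z₀ (piece B P)) := by
  obtain ⟨φ, hφ⟩ := exists_hom_of_mem_piece hP h h'
  obtain ⟨y, hy⟩ := id h'
  have hs := piece_subset (S := B) hP h h'
  have hy' := hy.of_hom hP hφ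
  have hin : ∀ z ∈ HoFibre.inside (map g) z₀ (piece B P'),
      z ∈ HoFibre.inside (map g) z₀ (piece B P) := fun z hz t => hs (hz t)
  refine ⟨hin, (weakEq_fibreRetr g P ⟨z₀, h⟩ hy').of_comp ?_⟩
  have e : (fibreRetr g P ⟨z₀, h⟩ hy').comp (restr (.id _) hin) =
      (fibreMap g φ y).comp (fibreRetr g P' ⟨z₀, h'⟩ hy) := by
    refine ContinuousMap.ext fun z => HoFibre.ext ?_ fun s => ?_
    · exact (pt_fibreRetr g P ⟨z₀, h⟩ hy' _).trans (retr_eq ((retr_spec P' ⟨_, pt_mem_piece z⟩).of_hom hP hφ))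
    · exact (path_fibreRetr g P ⟨z₀, h⟩ hy' _ s).trans (retr_eq ((retr_spec P' ⟨_, z.2 s⟩).of_hom hP hφ))
  rw [e]
  exact (hg _ _).comp (weakEq_fibreRetr g P' ⟨z₀, h'⟩ hy)

/-- If the levelwise homotopy fibres of a map of semi-simplicial spaces are related by weak
equivalences, they are weakly equivalent to the homotopy fibres of the map on realisations. -/
theorem weakEq_map_slice (g : E ⟶ B)
    (hg : ∀ {m n : SemiSimplexCategory} (f : m ⟶ n) (b : B.obj (op n)), WeakEq (fibreMap g f b))
    {n : SemiSimplexCategory} (b : B.obj (op n)) (t : stdSimplex ℝ (Fin (n.len + 1))) :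
    WeakEq (HoFibre.map (p := (g.app (op n)).hom) (p' := map g) (b' := mk b t) (slice E t) (slice B t)
      (fun _ => rfl) rfl) := by
  obtain ⟨C, hC, hb⟩ := exists_noJump (mk b t)
  obtain ⟨P, rfl, hP⟩ := exists_piece hC hb
  obtain ⟨θ, hθ⟩ := mk_mem_piece.1 hP
  have hθ' : ∀ y : B.obj (op n), Carried P (mk y t) (B.map θ.op y) := fun y => ⟨θ, hθ, rfl⟩
  have hθE : ∀ y : E.obj (op n), Carried P (mk y t) (E.map θ.op y) := fun y => ⟨θ, hθ, rfl⟩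
  -- the part of the homotopy fibre over the piece which contains the base point
  let j : C(HoFibre (g.app (op n)).hom b, HoFibre.inside (map g) (mk b t) (piece B P)) :=
    ⟨fun z => ⟨HoFibre.map (p' := map g) (b' := mk b t) (slice E t) (slice B t) (fun _ => rfl) rfl z,
      fun s => mk_mem_piece.2 ⟨θ, hθ⟩⟩, by fun_prop⟩
  have hj : WeakEq j := by
    refine (weakEq_fibreRetr g P ⟨_, hP⟩ (hθ' b)).of_comp ?_
    have e : (fibreRetr g P ⟨_, hP⟩ (hθ' b)).comp j = fibreMap g θ b := by
      refine ContinuousMap.ext fun z => HoFibre.ext ?_ fun s => ?_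
      · exact (pt_fibreRetr g P ⟨_, hP⟩ (hθ' b) _).trans (retr_eq (hθE (HoFibre.pt _ _ z)))
      · exact (path_fibreRetr g P ⟨_, hP⟩ (hθ' b) _ s).trans (retr_eq (hθ' (HoFibre.path _ _ (z, s))))
    exact e ▸ hg θ b
  have H : WeakEqOn (.id _) (HoFibre.inside (map g) (mk b t) (noJump P.nums)) Set.univ := by
    refine HoFibre.weakEqOn_inside (𝒲 := {U | ∃ C : Finset ℝ, C.Nonempty ∧ U = noJump C})
      ?_ ?_ ?_ ?_ ⟨_, hC, rfl⟩ hb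
    · rintro _ ⟨C, -, rfl⟩
      exact isOpen_noJump C
    · intro y
      obtain ⟨C, hC, h⟩ := exists_noJump y
      exact ⟨_, ⟨C, hC, rfl⟩, h⟩
    · rintro _ ⟨C, hC, rfl⟩ _ ⟨D, -, rfl⟩
      exact ⟨C ∪ D, hC.mono Finset.subset_union_left, noJump_inter C D⟩
    · rintro _ ⟨C, hC, rfl⟩ _ ⟨D, hD, rfl⟩ hDC z₀ hz₀
      rw [← Set.inter_eq_right.2 hDC, noJump_inter] at hz₀ ⊢
      obtain ⟨Q, rfl, hQ⟩ := exists_piece hC (hDC ((noJump_inter C D).ge hz₀).2)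
      obtain ⟨Q', e, hQ'⟩ := exists_piece (hC.mono Finset.subset_union_left) hz₀
      rw [← e, inside_noJump g hQ, inside_noJump g hQ']
      exact weakEqOn_inside g hg (e ▸ Finset.subset_union_left) hQ hQ'
  rw [inside_noJump g hP] at H
  obtain ⟨h, H⟩ := H
  exact ((WeakEq.of_homeo (Homeomorph.Set.univ _)).comp H).comp hj

end Realisation

/-! ### Faces, merging and couplings of points of simplices -/

section Simplex

variable {n m l p q : ℕ}

lemma map_apply_eq {α β : Type*} [Fintype α] [Fintype β] {f : α → β} (hf : Function.Injective f)
    (t : stdSimplex ℝ α) (i : α) : stdSimplex.map f t (f i) = t i := by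
  classical
  have h := sum_map_mul f t (fun y => if y = f i then (1 : ℝ) else 0)
  simpa [hf.eq_iff] using h

lemma map_apply_of_notMem {α β : Type*} [Fintype α] [Fintype β] {f : α → β}
    (t : stdSimplex ℝ α) {j : β} (hj : ∀ i, f i ≠ j) : stdSimplex.map f t j = 0 := by
  classical
  have h := sum_map_mul f t (fun y => if y = j then (1 : ℝ) else 0)
  simpa [hj] using h

lemma map_injective {α β : Type*} [Fintype α] [Fintype β] {f : α → β} (hf : Function.Injective f) :
    Function.Injective (stdSimplex.map (S := ℝ) f) := fun s t h => by
  ext i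
  rw [← map_apply_eq hf s, h, map_apply_eq hf]

/-- The point of a face with given vertices, when the other barycentric coordinates vanish. -/
lemma exists_map_eq {α β : Type*} [Fintype α] [Fintype β] {f : α → β} (hf : Function.Injective f)
    (t : stdSimplex ℝ β) (ht : ∀ j, (∀ i, f i ≠ j) → t j = 0) :
    ∃ u : stdSimplex ℝ α, stdSimplex.map f u = t ∧ ∀ i, u i = t (f i) := by
  classical
  have hs : ∑ i, t (f i) = 1 := by
    rw [← Finset.sum_image (f := fun j => t j) (s := Finset.univ) (g := f) (fun _ _ _ _ h => hf h),
      ← t.2.2]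
    refine Finset.sum_subset (Finset.subset_univ _) fun j _ hj => ht j fun i hi => hj ?_
    exact Finset.mem_image.2 ⟨i, Finset.mem_univ _, hi⟩
  let u : stdSimplex ℝ α := ⟨fun i => t (f i), fun i => t.2.1 _, hs⟩
  refine ⟨u, ?_, fun i => rfl⟩
  ext j
  by_cases hj : ∃ i, f i = j
  · obtain ⟨i, rfl⟩ := hj
    exact map_apply_eq hf u i
  · push Not at hj
    rw [map_apply_of_notMem _ hj, ht j hj]

/-- Every point of a simplex is an interior point of a face. -/
lemma exists_support {α : Type*} [Fintype α] [LinearOrder α] (t : stdSimplex ℝ α) :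
    ∃ (k : ℕ) (d : Fin (k + 1) ↪o α)
    (u : stdSimplex ℝ (Fin (k + 1))), (∀ i, 0 < u i) ∧ stdSimplex.map d u = t := by
  classical
  let s : Finset α := Finset.univ.filter fun i => 0 < t i
  have hs : s.Nonempty := by
    by_contra h
    rw [Finset.not_nonempty_iff_eq_empty, Finset.filter_eq_empty_iff] at h
    have : ∑ i, t i ≤ 0 := Finset.sum_nonpos fun i hi => not_lt.1 (h hi)
    rw [stdSimplex.sum_eq_one] at this
    linarith
  obtain ⟨k, hk⟩ := Nat.exists_eq_succ_of_ne_zero hs.card_pos.ne'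
  obtain ⟨u, h1, h2⟩ := exists_map_eq (s.orderEmbOfFin hk).injective t fun j hj => by
    by_contra h
    have : j ∈ Set.range (s.orderEmbOfFin hk) := by
      rw [Finset.range_orderEmbOfFin]
      exact Finset.mem_filter.2 ⟨Finset.mem_univ _, lt_of_le_of_ne (t.2.1 j) (Ne.symm h)⟩
    obtain ⟨i, hi⟩ := this
    exact hj i hi
  refine ⟨k, s.orderEmbOfFin hk, u, fun i => ?_, h1⟩
  rw [h2]
  exact (Finset.mem_filter.1 (s.orderEmbOfFin_mem hk i)).2

/-! The disjoint union of the ordered sets `Fin (l + 1)` and `Fin (p + 1)`, ordered in blocks over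
`Fin (p + 1)`, is embedded in a lexicographic product, which is identified with a set `Fin _`. -/

/-- The dimension of the simplex in which two simplices are merged. -/
def mergeDim (p l : ℕ) : ℕ := p * (l + 2) + (l + 1)

/-- An enumeration of a lexicographic product. -/
noncomputable def mergeIso (p l : ℕ) : (Fin (p + 1) ×ₗ WithTop (Fin (l + 1))) ≃o Fin (mergeDim p l + 1) :=
  (Fintype.orderIsoFinOfCardEq _ (by
    rw [Fintype.card_lex, Fintype.card_prod, Fintype.card_fin]
    have : Fintype.card (WithTop (Fin (l + 1))) = l + 2 := by
      rw [show Fintype.card (WithTop (Fin (l + 1))) = Fintype.card (Option (Fin (l + 1))) from rfl]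
      simp
    rw [this, mergeDim]; ring)).symm

/-- The projection of the merged vertices to the blocks. -/
noncomputable def mergeProj (p l : ℕ) : Fin (mergeDim p l + 1) →o Fin (p + 1) :=
  ⟨fun i => (ofLex ((mergeIso p l).symm i)).1, fun _ _ h =>
    Prod.Lex.monotone_fst _ _ ((mergeIso p l).symm.monotone h)⟩

/-- The first family of merged vertices. -/
noncomputable def mergeInl (f : Fin (l + 1) →o Fin (p + 1)) : Fin (l + 1) ↪o Fin (mergeDim p l + 1) :=
  OrderEmbedding.ofStrictMono (fun i => mergeIso p l (toLex (f i, (i : WithTop (Fin (l + 1))))))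
    fun _ _ h => (mergeIso p l).strictMono (Prod.Lex.toLex_lt_toLex'.2
      ⟨f.monotone h.le, fun _ => WithTop.coe_lt_coe.2 h⟩)

/-- The second family of merged vertices. -/
noncomputable def mergeInr (p l : ℕ) : Fin (p + 1) ↪o Fin (mergeDim p l + 1) :=
  OrderEmbedding.ofStrictMono (fun i => mergeIso p l (toLex (i, ⊤)))
    fun _ _ h => (mergeIso p l).strictMono (Prod.Lex.toLex_lt_toLex.2 (Or.inl h))

lemma mergeProj_inl (f : Fin (l + 1) →o Fin (p + 1)) (i : Fin (l + 1)) :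
    mergeProj p l (mergeInl f i) = f i := by
  change (ofLex ((mergeIso p l).symm (mergeIso p l (toLex (f i, (i : WithTop (Fin (l + 1)))))))).1 = _
  rw [OrderIso.symm_apply_apply]; rfl

lemma mergeProj_inr (i : Fin (p + 1)) : mergeProj p l (mergeInr p l i) = i := by
  change (ofLex ((mergeIso p l).symm (mergeIso p l (toLex (i, ⊤))))).1 = _
  rw [OrderIso.symm_apply_apply]; rfl

/-- The functoriality of merged vertices. -/
noncomputable def mergeMap {p' l' : ℕ} (δ : Fin (p' + 1) ↪o Fin (p + 1)) (d : Fin (l' + 1) ↪o Fin (l + 1)) :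
    Fin (mergeDim p' l' + 1) ↪o Fin (mergeDim p l + 1) :=
  OrderEmbedding.ofStrictMono (fun i => mergeIso p l (toLex (δ (ofLex ((mergeIso p' l').symm i)).1,
      WithTop.map d (ofLex ((mergeIso p' l').symm i)).2)))
    fun i j h => (mergeIso p l).strictMono (by
      have h' := (mergeIso p' l').symm.strictMono h
      rw [Prod.Lex.lt_iff] at h'
      refine Prod.Lex.toLex_lt_toLex.2 (h'.imp (fun h => δ.lt_iff_lt.2 h) fun h => ⟨congrArg δ h.1, ?_⟩)
      exact (WithTop.strictMono_map_iff.2 d.strictMono) h.2)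

lemma mergeProj_map {p' l' : ℕ} (δ : Fin (p' + 1) ↪o Fin (p + 1)) (d : Fin (l' + 1) ↪o Fin (l + 1))
    (i : Fin (mergeDim p' l' + 1)) : mergeProj p l (mergeMap δ d i) = δ (mergeProj p' l' i) := by
  change (ofLex ((mergeIso p l).symm (mergeIso p l _))).1 = _
  rw [OrderIso.symm_apply_apply]; rfl

lemma mergeMap_inl {p' l' : ℕ} (δ : Fin (p' + 1) ↪o Fin (p + 1)) (d : Fin (l' + 1) ↪o Fin (l + 1))
    {f : Fin (l + 1) →o Fin (p + 1)} {f' : Fin (l' + 1) →o Fin (p' + 1)} (h : ∀ i, f (d i) = δ (f' i))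
    (i : Fin (l' + 1)) : mergeMap δ d (mergeInl f' i) = mergeInl f (d i) := by
  change mergeIso p l (toLex (δ (ofLex ((mergeIso p' l').symm (mergeIso p' l' _))).1,
    WithTop.map d (ofLex ((mergeIso p' l').symm (mergeIso p' l' _))).2)) = mergeIso p l _
  rw [OrderIso.symm_apply_apply, h]; rfl

lemma mergeMap_inr {p' l' : ℕ} (δ : Fin (p' + 1) ↪o Fin (p + 1)) (d : Fin (l' + 1) ↪o Fin (l + 1))
    (i : Fin (p' + 1)) : mergeMap δ d (mergeInr p' l' i) = mergeInr p l (δ i) := by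
  change mergeIso p l (toLex (δ (ofLex ((mergeIso p' l').symm (mergeIso p' l' _))).1,
    WithTop.map d (ofLex ((mergeIso p' l').symm (mergeIso p' l' _))).2)) = mergeIso p l _
  rw [OrderIso.symm_apply_apply]; rfl

/-- The point dividing the segment between `r`, on the first family of merged vertices, and the
image of `r` under `f`, on the second family. -/
noncomputable def mergePt (f : Fin (l + 1) →o Fin (p + 1)) (v : I) (r : stdSimplex ℝ (Fin (l + 1))) :
    stdSimplex ℝ (Fin (mergeDim p l + 1)) :=
  mix v (stdSimplex.map (mergeInl f) r) (stdSimplex.map (mergeInr p l) (stdSimplex.map f r))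

@[fun_prop] lemma Continuous.mergePt {Z : Type*} [TopologicalSpace Z] (f : Fin (l + 1) →o Fin (p + 1))
    {v : Z → I} {r : Z → stdSimplex ℝ (Fin (l + 1))} (hv : Continuous v) (hr : Continuous r) :
    Continuous fun z => mergePt f (v z) (r z) := by
  unfold SemiSimp.mergePt; fun_prop

lemma map_mergePt {p' l' : ℕ} (δ : Fin (p' + 1) ↪o Fin (p + 1)) (d : Fin (l' + 1) ↪o Fin (l + 1))
    {f : Fin (l + 1) →o Fin (p + 1)} {f' : Fin (l' + 1) →o Fin (p' + 1)} (h : ∀ i, f (d i) = δ (f' i))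
    (v : I) (u : stdSimplex ℝ (Fin (l' + 1))) :
    stdSimplex.map (mergeMap δ d) (mergePt f' v u) = mergePt f v (stdSimplex.map d u) := by
  have h1 : mergeMap δ d ∘ mergeInl f' = mergeInl f ∘ d := funext (mergeMap_inl δ d h)
  have h2 : mergeMap δ d ∘ mergeInr p' l' ∘ f' = mergeInr p l ∘ f ∘ d :=
    funext fun i => (mergeMap_inr δ d _).trans (congrArg _ (h i).symm)
  simp only [mergePt, map_mix, stdSimplex.map_comp_apply, h1, h2]

lemma mergeProj_mergePt (f : Fin (l + 1) →o Fin (p + 1)) (v : I) (r : stdSimplex ℝ (Fin (l + 1))) :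
    stdSimplex.map (mergeProj p l) (mergePt f v r) = stdSimplex.map f r := by
  have h1 : (mergeProj p l : _ → Fin (p + 1)) ∘ mergeInl f = f := funext (mergeProj_inl f)
  have h2 : (mergeProj p l : _ → Fin (p + 1)) ∘ mergeInr p l ∘ f = f := funext fun i => mergeProj_inr _
  simp only [mergePt, map_mix, stdSimplex.map_comp_apply, h1, h2]
  ext i
  rw [mix_apply]; ring

/-- A sequence of distinct elements of `Fin (p + 1) × Fin (q + 1)` which is monotone in both
coordinates. -/
structure Chain (p q l : ℕ) where
  fst : Fin (l + 1) →o Fin (p + 1)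
  snd : Fin (l + 1) →o Fin (q + 1)
  inj : ∀ i j, fst i = fst j → snd i = snd j → i = j

namespace Chain

/-- A part of a chain. -/
def sub {k : ℕ} (γ : Chain p q l) (d : Fin (k + 1) ↪o Fin (l + 1)) : Chain p q k :=
  ⟨γ.fst.comp d.toOrderHom, γ.snd.comp d.toOrderHom, fun _ _ h h' => d.injective (γ.inj _ _ h h')⟩

/-- The image of a chain under an embedding of the first factor. -/
def mapFst {p' : ℕ} (δ : Fin (p + 1) ↪o Fin (p' + 1)) (γ : Chain p q l) : Chain p' q l :=
  ⟨δ.toOrderHom.comp γ.fst, γ.snd, fun _ _ h h' => γ.inj _ _ (δ.injective h) h'⟩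

/-- The image of a chain under an embedding of the second factor. -/
def mapSnd {q' : ℕ} (δ : Fin (q + 1) ↪o Fin (q' + 1)) (γ : Chain p q l) : Chain p q' l :=
  ⟨γ.fst, δ.toOrderHom.comp γ.snd, fun _ _ h h' => γ.inj _ _ h (δ.injective h')⟩

/-- The diagonal chain. -/
def diag (n : ℕ) : Chain n n n := ⟨OrderHom.id, OrderHom.id, fun _ _ h _ => h⟩

lemma lt_or_lt (γ : Chain p q l) {i j : Fin (l + 1)} (h : i < j) :
    γ.fst i < γ.fst j ∨ γ.snd i < γ.snd j := by
  by_contra hn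
  push Not at hn
  exact h.ne (γ.inj _ _ ((γ.fst.monotone h.le).antisymm hn.1) ((γ.snd.monotone h.le).antisymm hn.2))

/-- The distribution function of a point of a chain is determined by its images in the factors. -/
lemma sum_eq_min (γ : Chain p q l) (r : stdSimplex ℝ (Fin (l + 1))) (a b : ℕ) :
    ∑ i, (if (γ.fst i : ℕ) < a ∧ (γ.snd i : ℕ) < b then (1 : ℝ) else 0) * r i =
      min (psum (stdSimplex.map γ.fst r) a) (psum (stdSimplex.map γ.snd r) b) := by
  rw [psum_map, psum_map]
  have hle : ∀ (P Q : Fin (l + 1) → Prop) [DecidablePred P] [DecidablePred Q], (∀ i, P i → Q i) →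
      ∑ i, (if P i then (1 : ℝ) else 0) * r i ≤ ∑ i, (if Q i then (1 : ℝ) else 0) * r i := by
    intro P Q _ _ h
    refine Finset.sum_le_sum fun i _ => mul_le_mul_of_nonneg_right ?_ (r.2.1 i)
    split_ifs with h1 h2
    exacts [le_rfl, (h2 (h i h1)).elim, zero_le_one, le_rfl]
  by_cases h : ∀ i, (γ.fst i : ℕ) < a → (γ.snd i : ℕ) < b
  · rw [min_eq_left (hle _ _ h)]
    exact Finset.sum_congr rfl fun i _ => by
      congr 1; exact if_congr ⟨fun h => h.1, fun h' => ⟨h', h i h'⟩⟩ rfl rfl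
  · push Not at h
    obtain ⟨i, hi, hi'⟩ := h
    have h : ∀ j, (γ.snd j : ℕ) < b → (γ.fst j : ℕ) < a := fun j hj => by
      have : j ≤ i := by
        by_contra hji
        have : (γ.snd i : ℕ) ≤ γ.snd j := γ.snd.monotone (not_le.1 hji).le
        omega
      have : (γ.fst j : ℕ) ≤ γ.fst i := γ.fst.monotone this
      omega
    rw [min_eq_right (hle _ _ h)]
    exact Finset.sum_congr rfl fun i _ => by
      congr 1; exact if_congr ⟨fun h => h.2, fun h' => ⟨h i h', h'⟩⟩ rfl rfl

/-- The mass of an element of `Fin (p + 1) × Fin (q + 1)` under a point of a chain. -/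
lemma sum_eq_second_difference (γ : Chain p q l) (r : stdSimplex ℝ (Fin (l + 1))) (a b : ℕ) :
    ∑ i, (if (γ.fst i : ℕ) = a ∧ (γ.snd i : ℕ) = b then (1 : ℝ) else 0) * r i =
      min (psum (stdSimplex.map γ.fst r) (a + 1)) (psum (stdSimplex.map γ.snd r) (b + 1))
        - min (psum (stdSimplex.map γ.fst r) a) (psum (stdSimplex.map γ.snd r) (b + 1))
        - min (psum (stdSimplex.map γ.fst r) (a + 1)) (psum (stdSimplex.map γ.snd r) b)
        + min (psum (stdSimplex.map γ.fst r) a) (psum (stdSimplex.map γ.snd r) b) := by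
  simp only [← sum_eq_min, ← Finset.sum_sub_distrib, ← Finset.sum_add_distrib, ← sub_mul, ← add_mul]
  refine Finset.sum_congr rfl fun i _ => ?_
  congr 1
  by_cases h1 : (γ.fst i : ℕ) < a <;> by_cases h2 : (γ.snd i : ℕ) < b <;>
    by_cases h3 : (γ.fst i : ℕ) = a <;> by_cases h4 : (γ.snd i : ℕ) = b <;>
    first
    | omega
    | simp [h1, h2, h3, h4, le_iff_lt_or_eq]

lemma sum_eq_apply (γ : Chain p q l) (r : stdSimplex ℝ (Fin (l + 1))) (j : Fin (l + 1)) :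
    ∑ i, (if (γ.fst i : ℕ) = γ.fst j ∧ (γ.snd i : ℕ) = γ.snd j then (1 : ℝ) else 0) * r i = r j := by
  rw [Finset.sum_eq_single j]
  · simp
  · intro i _ hi
    rw [if_neg fun h => hi (γ.inj _ _ (Fin.ext h.1) (Fin.ext h.2)), zero_mul]
  · simp

lemma exists_of_pos {k : ℕ} {γ : Chain p q l} {γ' : Chain p q k} {r : stdSimplex ℝ (Fin (l + 1))}
    {r' : stdSimplex ℝ (Fin (k + 1))} (hr : ∀ i, 0 < r i)
    (h1 : stdSimplex.map γ.fst r = stdSimplex.map γ'.fst r')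
    (h2 : stdSimplex.map γ.snd r = stdSimplex.map γ'.snd r') (j : Fin (l + 1)) :
    ∃ i, γ'.fst i = γ.fst j ∧ γ'.snd i = γ.snd j ∧ r' i = r j := by
  have e := (sum_eq_apply γ r j).symm.trans (sum_eq_second_difference γ r _ _)
  rw [h1, h2, ← sum_eq_second_difference] at e
  have : ∃ i, γ'.fst i = γ.fst j ∧ γ'.snd i = γ.snd j := by
    by_contra hn
    refine (hr j).ne' (e.trans (Finset.sum_eq_zero fun i _ => ?_))
    rw [if_neg fun h => hn ⟨i, Fin.ext h.1, Fin.ext h.2⟩, zero_mul]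
  obtain ⟨i, hi, hi'⟩ := this
  refine ⟨i, hi, hi', ?_⟩
  rw [← hi, ← hi', sum_eq_apply] at e
  exact e.symm

lemma strictMono (γ : Chain p q l) : StrictMono fun i => toLex (γ.fst i, γ.snd i) := fun _ _ h =>
  Prod.Lex.toLex_lt_toLex'.2 ⟨γ.fst.monotone h.le, fun e => (γ.lt_or_lt h).resolve_left e.not_lt⟩

/-- A pair of points has only one coupling supported on a chain. -/
lemma unique {T : Type*} (Φ : ∀ {l : ℕ}, Chain p q l → stdSimplex ℝ (Fin (l + 1)) → T)
    (hΦ : ∀ {k l : ℕ} (γ : Chain p q l) (d : Fin (k + 1) ↪o Fin (l + 1)) u,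
      Φ (γ.sub d) u = Φ γ (stdSimplex.map d u)) {k l : ℕ} {γ : Chain p q l} {γ' : Chain p q k}
    {r : stdSimplex ℝ (Fin (l + 1))} {r' : stdSimplex ℝ (Fin (k + 1))}
    (h1 : stdSimplex.map γ.fst r = stdSimplex.map γ'.fst r')
    (h2 : stdSimplex.map γ.snd r = stdSimplex.map γ'.snd r') : Φ γ r = Φ γ' r' := by
  obtain ⟨m, d, u, hu, rfl⟩ := exists_support r
  obtain ⟨m', d', u', hu', rfl⟩ := exists_support r'
  rw [stdSimplex.map_comp_apply, stdSimplex.map_comp_apply] at h1 h2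
  rw [← hΦ, ← hΦ]
  have H := exists_of_pos (γ := γ.sub d) (γ' := γ'.sub d') hu h1 h2
  have H' := exists_of_pos (γ := γ'.sub d') (γ' := γ.sub d) hu' h1.symm h2.symm
  generalize γ.sub d = c at H H' ⊢
  generalize γ'.sub d' = c' at H H' ⊢
  have hr : Set.range (fun i => toLex (c.fst i, c.snd i)) =
      Set.range fun i => toLex (c'.fst i, c'.snd i) := by
    refine Set.Subset.antisymm ?_ ?_
    · rintro _ ⟨j, rfl⟩
      obtain ⟨i, h1, h2, -⟩ := H j
      exact ⟨i, by simp [h1, h2]⟩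
    · rintro _ ⟨j, rfl⟩
      obtain ⟨i, h1, h2, -⟩ := H' j
      exact ⟨i, by simp [h1, h2]⟩
  have hm : m = m' := by
    have := congrArg Set.ncard hr
    rw [← Set.image_univ, ← Set.image_univ, Set.ncard_image_of_injective _ c.strictMono.injective,
      Set.ncard_image_of_injective _ c'.strictMono.injective] at this
    simpa using this
  subst hm
  have hc := (c.strictMono.range_inj c'.strictMono).1 hr
  have e1 : c.fst = c'.fst := by
    ext i : 2; exact congrArg (fun f => (ofLex (f i)).1) hc
  have e2 : c.snd = c'.snd := by
    ext i : 2; exact congrArg (fun f => (ofLex (f i)).2) hc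
  obtain rfl : c = c' := by
    cases c; cases c'; simp_all
  congr 1
  ext j
  obtain ⟨i, h1, h2, h3⟩ := H j
  rw [← h3, c.inj _ _ h1 h2]

lemma second_difference_nonneg {a a' b b' : ℝ} (h : a ≤ a') (h' : b ≤ b') :
    0 ≤ min a' b' - min a b' - min a' b + min a b := by
  rcases le_total a' b' with h1 | h1 <;> rcases le_total a b' with h2 | h2 <;>
    rcases le_total a' b with h3 | h3 <;> rcases le_total a b with h4 | h4 <;>
    simp only [min_eq_left, min_eq_right, *] <;> linarith

lemma lt_of_second_difference_pos {a a' b b' : ℝ} (h : a ≤ a') (h' : b ≤ b')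
    (hw : 0 < min a' b' - min a b' - min a' b + min a b) : a < b' ∧ b < a' := by
  constructor
  · by_contra hn
    push Not at hn
    rw [min_eq_right (hn.trans h), min_eq_right hn, min_eq_right ((h'.trans hn).trans h),
      min_eq_right (h'.trans hn)] at hw
    linarith
  · by_contra hn
    push Not at hn
    rw [min_eq_left (hn.trans h'), min_eq_left ((h.trans hn).trans h'), min_eq_left hn,
      min_eq_left (h.trans hn)] at hw
    linarith

lemma psum_succ_sub (t : stdSimplex ℝ (Fin (n + 1))) (i : Fin (n + 1)) :
    psum t (i + 1) - psum t i = t i := by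
  rw [psum, psum, ← Finset.sum_sub_distrib, Finset.sum_eq_single i]
  · simp
  · intro j _ hj
    have : (j : ℕ) ≠ i := fun h => hj (Fin.ext h)
    have : (j : ℕ) < i + 1 ↔ (j : ℕ) < i := by omega
    simp [this]
  · simp

/-- Every pair of points has a coupling supported on a chain: the lengths of the intersections of
the intervals of two subdivisions of the unit interval. -/
lemma exists_coupling (s : stdSimplex ℝ (Fin (p + 1))) (t : stdSimplex ℝ (Fin (q + 1))) :
    ∃ (l : ℕ) (γ : Chain p q l) (r : stdSimplex ℝ (Fin (l + 1))),
      stdSimplex.map γ.fst r = s ∧ stdSimplex.map γ.snd r = t := by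
  let w : Fin (p + 1) → Fin (q + 1) → ℝ := fun i j =>
    min (psum s (i + 1)) (psum t (j + 1)) - min (psum s i) (psum t (j + 1))
      - min (psum s (i + 1)) (psum t j) + min (psum s i) (psum t j)
  have hS := psum_mono s
  have hT := psum_mono t
  have le1 : ∀ {m : ℕ} (t : stdSimplex ℝ (Fin (m + 1))) {j}, j ≤ m + 1 → psum t j ≤ 1 := fun t j hj =>
    (psum_mono t hj).trans (psum_last t).le
  have ge0 : ∀ {m : ℕ} (t : stdSimplex ℝ (Fin (m + 1))) j, 0 ≤ psum t j := fun t j =>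
    (psum_zero t).ge.trans (psum_mono t (Nat.zero_le j))
  have h1 : ∀ i, ∑ j, w i j = s i := fun i => by
    have : ∀ j : Fin (q + 1), w i j =
        (fun j : ℕ => (min (psum s (i + 1)) (psum t (j + 1)) - min (psum s i) (psum t (j + 1)))
          - (min (psum s (i + 1)) (psum t j) - min (psum s i) (psum t j))) j := fun j => by
      simp only [w]; ring
    rw [Finset.sum_congr rfl fun j _ => this j, Fin.sum_univ_eq_sum_range (fun j : ℕ =>
        (min (psum s (i + 1)) (psum t (j + 1)) - min (psum s i) (psum t (j + 1)))
          - (min (psum s (i + 1)) (psum t j) - min (psum s i) (psum t j))),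
      Finset.sum_range_sub (fun j => min (psum s (i + 1)) (psum t j) - min (psum s i) (psum t j)),
      psum_last, psum_zero, min_eq_left (le1 s (by omega)), min_eq_left (le1 s (by omega)),
      min_eq_right (ge0 s _), min_eq_right (ge0 s _), psum_succ_sub]
    ring
  have h2 : ∀ j, ∑ i, w i j = t j := fun j => by
    have : ∀ i : Fin (p + 1), w i j =
        (fun i : ℕ => (min (psum s (i + 1)) (psum t (j + 1)) - min (psum s (i + 1)) (psum t j))
          - (min (psum s i) (psum t (j + 1)) - min (psum s i) (psum t j))) i := fun i => by
      simp only [w]; ring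
    rw [Finset.sum_congr rfl fun i _ => this i, Fin.sum_univ_eq_sum_range (fun i : ℕ =>
        (min (psum s (i + 1)) (psum t (j + 1)) - min (psum s (i + 1)) (psum t j))
          - (min (psum s i) (psum t (j + 1)) - min (psum s i) (psum t j))),
      Finset.sum_range_sub (fun i => min (psum s i) (psum t (j + 1)) - min (psum s i) (psum t j)),
      psum_last, psum_zero, min_eq_right (le1 t (by omega)), min_eq_right (le1 t (by omega)),
      min_eq_left (ge0 t _), min_eq_left (ge0 t _), psum_succ_sub]
    ring
  let W : stdSimplex ℝ (Fin (p + 1) × Fin (q + 1)) := ⟨fun x => w x.1 x.2,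
    fun x => second_difference_nonneg (hS (Nat.le_succ _)) (hT (Nat.le_succ _)), by
    rw [Fintype.sum_prod_type]
    simp only [h1, stdSimplex.sum_eq_one]⟩
  have m1 : stdSimplex.map Prod.fst W = s := by
    ext i
    have := sum_map_mul Prod.fst W (fun x => if x = i then (1 : ℝ) else 0)
    rw [Fintype.sum_prod_type] at this
    simp only [ite_mul, one_mul, zero_mul, Finset.sum_ite_eq', Finset.mem_univ, if_true] at this
    rw [this, Finset.sum_eq_single i (fun j _ hj => by simp [hj]) (by simp)]
    simp only [if_true]
    exact h1 i
  have m2 : stdSimplex.map Prod.snd W = t := by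
    ext i
    have := sum_map_mul Prod.snd W (fun x => if x = i then (1 : ℝ) else 0)
    rw [Fintype.sum_prod_type] at this
    simp only [ite_mul, one_mul, zero_mul, Finset.sum_ite_eq', Finset.mem_univ, if_true] at this
    rw [this]
    exact h2 i
  obtain ⟨l, d, u, hu, hd⟩ := exists_support (stdSimplex.map toLex W)
  have hpos : ∀ i, 0 < w (ofLex (d i)).1 (ofLex (d i)).2 := fun i => by
    have h := map_apply_eq toLex.injective W (ofLex (d i))
    rw [← hd, toLex_ofLex, map_apply_eq d.injective] at h
    exact (hu i).trans_eq h
  have hlt := fun i => lt_of_second_difference_pos (hS (Nat.le_succ (ofLex (d i)).1.1))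
    (hT (Nat.le_succ (ofLex (d i)).2.1)) (hpos i)
  let γ : Chain p q l :=
    { fst := ⟨fun i => (ofLex (d i)).1, fun i j h => Prod.Lex.monotone_fst _ _ (d.monotone h)⟩
      snd := ⟨fun i => (ofLex (d i)).2, fun i j h => by
        rcases Prod.Lex.le_iff.1 (d.monotone h) with h | h
        · by_contra hn
          have e1 := hS (show ((ofLex (d i)).1 : ℕ) + 1 ≤ (ofLex (d j)).1 from h)
          have e2 := hT (show ((ofLex (d j)).2 : ℕ) + 1 ≤ (ofLex (d i)).2 from not_le.1 hn)
          have e3 := (hlt i).2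
          have e4 := (hlt j).1
          simp only [Nat.succ_eq_add_one] at e3 e4
          linarith
        · exact h.2⟩
      inj := fun i j h h' => d.injective (ofLex.injective (Prod.ext h h')) }
  have e : stdSimplex.map ofLex (stdSimplex.map toLex W) = W :=
    (stdSimplex.map_comp_apply _ _ _).trans (stdSimplex.map_id_apply W)
  refine ⟨l, γ, u, ?_, ?_⟩
  · have : (γ.fst : _ → Fin (p + 1)) = Prod.fst ∘ ofLex ∘ d := rfl
    rw [this, ← stdSimplex.map_comp_apply, ← stdSimplex.map_comp_apply, hd]
    exact (congrArg _ e).trans m1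
  · have : (γ.snd : _ → Fin (q + 1)) = Prod.snd ∘ ofLex ∘ d := rfl
    rw [this, ← stdSimplex.map_comp_apply, ← stdSimplex.map_comp_apply, hd]
    exact (congrArg _ e).trans m2

instance : Finite (Chain p q l) :=
  Finite.of_injective (fun γ => ((γ.fst : _ → _), (γ.snd : _ → _))) fun γ γ' h => by
    obtain ⟨a, b, h1⟩ := γ
    obtain ⟨a', b', h2⟩ := γ'
    obtain ⟨h3, h4⟩ := Prod.mk.inj h
    obtain rfl : a = a' := DFunLike.coe_injective h3
    obtain rfl : b = b' := DFunLike.coe_injective h4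
    rfl

lemma lt_mul (γ : Chain p q l) : l < (p + 1) * (q + 1) := by
  have h := Fintype.card_le_of_injective _ γ.strictMono.injective
  simpa using h

/-- Functions on a product of simplices are continuous if they are continuous on the simplices
given by chains. -/
lemma isQuotientMap_coupling (p q : ℕ) : IsQuotientMap
    fun z : Σ l : Fin ((p + 1) * (q + 1)), Σ _ : Chain p q l, stdSimplex ℝ (Fin (l.1 + 1)) =>
      (stdSimplex.map z.2.1.fst z.2.2, stdSimplex.map z.2.1.snd z.2.2) := by
  have hc : Continuous
    fun z : Σ l : Fin ((p + 1) * (q + 1)), Σ _ : Chain p q l, stdSimplex ℝ (Fin (l.1 + 1)) =>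
      (stdSimplex.map z.2.1.fst z.2.2, stdSimplex.map z.2.1.snd z.2.2) :=
    continuous_sigma fun l => continuous_sigma fun γ =>
      (stdSimplex.continuous_map γ.fst).prodMk (stdSimplex.continuous_map γ.snd)
  refine hc.isClosedMap.isQuotientMap hc fun ⟨s, t⟩ => ?_
  obtain ⟨l, γ, r, rfl, rfl⟩ := exists_coupling s t
  exact ⟨⟨⟨l, γ.lt_mul⟩, γ, r⟩, rfl⟩

end Chain

end Simplex

/-! ### Realisations of bi-semi-simplicial sets -/

/-- Bi-semi-simplicial sets. -/
abbrev BiSSet := SemiSimplexCategoryᵒᵖ ⥤ SemiSSet.{u}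

/-- Geometric realisation as a functor. -/
def realisationFunctor : SemiTop.{u} ⥤ TopCat.{u} where
  obj S := TopCat.of (Realisation S)
  map g := TopCat.ofHom (Realisation.map g)
  map_id S := by
    ext z
    obtain ⟨z, rfl⟩ := Quot.exists_rep z
    rfl
  map_comp g h := by
    ext z
    obtain ⟨z, rfl⟩ := Quot.exists_rep z
    rfl

/-- The semi-simplicial space of levelwise realisations of a bi-semi-simplicial set. -/
def levels (Z : BiSSet.{u}) : SemiTop.{u} :=
  Z ⋙ (Functor.whiskeringRight _ _ _).obj TopCat.discrete ⋙ realisationFunctor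

namespace Realisation

variable {Z : BiSSet.{u}} {p q : ℕ}

/-- The point of an iterated realisation with given simplex and barycentric coordinates. -/
def mk₂ (z : (Z.obj (op (.mk q))).obj (op (.mk p))) (s : stdSimplex ℝ (Fin (p + 1)))
    (t : stdSimplex ℝ (Fin (q + 1))) : Realisation (levels Z) :=
  mk (S := levels Z) (n := .mk q) (mk (S := disc (Z.obj (op (.mk q)))) (n := .mk p) z s) t

lemma mk₂_map_left {p' : ℕ} (f : SemiSimplexCategory.mk p' ⟶ .mk p)
    (z : (Z.obj (op (.mk q))).obj (op (.mk p))) (s : stdSimplex ℝ (Fin (p' + 1)))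
    (t : stdSimplex ℝ (Fin (q + 1))) : mk₂ ((Z.obj (op (.mk q))).map f.op z) s t =
      mk₂ z (stdSimplex.map (SemiSimplexCategory.homEquiv f) s) t :=
  congrArg (fun w => mk (S := levels Z) (n := .mk q) w t)
    (mk_map (S := disc (Z.obj (op (.mk q)))) f z s)

lemma mk₂_map_right {q' : ℕ} (f : SemiSimplexCategory.mk q' ⟶ .mk q)
    (z : (Z.obj (op (.mk q))).obj (op (.mk p))) (s : stdSimplex ℝ (Fin (p + 1)))
    (t : stdSimplex ℝ (Fin (q' + 1))) : mk₂ ((Z.map f.op).app _ z) s t =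
      mk₂ z s (stdSimplex.map (SemiSimplexCategory.homEquiv f) t) :=
  mk_map (S := levels Z) f (mk (S := disc (Z.obj (op (.mk q)))) (n := .mk p) z s) t

lemma exists_rep₂ (w : Realisation (levels Z)) : ∃ (p q : ℕ)
    (z : (Z.obj (op (.mk q))).obj (op (.mk p))) (s : stdSimplex ℝ (Fin (p + 1)))
    (t : stdSimplex ℝ (Fin (q + 1))), w = mk₂ z s t := by
  obtain ⟨⟨q⟩, w, t, rfl⟩ := exists_rep w
  obtain ⟨⟨p⟩, z, s, rfl⟩ := exists_rep (S := disc (Z.obj (op (.mk q)))) w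
  exact ⟨p, q, z, s, t, rfl⟩

@[fun_prop] lemma continuous_mk₂ (z : (Z.obj (op (.mk q))).obj (op (.mk p))) {A : Type*}
    [TopologicalSpace A] {s : A → stdSimplex ℝ (Fin (p + 1))} {t : A → stdSimplex ℝ (Fin (q + 1))}
    (hs : Continuous s) (ht : Continuous t) : Continuous fun a => mk₂ z (s a) (t a) :=
  continuous_mk (S := levels Z) (n := .mk q)
    (continuous_mk (S := disc (Z.obj (op (.mk q)))) (n := .mk p) continuous_const hs) ht

/-- Compatible families of maps define a continuous map on an iterated realisation. -/
lemma exists_desc₂ {T : Type*} [TopologicalSpace T]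
    (Φ : ∀ {p q : ℕ}, (Z.obj (op (.mk q))).obj (op (.mk p)) →
      stdSimplex ℝ (Fin (p + 1)) → stdSimplex ℝ (Fin (q + 1)) → T)
    (hc : ∀ {p q : ℕ} (z : (Z.obj (op (.mk q))).obj (op (.mk p))),
      Continuous fun w : stdSimplex ℝ (Fin (p + 1)) × stdSimplex ℝ (Fin (q + 1)) => Φ z w.1 w.2)
    (h1 : ∀ {p p' q : ℕ} (f : SemiSimplexCategory.mk p' ⟶ .mk p)
      (z : (Z.obj (op (.mk q))).obj (op (.mk p))) s t,
      Φ ((Z.obj (op (.mk q))).map f.op z) s t = Φ z (stdSimplex.map (SemiSimplexCategory.homEquiv f) s) t)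
    (h2 : ∀ {p q q' : ℕ} (f : SemiSimplexCategory.mk q' ⟶ .mk q)
      (z : (Z.obj (op (.mk q))).obj (op (.mk p))) s t,
      Φ ((Z.map f.op).app _ z) s t = Φ z s (stdSimplex.map (SemiSimplexCategory.homEquiv f) t)) :
    ∃ F : C(Realisation (levels Z), T), ∀ {p q : ℕ} (z : (Z.obj (op (.mk q))).obj (op (.mk p))) s t,
      F (mk₂ z s t) = Φ z s t := by
  let G : ∀ q : ℕ, Realisation (disc (Z.obj (op (.mk q)))) → stdSimplex ℝ (Fin (q + 1)) → T :=
    fun q w t => Quot.lift (fun v : PreRealisation (disc (Z.obj (op (.mk q)))) =>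
      Φ (p := v.1.len) v.2.1 v.2.2 t) (by
        rintro _ _ ⟨f, x, s⟩
        exact h1 f x s t) w
  have hG : ∀ {q q' : ℕ} (f : SemiSimplexCategory.mk q' ⟶ .mk q)
      (w : Realisation (disc (Z.obj (op (.mk q))))) t,
      G q' (map (discMap (Z.map f.op)) w) t =
        G q w (stdSimplex.map (SemiSimplexCategory.homEquiv f) t) := by
    intro q q' f w t
    obtain ⟨⟨n, z, s⟩, rfl⟩ := Quot.exists_rep w
    exact h2 f z s t
  let F : Realisation (levels Z) → T := Quot.lift (fun w : PreRealisation (levels Z) =>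
      G w.1.len w.2.1 w.2.2) (by
    rintro _ _ ⟨f, w, t⟩
    exact hG f w t)
  refine ⟨⟨F, ?_⟩, fun z s t => rfl⟩
  refine continuous_quot_lift _ (continuous_sigma fun n => ?_)
  refine (isQuotientMap_mk (S := disc (Z.obj (op n)))).continuous_lift_prod_left ?_
  refine continuous_sigma_prod fun m => ?_
  have : Continuous fun w : (TopCat.discrete.obj ((Z.obj (op n)).obj (op m)) ×
      stdSimplex ℝ (Fin (m.len + 1)) × stdSimplex ℝ (Fin (n.len + 1))) =>
        Φ (p := m.len) (q := n.len) w.1 w.2.1 w.2.2 :=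
    continuous_prod_of_discrete_left.2 fun z => hc (p := m.len) (q := n.len) z
  exact this.comp ((continuous_fst.comp continuous_fst).prodMk
    ((continuous_snd.comp continuous_fst).prodMk continuous_snd))

lemma exists_swap (Z : BiSSet.{u}) : ∃ F : C(Realisation (levels Z), Realisation (levels Z.flip)),
    ∀ {p q : ℕ} (z : (Z.obj (op (.mk q))).obj (op (.mk p))) s t,
      F (mk₂ z s t) = mk₂ (Z := Z.flip) (p := q) (q := p) z t s :=
  exists_desc₂ (fun {p q} z s t => mk₂ (Z := Z.flip) (p := q) (q := p) z t s)
    (fun z => by fun_prop)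
    (fun f z s t => mk₂_map_right (Z := Z.flip) f z t s)
    (fun f z s t => mk₂_map_left (Z := Z.flip) f z t s)

/-- Iterated realisations may be formed in either order. -/
noncomputable def swap (Z : BiSSet.{u}) : Realisation (levels Z) ≃ₜ Realisation (levels Z.flip) where
  toFun := (exists_swap Z).choose
  invFun := (exists_swap Z.flip).choose
  left_inv w := by
    obtain ⟨p, q, z, s, t, rfl⟩ := exists_rep₂ w
    rw [(exists_swap Z).choose_spec, (exists_swap Z.flip).choose_spec]
  right_inv w := by
    obtain ⟨p, q, z, s, t, rfl⟩ := exists_rep₂ w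
    rw [(exists_swap Z.flip).choose_spec]
    exact (exists_swap Z).choose_spec _ _ _
  continuous_toFun := ContinuousMap.continuous _
  continuous_invFun := ContinuousMap.continuous _

lemma swap_mk₂ (z : (Z.obj (op (.mk q))).obj (op (.mk p))) (s : stdSimplex ℝ (Fin (p + 1)))
    (t : stdSimplex ℝ (Fin (q + 1))) :
    swap Z (mk₂ z s t) = mk₂ (Z := Z.flip) (p := q) (q := p) z t s :=
  (exists_swap Z).choose_spec z s t

end Realisation

/-! ### Degeneracies and products -/

/-- A functorial action of all monotone maps on the simplices of a semi-simplicial set which extends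
the action of the injective ones. -/
structure Degeneracies (X : SemiSSet.{u}) where
  pull : ∀ {m n : ℕ}, (Fin (m + 1) →o Fin (n + 1)) → X.obj (op (.mk n)) → X.obj (op (.mk m))
  pull_pull : ∀ {k m n : ℕ} (f : Fin (k + 1) →o Fin (m + 1)) (g : Fin (m + 1) →o Fin (n + 1))
    (x : X.obj (op (.mk n))), pull f (pull g x) = pull (g.comp f) x
  pull_map : ∀ {m n : ℕ} (f : SemiSimplexCategory.mk m ⟶ .mk n) (x : X.obj (op (.mk n))),
    pull (SemiSimplexCategory.homEquiv f).toOrderHom x = X.map f.op x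

/-- The degeneracies of a simplicial set. -/
def SSet.degeneracies (K : SSet.{u}) : Degeneracies (SemiSimplexCategory.toSimplexCategory.op ⋙ K) where
  pull f := K.map (SimplexCategory.mkHom f).op
  pull_pull f g x := (ConcreteCategory.congr_hom
    (K.map_comp (SimplexCategory.mkHom g).op (SimplexCategory.mkHom f).op) x).symm
  pull_map _ _ := rfl

/-- Transport of degeneracies along an isomorphism. -/
def Degeneracies.ofIso {X Y : SemiSSet.{u}} (D : Degeneracies Y) (e : Y ≅ X) : Degeneracies X where
  pull {m n} f x := e.hom.app (op (.mk m)) (D.pull f (e.inv.app (op (.mk n)) x))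
  pull_pull {k m n} f g x := by
    have := ConcreteCategory.congr_hom (e.hom_inv_id_app (op (.mk m))) (D.pull g (e.inv.app (op (.mk n)) x))
    exact congrArg (e.hom.app (op (.mk k))) ((congrArg (D.pull f) this).trans (D.pull_pull _ _ _))
  pull_map {m n} f x := by
    rw [D.pull_map]
    have h := ConcreteCategory.congr_hom (e.inv.naturality f.op) x
    exact (congrArg (e.hom.app (op (.mk m))) h.symm).trans
      (ConcreteCategory.congr_hom (e.inv_hom_id_app (op (.mk m))) (X.map f.op x))

lemma AdmitsDegeneracies.exists_degeneracies {X : SemiSSet.{u}} (h : AdmitsDegeneracies X) :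
    Nonempty (Degeneracies X) := by
  obtain ⟨Y, ⟨e⟩⟩ := h
  exact ⟨(SSet.degeneracies Y).ofIso e⟩

namespace Degeneracies

variable {X : SemiSSet.{u}} (D : Degeneracies X) {m n : ℕ}

lemma pull_emb (f : Fin (m + 1) ↪o Fin (n + 1)) (x : X.obj (op (.mk n))) :
    D.pull f.toOrderHom x = X.map (SemiSimplexCategory.homEquiv.symm f : .mk m ⟶ .mk n).op x :=
  D.pull_map (SemiSimplexCategory.homEquiv.symm f) x

lemma pull_id (x : X.obj (op (.mk n))) : D.pull OrderHom.id x = x := by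
  have := D.pull_map (𝟙 (SemiSimplexCategory.mk n)) x
  rw [op_id, X.map_id] at this
  exact this

end Degeneracies

/-- The bi-semi-simplicial set `(q, p) ↦ X_p × Y_q`. -/
def box (X Y : SemiSSet.{u}) : BiSSet.{u} where
  obj q :=
    { obj := fun p => X.obj p × Y.obj q
      map := fun f => ↾(fun z => (X.map f z.1, z.2)) }
  map g := { app := fun p => ↾(fun z => (z.1, Y.map g z.2)) }

namespace Realisation

variable {X Y : SemiSSet.{u}}

/-- Compatible families of maps define a continuous map on a realisation. -/
lemma exists_desc {K : SemiSSet.{u}} {T : Type*} [TopologicalSpace T]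
    (Φ : ∀ {n : ℕ}, K.obj (op (.mk n)) → stdSimplex ℝ (Fin (n + 1)) → T)
    (hc : ∀ {n : ℕ} (x : K.obj (op (.mk n))), Continuous fun t => Φ x t)
    (h : ∀ {m n : ℕ} (f : SemiSimplexCategory.mk m ⟶ .mk n) (x : K.obj (op (.mk n))) t,
      Φ (K.map f.op x) t = Φ x (stdSimplex.map (SemiSimplexCategory.homEquiv f) t)) :
    ∃ F : C(Realisation (disc K), T), ∀ {n : ℕ} (x : K.obj (op (.mk n))) t,
      F (mk (S := disc K) (n := .mk n) x t) = Φ x t := by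
  let F : Realisation (disc K) → T := Quot.lift (fun w : PreRealisation (disc K) =>
      Φ (n := w.1.len) w.2.1 w.2.2) (by
    rintro _ _ ⟨f, x, t⟩
    exact h f x t)
  refine ⟨⟨F, continuous_quot_lift _ (continuous_sigma fun n => ?_)⟩, fun x t => rfl⟩
  have : Continuous fun w : TopCat.discrete.obj (K.obj (op n)) × stdSimplex ℝ (Fin (n.len + 1)) =>
      Φ (n := n.len) w.1 w.2 := continuous_prod_of_discrete_left.2 fun x => hc (n := n.len) x
  exact this

/-- Families of maps which are compatible with the subdivision of products of simplices define a
continuous map on the iterated realisation of an external product. -/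
lemma exists_desc_chain {T : Type*} [TopologicalSpace T]
    (Φ : ∀ {p q l : ℕ}, X.obj (op (.mk p)) → Y.obj (op (.mk q)) → Chain p q l →
      C(stdSimplex ℝ (Fin (l + 1)), T))
    (h : ∀ {p q k l : ℕ} (x : X.obj (op (.mk p))) (y : Y.obj (op (.mk q))) (γ : Chain p q l)
      (d : Fin (k + 1) ↪o Fin (l + 1)) u, Φ x y (γ.sub d) u = Φ x y γ (stdSimplex.map d u))
    (h1 : ∀ {p p' q l : ℕ} (f : SemiSimplexCategory.mk p' ⟶ .mk p) (x : X.obj (op (.mk p)))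
      (y : Y.obj (op (.mk q))) (γ : Chain p' q l) r,
      Φ (X.map f.op x) y γ r = Φ x y (γ.mapFst (SemiSimplexCategory.homEquiv f)) r)
    (h2 : ∀ {p q q' l : ℕ} (f : SemiSimplexCategory.mk q' ⟶ .mk q) (x : X.obj (op (.mk p)))
      (y : Y.obj (op (.mk q))) (γ : Chain p q' l) r,
      Φ x (Y.map f.op y) γ r = Φ x y (γ.mapSnd (SemiSimplexCategory.homEquiv f)) r) :
    ∃ F : C(Realisation (levels (box X Y)), T), ∀ {p q l : ℕ} (x : X.obj (op (.mk p)))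
      (y : Y.obj (op (.mk q))) (γ : Chain p q l) r,
      F (mk₂ (Z := box X Y) (p := p) (q := q) (x, y) (stdSimplex.map γ.fst r)
        (stdSimplex.map γ.snd r)) = Φ x y γ r := by
  choose L c r hr1 hr2 using fun (p q : ℕ) => Chain.exists_coupling (p := p) (q := q)
  have key : ∀ {p q l : ℕ} (x : X.obj (op (.mk p))) (y : Y.obj (op (.mk q))) (γ : Chain p q l) u s t,
      stdSimplex.map γ.fst u = s → stdSimplex.map γ.snd u = t →
      Φ x y (c p q s t) (r p q s t) = Φ x y γ u := fun {p q l} x y γ u s t h1 h2 =>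
    Chain.unique (fun γ r => Φ x y γ r) (fun γ d u => h x y γ d u) ((hr1 p q s t).trans h1.symm)
      ((hr2 p q s t).trans h2.symm)
  suffices H : ∃ F : C(Realisation (levels (box X Y)), T), ∀ {p q : ℕ}
      (z : ((box X Y).obj (op (.mk q))).obj (op (.mk p))) s t,
      F (mk₂ z s t) = Φ z.1 z.2 (c p q s t) (r p q s t) by
    obtain ⟨F, hF⟩ := H
    exact ⟨F, fun {p q l} x y γ u => (hF (p := p) (q := q) (x, y) _ _).trans
      (key x y γ u _ _ rfl rfl)⟩
  refine exists_desc₂ (Z := box X Y) (T := T)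
    (fun {p q} z s t => Φ z.1 z.2 (c p q s t) (r p q s t)) (fun {p q} z => ?_)
    (fun {p p' q} f z s t => ?_) (fun {p q q'} f z s t => ?_)
  · rw [(Chain.isQuotientMap_coupling p q).continuous_iff]
    refine continuous_sigma fun l => continuous_sigma fun γ => ?_
    exact (Φ z.1 z.2 γ).continuous.congr fun u => (key z.1 z.2 γ u _ _ rfl rfl).symm
  · have e := congrArg (stdSimplex.map (SemiSimplexCategory.homEquiv f)) (hr1 p' q s t)
    rw [stdSimplex.map_comp_apply] at e
    have e1 := h1 f z.1 z.2 (c p' q s t) (r p' q s t)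
    have e2 := key z.1 z.2 ((c p' q s t).mapFst (SemiSimplexCategory.homEquiv f)) (r p' q s t)
      (stdSimplex.map (SemiSimplexCategory.homEquiv f) s) t e (hr2 p' q s t)
    exact e1.trans e2.symm
  · have e := congrArg (stdSimplex.map (SemiSimplexCategory.homEquiv f)) (hr2 p q' s t)
    rw [stdSimplex.map_comp_apply] at e
    have e1 := h2 f z.1 z.2 (c p q' s t) (r p q' s t)
    have e2 := key z.1 z.2 ((c p q' s t).mapSnd (SemiSimplexCategory.homEquiv f)) (r p q' s t)
      s (stdSimplex.map (SemiSimplexCategory.homEquiv f) t) (hr1 p q' s t) e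
    exact e1.trans e2.symm

lemma exists_diag (X Y : SemiSSet.{u}) : ∃ F : C(Realisation (disc (prod X Y)),
    Realisation (levels (box X Y))), ∀ {n : ℕ} (x : X.obj (op (.mk n))) (y : Y.obj (op (.mk n))) t,
      F (mk (S := disc (prod X Y)) (n := .mk n) (x, y) t) =
        mk₂ (Z := box X Y) (p := n) (q := n) (x, y) t t := by
  suffices H : ∃ F : C(Realisation (disc (prod X Y)), Realisation (levels (box X Y))),
      ∀ {n : ℕ} (z : (prod X Y).obj (op (.mk n))) t,
      F (mk (S := disc (prod X Y)) (n := .mk n) z t) = mk₂ (Z := box X Y) (p := n) (q := n) z t t by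
    obtain ⟨F, hF⟩ := H
    exact ⟨F, fun {n} x y t => hF (n := n) (x, y) t⟩
  refine exists_desc (K := prod X Y) (fun {n} z t => mk₂ (Z := box X Y) (p := n) (q := n) z t t)
    (fun z => by fun_prop) fun {m n} f z t => ?_
  have e1 := mk₂_map_left (Z := box X Y) (q := m) f (z.1, Y.map f.op z.2) t t
  have e2 := mk₂_map_right (Z := box X Y) (p := n) f z (stdSimplex.map (SemiSimplexCategory.homEquiv f) t) t
  exact e1.trans e2

/-- The diagonal map from the realisation of a product. -/
noncomputable def diag (X Y : SemiSSet.{u}) :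
    C(Realisation (disc (prod X Y)), Realisation (levels (box X Y))) := (exists_diag X Y).choose

lemma diag_mk {n : ℕ} (x : X.obj (op (.mk n))) (y : Y.obj (op (.mk n))) (t) :
    diag X Y (mk (S := disc (prod X Y)) (n := .mk n) (x, y) t) =
      mk₂ (Z := box X Y) (p := n) (q := n) (x, y) t t :=
  (exists_diag X Y).choose_spec x y t

lemma mk₂_pull (D : Degeneracies X) (D' : Degeneracies Y) {a a' b b' : ℕ}
    (d : Fin (a' + 1) ↪o Fin (a + 1)) (d' : Fin (b' + 1) ↪o Fin (b + 1)) (x : X.obj (op (.mk a)))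
    (y : Y.obj (op (.mk b))) (s t) : mk₂ (Z := box X Y) (p := a') (q := b')
      (D.pull d.toOrderHom x, D'.pull d'.toOrderHom y) s t =
      mk₂ (Z := box X Y) (p := a) (q := b) (x, y) (stdSimplex.map d s) (stdSimplex.map d' t) := by
  rw [D.pull_emb, D'.pull_emb]
  exact (mk₂_map_left (Z := box X Y) (p := a) (q := b') (SemiSimplexCategory.homEquiv.symm d)
    (x, _) s t).trans (mk₂_map_right (Z := box X Y) (p := a) (q := b)
      (SemiSimplexCategory.homEquiv.symm d') (x, y) (stdSimplex.map d s) t)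

/-- The homotopy between a point of the iterated realisation and its subdivision. -/
noncomputable def mergePt₂ (D : Degeneracies X) (D' : Degeneracies Y) {p q l : ℕ}
    (x : X.obj (op (.mk p))) (y : Y.obj (op (.mk q))) (γ : Chain p q l) :
    C(stdSimplex ℝ (Fin (l + 1)) × I, Realisation (levels (box X Y))) :=
  ⟨fun w => mk₂ (Z := box X Y) (p := mergeDim p l) (q := mergeDim q l)
    (D.pull (mergeProj p l) x, D'.pull (mergeProj q l) y) (mergePt γ.fst w.2 w.1)
    (mergePt γ.snd w.2 w.1), by fun_prop⟩

lemma mergePt₂_map (D : Degeneracies X) (D' : Degeneracies Y) {p q l p' q' l' : ℕ}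
    (δ : Fin (p' + 1) ↪o Fin (p + 1)) (δ' : Fin (q' + 1) ↪o Fin (q + 1))
    (d : Fin (l' + 1) ↪o Fin (l + 1)) {γ : Chain p q l} {γ' : Chain p' q' l'}
    (h : ∀ i, γ.fst (d i) = δ (γ'.fst i)) (h' : ∀ i, γ.snd (d i) = δ' (γ'.snd i))
    (x : X.obj (op (.mk p))) (y : Y.obj (op (.mk q))) (u v) :
    mergePt₂ D D' (D.pull δ.toOrderHom x) (D'.pull δ'.toOrderHom y) γ' (u, v) =
      mergePt₂ D D' x y γ (stdSimplex.map d u, v) := by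
  have e1 : D.pull (mergeProj p' l') (D.pull δ.toOrderHom x) =
      D.pull (mergeMap δ d).toOrderHom (D.pull (mergeProj p l) x) := by
    rw [D.pull_pull, D.pull_pull]
    exact congrArg (fun f => D.pull f x) (OrderHom.ext _ _ (funext fun i => (mergeProj_map δ d i).symm))
  have e2 : D'.pull (mergeProj q' l') (D'.pull δ'.toOrderHom y) =
      D'.pull (mergeMap δ' d).toOrderHom (D'.pull (mergeProj q l) y) := by
    rw [D'.pull_pull, D'.pull_pull]
    exact congrArg (fun f => D'.pull f y) (OrderHom.ext _ _ (funext fun i => (mergeProj_map δ' d i).symm))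
  change mk₂ _ _ _ = mk₂ _ _ _
  rw [e1, e2, mk₂_pull, map_mergePt δ d h, map_mergePt δ' d h']

lemma mergePt₂_zero (D : Degeneracies X) (D' : Degeneracies Y) {p q l : ℕ}
    (x : X.obj (op (.mk p))) (y : Y.obj (op (.mk q))) (γ : Chain p q l) (u) :
    mergePt₂ D D' x y γ (u, 0) =
      mk₂ (Z := box X Y) (p := l) (q := l) (D.pull γ.fst x, D'.pull γ.snd y) u u := by
  have e1 : D.pull γ.fst x = D.pull (mergeInl γ.fst).toOrderHom (D.pull (mergeProj p l) x) := by
    rw [D.pull_pull]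
    exact congrArg (fun f => D.pull f x) (OrderHom.ext _ _ (funext fun i => (mergeProj_inl _ i).symm))
  have e2 : D'.pull γ.snd y = D'.pull (mergeInl γ.snd).toOrderHom (D'.pull (mergeProj q l) y) := by
    rw [D'.pull_pull]
    exact congrArg (fun f => D'.pull f y) (OrderHom.ext _ _ (funext fun i => (mergeProj_inl _ i).symm))
  rw [e1, e2, mk₂_pull]
  change mk₂ _ (mergePt _ 0 _) (mergePt _ 0 _) = _
  rw [mergePt, mergePt, mix_zero, mix_zero]

lemma mergePt₂_one (D : Degeneracies X) (D' : Degeneracies Y) {p q l : ℕ}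
    (x : X.obj (op (.mk p))) (y : Y.obj (op (.mk q))) (γ : Chain p q l) (u) :
    mergePt₂ D D' x y γ (u, 1) = mk₂ (Z := box X Y) (p := p) (q := q) (x, y)
      (stdSimplex.map γ.fst u) (stdSimplex.map γ.snd u) := by
  have e1 : x = D.pull (mergeInr p l).toOrderHom (D.pull (mergeProj p l) x) := by
    rw [D.pull_pull]
    refine (D.pull_id x).symm.trans ?_
    exact congrArg (fun f => D.pull f x) (OrderHom.ext _ _ (funext fun i => (mergeProj_inr i).symm))
  have e2 : y = D'.pull (mergeInr q l).toOrderHom (D'.pull (mergeProj q l) y) := by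
    rw [D'.pull_pull]
    refine (D'.pull_id y).symm.trans ?_
    exact congrArg (fun f => D'.pull f y) (OrderHom.ext _ _ (funext fun i => (mergeProj_inr i).symm))
  conv_rhs => rw [e1, e2, mk₂_pull]
  change mk₂ _ (mergePt _ 1 _) (mergePt _ 1 _) = _
  rw [mergePt, mergePt, mix_one, mix_one]

/-- In the presence of degeneracies the iterated realisation of an external product can be
subdivided; this inverts the diagonal map up to homotopy. -/
theorem weakEq_diag (D : Degeneracies X) (D' : Degeneracies Y) : WeakEq (diag X Y) := by
  obtain ⟨R, hR⟩ := exists_desc_chain (X := X) (Y := Y) (T := Realisation (disc (prod X Y)))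
    (fun {p q l} x y γ => ⟨fun r => mk (S := disc (prod X Y)) (n := .mk l)
      (D.pull γ.fst x, D'.pull γ.snd y) r, by fun_prop⟩)
    (fun {p q k l} x y γ d u => by
      have e := mk_map (S := disc (prod X Y)) (SemiSimplexCategory.homEquiv.symm d : .mk k ⟶ .mk l)
        (D.pull γ.fst x, D'.pull γ.snd y) u
      have e1 := (D.pull_emb d (D.pull γ.fst x)).symm.trans (D.pull_pull _ _ _)
      have e2 := (D'.pull_emb d (D'.pull γ.snd y)).symm.trans (D'.pull_pull _ _ _)
      refine Eq.trans ?_ e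
      exact congrArg (fun z => mk (S := disc (prod X Y)) (n := .mk k) z u) (Prod.ext e1.symm e2.symm))
    (fun {p p' q l} f x y γ r => by
      have e1 := (congrArg (D.pull γ.fst) (D.pull_map f x).symm).trans (D.pull_pull _ _ _)
      exact congrArg (fun z => mk (S := disc (prod X Y)) (n := .mk l) z r) (Prod.ext e1 rfl))
    (fun {p q q' l} f x y γ r => by
      have e1 := (congrArg (D'.pull γ.snd) (D'.pull_map f y).symm).trans (D'.pull_pull _ _ _)
      exact congrArg (fun z => mk (S := disc (prod X Y)) (n := .mk l) z r) (Prod.ext rfl e1))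
  have hid : ∀ {a : ℕ} (t : stdSimplex ℝ (Fin (a + 1))),
      stdSimplex.map (RelEmbedding.refl (α := Fin (a + 1)) (· ≤ ·)) t = t := fun t =>
    stdSimplex.map_id_apply t
  have hx : ∀ {a : ℕ} (x : X.obj (op (.mk a))),
      D.pull (OrderEmbedding.toOrderHom (RelEmbedding.refl (α := Fin (a + 1)) (· ≤ ·))) x = x :=
    fun x => D.pull_id x
  have hy : ∀ {a : ℕ} (y : Y.obj (op (.mk a))),
      D'.pull (OrderEmbedding.toOrderHom (RelEmbedding.refl (α := Fin (a + 1)) (· ≤ ·))) y = y :=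
    fun y => D'.pull_id y
  obtain ⟨G, hG⟩ := exists_desc_chain (X := X) (Y := Y) (T := C(I, Realisation (levels (box X Y))))
    (fun {p q l} x y γ => (mergePt₂ D D' x y γ).curry)
    (fun {p q k l} x y γ d u => by
      ext v
      have e := mergePt₂_map D D' (RelEmbedding.refl _) (RelEmbedding.refl _) d (γ := γ) (γ' := γ.sub d)
        (fun _ => rfl) (fun _ => rfl) x y u v
      rw [hx x, hy y] at e
      exact e)
    (fun {p p' q l} f x y γ r => by
      ext v
      have e := mergePt₂_map D D' (SemiSimplexCategory.homEquiv f) (RelEmbedding.refl _)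
        (RelEmbedding.refl _) (γ := γ.mapFst (SemiSimplexCategory.homEquiv f)) (γ' := γ)
        (fun _ => rfl) (fun _ => rfl) x y r v
      rw [hid, D.pull_map, hy y] at e
      exact e)
    (fun {p q q' l} f x y γ r => by
      ext v
      have e := mergePt₂_map D D' (RelEmbedding.refl _) (SemiSimplexCategory.homEquiv f)
        (RelEmbedding.refl _) (γ := γ.mapSnd (SemiSimplexCategory.homEquiv f)) (γ' := γ)
        (fun _ => rfl) (fun _ => rfl) x y r v
      rw [hid, D'.pull_map, hx x] at e
      exact e)
  have hw : ∀ w : Realisation (levels (box X Y)), ∃ (p q l : ℕ) (x : X.obj (op (.mk p)))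
      (y : Y.obj (op (.mk q))) (γ : Chain p q l) (r : stdSimplex ℝ (Fin (l + 1))),
      w = mk₂ (Z := box X Y) (p := p) (q := q) (x, y) (stdSimplex.map γ.fst r)
        (stdSimplex.map γ.snd r) := fun w => by
    obtain ⟨p, q, z, s, t, rfl⟩ := exists_rep₂ w
    obtain ⟨l, γ, r, rfl, rfl⟩ := Chain.exists_coupling s t
    exact ⟨p, q, l, z.1, z.2, γ, r, rfl⟩
  refine .of_homotopic_inverse R ?_ (.symm ⟨⟨⟨fun z => G z.2 z.1, by fun_prop⟩, fun w => ?_, fun w => ?_⟩⟩)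
  · suffices h : R.comp (diag X Y) = ContinuousMap.id _ from h ▸ .refl _
    ext w
    obtain ⟨⟨n⟩, z, t, rfl⟩ := exists_rep (S := disc (prod X Y)) w
    have e1 : diag X Y (mk (S := disc (prod X Y)) (n := .mk n) z t) =
      mk₂ (Z := box X Y) (p := n) (q := n) (z.1, z.2) t t := diag_mk _ _ _
    have e2 := hR z.1 z.2 (Chain.diag n) t
    refine (congrArg R (e1.trans ?_)).trans (e2.trans ?_)
    · congr 1 <;> exact (stdSimplex.map_id_apply t).symm
    · exact congrArg (fun z => mk (S := disc (prod X Y)) (n := .mk n) z t)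
        (Prod.ext (D.pull_id _) (D'.pull_id _))
  · obtain ⟨p, q, l, x, y, γ, r, rfl⟩ := hw w
    refine (congrArg (fun f : C(I, _) => f 0) (hG x y γ r)).trans ?_
    refine (mergePt₂_zero D D' x y γ r).trans ?_
    rw [ContinuousMap.comp_apply, hR]
    exact (diag_mk _ _ _).symm
  · obtain ⟨p, q, l, x, y, γ, r, rfl⟩ := hw w
    refine (congrArg (fun f : C(I, _) => f 1) (hG x y γ r)).trans ?_
    exact mergePt₂_one D D' x y γ r

end Realisation

/-! ### Cones and the semi-simplicial point -/

section Cone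

variable {m n : ℕ}

/-- The point dividing the segment from a point of a face of a simplex to the opposite vertex. -/
noncomputable def conePt (t : stdSimplex ℝ (Fin (n + 1))) (u : I) : stdSimplex ℝ (Fin (n + 1 + 1)) :=
  mix u (stdSimplex.map Fin.castSucc t) (stdSimplex.vertex (Fin.last (n + 1)))

@[fun_prop] lemma Continuous.conePt {A : Type*} [TopologicalSpace A]
    {t : A → stdSimplex ℝ (Fin (n + 1))} {u : A → I} (ht : Continuous t) (hu : Continuous u) :
    Continuous fun a => conePt (t a) (u a) := by
  unfold SemiSimp.conePt; fun_prop

lemma conePt_zero (t : stdSimplex ℝ (Fin (n + 1))) : conePt t 0 = stdSimplex.map Fin.castSuccOrderEmb t :=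
  mix_zero _ _

lemma conePt_one (t : stdSimplex ℝ (Fin (n + 1))) :
    conePt t 1 = stdSimplex.map (OrderEmbedding.ofStrictMono (fun _ : Fin 1 => Fin.last (n + 1))
      (Subsingleton.strictMono _)) (stdSimplex.vertex 0) := by
  rw [stdSimplex.map_vertex]
  exact mix_one _ _

/-- The extension of an order embedding to the cones. -/
def coneMap (f : Fin (m + 1) ↪o Fin (n + 1)) : Fin (m + 1 + 1) ↪o Fin (n + 1 + 1) :=
  OrderEmbedding.ofStrictMono (Fin.lastCases (Fin.last _) fun i => (f i).castSucc) fun i j h => by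
    induction i using Fin.lastCases with
    | last => exact absurd h (not_lt.2 (Fin.le_last j))
    | cast i =>
      induction j using Fin.lastCases with
      | last => simp
      | cast j => simpa using h

lemma coneMap_castSucc (f : Fin (m + 1) ↪o Fin (n + 1)) (i : Fin (m + 1)) :
    coneMap f i.castSucc = (f i).castSucc :=
  Fin.lastCases_castSucc (motive := fun _ => Fin (n + 1 + 1)) (last := Fin.last (n + 1))
    (cast := fun i => (f i).castSucc) i

lemma coneMap_last (f : Fin (m + 1) ↪o Fin (n + 1)) : coneMap f (Fin.last (m + 1)) = Fin.last (n + 1) :=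
  Fin.lastCases_last (motive := fun _ => Fin (n + 1 + 1)) (last := Fin.last (n + 1))
    (cast := fun i => (f i).castSucc)

lemma map_conePt (f : Fin (m + 1) ↪o Fin (n + 1)) (t : stdSimplex ℝ (Fin (m + 1))) (u : I) :
    stdSimplex.map (coneMap f) (conePt t u) = conePt (stdSimplex.map f t) u := by
  rw [conePt, map_mix, stdSimplex.map_comp_apply, stdSimplex.map_vertex, conePt,
    stdSimplex.map_comp_apply]
  congr 2
  · funext i
    exact coneMap_castSucc f i
  · exact coneMap_last f

end Cone

/-- The simplices of a semi-simplicial set which form the image of a semi-simplicial point. -/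
def ptAt {Y : SemiSSet.{u}} (e : point ⟶ Y) (n : ℕ) : Y.obj (op (.mk n)) :=
  e.app (op (.mk n)) PUnit.unit

lemma map_ptAt {Y : SemiSSet.{u}} (e : point ⟶ Y) {m n : ℕ} (f : SemiSimplexCategory.mk m ⟶ .mk n) :
    Y.map f.op (ptAt e n) = ptAt e m :=
  (ConcreteCategory.congr_hom (e.naturality f.op) PUnit.unit).symm

/-- The semi-simplicial map `x ↦ (x, e)`. -/
def inclAt (X : SemiSSet.{u}) {Y : SemiSSet.{u}} (e : point ⟶ Y) : X ⟶ prod X Y where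
  app n := ↾(fun x => (x, e.app n PUnit.unit))
  naturality m n f := by
    have h : e.app n PUnit.unit = Y.map f (e.app m PUnit.unit) :=
      ConcreteCategory.congr_hom (e.naturality f) PUnit.unit
    exact ConcreteCategory.hom_ext _ _ fun x =>
      congrArg (fun y => ((X.map f x, y) : X.obj n × Y.obj n)) h

namespace Realisation

variable {X Y : SemiSSet.{u}}

/-- The base point of the realisation of the semi-simplicial point. -/
noncomputable def base : Realisation (disc point.{u}) :=
  mk (S := disc point) (n := .mk 0) PUnit.unit (stdSimplex.vertex 0)

lemma exists_cone₂ (X : SemiSSet.{u}) {Y : SemiSSet.{u}} (e : point ⟶ Y) :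
    ∃ F : C(Realisation (disc X), C(I, Realisation (levels (box X Y)))),
      ∀ {n : ℕ} (x : X.obj (op (.mk n))) t u, F (mk (S := disc X) (n := .mk n) x t) u =
        mk₂ (Z := box X Y) (p := n) (q := n + 1) (x, ptAt e (n + 1)) t (conePt t u) := by
  let Ψ : ∀ {n : ℕ} (x : X.obj (op (.mk n))), C(stdSimplex ℝ (Fin (n + 1)) × I,
    Realisation (levels (box X Y))) := fun {n} x => ⟨fun w => mk₂ (Z := box X Y) (p := n) (q := n + 1)
      (x, ptAt e (n + 1)) w.1 (conePt w.1 w.2), by fun_prop⟩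
  obtain ⟨F, hF⟩ := exists_desc (K := X) (fun {n} x => (Ψ x).curry) (fun {n} x => by fun_prop)
    (fun {m n} f x t => by
      ext u
      change mk₂ _ _ _ = mk₂ _ _ _
      rw [← map_conePt]
      have e1 := mk₂_map_left (Z := box X Y) (q := m + 1) f (x, ptAt e (m + 1)) t (conePt t u)
      have e2 := mk₂_map_right (Z := box X Y) (p := n)
        (SemiSimplexCategory.homEquiv.symm (coneMap (SemiSimplexCategory.homEquiv f)) :
          .mk (m + 1) ⟶ .mk (n + 1)) (x, ptAt e (n + 1))
        (stdSimplex.map (SemiSimplexCategory.homEquiv f) t) (conePt t u)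
      have e3 := map_ptAt e (SemiSimplexCategory.homEquiv.symm (coneMap (SemiSimplexCategory.homEquiv f)) :
          .mk (m + 1) ⟶ .mk (n + 1))
      refine e1.trans (Eq.trans ?_ e2)
      exact congrArg (fun y => mk₂ (Z := box X Y) (p := n) (q := m + 1) (x, y) _ _) e3.symm)
  exact ⟨F, fun x t u => congrArg (fun f : C(I, _) => f u) (hF x t)⟩

/-- The point of the first factor and the cone over its barycentric coordinates in the image of a
semi-simplicial point in the second factor. -/
noncomputable def cone₂ (X : SemiSSet.{u}) {Y : SemiSSet.{u}} (e : point ⟶ Y) :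
    C(Realisation (disc X) × I, Realisation (levels (box X Y))) :=
  ((exists_cone₂ X e).choose).uncurry

lemma cone₂_mk (e : point ⟶ Y) {n : ℕ} (x : X.obj (op (.mk n))) (t u) :
    cone₂ X e (mk (S := disc X) (n := .mk n) x t, u) =
      mk₂ (Z := box X Y) (p := n) (q := n + 1) (x, ptAt e (n + 1)) t (conePt t u) :=
  (exists_cone₂ X e).choose_spec x t u

lemma mk₂_ptAt (e : point ⟶ Y) {n m m' : ℕ} (x : X.obj (op (.mk n))) (t)
    (f : Fin (m + 1) ↪o Fin (m' + 1)) (s) :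
    mk₂ (Z := box X Y) (p := n) (q := m') (x, ptAt e m') t (stdSimplex.map f s) =
      mk₂ (Z := box X Y) (p := n) (q := m) (x, ptAt e m) t s := by
  have e2 := mk₂_map_right (Z := box X Y) (p := n)
    (SemiSimplexCategory.homEquiv.symm f : .mk m ⟶ .mk m') (x, ptAt e m') t s
  refine e2.symm.trans ?_
  exact congrArg (fun y => mk₂ (Z := box X Y) (p := n) (q := m) (x, y) _ _) (map_ptAt e _)

lemma cone₂_zero (e : point ⟶ Y) (z : Realisation (disc X)) :
    cone₂ X e (z, 0) = diag X Y (map (discMap (inclAt X e)) z) := by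
  obtain ⟨⟨n⟩, x, t, rfl⟩ := exists_rep z
  refine (cone₂_mk e x t 0).trans ?_
  rw [conePt_zero]
  exact (mk₂_ptAt e x t _ t).trans (diag_mk _ _ _).symm

lemma cone₂_one (e : point ⟶ Y) {n : ℕ} (x : X.obj (op (.mk n))) (t) :
    cone₂ X e (mk (S := disc X) (n := .mk n) x t, 1) =
      mk₂ (Z := box X Y) (p := n) (q := 0) (x, ptAt e 0) t (stdSimplex.vertex 0) := by
  refine (cone₂_mk e x t 1).trans ?_
  rw [conePt_one, mk₂_ptAt]

/-- The projection of the external product to the second factor. -/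
def boxSnd (X Y : SemiSSet.{u}) : levels (box X Y) ⟶ disc Y where
  app q :=
    let F : C(Realisation (disc ((box X Y).obj q)), TopCat.discrete.obj (Y.obj q)) :=
      { toFun := Quot.lift (fun w => w.2.1.2) (by rintro _ _ ⟨f, x, t⟩; rfl)
        continuous_toFun := by
          refine continuous_quot_lift _ (continuous_sigma fun n => ?_)
          let φ : TopCat.discrete.obj (X.obj (op n) × Y.obj q) → TopCat.discrete.obj (Y.obj q) :=
            fun z => z.2
          exact (show Continuous φ from continuous_of_discreteTopology).comp continuous_fst }
    TopCat.ofHom (X := Realisation (disc ((box X Y).obj q))) (Y := TopCat.discrete.obj (Y.obj q)) F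
  naturality q q' f := by
    ext z
    obtain ⟨z, rfl⟩ := Quot.exists_rep z
    rfl

lemma map_boxSnd_diag (z : Realisation (disc (prod X Y))) :
    map (boxSnd X Y) (diag X Y z) = map (discMap (snd X Y)) z := by
  obtain ⟨⟨n⟩, x, t, rfl⟩ := exists_rep z
  exact congrArg (map (boxSnd X Y)) (diag_mk x.1 x.2 t)

/-- The contraction of the realisation of the semi-simplicial point. -/
noncomputable def contraction : C(Realisation (disc point.{u}) × I, Realisation (disc point.{u})) :=
  (map (boxSnd point point)).comp (cone₂ point (𝟙 point))

lemma map_contraction (e : point ⟶ Y) (z : Realisation (disc X)) (u : I) :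
    map (discMap e) (contraction (map (discMap (toPoint X)) z, u)) =
      map (boxSnd X Y) (cone₂ X e (z, u)) := by
  obtain ⟨⟨n⟩, x, t, rfl⟩ := exists_rep z
  have e1 := cone₂_mk (X := point) (𝟙 point) (n := n) PUnit.unit t u
  have e2 := cone₂_mk e (n := n) x t u
  exact (congrArg (fun w => map (discMap e) (map (boxSnd point point) w)) e1).trans
    (congrArg (map (boxSnd X Y)) e2.symm)

lemma contraction_zero (z : Realisation (disc point.{u})) : contraction (z, 0) = z := by
  refine (congrArg (map (boxSnd point point)) (cone₂_zero (𝟙 point) z)).trans ?_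
  rw [map_boxSnd_diag]
  obtain ⟨⟨n⟩, x, t, rfl⟩ := exists_rep z
  rfl

lemma contraction_one (z : Realisation (disc point.{u})) : contraction (z, 1) = base := by
  obtain ⟨⟨n⟩, x, t, rfl⟩ := exists_rep z
  exact congrArg (map (boxSnd point point)) (cone₂_one (X := point) (𝟙 point) (n := n) x t)

lemma contractibleSpace_point : ContractibleSpace (Realisation (disc point.{u})) := by
  rw [contractible_iff_id_nullhomotopic]
  exact ⟨base, ⟨⟨⟨fun z => contraction (z.2, z.1), by fun_prop⟩, fun z => contraction_zero z,
    fun z => contraction_one z⟩⟩⟩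

/-- The inclusion of the first factor as a fibre of the external product. -/
def boxFibre (X : SemiSSet.{u}) {Y : SemiSSet.{u}} {n : SemiSimplexCategory} (y : (disc Y).obj (op n)) :
    C(Realisation (disc X), HoFibre ((boxSnd X Y).app (op n)).hom y) :=
  HoFibre.mk (map (S := disc X) (T := disc ((box X Y).obj (op n)))
      (discMap { app := fun p => ↾(fun x => (x, y)), naturality := fun _ _ _ => rfl }))
    (.const _ y) (fun z => by obtain ⟨z, rfl⟩ := Quot.exists_rep z; rfl) (fun _ => rfl)

/-- Paths in the discrete space `Y_n` are constant, so that homotopy fibres over it are fibres. -/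
lemma weakEq_boxFibre {n : SemiSimplexCategory} (y : (disc Y).obj (op n)) : WeakEq (boxFibre X y) := by
  let r : C(HoFibre ((boxSnd X Y).app (op n)).hom y, Realisation (disc X)) :=
    (map (S := disc ((box X Y).obj (op n))) (T := disc X)
      (discMap { app := fun p => ↾(fun z => z.1), naturality := fun _ _ _ => rfl })).comp (HoFibre.pt _ _)
  refine .of_homotopic_inverse r ?_ ?_
  · suffices h : r.comp (boxFibre X y) = .id _ from h ▸ .refl _
    ext z
    obtain ⟨z, rfl⟩ := Quot.exists_rep z
    rfl
  · suffices h : (boxFibre X y).comp r = .id _ from h ▸ .refl _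
    have hd : DiscreteTopology ((disc Y).obj (op n)) :=
      inferInstanceAs (DiscreteTopology (TopCat.discrete.obj (Y.obj (op n))))
    refine ContinuousMap.ext fun z => ?_
    have hz : ∀ t, HoFibre.path _ _ (z, t) = y := fun t =>
      (PreconnectedSpace.constant (f := fun t => HoFibre.path _ _ (z, t)) inferInstance
        (by fun_prop)).trans (HoFibre.path_one z)
    refine HoFibre.ext ?_ fun t => ?_
    · have hp : ((boxSnd X Y).app (op n)).hom (HoFibre.pt _ _ z) = y := by
        exact (HoFibre.path_zero z).symm.trans (hz 0)
      have aux : ∀ w : (levels (box X Y)).obj (op n), ((boxSnd X Y).app (op n)).hom w = y →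
          map (S := disc X) (T := disc ((box X Y).obj (op n)))
            (discMap { app := fun p => ↾(fun x => (x, y)), naturality := fun _ _ _ => rfl })
            (map (S := disc ((box X Y).obj (op n))) (T := disc X)
              (discMap { app := fun p => ↾(fun z => z.1), naturality := fun _ _ _ => rfl }) w) = w := by
        intro w hw
        obtain ⟨⟨k, ⟨x, y'⟩, t⟩, rfl⟩ := Quot.exists_rep w
        obtain rfl : y' = y := hw
        rfl
      exact aux _ hp
    · change y = HoFibre.path _ _ (z, t)
      exact (hz t).symm

lemma weakEq_fibreMap_boxSnd {m n : SemiSimplexCategory} (f : m ⟶ n) (y : (disc Y).obj (op n)) :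
    WeakEq (fibreMap (boxSnd X Y) f y) := by
  refine (weakEq_boxFibre (X := X) y).of_comp_left ?_
  suffices h : (fibreMap (boxSnd X Y) f y).comp (boxFibre X y) = boxFibre X ((disc Y).map f.op y) from
    h ▸ weakEq_boxFibre _
  ext z
  · obtain ⟨z, rfl⟩ := Quot.exists_rep z
    rfl
  · rfl

/-- The map from `‖X‖` to the homotopy fibre of the projection `‖X × Y‖ → ‖Y‖` given by a
semi-simplicial point of `Y`. -/
noncomputable def prodFibre (X : SemiSSet.{u}) {Y : SemiSSet.{u}} (e : point ⟶ Y) :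
    C(Realisation (disc X), HoFibre (map (discMap (snd X Y))) (map (discMap e) base)) :=
  HoFibre.mk (map (discMap (inclAt X e)))
    ⟨fun w => map (discMap e) (contraction (map (discMap (toPoint X)) w.1, w.2)), by fun_prop⟩
    (fun z => by
      change map _ (contraction _) = _
      rw [contraction_zero]
      obtain ⟨z, rfl⟩ := Quot.exists_rep z
      rfl)
    (fun z => congrArg (map (discMap e)) (contraction_one _))

/-- The projection `‖X × Y‖ → ‖Y‖` has homotopy fibre `‖X‖`. -/
theorem weakEq_prodFibre (D : Degeneracies X) (D' : Degeneracies Y) (e : point ⟶ Y) :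
    WeakEq (prodFibre X e) := by
  have hd : WeakEq (HoFibre.map (p := map (discMap (snd X Y))) (p' := map (boxSnd X Y))
      (b := map (discMap e) base) (diag X Y) (.id _) map_boxSnd_diag rfl) :=
    HoFibre.weakEq_map (weakEq_diag D D') .id _ _
  let y : (disc Y).obj (op (.mk 0)) := ptAt e 0
  have hs := (weakEq_map_slice (boxSnd X Y) weakEq_fibreMap_boxSnd y (stdSimplex.vertex 0)).comp
    (weakEq_boxFibre (X := X) y)
  refine hd.of_comp (hs.of_homotopic ?_)
  refine .symm ⟨⟨HoFibre.mk (p := map (boxSnd X Y)) (b := map (discMap e) base)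
    ((cone₂ X e).comp .prodSwap)
    ⟨fun w => map (discMap e) (contraction (map (discMap (toPoint X)) w.1.2, w.1.1 ⊔ w.2)), by fun_prop⟩
    (fun z => ?_) (fun z => ?_), fun z => ?_, fun z => ?_⟩⟩
  · exact (congrArg (fun u => map (discMap e) (contraction (map (discMap (toPoint X)) z.2, u)))
      (sup_eq_left.2 z.1.2.1)).trans (map_contraction e _ _)
  · exact (congrArg (fun u => map (discMap e) (contraction (map (discMap (toPoint X)) z.2, u)))
      (sup_eq_right.2 z.1.2.2)).trans (congrArg (map (discMap e)) (contraction_one _))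
  · ext
    · exact cone₂_zero e z
    · exact congrArg (fun u => map (discMap e) (contraction (map (discMap (toPoint X)) z, u)))
        (sup_eq_right.2 unitInterval.nonneg')
  · ext
    · obtain ⟨⟨n⟩, x, t, rfl⟩ := exists_rep z
      exact cone₂_one e x t
    · exact (congrArg (fun u => map (discMap e) (contraction (map (discMap (toPoint X)) z, u)))
        (sup_eq_left.2 unitInterval.le_one')).trans (congrArg (map (discMap e)) (contraction_one _))

end Realisation

/-! ### Non-degenerate representatives of points of realisations -/

section Simplex

variable {j j' k m n : ℕ}

lemma le_map_apply {α β : Type*} [Fintype α] [Fintype β] (f : α → β) (t : stdSimplex ℝ α) (i : α) :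
    t i ≤ stdSimplex.map f t (f i) := by
  classical
  have h := sum_map_mul f t (fun y => if y = f i then (1 : ℝ) else 0)
  simp only [ite_mul, one_mul, zero_mul, Finset.sum_ite_eq', Finset.mem_univ, if_true] at h
  rw [h]
  refine le_trans ?_ (Finset.single_le_sum (f := fun x => if f x = f i then t x else 0)
    (fun x _ => ?_) (Finset.mem_univ i))
  · simp
  · split_ifs
    exacts [t.2.1 x, le_rfl]

lemma map_pos_of_surjective {α β : Type*} [Fintype α] [Fintype β] {f : α → β}
    (hf : Function.Surjective f) {t : stdSimplex ℝ α} (ht : ∀ i, 0 < t i) (i : β) :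
    0 < stdSimplex.map f t i := by
  obtain ⟨i, rfl⟩ := hf i
  exact (ht i).trans_le (le_map_apply f t i)

lemma surjective_of_map_pos {α β : Type*} [Fintype α] [Fintype β] {f : α → β} {t : stdSimplex ℝ α}
    (h : ∀ i, 0 < stdSimplex.map f t i) : Function.Surjective f := fun i => by
  by_contra hi
  push Not at hi
  exact (h i).ne' (map_apply_of_notMem t hi)

lemma range_eq_of_pos {d : Fin (j + 1) ↪o Fin (k + 1)} {u : stdSimplex ℝ (Fin (j + 1))}
    (hu : ∀ i, 0 < u i) : Set.range d = {i | 0 < stdSimplex.map d u i} := by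
  ext i
  constructor
  · rintro ⟨i, rfl⟩
    exact (hu i).trans_le (le_map_apply d u i)
  · intro hi
    by_contra h
    exact ne_of_gt hi (map_apply_of_notMem u fun i' h' => h ⟨i', h'⟩)

lemma support_unique {d : Fin (j + 1) ↪o Fin (k + 1)} {d' : Fin (j' + 1) ↪o Fin (k + 1)}
    {u : stdSimplex ℝ (Fin (j + 1))} {u' : stdSimplex ℝ (Fin (j' + 1))} (hu : ∀ i, 0 < u i)
    (hu' : ∀ i, 0 < u' i) (h : stdSimplex.map d u = stdSimplex.map d' u') :
    (⟨j, d, u⟩ : Σ j : ℕ, (Fin (j + 1) ↪o Fin (k + 1)) × stdSimplex ℝ (Fin (j + 1))) =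
      ⟨j', d', u'⟩ := by
  have hr : Set.range d = Set.range d' := by rw [range_eq_of_pos hu, range_eq_of_pos hu', h]
  obtain rfl : j = j' := by
    have h1 := Set.ncard_range_of_injective d.injective
    have h2 := Set.ncard_range_of_injective d'.injective
    rw [hr, h2] at h1
    simpa using h1.symm
  obtain rfl := OrderEmbedding.range_inj.1 hr
  obtain rfl := map_injective d.injective h
  rfl

/-- Every monotone map is a surjection followed by an injection. -/
lemma exists_factorisation (g : Fin (j + 1) →o Fin (k + 1)) : ∃ (m : ℕ)
    (s : Fin (j + 1) →o Fin (m + 1)) (e : Fin (m + 1) ↪o Fin (k + 1)), Function.Surjective s ∧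
      e.toOrderHom.comp s = g := by
  classical
  let S : Finset (Fin (k + 1)) := Finset.univ.image g
  have hS : S.Nonempty := ⟨g 0, Finset.mem_image_of_mem _ (Finset.mem_univ _)⟩
  obtain ⟨m, hm⟩ := Nat.exists_eq_succ_of_ne_zero hS.card_pos.ne'
  have hg : ∀ i, g i ∈ S := fun i => Finset.mem_image_of_mem _ (Finset.mem_univ _)
  refine ⟨m, ⟨fun i => (S.orderIsoOfFin hm).symm ⟨g i, hg i⟩, fun a b h =>
    (S.orderIsoOfFin hm).symm.monotone (g.monotone h)⟩, S.orderEmbOfFin hm, fun a => ?_, ?_⟩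
  · obtain ⟨i, -, hi⟩ := Finset.mem_image.1 (S.orderEmbOfFin_mem hm a)
    refine ⟨i, (S.orderIsoOfFin hm).symm_apply_eq.2 (Subtype.ext ?_)⟩
    rw [Finset.coe_orderIsoOfFin_apply]
    exact hi
  · ext i : 2
    change S.orderEmbOfFin hm _ = _
    rw [← Finset.coe_orderIsoOfFin_apply]
    exact congrArg Subtype.val ((S.orderIsoOfFin hm).apply_symm_apply _)

end Simplex

lemma Realisation.mk_pull {X : SemiSSet.{u}} (D : Degeneracies X) {m n : ℕ}
    (d : Fin (m + 1) ↪o Fin (n + 1)) (x : X.obj (op (.mk n))) (t : stdSimplex ℝ (Fin (m + 1))) :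
    mk (S := disc X) (n := .mk m) (D.pull d.toOrderHom x) t =
      mk (S := disc X) (n := .mk n) x (stdSimplex.map d t) := by
  rw [D.pull_emb]
  exact mk_map (S := disc X) (m := .mk m) (n := .mk n) (SemiSimplexCategory.homEquiv.symm d) x t

namespace Thin

variable {K : SSet.{u}} {j k m n : ℕ}

/-- The simplices of a simplicial set, by dimension. -/
abbrev Sx (K : SSet.{u}) (n : ℕ) := K.obj (op (SimplexCategory.mk n))

/-- The action of monotone maps on the simplices of a simplicial set. -/
def pull (θ : Fin (m + 1) →o Fin (n + 1)) (x : Sx K n) : Sx K m := K.map (SimplexCategory.mkHom θ).op x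

lemma pull_pull (f : Fin (k + 1) →o Fin (m + 1)) (g : Fin (m + 1) →o Fin (n + 1)) (x : Sx K n) :
    pull f (pull g x) = pull (g.comp f) x := (SSet.degeneracies K).pull_pull f g x

@[simp] lemma pull_id (x : Sx K n) : pull OrderHom.id x = x := (SSet.degeneracies K).pull_id x

/-- The semi-simplicial set underlying a simplicial set. -/
abbrev under (K : SSet.{u}) : SemiSSet.{u} :=
  SemiSimplexCategory.toSimplexCategory.op ⋙ K

/-- The points of the semi-simplicial realisation of a simplicial set. -/
def fat (x : Sx K n) (t : stdSimplex ℝ (Fin (n + 1))) : Realisation (disc (under K)) :=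
  Realisation.mk (S := disc (under K)) (n := .mk n) x t

lemma fat_pull (d : Fin (m + 1) ↪o Fin (n + 1)) (x : Sx K n) (t : stdSimplex ℝ (Fin (m + 1))) :
    fat (pull d.toOrderHom x) t = fat x (stdSimplex.map d t) :=
  Realisation.mk_pull (SSet.degeneracies K) d x t

lemma exists_fat (z : Realisation (disc (under K))) : ∃ (n : ℕ) (x : Sx K n)
    (t : stdSimplex ℝ (Fin (n + 1))), z = fat x t := by
  obtain ⟨⟨n⟩, x, t, rfl⟩ := Realisation.exists_rep z
  exact ⟨n, x, t, rfl⟩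

/-- Every point of a semi-simplicial realisation is an interior point of a simplex. -/
lemma exists_fat_pos (z : Realisation (disc (under K))) : ∃ (n : ℕ) (x : Sx K n)
    (t : stdSimplex ℝ (Fin (n + 1))), (∀ i, 0 < t i) ∧ z = fat x t := by
  obtain ⟨n, x, t, rfl⟩ := exists_fat z
  obtain ⟨k, d, u, hu, rfl⟩ := exists_support t
  exact ⟨k, _, u, hu, (fat_pull d x u).symm⟩

/-- Every simplex is a degeneracy of a non-degenerate one. -/
lemma exists_degData (x : Sx K k) : ∃ c : Σ m : ℕ, Sx K m × (Fin (k + 1) →o Fin (m + 1)),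
    c.2.1 ∈ K.nonDegenerate c.1 ∧ Function.Surjective c.2.2 ∧ pull c.2.2 c.2.1 = x := by
  obtain ⟨m, f, hf, y, h⟩ := K.exists_nonDegenerate x
  exact ⟨⟨m, y.1, f.toOrderHom⟩, y.2, SimplexCategory.epi_iff_surjective.1 hf, h.symm⟩

/-- The non-degenerate simplex and the surjection which give rise to a simplex. -/
noncomputable def degData (x : Sx K k) : Σ m : ℕ, Sx K m × (Fin (k + 1) →o Fin (m + 1)) :=
  (exists_degData x).choose

lemma degData_unique {x : Sx K k} {m m' : ℕ} {y : Sx K m} {y' : Sx K m'}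
    {π : Fin (k + 1) →o Fin (m + 1)} {π' : Fin (k + 1) →o Fin (m' + 1)} (hy : y ∈ K.nonDegenerate m)
    (hy' : y' ∈ K.nonDegenerate m') (hπ : Function.Surjective π) (hπ' : Function.Surjective π')
    (h : pull π y = x) (h' : pull π' y' = x) :
    (⟨m, y, π⟩ : Σ m : ℕ, Sx K m × (Fin (k + 1) →o Fin (m + 1))) = ⟨m', y', π'⟩ := by
  have e1 : Epi (SimplexCategory.mkHom π) := SimplexCategory.epi_iff_surjective.2 hπ
  have e2 : Epi (SimplexCategory.mkHom π') := SimplexCategory.epi_iff_surjective.2 hπ'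
  obtain rfl := K.unique_nonDegenerate_dim x (SimplexCategory.mkHom π) ⟨y, hy⟩ h.symm
    (SimplexCategory.mkHom π') ⟨y', hy'⟩ h'.symm
  have h1 := K.unique_nonDegenerate_simplex x (SimplexCategory.mkHom π) ⟨y, hy⟩ h.symm
    (SimplexCategory.mkHom π') ⟨y', hy'⟩ h'.symm
  have h2 := K.unique_nonDegenerate_map x (SimplexCategory.mkHom π) ⟨y, hy⟩ h.symm
    (SimplexCategory.mkHom π') ⟨y', hy'⟩ h'.symm
  obtain rfl : y = y' := congrArg Subtype.val h1
  obtain rfl : π = π' := congrArg SimplexCategory.Hom.toOrderHom h2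
  rfl

lemma degData_eq {x : Sx K k} {m : ℕ} {y : Sx K m} {π : Fin (k + 1) →o Fin (m + 1)}
    (hy : y ∈ K.nonDegenerate m) (hπ : Function.Surjective π) (h : pull π y = x) :
    degData x = ⟨m, y, π⟩ :=
  have hx := (exists_degData x).choose_spec
  degData_unique hx.1 hy hx.2.1 hπ hx.2.2 h

/-- A simplex with a point in it. -/
abbrev Cell (K : SSet.{u}) := Σ m : ℕ, Sx K m × stdSimplex ℝ (Fin (m + 1))

/-- The point `w` of a simplex agrees, up to faces and degeneracies, with the interior point `c` of a
non-degenerate simplex. -/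
def HasCore (w c : Cell K) : Prop :=
  ∃ (j : ℕ) (d : Fin (j + 1) ↪o Fin (w.1 + 1)) (π : Fin (j + 1) →o Fin (c.1 + 1))
    (u : stdSimplex ℝ (Fin (j + 1))), pull d.toOrderHom w.2.1 = pull π c.2.1 ∧
      stdSimplex.map d u = w.2.2 ∧ stdSimplex.map π u = c.2.2 ∧ c.2.1 ∈ K.nonDegenerate c.1 ∧
      (∀ i, 0 < u i) ∧ Function.Surjective π

lemma exists_hasCore (w : Cell K) : ∃ c, HasCore w c := by
  obtain ⟨j, d, u, hu, h⟩ := exists_support w.2.2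
  obtain ⟨c, h1, h2, h3⟩ := exists_degData (pull d.toOrderHom w.2.1)
  exact ⟨⟨c.1, c.2.1, stdSimplex.map c.2.2 u⟩, j, d, c.2.2, u, h3.symm, h, rfl, h1, hu, h2⟩

lemma HasCore.unique {w c c' : Cell K} (h : HasCore w c) (h' : HasCore w c') : c = c' := by
  obtain ⟨j, d, π, u, h1, h2, h3, h4, hu, hπ⟩ := h
  obtain ⟨j', d', π', u', h1', h2', h3', h4', hu', hπ'⟩ := h'
  obtain ⟨⟩ := support_unique hu hu' (h2.trans h2'.symm)
  have e := degData_unique h4 h4' hπ hπ' h1.symm h1'.symm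
  obtain ⟨m, y, s⟩ := c
  obtain ⟨m', y', s'⟩ := c'
  obtain ⟨⟩ := e
  obtain rfl : s = s' := h3.symm.trans h3'
  rfl

lemma HasCore.of_pull {θ : Fin (m + 1) →o Fin (n + 1)} {x : Sx K n} {t : stdSimplex ℝ (Fin (m + 1))}
    {c : Cell K} (h : HasCore ⟨m, pull θ x, t⟩ c) : HasCore ⟨n, x, stdSimplex.map θ t⟩ c := by
  obtain ⟨j, d, π, u, h1, h2, h3, h4, hu, hπ⟩ := h
  obtain ⟨j', s, e, hs, he⟩ := exists_factorisation (θ.comp d.toOrderHom)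
  obtain ⟨a, ha1, ha2, ha3⟩ := exists_degData (pull e.toOrderHom x)
  have hq : pull (a.2.2.comp s) a.2.1 = pull d.toOrderHom (pull θ x) := by
    rw [← pull_pull, ha3, pull_pull, pull_pull, he]
  have e1 := degData_unique ha1 h4 (π := a.2.2.comp s) (ha2.comp hs) hπ hq h1.symm
  obtain ⟨m', y, r⟩ := c
  obtain ⟨m'', y', ρ⟩ := a
  obtain ⟨⟩ := e1
  refine ⟨j', e, ρ, stdSimplex.map s u, ha3.symm, ?_, ?_, h4, map_pos_of_surjective hs hu, ha2⟩
  · rw [stdSimplex.map_comp_apply]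
    change _ = stdSimplex.map θ t
    rw [← show stdSimplex.map d u = t from h2, stdSimplex.map_comp_apply]
    have he' : ⇑e ∘ ⇑s = ⇑θ ∘ ⇑d := funext fun i => DFunLike.congr_fun he i
    rw [he']
  · rw [stdSimplex.map_comp_apply]
    exact h3

/-- The interior point of a non-degenerate simplex which represents a point. -/
noncomputable def coreCell (w : Cell K) : Cell K := (exists_hasCore w).choose

lemma hasCore_coreCell (w : Cell K) : HasCore w (coreCell w) := (exists_hasCore w).choose_spec

lemma coreCell_eq {w c : Cell K} (h : HasCore w c) : coreCell w = c :=
  (hasCore_coreCell w).unique h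

lemma coreCell_pull (θ : Fin (m + 1) →o Fin (n + 1)) (x : Sx K n) (t : stdSimplex ℝ (Fin (m + 1))) :
    coreCell ⟨m, pull θ x, t⟩ = coreCell ⟨n, x, stdSimplex.map θ t⟩ :=
  (coreCell_eq (hasCore_coreCell _).of_pull).symm

/-- The gluing relation of degeneracies. -/
inductive Rel (K : SSet.{u}) : Realisation (disc (under K)) → Realisation (disc (under K)) → Prop
  | glue {m n : ℕ} (θ : Fin (m + 1) →o Fin (n + 1)) (x : Sx K n) (t : stdSimplex ℝ (Fin (m + 1))) :
      Rel K (fat (pull θ x) t) (fat x (stdSimplex.map θ t))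

end Thin

/-- The realisation of a simplicial set as a quotient of its semi-simplicial realisation. -/
def Thin (K : SSet.{u}) : Type u := Quot (Thin.Rel K)

namespace Thin

variable {K : SSet.{u}} {j k m n : ℕ}

instance (K : SSet.{u}) : TopologicalSpace (Thin K) :=
  inferInstanceAs (TopologicalSpace (Quot (Rel K)))

/-- The quotient map from the semi-simplicial realisation to the realisation. -/
def toThin (K : SSet.{u}) : C(Realisation (disc (under K)), Thin K) := ⟨Quot.mk _, continuous_quot_mk⟩

lemma isQuotientMap_toThin : IsQuotientMap (toThin K) := isQuotientMap_quot_mk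

lemma toThin_pull (θ : Fin (m + 1) →o Fin (n + 1)) (x : Sx K n) (t : stdSimplex ℝ (Fin (m + 1))) :
    toThin K (fat (pull θ x) t) = toThin K (fat x (stdSimplex.map θ t)) := Quot.sound (.glue θ x t)

/-- The interior point of a non-degenerate simplex which represents a point of the realisation. -/
noncomputable def core : Thin K → Cell K :=
  Quot.lift (Quot.lift (fun w => coreCell ⟨w.1.len, w.2⟩) (by
    rintro _ _ ⟨f, x, t⟩
    exact coreCell_pull (SemiSimplexCategory.homEquiv f).toOrderHom x t)) (by
    rintro _ _ ⟨θ, x, t⟩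
    exact coreCell_pull θ x t)

lemma core_fat (x : Sx K n) (t : stdSimplex ℝ (Fin (n + 1))) :
    core (toThin K (fat x t)) = coreCell ⟨n, x, t⟩ := rfl

lemma HasCore.toThin_eq {w c : Cell K} (h : HasCore w c) :
    toThin K (fat c.2.1 c.2.2) = toThin K (fat w.2.1 w.2.2) := by
  obtain ⟨j, d, π, u, h1, h2, h3, -⟩ := h
  rw [← h3, ← h2, ← toThin_pull, ← h1]
  exact toThin_pull _ _ _

lemma toThin_core (z : Thin K) : toThin K (fat (core z).2.1 (core z).2.2) = z := by
  obtain ⟨z, rfl⟩ := isQuotientMap_toThin.surjective z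
  obtain ⟨n, x, t, rfl⟩ := exists_fat z
  exact (hasCore_coreCell ⟨n, x, t⟩).toThin_eq

lemma core_pull {y : Sx K m} (hy : y ∈ K.nonDegenerate m) (π : Fin (n + 1) →o Fin (m + 1))
    {u : stdSimplex ℝ (Fin (n + 1))} (h : ∀ i, 0 < stdSimplex.map π u i) :
    core (toThin K (fat (pull π y) u)) = ⟨m, y, stdSimplex.map π u⟩ := by
  rw [toThin_pull, core_fat]
  refine coreCell_eq ⟨m, .refl _, OrderHom.id, stdSimplex.map π u, rfl, ?_, ?_, hy, h,
    Function.surjective_id⟩ <;> exact stdSimplex.map_id_apply _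

/-- The dimension of the non-degenerate simplex which gives rise to a simplex. -/
noncomputable def dim (x : Sx K n) : ℕ := (degData x).1

/-- The dimension of the cell which contains a point. -/
noncomputable def coreDim (z : Thin K) : ℕ := (core z).1

lemma exists_data (x : Sx K n) : ∃ (y : Sx K (dim x)) (π : Fin (n + 1) →o Fin (dim x + 1)),
    y ∈ K.nonDegenerate (dim x) ∧ Function.Surjective π ∧ x = pull π y ∧ degData x = ⟨dim x, y, π⟩ :=
  have h := (exists_degData x).choose_spec
  ⟨(degData x).2.1, (degData x).2.2, h.1, h.2.1, h.2.2.symm, rfl⟩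

lemma dim_le (x : Sx K n) : dim x ≤ n := by
  obtain ⟨y, π, -, hπ, -⟩ := exists_data x
  simpa using Fintype.card_le_of_surjective π hπ

lemma coreDim_le (x : Sx K n) (t : stdSimplex ℝ (Fin (n + 1))) : coreDim (toThin K (fat x t)) ≤ dim x := by
  obtain ⟨y, π, hy, hπ, hx, -⟩ := exists_data x
  obtain ⟨j, d, ρ, u, h1, h2, h3, h4, h5, h6⟩ :=
    hasCore_coreCell (⟨_, y, stdSimplex.map π t⟩ : Cell K)
  have e : coreDim (toThin K (fat x t)) = (coreCell ⟨_, y, stdSimplex.map π t⟩).1 := by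
    rw [← core_fat, ← toThin_pull, ← hx]; rfl
  rw [e]
  have c1 : (coreCell ⟨_, y, stdSimplex.map π t⟩).1 ≤ j := by
    simpa using Fintype.card_le_of_surjective ρ h6
  have c2 : j ≤ dim x := by simpa using Fintype.card_le_of_injective d d.injective
  exact c1.trans c2

lemma pos_of_coreDim_eq {x : Sx K n} {t : stdSimplex ℝ (Fin (n + 1))} {y : Sx K m}
    {π : Fin (n + 1) →o Fin (m + 1)} (hx : x = pull π y)
    (h : m ≤ coreDim (toThin K (fat x t))) (i) : 0 < stdSimplex.map π t i := by
  obtain ⟨j, d, ρ, u, h1, h2, h3, h4, h5, h6⟩ :=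
    hasCore_coreCell (⟨_, y, stdSimplex.map π t⟩ : Cell K)
  have e : coreDim (toThin K (fat x t)) = (coreCell ⟨_, y, stdSimplex.map π t⟩).1 := by
    rw [← core_fat, ← toThin_pull, ← hx]; rfl
  rw [e] at h
  have c1 : (coreCell ⟨_, y, stdSimplex.map π t⟩).1 ≤ j := by
    simpa using Fintype.card_le_of_surjective ρ h6
  have c2 : j ≤ m := by simpa using Fintype.card_le_of_injective d d.injective
  obtain rfl : j = m := le_antisymm c2 (h.trans c1)
  have hd : Function.Surjective d := Finite.injective_iff_surjective.1 d.injective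
  obtain ⟨i, rfl⟩ := hd i
  change 0 < (⟨_, y, stdSimplex.map π t⟩ : Cell K).2.2 (d i)
  rw [← h2]
  exact map_pos_of_surjective hd h5 _

lemma coreDim_of_pos (x : Sx K n) {t : stdSimplex ℝ (Fin (n + 1))} (ht : ∀ i, 0 < t i) :
    coreDim (toThin K (fat x t)) = dim x := by
  obtain ⟨y, π, hy, hπ, hx, -⟩ := exists_data x
  have := core_pull hy π (u := t) (map_pos_of_surjective hπ ht)
  rw [← hx] at this
  rw [coreDim, this]

lemma exists_pos (n : ℕ) : ∃ t : stdSimplex ℝ (Fin (n + 1)), ∀ i, 0 < t i :=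
  ⟨⟨fun _ => 1 / (n + 1 : ℝ), fun _ => by positivity, by simp; field_simp⟩,
    fun _ => show (0 : ℝ) < 1 / (n + 1 : ℝ) by positivity⟩

lemma dim_pull_le (θ : Fin (m + 1) →o Fin (n + 1)) (x : Sx K n) : dim (pull θ x) ≤ dim x := by
  obtain ⟨t, ht⟩ := exists_pos m
  rw [← coreDim_of_pos _ ht, toThin_pull]
  exact coreDim_le _ _

/-- A face of the same dimension arises from the same non-degenerate simplex. -/
lemma degData_pull {θ : Fin (m + 1) →o Fin (n + 1)} {x : Sx K n} {d : ℕ} {y : Sx K d}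
    {π : Fin (n + 1) →o Fin (d + 1)} (hy : y ∈ K.nonDegenerate d) (hx : x = pull π y)
    (h : d ≤ dim (pull θ x)) : degData (pull θ x) = ⟨d, y, π.comp θ⟩ := by
  obtain ⟨t, ht⟩ := exists_pos m
  rw [← coreDim_of_pos _ ht] at h
  have e : pull θ x = pull (π.comp θ) y := by rw [hx, pull_pull]
  exact degData_eq hy (surjective_of_map_pos (pos_of_coreDim_eq e h)) e.symm

end Thin

/-- A quotient map restricts to a quotient map over the intersection of a closed and an open set. -/
lemma isQuotientMap_restrict {X Y : Type*} [TopologicalSpace X] [TopologicalSpace Y] {f : X → Y}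
    (hf : IsQuotientMap f) {S O : Set Y} (hS : IsClosed S) (hO : IsOpen O) :
    IsQuotientMap ((S ∩ O).restrictPreimage f) := by
  refine isQuotientMap_iff_isClosed.2 ⟨Set.restrictPreimage_surjective _ hf.surjective,
    fun D => ⟨fun h => h.preimage hf.continuous.restrictPreimage, fun h => ?_⟩⟩
  obtain ⟨C, hC, e⟩ := isClosed_induced_iff.1 h
  have hD : ∀ x (hx : f x ∈ S ∩ O), x ∈ C ↔ ⟨f x, hx⟩ ∈ D := fun x hx => by
    have := Set.ext_iff.1 e ⟨x, hx⟩
    exact this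
  refine isClosed_induced_iff.2 ⟨{y | y ∈ S ∧ ∀ h : y ∈ S ∩ O, ⟨y, h⟩ ∈ D}, ?_, ?_⟩
  · refine hf.isClosed_preimage.1 ?_
    have : f ⁻¹' {y | y ∈ S ∧ ∀ h : y ∈ S ∩ O, ⟨y, h⟩ ∈ D} = f ⁻¹' S ∩ (C ∪ f ⁻¹' Oᶜ) := by
      ext x
      constructor
      · rintro ⟨h1, h2⟩
        refine ⟨h1, or_iff_not_imp_right.2 fun h => ?_⟩
        have hx : f x ∈ S ∩ O := ⟨h1, not_not.1 h⟩
        exact (hD x hx).2 (h2 hx)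
      · rintro ⟨h1, h2⟩
        refine ⟨h1, fun h => (hD x h).1 (h2.resolve_right fun h' => h' h.2)⟩
    rw [this]
    exact (hS.preimage hf.continuous).inter (hC.union (hO.isClosed_compl.preimage hf.continuous))
  · ext y
    exact ⟨fun h => h.2 y.2, fun h => ⟨y.2.1, fun _ => h⟩⟩

lemma Realisation.isClosed_iff {X : SemiSSet.{u}} {C : Set (Realisation (disc X))} :
    IsClosed C ↔ ∀ (n : ℕ) (x : X.obj (op (.mk n))),
      IsClosed {t | mk (S := disc X) (n := .mk n) x t ∈ C} := by
  constructor
  · intro h n x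
    exact h.preimage (f := fun t => mk (S := disc X) (n := .mk n) x t) (by fun_prop)
  · intro h
    rw [← isOpen_compl_iff, isOpen_iff]
    intro n
    rw [isOpen_iff_continuous_mem]
    have key : ∀ (K : Type u) (g : K × stdSimplex ℝ (Fin (n.len + 1)) → Prop),
        (∀ x, Continuous fun t => g (x, t)) →
        Continuous fun z : TopCat.discrete.obj K × stdSimplex ℝ (Fin (n.len + 1)) => g z :=
      fun K g hg => continuous_prod_of_discrete_left.2 hg
    refine key (X.obj (op n)) (fun z => mk (S := disc X) (n := n) z.1 z.2 ∈ Cᶜ) fun x => ?_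
    exact continuous_Prop.2 (h n.len x).isOpen_compl

namespace Thin

variable {K : SSet.{u}} {j k m n : ℕ}

/-! ### Maps defined on skeleta -/

/-- The point `w` of a simplex is an interior point of a face; that is `c`. -/
def HasFace (w c : Cell K) : Prop :=
  ∃ d : Fin (c.1 + 1) ↪o Fin (w.1 + 1), c.2.1 = pull d.toOrderHom w.2.1 ∧
    stdSimplex.map d c.2.2 = w.2.2 ∧ ∀ i, 0 < c.2.2 i

lemma exists_hasFace (w : Cell K) : ∃ c, HasFace w c := by
  obtain ⟨j, d, u, hu, h⟩ := exists_support w.2.2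
  exact ⟨⟨j, pull d.toOrderHom w.2.1, u⟩, d, rfl, h, hu⟩

lemma HasFace.unique {w c c' : Cell K} (h : HasFace w c) (h' : HasFace w c') : c = c' := by
  obtain ⟨m, x, t⟩ := c
  obtain ⟨m', x', t'⟩ := c'
  obtain ⟨(d : Fin (m + 1) ↪o Fin (w.1 + 1)), h1, h2, h3⟩ := h
  obtain ⟨(d' : Fin (m' + 1) ↪o Fin (w.1 + 1)), h1', h2', h3'⟩ := h'
  obtain rfl : x = pull (OrderEmbedding.toOrderHom (X := Fin (m + 1)) d) w.2.1 := h1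
  obtain rfl : x' = pull (OrderEmbedding.toOrderHom (X := Fin (m' + 1)) d') w.2.1 := h1'
  obtain ⟨⟩ := support_unique h3 h3' (h2.trans h2'.symm)
  rfl

lemma HasFace.of_pull {f : Fin (m + 1) ↪o Fin (n + 1)} {x : Sx K n} {t : stdSimplex ℝ (Fin (m + 1))}
    {c : Cell K} (h : HasFace ⟨m, pull f.toOrderHom x, t⟩ c) : HasFace ⟨n, x, stdSimplex.map f t⟩ c := by
  obtain ⟨d, h1, h2, h3⟩ := h
  refine ⟨d.trans f, h1.trans (pull_pull _ _ _), ?_, h3⟩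
  change _ = stdSimplex.map f t
  rw [← show stdSimplex.map d c.2.2 = t from h2, stdSimplex.map_comp_apply]
  rfl

/-- The interior point of a simplex which represents a point of the semi-simplicial realisation. -/
noncomputable def face : Realisation (disc (under K)) → Cell K :=
  Quot.lift (fun w => (exists_hasFace (⟨w.1.len, w.2⟩ : Cell K)).choose) (by
    rintro _ _ ⟨f, x, t⟩
    exact ((exists_hasFace _).choose_spec.of_pull (f := SemiSimplexCategory.homEquiv f)).unique
      (exists_hasFace _).choose_spec)

lemma hasFace_face (x : Sx K n) (t : stdSimplex ℝ (Fin (n + 1))) : HasFace ⟨n, x, t⟩ (face (fat x t)) :=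
  (exists_hasFace (⟨n, x, t⟩ : Cell K)).choose_spec

lemma isClosed_iff {C : Set (Realisation (disc (under K)))} :
    IsClosed C ↔ ∀ (n : ℕ) (x : Sx K n), IsClosed {t | fat x t ∈ C} := Realisation.isClosed_iff

/-- A subset of the preimage of a skeleton is closed if it is so on each simplex of the dimensions of that
skeleton: every other simplex meets it in finitely many faces of this kind. -/
lemma isClosed_slice {C : Set (Realisation (disc (under K)))} (hC : ∀ z ∈ C, coreDim (toThin K z) < n)
    (h : ∀ (k : ℕ) (x : Sx K k), dim x < n → IsClosed {t | fat x t ∈ C}) : IsClosed C := by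
  refine isClosed_iff.2 fun k x => ?_
  have : {t | fat x t ∈ C} = ⋃ j : Fin (k + 1), ⋃ d : Fin (j + 1) ↪o Fin (k + 1),
      ⋃ _ : dim (pull d.toOrderHom x) < n, stdSimplex.map d '' {u | fat (pull d.toOrderHom x) u ∈ C} := by
    ext t
    simp only [Set.mem_iUnion, Set.mem_image]
    constructor
    · intro ht
      obtain ⟨j, d, u, hu, rfl⟩ := exists_support t
      have hj : j < k + 1 := by simpa using Fintype.card_le_of_injective d d.injective
      have ht' : fat (pull d.toOrderHom x) u ∈ C := by rw [fat_pull]; exact ht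
      refine ⟨⟨j, hj⟩, d, ?_, u, ht', rfl⟩
      rw [← coreDim_of_pos _ hu]
      exact hC _ ht'
    · rintro ⟨j, d, -, u, hu, rfl⟩
      have hu' : fat (pull d.toOrderHom x) u ∈ C := hu
      rwa [fat_pull] at hu'
  rw [this]
  refine isClosed_iUnion_of_finite fun j => isClosed_iUnion_of_finite fun d =>
    isClosed_iUnion_of_finite fun hd => ?_
  exact ((h _ _ hd).isCompact.image (stdSimplex.continuous_map d)).isClosed

variable (K) in
/-- The points in cells of dimension less than `n`. -/
def skel (n : ℕ) : Set (Thin K) := {z | coreDim z < n}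

lemma isClosed_skel (n : ℕ) : IsClosed (skel K n) := by
  refine isQuotientMap_toThin.isClosed_preimage.1 (isClosed_slice (fun z hz => hz) fun k x hx => ?_)
  convert isClosed_univ
  exact Set.eq_univ_of_forall fun t => (coreDim_le x t).trans_lt hx

@[fun_prop] lemma continuous_fat {A : Type*} [TopologicalSpace A] (x : Sx K n)
    {t : A → stdSimplex ℝ (Fin (n + 1))} (ht : Continuous t) : Continuous fun a => fat x (t a) :=
  Realisation.continuous_mk (S := disc (under K)) (n := .mk n) (x := fun _ => x) continuous_const ht

/-- Continuity over a relatively open subset of a skeleton can be tested on simplices. -/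
lemma continuous_of_slice {T : Type*} [TopologicalSpace T] {O : Set (Thin K)} (hO : IsOpen O)
    {F : toThin K ⁻¹' (skel K n ∩ O) → T}
    (h : ∀ (k : ℕ) (x : Sx K k) (hx : dim x < n), Continuous fun t : {t | toThin K (fat x t) ∈ O} =>
      F ⟨fat x t, (coreDim_le x t).trans_lt hx, t.2⟩) : Continuous F := by
  refine continuous_iff_isClosed.2 fun D hD => isClosed_induced_iff.2
    ⟨{z | toThin K z ∈ skel K n ∧ ∀ h : z ∈ toThin K ⁻¹' (skel K n ∩ O), F ⟨z, h⟩ ∈ D}, ?_, ?_⟩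
  · refine isClosed_slice (fun z hz => hz.1) fun k x hx => ?_
    have hO' : IsOpen {t | toThin K (fat x t) ∈ O} :=
      hO.preimage (f := fun t => toThin K (fat x t)) (by fun_prop)
    obtain ⟨U, hU, e⟩ := isOpen_induced_iff.1 (hD.isOpen_compl.preimage (h k x hx))
    have : {t | fat x t ∈ {z | toThin K z ∈ skel K n ∧ ∀ h : z ∈ toThin K ⁻¹' (skel K n ∩ O),
        F ⟨z, h⟩ ∈ D}} = (U ∩ {t | toThin K (fat x t) ∈ O})ᶜ := by
      ext t
      have he : ∀ ht : toThin K (fat x t) ∈ O, t ∈ U ↔ F ⟨fat x t, (coreDim_le x t).trans_lt hx, ht⟩ ∉ D :=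
        fun ht => Set.ext_iff.1 e ⟨t, ht⟩
      constructor
      · rintro ⟨-, h2⟩ ⟨h3, h4⟩
        exact (he h4).1 h3 (h2 ⟨(coreDim_le x t).trans_lt hx, h4⟩)
      · intro h1
        refine ⟨(coreDim_le x t).trans_lt hx, fun h2 => ?_⟩
        by_contra h3
        exact h1 ⟨(he h2.2).2 h3, h2.2⟩
    rw [this]
    exact (hU.inter hO').isClosed_compl
  · ext z
    exact ⟨fun h => h.2 z.2, fun h => ⟨z.2.1, fun _ => h⟩⟩

/-- Families of maps on simplices which are compatible with faces define a map on a relatively open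
subset of a skeleton of the semi-simplicial realisation. -/
lemma exists_desc_skel {T : Type*} [TopologicalSpace T] {O : Set (Thin K)} (hO : IsOpen O)
    (Φ : ∀ {k : ℕ}, Sx K k → stdSimplex ℝ (Fin (k + 1)) → T)
    (hc : ∀ {k : ℕ} (x : Sx K k), dim x < n →
      Continuous fun t : {t | toThin K (fat x t) ∈ O} => Φ x t)
    (h : ∀ {j k : ℕ} (d : Fin (j + 1) ↪o Fin (k + 1)) (x : Sx K k) (t), dim x < n →
      toThin K (fat (pull d.toOrderHom x) t) ∈ O →
      Φ (pull d.toOrderHom x) t = Φ x (stdSimplex.map d t)) :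
    ∃ F : C(toThin K ⁻¹' (skel K n ∩ O), T), ∀ {k : ℕ} (x : Sx K k) t (_ : dim x < n)
      (ht : fat x t ∈ toThin K ⁻¹' (skel K n ∩ O)), F ⟨fat x t, ht⟩ = Φ x t := by
  have key : ∀ {k : ℕ} (x : Sx K k) t (_ : dim x < n) (_ : fat x t ∈ toThin K ⁻¹' (skel K n ∩ O)),
      Φ (face (fat x t)).2.1 (face (fat x t)).2.2 = Φ x t := by
    intro k x t hx ht
    obtain ⟨d, h1, h2, h3⟩ := hasFace_face x t
    have h2' : stdSimplex.map d (face (fat x t)).2.2 = t := h2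
    rw [h1]
    refine (h d x _ hx ?_).trans (congrArg (Φ x) h2')
    rw [fat_pull, h2']
    exact ht.2
  exact ⟨⟨fun z => Φ (face z.1).2.1 (face z.1).2.2, continuous_of_slice hO fun k x hx =>
    (hc x hx).congr fun t => (key x t hx ⟨(coreDim_le x t).trans_lt hx, t.2⟩).symm⟩, key⟩

/-- A map on a relatively open subset of a skeleton of the semi-simplicial realisation which respects
degeneracies descends to the realisation. -/
lemma exists_lift {T : Type*} [TopologicalSpace T] {O : Set (Thin K)} (hO : IsOpen O)
    (F : C(toThin K ⁻¹' (skel K n ∩ O), T))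
    (hF : ∀ z z' : toThin K ⁻¹' (skel K n ∩ O), toThin K z = toThin K z' → F z = F z') :
    ∃ G : C((skel K n ∩ O : Set (Thin K)), T), ∀ z : toThin K ⁻¹' (skel K n ∩ O),
      G ⟨toThin K z, z.2⟩ = F z := by
  have hq := isQuotientMap_restrict (isQuotientMap_toThin (K := K)) (isClosed_skel (K := K) n) hO
  have hF' : Function.FactorsThrough F ((skel K n ∩ O).restrictPreimage (toThin K)) :=
    fun z z' h => hF z z' (congrArg Subtype.val h)
  let q : C(toThin K ⁻¹' (skel K n ∩ O), (skel K n ∩ O : Set (Thin K))) :=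
    ⟨(skel K n ∩ O).restrictPreimage (toThin K), hq.continuous⟩
  have hq' : IsQuotientMap q := hq
  exact ⟨hq'.lift F hF', fun z => DFunLike.congr_fun (hq'.lift_comp F hF') z⟩

lemma exists_pos_of_mem_skel {z : Realisation (disc (under K))} (hz : toThin K z ∈ skel K n) :
    ∃ (k : ℕ) (x : Sx K k) (t : stdSimplex ℝ (Fin (k + 1))), dim x < n ∧ (∀ i, 0 < t i) ∧ z = fat x t := by
  obtain ⟨k, x, t, ht, rfl⟩ := exists_fat_pos z
  refine ⟨k, x, t, ?_, ht, rfl⟩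
  rw [← coreDim_of_pos x ht]
  exact hz

end Thin

/-! ### Pushing points of simplices to the boundary -/

section Push

variable {j k N : ℕ}

/-- The least barycentric coordinate, cut off at half the value at the barycentre. -/
noncomputable def gap (P : stdSimplex ℝ (Fin (N + 1))) : ℝ :=
  min (Finset.univ.inf' Finset.univ_nonempty P) (1 / (2 * (N + 1)))

lemma continuous_gap : Continuous (gap (N := N)) :=
  (Continuous.finset_inf'_apply _ fun i _ => by fun_prop).min continuous_const

lemma gap_le (P : stdSimplex ℝ (Fin (N + 1))) (i) : gap P ≤ P i :=
  (min_le_left _ _).trans (Finset.inf'_le _ (Finset.mem_univ i))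

lemma gap_nonneg (P : stdSimplex ℝ (Fin (N + 1))) : 0 ≤ gap P :=
  le_min (Finset.le_inf' _ _ fun i _ => P.2.1 i) (by positivity)

lemma gap_mul_le (P : stdSimplex ℝ (Fin (N + 1))) : (N + 1) * gap P ≤ 1 / 2 := by
  have h : gap P ≤ 1 / (2 * (N + 1)) := min_le_right _ _
  calc (N + 1) * gap P ≤ (N + 1) * (1 / (2 * (N + 1))) := by gcongr
    _ = 1 / 2 := by field_simp

lemma exists_eq_gap {P : stdSimplex ℝ (Fin (N + 1))} {i : Fin (N + 1)} (h : P i < 1 / (2 * (N + 1))) :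
    ∃ i, P i = gap P ∧ P i < 1 / (2 * (N + 1)) := by
  obtain ⟨i', -, hi'⟩ := Finset.exists_mem_eq_inf' (Finset.univ_nonempty (α := Fin (N + 1))) P
  have h2 : P i' < 1 / (2 * (N + 1)) := by
    rw [← hi']
    exact (Finset.inf'_le _ (Finset.mem_univ i)).trans_lt h
  refine ⟨i', ?_, h2⟩
  rw [gap, hi', min_eq_left h2.le]

lemma gap_eq_zero {P : stdSimplex ℝ (Fin (N + 1))} {i : Fin (N + 1)} (h : P i ≤ 0) : gap P = 0 :=
  le_antisymm ((gap_le P i).trans h) (gap_nonneg P)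

lemma gap_div_mul (P : stdSimplex ℝ (Fin (N + 1))) (i) : gap P / P i * P i = gap P := by
  by_cases h : P i = 0
  · rw [h, mul_zero, gap_eq_zero h.le]
  · exact div_mul_cancel₀ _ h

/-- The factor which normalises the sum of the coordinates. -/
noncomputable def pushDen (P : stdSimplex ℝ (Fin (N + 1))) (v : I) : ℝ := 1 - v * ((N + 1) * gap P)

lemma pushDen_pos (P : stdSimplex ℝ (Fin (N + 1))) (v : I) : 0 < pushDen P v := by
  have h1 := gap_mul_le P
  have h2 : 0 ≤ (N + 1) * gap P := mul_nonneg (by positivity) (gap_nonneg P)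
  have h3 := mul_le_of_le_one_left h2 v.2.2
  unfold pushDen
  linarith

/-- The coordinates of a point pushed away from the centres of the fibres of a map of vertices. -/
noncomputable def pushFun (π : Fin (k + 1) → Fin (N + 1)) (t : stdSimplex ℝ (Fin (k + 1))) (v : I)
    (i : Fin (k + 1)) : ℝ :=
  (1 - v * (gap (stdSimplex.map π t) / stdSimplex.map π t (π i))) / pushDen (stdSimplex.map π t) v * t i

lemma sum_pushFun (π : Fin (k + 1) → Fin (N + 1)) (t : stdSimplex ℝ (Fin (k + 1))) (v : I)
    (g : Fin (N + 1) → ℝ) : ∑ i, g (π i) * pushFun π t v i =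
      ∑ i, g i * ((stdSimplex.map π t i - v * gap (stdSimplex.map π t)) / pushDen (stdSimplex.map π t) v) := by
  have h := sum_map_mul π t (fun i => g i * ((1 - v * (gap (stdSimplex.map π t) / stdSimplex.map π t i)) /
    pushDen (stdSimplex.map π t) v))
  have e : ∀ i, g (π i) * pushFun π t v i = g (π i) * ((1 - v * (gap (stdSimplex.map π t) /
    stdSimplex.map π t (π i))) / pushDen (stdSimplex.map π t) v) * t i := fun i => by
    rw [pushFun]; ring
  rw [Finset.sum_congr rfl fun i _ => e i, ← h]
  refine Finset.sum_congr rfl fun i _ => ?_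
  have e2 := gap_div_mul (stdSimplex.map π t) i
  rw [mul_assoc, div_mul_eq_mul_div, sub_mul, one_mul, mul_assoc, e2]

/-- The deformation which pushes a point of a simplex towards the preimage of the boundary under a map
of simplices. -/
noncomputable def push (π : Fin (k + 1) → Fin (N + 1)) (t : stdSimplex ℝ (Fin (k + 1))) (v : I) :
    stdSimplex ℝ (Fin (k + 1)) :=
  ⟨pushFun π t v, fun i => by
    refine mul_nonneg (div_nonneg (sub_nonneg.2 ?_) (pushDen_pos _ v).le) (t.2.1 i)
    exact mul_le_one₀ v.2.2 (div_nonneg (gap_nonneg _) (by exact (stdSimplex.map π t).2.1 _))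
      (div_le_one_of_le₀ (gap_le _ _) (by exact (stdSimplex.map π t).2.1 _)), by
    have h := sum_pushFun π t v (fun _ => 1)
    simp only [one_mul] at h
    rw [h, ← Finset.sum_div, Finset.sum_sub_distrib, stdSimplex.sum_eq_one, Finset.sum_const,
      Finset.card_univ, Fintype.card_fin, nsmul_eq_mul, div_eq_one_iff_eq (pushDen_pos _ v).ne', pushDen]
    push_cast
    ring⟩

lemma push_apply (π : Fin (k + 1) → Fin (N + 1)) (t : stdSimplex ℝ (Fin (k + 1))) (v : I) (i) :
    push π t v i = pushFun π t v i := rfl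

lemma map_push_apply (π : Fin (k + 1) → Fin (N + 1)) (t : stdSimplex ℝ (Fin (k + 1))) (v : I) (i) :
    stdSimplex.map π (push π t v) i =
      (stdSimplex.map π t i - v * gap (stdSimplex.map π t)) / pushDen (stdSimplex.map π t) v := by
  have h := sum_map_mul π (push π t v) (fun y => if y = i then (1 : ℝ) else 0)
  have h' := sum_pushFun π t v (fun y => if y = i then (1 : ℝ) else 0)
  simp only [push_apply] at h
  rw [h'] at h
  simpa using h

lemma map_push (π : Fin (k + 1) → Fin (N + 1)) (t : stdSimplex ℝ (Fin (k + 1))) (v : I) :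
    stdSimplex.map π (push π t v) = push id (stdSimplex.map π t) v := by
  have h := fun i => map_push_apply id (stdSimplex.map π t) v i
  simp only [stdSimplex.map_id_apply] at h
  ext i
  rw [map_push_apply, h]

lemma push_of_gap (π : Fin (k + 1) → Fin (N + 1)) {t : stdSimplex ℝ (Fin (k + 1))} (v : I)
    (h : gap (stdSimplex.map π t) = 0) : push π t v = t := by
  ext i
  rw [push_apply, pushFun, pushDen, h]
  simp

@[simp] lemma push_zero (π : Fin (k + 1) → Fin (N + 1)) (t : stdSimplex ℝ (Fin (k + 1))) :
    push π t 0 = t := by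
  ext i
  rw [push_apply, pushFun, pushDen]
  simp

lemma push_map (π : Fin (k + 1) → Fin (N + 1)) (d : Fin (j + 1) ↪o Fin (k + 1))
    (t : stdSimplex ℝ (Fin (j + 1))) (v : I) :
    stdSimplex.map d (push (π ∘ d) t v) = push π (stdSimplex.map d t) v := by
  ext i
  rw [push_apply, pushFun, stdSimplex.map_comp_apply]
  by_cases hi : ∃ i', d i' = i
  · obtain ⟨i, rfl⟩ := hi
    rw [map_apply_eq d.injective, map_apply_eq d.injective, push_apply, pushFun]
    rfl
  · push Not at hi
    rw [map_apply_of_notMem _ hi, map_apply_of_notMem _ hi, mul_zero]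

lemma exists_map_push_lt (π : Fin (k + 1) → Fin (N + 1)) {t : stdSimplex ℝ (Fin (k + 1))} (v : I)
    {i : Fin (N + 1)} (h : stdSimplex.map π t i < 1 / (2 * (N + 1))) :
    ∃ i, stdSimplex.map π (push π t v) i < 1 / (2 * (N + 1)) := by
  obtain ⟨i, h1, h2⟩ := exists_eq_gap h
  refine ⟨i, lt_of_le_of_lt ?_ h2⟩
  rw [map_push_apply, div_le_iff₀ (pushDen_pos _ v), pushDen, ← h1]
  have h3 : (N + 1) * stdSimplex.map π t i ≤ 1 := by rw [h1]; linarith [gap_mul_le (stdSimplex.map π t)]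
  have h4 : 0 ≤ (v : ℝ) * stdSimplex.map π t i := mul_nonneg v.2.1 ((stdSimplex.map π t).2.1 i)
  nlinarith [mul_le_mul_of_nonneg_left h3 h4]

lemma exists_map_push_one (π : Fin (k + 1) → Fin (N + 1)) {t : stdSimplex ℝ (Fin (k + 1))}
    {i : Fin (N + 1)} (h : stdSimplex.map π t i < 1 / (2 * (N + 1))) :
    ∃ i, stdSimplex.map π (push π t 1) i = 0 := by
  obtain ⟨i, h1, h2⟩ := exists_eq_gap h
  refine ⟨i, ?_⟩
  rw [map_push_apply, h1]
  simp

lemma continuous_div_mul {A : Type*} [TopologicalSpace A] {g P t : A → ℝ} (hg : Continuous g)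
    (hP : Continuous P) (ht : Continuous t) (h0 : ∀ a, 0 ≤ g a) (h1 : ∀ a, g a ≤ P a)
    (h2 : ∀ a, 0 ≤ t a) (h3 : ∀ a, t a ≤ P a) : Continuous fun a => g a / P a * t a := by
  refine continuous_iff_continuousAt.2 fun a => ?_
  by_cases ha : P a = 0
  · have e : g a / P a * t a = 0 := by rw [ha, div_zero, zero_mul]
    have hb : ∀ b, g b / P b * t b ≤ P b := fun b =>
      (mul_le_of_le_one_left (h2 b) (div_le_one_of_le₀ (h1 b) ((h0 b).trans (h1 b)))).trans (h3 b)
    have hP' : Filter.Tendsto P (𝓝 a) (𝓝 0) := ha ▸ hP.tendsto a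
    rw [ContinuousAt, e]
    exact squeeze_zero (fun b => mul_nonneg (div_nonneg (h0 b) ((h0 b).trans (h1 b))) (h2 b)) hb hP'
  · exact (hg.continuousAt.div hP.continuousAt ha).mul ht.continuousAt

@[fun_prop] lemma Continuous.push {A : Type*} [TopologicalSpace A] (π : Fin (k + 1) → Fin (N + 1))
    {t : A → stdSimplex ℝ (Fin (k + 1))} {v : A → I} (ht : Continuous t) (hv : Continuous v) :
    Continuous fun a => push π (t a) (v a) := by
  refine Continuous.subtype_mk (continuous_pi fun i => ?_) _
  have hP : Continuous fun a => stdSimplex.map π (t a) := by fun_prop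
  have hg : Continuous fun a => gap (stdSimplex.map π (t a)) := continuous_gap.comp hP
  have h1 : Continuous fun a => gap (stdSimplex.map π (t a)) / stdSimplex.map π (t a) (π i) * t a i :=
    continuous_div_mul hg (by fun_prop) (by fun_prop) (fun _ => gap_nonneg _) (fun _ => gap_le _ _)
      (fun a => (t a).2.1 i) (fun a => le_map_apply _ _ _)
  have h2 : Continuous fun a => pushDen (stdSimplex.map π (t a)) (v a) := by
    unfold pushDen; fun_prop
  have e : ∀ a, pushFun π (t a) (v a) i = (t a i - v a * (gap (stdSimplex.map π (t a)) /
      stdSimplex.map π (t a) (π i) * t a i)) / pushDen (stdSimplex.map π (t a)) (v a) := fun a => by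
    rw [pushFun]; ring
  simp only [e]
  exact ((by fun_prop : Continuous fun a => t a i).sub ((by fun_prop : Continuous fun a => (v a : ℝ)).mul
    h1)).div h2 fun a => (pushDen_pos _ _).ne'

end Push

section WeakEqOn

variable {X Y : Type*} [TopologicalSpace X] [TopologicalSpace Y]

/-- The points of a subset of a subset. -/
def nestedHomeo {S U : Set X} (h : U ⊆ S) : ((↑) ⁻¹' U : Set S) ≃ₜ U where
  toFun x := ⟨x.1.1, x.2⟩
  invFun x := ⟨⟨x.1, h x.2⟩, x.2⟩
  continuous_toFun := by fun_prop
  continuous_invFun := by fun_prop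

/-- The relative form of `weakEq_of_cover`, for a cover of a subset by relatively open sets. -/
lemma weakEqOn_of_cover (f : C(X, Y)) {S : Set Y} {𝒰 : Set (Set Y)}
    (ho : ∀ U ∈ 𝒰, ∃ O, IsOpen O ∧ U = S ∩ O) (hcov : ∀ y ∈ S, ∃ U ∈ 𝒰, y ∈ U)
    (hcap : ∀ U ∈ 𝒰, ∀ V ∈ 𝒰, U ∩ V ∈ 𝒰) (hf : ∀ U ∈ 𝒰, WeakEqOn f (f ⁻¹' U) U) :
    WeakEqOn f (f ⁻¹' S) S := by
  refine ⟨fun x hx => hx, weakEq_of_cover _ (𝒰 := Set.preimage (↑) '' 𝒰) ?_ ?_ ?_ ?_⟩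
  · rintro _ ⟨U, hU, rfl⟩
    obtain ⟨O, hO, rfl⟩ := ho U hU
    refine isOpen_induced_iff.2 ⟨O, hO, ?_⟩
    ext y
    exact ⟨fun h => ⟨y.2, h⟩, fun h => h.2⟩
  · intro y
    obtain ⟨U, hU, h⟩ := hcov y y.2
    exact ⟨_, ⟨U, hU, rfl⟩, h⟩
  · rintro _ ⟨U, hU, rfl⟩ _ ⟨V, hV, rfl⟩
    exact ⟨_, hcap U hU V hV, rfl⟩
  · rintro _ ⟨U, hU, rfl⟩
    obtain ⟨O, hO, e⟩ := ho U hU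
    have hUS : U ⊆ S := e ▸ Set.inter_subset_left
    obtain ⟨h, H⟩ := hf U hU
    exact ⟨fun x hx => hx, ((WeakEq.of_homeo (nestedHomeo hUS).symm).comp H).comp
      (.of_homeo (nestedHomeo (S := f ⁻¹' S) (U := f ⁻¹' U) (Set.preimage_mono hUS)))⟩

/-- The inclusion of a deformation retract is a weak equivalence. -/
lemma weakEqOn_of_deformation {A U : Set X} (hA : A ⊆ U) (D : C(U, C(I, X))) (h0 : ∀ z, D z 0 = z)
    (hU : ∀ z v, D z v ∈ U) (h1 : ∀ z, D z 1 ∈ A) (hD : ∀ z : U, z.1 ∈ A → ∀ v, D z v = z) :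
    WeakEqOn (.id X) A U :=
  ⟨hA, .of_inverse ⟨fun z => ⟨D z 1, h1 z⟩, by fun_prop⟩ ⟨fun z => ⟨D z.1 z.2, hU _ _⟩, by fun_prop⟩
    ⟨Prod.fst, continuous_fst⟩ (fun z => Subtype.ext (h0 z)) (fun z => rfl) (fun z => rfl)
    (fun z => Subtype.ext (hD ⟨z, hA z.2⟩ z.2 1).symm)
    fun z v => Subtype.ext (hD ⟨z, hA z.2⟩ z.2 v).symm⟩

end WeakEqOn

namespace Thin

variable {K : SSet.{u}} {j k m n N : ℕ}

/-! ### Comparison of the two realisations of a simplicial set -/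

lemma coreDim_pos_iff {x : Sx K k} {y : Sx K n} {π : Fin (k + 1) →o Fin (n + 1)}
    (hy : y ∈ K.nonDegenerate n) (hx : x = pull π y) (t : stdSimplex ℝ (Fin (k + 1))) :
    n ≤ coreDim (toThin K (fat x t)) ↔ ∀ i, 0 < stdSimplex.map π t i := by
  refine ⟨pos_of_coreDim_eq hx, fun h => ?_⟩
  rw [hx, coreDim, core_pull hy π h]

lemma exists_le_zero {x : Sx K k} {y : Sx K n} {π : Fin (k + 1) →o Fin (n + 1)}
    (hy : y ∈ K.nonDegenerate n) (hx : x = pull π y) {t : stdSimplex ℝ (Fin (k + 1))}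
    (h : coreDim (toThin K (fat x t)) < n) : ∃ i, stdSimplex.map π t i ≤ 0 := by
  by_contra hc
  push Not at hc
  exact absurd ((coreDim_pos_iff hy hx t).2 hc) (not_le.2 h)

variable (K N) in
/-- The points of the `N`-cells which are not close to the boundary. -/
def central : Set (Thin K) := {z | coreDim z = N ∧ ∀ i, 1 / (2 * (N + 1)) ≤ (core z).2.2 i}

lemma fat_mem_central {x : Sx K k} {y : Sx K N} {π : Fin (k + 1) →o Fin (N + 1)}
    (hy : y ∈ K.nonDegenerate N) (hx : x = pull π y) (t : stdSimplex ℝ (Fin (k + 1))) :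
    toThin K (fat x t) ∈ central K N ↔ ∀ i, 1 / (2 * (N + 1)) ≤ stdSimplex.map π t i := by
  constructor
  · rintro ⟨h1, h2⟩
    have h3 := (coreDim_pos_iff hy hx t).1 h1.ge
    rw [hx, core_pull hy π h3] at h2
    exact h2
  · intro h
    have h3 : ∀ i, 0 < stdSimplex.map π t i := fun i => lt_of_lt_of_le (by positivity) (h i)
    have e := core_pull hy π h3
    rw [← hx] at e
    refine ⟨by rw [coreDim, e], ?_⟩
    rw [e]
    exact h

lemma isClosed_central : IsClosed (central K N) := by
  refine isQuotientMap_toThin.isClosed_preimage.1 (isClosed_slice (n := N + 1)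
    (fun z hz => by rw [hz.1]; exact Nat.lt_succ_self N) fun k x hx => ?_)
  obtain hx | hx := Nat.lt_succ_iff_lt_or_eq.1 hx
  · convert isClosed_empty
    refine Set.eq_empty_of_forall_notMem fun t ht => ?_
    have := coreDim_le x t
    rw [show coreDim (toThin K (fat x t)) = N from ht.1] at this
    omega
  · subst hx
    obtain ⟨y, π, hy, hπ, e, -⟩ := exists_data x
    have : {t | fat x t ∈ toThin K ⁻¹' central K (dim x)} =
        ⋂ i, {t | 1 / (2 * ((dim x : ℝ) + 1)) ≤ stdSimplex.map π t i} := by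
      ext t
      rw [Set.mem_iInter]
      exact fat_mem_central hy e t
    rw [this]
    exact isClosed_iInter fun i => isClosed_le continuous_const (by fun_prop)

/-- A deformation of the skeleton which moves only the points of `N`-cells, and pushes them away from the
centre of the cell. It is continuous since points of `N`-simplices in the lower skeleton are fixed. -/
lemma exists_push (K : SSet.{u}) (N : ℕ) : ∃ F : C(toThin K ⁻¹' (skel K (N + 1) ∩ Set.univ),
      C(I, Realisation (disc (under K)))),
    (∀ {k : ℕ} (x : Sx K k) t (_ : dim x < N) h v, F ⟨fat x t, h⟩ v = fat x t) ∧
    ∀ {k : ℕ} (x : Sx K k) (y : Sx K N) (π : Fin (k + 1) →o Fin (N + 1)) t, y ∈ K.nonDegenerate N →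
      Function.Surjective π → x = pull π y → ∀ h v, F ⟨fat x t, h⟩ v = fat x (push π t v) := by
  classical
  let Ψ : ∀ {k : ℕ}, (Σ m : ℕ, Sx K m × (Fin (k + 1) →o Fin (m + 1))) → Sx K k →
      stdSimplex ℝ (Fin (k + 1)) → C(I, Realisation (disc (under K))) := fun c x t =>
    if c.1 < N then .const _ (fat x t) else ⟨fun v => fat x (push c.2.2 t v), by fun_prop⟩
  obtain ⟨F, hF⟩ := exists_desc_skel (K := K) (n := N + 1) isOpen_univ
    (fun {k} x t => Ψ (degData x) x t) (fun {k} x hx => by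
      dsimp only [Ψ]
      split_ifs
      · have : Continuous fun w : {t | toThin K (fat x t) ∈ Set.univ} × I => fat x w.1 := by fun_prop
        exact (ContinuousMap.curry ⟨_, this⟩).continuous
      · have : Continuous fun w : {t | toThin K (fat x t) ∈ Set.univ} × I =>
          fat x (push (degData x).2.2 w.1 w.2) := by fun_prop
        exact (ContinuousMap.curry ⟨_, this⟩).continuous)
    (fun {j k} d x t hx _ => by
      obtain ⟨y, π, hy, hπ, e, hd⟩ := exists_data x
      have hle := dim_pull_le d.toOrderHom x
      ext v
      by_cases h1 : dim x < N
      · have h2 : (degData x).1 < N := h1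
        have h3 : (degData (pull d.toOrderHom x)).1 < N := hle.trans_lt h1
        simp only [Ψ, if_pos h2, if_pos h3]
        exact fat_pull d x t
      · have hN : dim x = N := by omega
        have h2 : ¬ (degData x).1 < N := h1
        by_cases h3 : dim (pull d.toOrderHom x) < N
        · have h4 : (degData (pull d.toOrderHom x)).1 < N := h3
          simp only [Ψ, if_neg h2, if_pos h4]
          change fat (pull d.toOrderHom x) t = fat x (push (degData x).2.2 _ v)
          have h5 : coreDim (toThin K (fat x (stdSimplex.map d t))) < dim x := by
            rw [← fat_pull, hN]
            exact (coreDim_le _ _).trans_lt h3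
          obtain ⟨i, hi⟩ := exists_le_zero hy e h5
          rw [hd]
          change _ = fat x (push π _ v)
          rw [push_of_gap π v (gap_eq_zero hi), fat_pull]
        · have h4 : ¬ (degData (pull d.toOrderHom x)).1 < N := h3
          simp only [Ψ, if_neg h2, if_neg h4]
          change fat _ (push (degData (pull d.toOrderHom x)).2.2 _ v) = fat x (push (degData x).2.2 _ v)
          rw [degData_pull (θ := d.toOrderHom) hy e (by omega), hd]
          change fat _ (push (π ∘ d) t v) = fat x (push π _ v)
          rw [fat_pull, push_map])
  refine ⟨F, fun {k} x t hx h v => ?_, fun {k} x y π t hy hπ e h v => ?_⟩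
  · rw [hF x t (by omega) h]
    simp only [Ψ, if_pos (show (degData x).1 < N from hx)]
    rfl
  · have hd := degData_eq hy hπ e.symm
    rw [hF x t (by rw [dim, hd]; exact Nat.lt_succ_self N) h, hd]
    simp only [Ψ, lt_irrefl, if_false]
    rfl

/-- The homotopy over the open `N`-cells from the point `[π^* y, t]` of a degenerate simplex to the point
`[y, π_* t]`, inside the simplex in which `t` and `π_* t` are merged. -/
lemma exists_merge (K : SSet.{u}) (N : ℕ) : ∃ F : C(toThin K ⁻¹' (skel K (N + 1) ∩ (skel K N)ᶜ),
      C(I, Realisation (disc (under K)))),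
    ∀ {k : ℕ} (y : Sx K N) (π : Fin (k + 1) →o Fin (N + 1)) t, y ∈ K.nonDegenerate N →
      Function.Surjective π → ∀ h v, F ⟨fat (pull π y) t, h⟩ v =
        fat (pull (mergeProj N k) y) (mergePt π v t) := by
  let Ψ : ∀ {k : ℕ}, (Σ m : ℕ, Sx K m × (Fin (k + 1) →o Fin (m + 1))) →
      C(stdSimplex ℝ (Fin (k + 1)), C(I, Realisation (disc (under K)))) := fun {k} c =>
    ContinuousMap.curry ⟨fun w => fat (pull (mergeProj c.1 k) c.2.1) (mergePt c.2.2 w.2 w.1), by fun_prop⟩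
  obtain ⟨F, hF⟩ := exists_desc_skel (K := K) (n := N + 1) (isClosed_skel (K := K) N).isOpen_compl
    (fun {k} x t => Ψ (degData x) t) (fun {k} x hx => by fun_prop)
    (fun {j k} d x t hx ht => by
      obtain ⟨y, π, hy, hπ, e, hd⟩ := exists_data x
      have h1 : N ≤ dim (pull d.toOrderHom x) := (not_lt.1 (show ¬ coreDim (toThin K
        (fat (pull d.toOrderHom x) t)) < N from ht)).trans (coreDim_le _ _)
      rw [degData_pull (θ := d.toOrderHom) hy e (by omega), hd]
      ext v
      change fat (pull (mergeProj _ j) y) (mergePt (π.comp d.toOrderHom) v t) =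
        fat (pull (mergeProj _ k) y) (mergePt π v (stdSimplex.map d t))
      have e2 : pull (mergeProj (dim x) j) y =
          pull (mergeMap (RelEmbedding.refl _) d).toOrderHom (pull (mergeProj (dim x) k) y) := by
        rw [pull_pull]
        exact congrArg (fun f => pull f y) (OrderHom.ext _ _ (funext fun i =>
          (mergeProj_map (RelEmbedding.refl _) d i).symm))
      rw [e2, fat_pull, map_mergePt (RelEmbedding.refl _) d fun _ => rfl])
  refine ⟨F, fun {k} y π t hy hπ h v => ?_⟩
  have hd := degData_eq (x := pull π y) hy hπ rfl
  rw [hF (pull π y) t (by rw [dim, hd]; exact Nat.lt_succ_self N) h, hd]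
  rfl

lemma mem_stratum {z : Realisation (disc (under K))} (hz : toThin K z ∈ skel K (N + 1) ∩ (skel K N)ᶜ) :
    ∃ (k : ℕ) (y : Sx K N) (π : Fin (k + 1) →o Fin (N + 1)) (t : stdSimplex ℝ (Fin (k + 1))),
      y ∈ K.nonDegenerate N ∧ Function.Surjective π ∧ z = fat (pull π y) t ∧
        core (toThin K z) = ⟨N, y, stdSimplex.map π t⟩ := by
  obtain ⟨k, x, t, h1, h2, rfl⟩ := exists_pos_of_mem_skel hz.1
  have h3 : dim x = N := by
    have : ¬ coreDim (toThin K (fat x t)) < N := hz.2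
    rw [coreDim_of_pos x h2] at this
    omega
  subst h3
  obtain ⟨y, π, hy, hπ, e, -⟩ := exists_data x
  have := core_pull hy π (map_pos_of_surjective hπ h2)
  rw [← e] at this
  exact ⟨k, y, π, t, hy, hπ, by rw [← e], this⟩

/-- Over the open cells, the points of the semi-simplicial realisation are merged with those of the
cell itself. -/
lemma weakEqOn_stratum {V : Set (Thin K)} (hV : V ⊆ skel K (N + 1) ∩ (skel K N)ᶜ) :
    WeakEqOn (toThin K) (toThin K ⁻¹' V) V := by
  obtain ⟨F, hF⟩ := exists_merge K N
  have hF1 : ∀ z, F z 1 = fat (core (toThin K z)).2.1 (core (toThin K z)).2.2 := fun ⟨z, hz⟩ => by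
    obtain ⟨k, y, π, t, hy, hπ, rfl, e⟩ := mem_stratum hz
    rw [hF y π t hy hπ, e, mergePt, mix_one, ← fat_pull, pull_pull]
    have : (mergeProj N k).comp (mergeInr N k).toOrderHom = OrderHom.id :=
      OrderHom.ext _ _ (funext fun i => mergeProj_inr i)
    rw [this, pull_id]
  have hF0 : ∀ z, F z 0 = z := fun ⟨z, hz⟩ => by
    obtain ⟨k, y, π, t, hy, hπ, rfl, e⟩ := mem_stratum hz
    rw [hF y π t hy hπ, mergePt, mix_zero, ← fat_pull, pull_pull]
    have : (mergeProj N k).comp (mergeInl π).toOrderHom = π :=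
      OrderHom.ext _ _ (funext fun i => mergeProj_inl π i)
    rw [this]
  have hFv : ∀ z v, toThin K (F z v) = toThin K z := fun ⟨z, hz⟩ v => by
    obtain ⟨k, y, π, t, hy, hπ, rfl, e⟩ := mem_stratum hz
    rw [hF y π t hy hπ, toThin_pull, mergeProj_mergePt, ← toThin_pull]
  obtain ⟨G, hG⟩ := exists_lift (isClosed_skel (K := K) N).isOpen_compl
    (⟨fun z => F z 1, by fun_prop⟩ : C(_, Realisation (disc (under K)))) (fun z z' h => by
      change F z 1 = F z' 1
      rw [hF1, hF1, h])
  have hG' : ∀ z (hz : z ∈ V), toThin K (G ⟨z, hV hz⟩) = z := fun z hz => by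
    obtain ⟨w, rfl⟩ := isQuotientMap_toThin.surjective z
    exact (congrArg (toThin K) (hG ⟨w, hV hz⟩)).trans (hFv _ _)
  have hGm : ∀ z (hz : z ∈ V), G ⟨z, hV hz⟩ ∈ toThin K ⁻¹' V := fun z hz => by
    change toThin K _ ∈ V
    rwa [hG' z hz]
  have hFm : ∀ w : ↥(toThin K ⁻¹' V) × I, F ⟨w.1.1, hV w.1.2⟩ w.2 ∈ toThin K ⁻¹' V := fun w => by
    change toThin K _ ∈ V
    rw [hFv]
    exact w.1.2
  exact ⟨fun z hz => hz, .of_inverse ⟨fun z => ⟨G ⟨z, hV z.2⟩, hGm z z.2⟩, by fun_prop⟩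
    ⟨Prod.fst, continuous_fst⟩ ⟨fun w => ⟨F ⟨w.1.1, hV w.1.2⟩ w.2, hFm w⟩, by fun_prop⟩ (fun z => rfl)
    (fun z => Subtype.ext (hG' z z.2).symm) (fun z => Subtype.ext (hF0 _))
    (fun z => Subtype.ext (hG ⟨z.1, hV z.2⟩).symm) (fun z v => Subtype.ext (hFv _ _))⟩

/-- Points close to a skeleton can be pushed into it, compatibly in the two realisations. -/
lemma weakEqOn_near (h : WeakEqOn (toThin K) (toThin K ⁻¹' skel K N) (skel K N)) :
    WeakEqOn (toThin K) (toThin K ⁻¹' (skel K (N + 1) ∩ (central K N)ᶜ)) (skel K (N + 1) ∩ (central K N)ᶜ) := by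
  obtain ⟨F, hF, hF'⟩ := exists_push K N
  -- a point is either in the lower skeleton, or it is carried by a degeneracy of an `N`-simplex
  have cases : ∀ z : toThin K ⁻¹' (skel K (N + 1) ∩ Set.univ),
      (∃ (k : ℕ) (x : Sx K k) (t : stdSimplex ℝ (Fin (k + 1))), dim x < N ∧ z.1 = fat x t) ∨
      ∃ (k : ℕ) (y : Sx K N) (π : Fin (k + 1) →o Fin (N + 1)) (t : stdSimplex ℝ (Fin (k + 1))),
        y ∈ K.nonDegenerate N ∧ Function.Surjective π ∧ z.1 = fat (pull π y) t ∧
          core (toThin K z) = ⟨N, y, stdSimplex.map π t⟩ := fun ⟨z, hz⟩ => by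
    by_cases hN : toThin K z ∈ skel K N
    · obtain ⟨k, x, t, h1, h2, rfl⟩ := exists_pos_of_mem_skel hN
      exact .inl ⟨k, x, t, h1, rfl⟩
    · exact .inr (mem_stratum ⟨hz.1, hN⟩)
  have F0 : ∀ z, F z 0 = z := fun ⟨z, hz⟩ => by
    obtain ⟨k, x, t, h1, rfl⟩ | ⟨k, y, π, t, hy, hπ, rfl, e⟩ := cases ⟨z, hz⟩
    · exact hF x t h1 _ _
    · rw [hF' _ y π t hy hπ rfl, push_zero]
  have Fskel : ∀ z v, toThin K (F z v) ∈ skel K (N + 1) := fun ⟨z, hz⟩ v => by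
    obtain ⟨k, x, t, h1, rfl⟩ | ⟨k, y, π, t, hy, hπ, rfl, e⟩ := cases ⟨z, hz⟩
    · rw [hF x t h1]
      exact hz.1
    · rw [hF' _ y π t hy hπ rfl, toThin_pull]
      exact (coreDim_le _ _).trans_lt (Nat.lt_succ_of_le (dim_le y))
  have Ffix : ∀ z : toThin K ⁻¹' (skel K (N + 1) ∩ Set.univ), toThin K z ∈ skel K N →
      ∀ v, F z v = z := fun ⟨z, hz⟩ h v => by
    obtain ⟨k, x, t, h1, h2, rfl⟩ := exists_pos_of_mem_skel h
    exact hF x t h1 _ _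
  have Fnear : ∀ z : toThin K ⁻¹' (skel K (N + 1) ∩ Set.univ), toThin K z ∉ central K N →
      ∀ v, toThin K (F z v) ∉ central K N :=
    fun ⟨z, hz⟩ h v => by
    obtain ⟨k, x, t, h1, rfl⟩ | ⟨k, y, π, t, hy, hπ, rfl, e⟩ := cases ⟨z, hz⟩
    · rw [hF x t h1]
      exact h
    · rw [fat_mem_central hy rfl] at h
      rw [hF' _ y π t hy hπ rfl, fat_mem_central hy rfl]
      push Not at h ⊢
      obtain ⟨i, hi⟩ := h
      exact exists_map_push_lt π v hi
  have Fone : ∀ z : toThin K ⁻¹' (skel K (N + 1) ∩ Set.univ), toThin K z ∉ central K N →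
      toThin K (F z 1) ∈ skel K N := fun ⟨z, hz⟩ h => by
    obtain ⟨k, x, t, h1, rfl⟩ | ⟨k, y, π, t, hy, hπ, rfl, e⟩ := cases ⟨z, hz⟩
    · rw [hF x t h1]
      exact (coreDim_le x t).trans_lt h1
    · rw [fat_mem_central hy rfl] at h
      rw [hF' _ y π t hy hπ rfl]
      push Not at h
      obtain ⟨i, hi⟩ := h
      obtain ⟨i, hi⟩ := exists_map_push_one π hi
      by_contra hc
      exact ((coreDim_pos_iff hy rfl _).1 (not_lt.1 hc) i).ne' hi
  have Fthin : ∀ z z' : toThin K ⁻¹' (skel K (N + 1) ∩ Set.univ), toThin K z = toThin K z' →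
      ∀ v, toThin K (F z v) = toThin K (F z' v) := by
    have key : ∀ (z : toThin K ⁻¹' (skel K (N + 1) ∩ Set.univ)) v, toThin K z ∉ skel K N → toThin K (F z v) =
        toThin K (fat (core (toThin K z)).2.1 (push id (core (toThin K z)).2.2 v)) := fun ⟨z, hz⟩ v hN => by
      obtain ⟨k, y, π, t, hy, hπ, rfl, e⟩ := mem_stratum ⟨hz.1, hN⟩
      rw [hF' _ y π t hy hπ rfl, toThin_pull, map_push, e]
    intro z z' hzz v
    by_cases hN : toThin K z ∈ skel K N
    · rw [Ffix z hN, Ffix z' (hzz ▸ hN), hzz]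
    · rw [key z v hN, key z' v (hzz ▸ hN), hzz]
  obtain ⟨G, hG⟩ := exists_lift (T := C(I, Thin K)) isOpen_univ
    (⟨fun z => (toThin K).comp (F z), by fun_prop⟩ : C(_, C(I, Thin K)))
    (fun z z' h => ContinuousMap.ext fun v => Fthin z z' h v)
  have hG' : ∀ (z : toThin K ⁻¹' (skel K (N + 1) ∩ Set.univ)) v,
      G ⟨toThin K z, z.2⟩ v = toThin K (F z v) := fun z v =>
    congrArg (fun f : C(I, Thin K) => f v) (hG z)
  have hmem : ∀ {z}, z ∈ skel K (N + 1) ∩ (central K N)ᶜ → z ∈ skel K (N + 1) ∩ Set.univ :=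
    fun hz => ⟨hz.1, trivial⟩
  have hsub : skel K N ⊆ skel K (N + 1) ∩ (central K N)ᶜ := fun z hz =>
    ⟨Nat.lt_succ_of_lt hz, fun h => absurd h.1 (ne_of_lt hz)⟩
  obtain ⟨_, hA⟩ := weakEqOn_of_deformation (A := toThin K ⁻¹' skel K N)
    (U := toThin K ⁻¹' (skel K (N + 1) ∩ (central K N)ᶜ)) (fun z hz => hsub hz)
    ⟨fun z => F ⟨z, hmem z.2⟩, by fun_prop⟩ (fun z => F0 _)
    (fun z v => ⟨Fskel _ _, Fnear ⟨z, hmem z.2⟩ z.2.2 _⟩) (fun z => Fone ⟨z, hmem z.2⟩ z.2.2)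
    (fun z hz v => Ffix ⟨z, hmem z.2⟩ hz v)
  have hsurj : ∀ z : ↥(skel K (N + 1) ∩ (central K N)ᶜ),
      ∃ w : toThin K ⁻¹' (skel K (N + 1) ∩ (central K N)ᶜ), z = ⟨toThin K w, w.2⟩ := fun ⟨z, hz⟩ => by
    obtain ⟨w, rfl⟩ := isQuotientMap_toThin.surjective z
    exact ⟨⟨w, hz⟩, rfl⟩
  obtain ⟨_, hB⟩ := weakEqOn_of_deformation (A := skel K N) (U := skel K (N + 1) ∩ (central K N)ᶜ) hsub
    ⟨fun z => G ⟨z, hmem z.2⟩, by fun_prop⟩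
    (fun z => by
      obtain ⟨w, rfl⟩ := hsurj z
      exact (hG' ⟨w, hmem w.2⟩ 0).trans (congrArg (toThin K) (F0 _)))
    (fun z v => by
      obtain ⟨w, rfl⟩ := hsurj z
      have := hG' ⟨w, hmem w.2⟩ v
      exact this ▸ ⟨Fskel _ _, Fnear ⟨w, hmem w.2⟩ w.2.2 _⟩)
    (fun z => by
      obtain ⟨w, rfl⟩ := hsurj z
      have := hG' ⟨w, hmem w.2⟩ 1
      exact this ▸ Fone ⟨w, hmem w.2⟩ w.2.2)
    (fun z hz v => by
      obtain ⟨w, rfl⟩ := hsurj z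
      exact (hG' ⟨w, hmem w.2⟩ v).trans (congrArg (toThin K) (Ffix ⟨w, hmem w.2⟩ hz _)))
  obtain ⟨_, hN⟩ := h
  exact ⟨fun z hz => hz, hA.of_comp_left (hB.comp hN)⟩

/-- The comparison over skeleta, by induction: the open set of points which are not central in an `N`-cell
and the union of the open `N`-cells cover the next skeleton. -/
lemma weakEqOn_skel (N : ℕ) : WeakEqOn (toThin K) (toThin K ⁻¹' skel K N) (skel K N) := by
  induction N with
  | zero => exact ⟨fun z hz => hz, fun n a c => absurd (c fun _ => 0).2 (Nat.not_lt_zero _)⟩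
  | succ N ih =>
    have h1 := weakEqOn_near ih
    have h2 : ∀ {V : Set (Thin K)}, V ⊆ skel K (N + 1) ∩ (skel K N)ᶜ →
      WeakEqOn (toThin K) (toThin K ⁻¹' V) V := weakEqOn_stratum
    have ho := (isClosed_central (K := K) (N := N)).isOpen_compl
    have ho' := (isClosed_skel (K := K) N).isOpen_compl
    have e : skel K (N + 1) ∩ (central K N)ᶜ ∩ (skel K (N + 1) ∩ (skel K N)ᶜ) =
        skel K (N + 1) ∩ ((central K N)ᶜ ∩ (skel K N)ᶜ) := by
      rw [Set.inter_inter_inter_comm, Set.inter_self]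
    refine weakEqOn_of_cover (toThin K) (𝒰 := {skel K (N + 1) ∩ (central K N)ᶜ,
      skel K (N + 1) ∩ (skel K N)ᶜ, skel K (N + 1) ∩ ((central K N)ᶜ ∩ (skel K N)ᶜ)}) ?_ ?_ ?_ ?_
    · rintro _ (rfl | rfl | rfl)
      exacts [⟨_, ho, rfl⟩, ⟨_, ho', rfl⟩, ⟨_, ho.inter ho', rfl⟩]
    · intro z hz
      by_cases h : z ∈ skel K N
      · exact ⟨_, .inl rfl, hz, fun h' => absurd h'.1 (ne_of_lt h)⟩
      · exact ⟨_, .inr (.inl rfl), hz, h⟩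
    · rintro _ (rfl | rfl | rfl) _ (rfl | rfl | rfl)
      · exact .inl (Set.inter_self _)
      · exact .inr (.inr e)
      · exact .inr (.inr (Set.inter_eq_right.2 fun z h => ⟨h.1, h.2.1⟩))
      · exact .inr (.inr ((Set.inter_comm _ _).trans e))
      · exact .inr (.inl (Set.inter_self _))
      · exact .inr (.inr (Set.inter_eq_right.2 fun z h => ⟨h.1, h.2.2⟩))
      · exact .inr (.inr (Set.inter_eq_left.2 fun z h => ⟨h.1, h.2.1⟩))
      · exact .inr (.inr (Set.inter_eq_left.2 fun z h => ⟨h.1, h.2.2⟩))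
      · exact .inr (.inr (Set.inter_self _))
    · rintro _ (rfl | rfl | rfl)
      exacts [h1, h2 subset_rfl, h2 fun z h => ⟨h.1, h.2.2⟩]

/-- Points of the realisation are closed: in a simplex only finitely many faces and monotone maps matter. -/
lemma isClosed_fibre (x : Sx K k) (z : Thin K) : IsClosed {t | toThin K (fat x t) = z} := by
  have : {t | toThin K (fat x t) = z} = ⋃ j : Fin (k + 1), ⋃ d : Fin (j + 1) ↪o Fin (k + 1),
      ⋃ π : Fin (j + 1) → Fin ((core z).1 + 1), ⋃ _ : ∃ h : Monotone π,
        pull d.toOrderHom x = pull ⟨π, h⟩ (core z).2.1,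
        stdSimplex.map d '' {u | stdSimplex.map π u = (core z).2.2} := by
    ext t
    simp only [Set.mem_iUnion, Set.mem_image]
    constructor
    · rintro rfl
      obtain ⟨j, d, π, u, h1, h2, h3, -⟩ := hasCore_coreCell (⟨k, x, t⟩ : Cell K)
      have hj : j < k + 1 := by simpa using Fintype.card_le_of_injective d d.injective
      exact ⟨⟨j, hj⟩, d, π, ⟨π.monotone, h1⟩, u, h3, h2⟩
    · rintro ⟨j, d, π, ⟨h, h1⟩, u, h2, rfl⟩
      change toThin K (fat x _) = z
      rw [← fat_pull, h1, toThin_pull]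
      refine Eq.trans ?_ (toThin_core z)
      exact congrArg (fun w => toThin K (fat (core z).2.1 w)) h2
  rw [this]
  refine isClosed_iUnion_of_finite fun j => isClosed_iUnion_of_finite fun d =>
    isClosed_iUnion_of_finite fun π => isClosed_iUnion_of_finite fun _ => ?_
  exact ((isClosed_eq (by fun_prop) continuous_const).isCompact.image (stdSimplex.continuous_map d)).isClosed

/-- Compact subsets of the realisation meet only finitely many dimensions. -/
lemma exists_subset_skel {C : Set (Thin K)} (hC : IsCompact C) : ∃ N, C ⊆ skel K N := by
  by_contra hn
  push Not at hn
  choose z hz hz' using fun N => Set.not_subset.1 (hn N)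
  have hd : ∀ N, N ≤ coreDim (z N) := fun N => not_lt.1 (hz' N)
  have hcl : ∀ B ⊆ Set.range z, IsClosed B := fun B hB => by
    refine isQuotientMap_toThin.isClosed_preimage.1 (isClosed_iff.2 fun k x => ?_)
    have hfin : (B ∩ {w | coreDim w ≤ k}).Finite := by
      refine ((Set.finite_le_nat k).image z).subset ?_
      rintro w ⟨hw, hw'⟩
      obtain ⟨N, rfl⟩ := hB hw
      exact ⟨N, (hd N).trans hw', rfl⟩
    have : {t | fat x t ∈ toThin K ⁻¹' B} = ⋃ w ∈ B ∩ {w | coreDim w ≤ k}, {t | toThin K (fat x t) = w} := by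
      ext t
      simp only [Set.mem_iUnion]
      exact ⟨fun h => ⟨_, ⟨h, (coreDim_le x t).trans (dim_le x)⟩, rfl⟩, fun ⟨w, hw, h⟩ => by
        change toThin K (fat x t) ∈ B
        rw [show toThin K (fat x t) = w from h]
        exact hw.1⟩
    rw [this]
    exact hfin.isClosed_biUnion fun w _ => isClosed_fibre x w
  have hc : IsCompact (Set.range z) := hC.of_isClosed_subset (hcl _ subset_rfl) (Set.range_subset_iff.2 hz)
  have hdisc : IsDiscrete (Set.range z) := by
    refine ⟨discreteTopology_iff_forall_isClosed.2 fun B => ?_⟩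
    refine isClosed_induced_iff.2 ⟨(↑) '' B, hcl _ ?_, Set.preimage_image_eq _ Subtype.val_injective⟩
    rintro _ ⟨w, -, rfl⟩
    exact w.2
  obtain ⟨M, hM⟩ := ((hc.finite hdisc).image coreDim).bddAbove
  have := hM ⟨z (M + 1), ⟨M + 1, rfl⟩, rfl⟩
  have := hd (M + 1)
  omega

theorem weakEq_toThin (K : SSet.{u}) : WeakEq (toThin K) := by
  intro n a c h
  obtain ⟨N, hN⟩ := exists_subset_skel (isCompact_range c.continuous)
  obtain ⟨_, H⟩ := weakEqOn_skel (K := K) N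
  have hc : ∀ x, c x ∈ skel K N := fun x => hN ⟨x, rfl⟩
  obtain ⟨a', L, h1, h2, h3, h4⟩ := H n ⟨fun x => ⟨a x, by
      change toThin K _ ∈ skel K N
      rw [h x]
      exact hc x⟩, by fun_prop⟩
    ⟨fun x => ⟨c x, hc x⟩, by fun_prop⟩ fun x => Subtype.ext (h x)
  exact ⟨⟨fun x => a' x, by fun_prop⟩, ⟨fun w => L w, by fun_prop⟩, fun x => congrArg Subtype.val (h1 x),
    fun x => congrArg Subtype.val (h2 x), fun x => congrArg Subtype.val (h3 x),
    fun x t => congrArg Subtype.val (h4 x t)⟩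

end Thin

namespace Thin

variable {K L : SSet.{u}} {j k m n : ℕ}

/-- The characteristic map of a simplex. -/
noncomputable def charMap (x : Sx K n) : C(stdSimplex ℝ (Fin (n + 1)), SSet.toTop.obj K) :=
  TopCat.toSSetObjEquiv _ (op (.mk n)) ((sSetTopAdj.unit.app K).app (op (.mk n)) x)

lemma charMap_pull (θ : Fin (m + 1) →o Fin (n + 1)) (x : Sx K n) (t : stdSimplex ℝ (Fin (m + 1))) :
    charMap (pull θ x) t = charMap x (stdSimplex.map θ t) := by
  have h := ConcreteCategory.congr_hom ((sSetTopAdj.unit.app K).naturality (SimplexCategory.mkHom θ).op) x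
  exact congrArg (fun y => TopCat.toSSetObjEquiv _ (op (.mk m)) y t) h

lemma map_charMap (g : K ⟶ L) (x : Sx K n) (t : stdSimplex ℝ (Fin (n + 1))) :
    SSet.toTop.map g (charMap x t) = charMap (g.app _ x) t := by
  have h := ConcreteCategory.congr_hom (NatTrans.congr_app (sSetTopAdj.unit.naturality g) (op (.mk n))) x
  exact (congrArg (fun y => TopCat.toSSetObjEquiv _ (op (.mk n)) y t) h).symm

lemma vertex_eq (v : Sx K 0) (t : stdSimplex ℝ (Fin 1)) : vertex K v = charMap v t :=
  congrArg (charMap v) (Subsingleton.elim _ t)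

/-- Maps out of the geometric realisation are determined by their values on simplices. -/
lemma hom_ext {T : TopCat.{u}} {f g : SSet.toTop.obj K ⟶ T}
    (h : ∀ {n : ℕ} (x : Sx K n) t, f (charMap x t) = g (charMap x t)) : f = g := by
  apply (sSetTopAdj.homEquiv K T).injective
  rw [Adjunction.homEquiv_unit, Adjunction.homEquiv_unit]
  ext ⟨n⟩ x
  apply (TopCat.toSSetObjEquiv T (op n)).injective
  ext t
  exact h (n := n.len) x t

/-- The universal property of the geometric realisation, from its adjunction with the singular simplicial
set. -/
lemma exists_hom {T : TopCat.{u}} (Φ : ∀ {n : ℕ}, Sx K n → C(stdSimplex ℝ (Fin (n + 1)), T))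
    (h : ∀ {m n : ℕ} (θ : Fin (m + 1) →o Fin (n + 1)) (x : Sx K n) t,
      Φ (pull θ x) t = Φ x (stdSimplex.map θ t)) :
    ∃ f : SSet.toTop.obj K ⟶ T, ∀ {n : ℕ} (x : Sx K n) t, f (charMap x t) = Φ x t := by
  let φ : K ⟶ TopCat.toSSet.obj T :=
    { app := fun n => ↾(fun x => (TopCat.toSSetObjEquiv T n).symm (Φ (n := n.unop.len) x))
      naturality := fun n m f => by
        ext x
        apply (TopCat.toSSetObjEquiv T m).injective
        ext t
        exact h f.unop.toOrderHom x t }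
  refine ⟨(sSetTopAdj.homEquiv K T).symm φ, fun {n} x t => ?_⟩
  have e : sSetTopAdj.unit.app K ≫ TopCat.toSSet.map ((sSetTopAdj.homEquiv K T).symm φ) = φ := by
    exact (Adjunction.homEquiv_unit _ _ _ _).symm.trans (Equiv.apply_symm_apply _ φ)
  have e' := ConcreteCategory.congr_hom (NatTrans.congr_app e (op (.mk n))) x
  exact congrArg (fun y => TopCat.toSSetObjEquiv T (op (.mk n)) y t) e'

lemma exists_fromThin (K : SSet.{u}) : ∃ F : C(Thin K, SSet.toTop.obj K),
    ∀ {n : ℕ} (x : Sx K n) t, F (toThin K (fat x t)) = charMap x t := by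
  obtain ⟨F, hF⟩ := Realisation.exists_desc (K := under K) (T := SSet.toTop.obj K)
    (fun {n} x t => charMap (K := K) (n := n) x t) (fun x => by fun_prop)
    (fun {m n} f x t => charMap_pull (K := K) (SemiSimplexCategory.toSimplexCategory.map f).toOrderHom x t)
  have hF' : Function.FactorsThrough F (toThin K) := fun z z' h => by
    have h' : Relation.EqvGen (Rel K) z z' := Quot.eqvGen_exact h
    clear h
    induction h' with
    | rel _ _ h =>
      obtain ⟨θ, x, t⟩ := h
      exact (hF _ _).trans ((charMap_pull θ x t).trans (hF _ _).symm)
    | refl => rfl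
    | symm _ _ _ ih => exact ih.symm
    | trans _ _ _ _ _ ih ih' => exact ih.trans ih'
  exact ⟨isQuotientMap_toThin.lift F hF', fun x t =>
    (DFunLike.congr_fun (isQuotientMap_toThin.lift_comp F hF') (fat x t)).trans (hF x t)⟩

end Thin

open Thin

/-- The map from the semi-simplicial realisation to the geometric realisation of a simplicial set. -/
noncomputable def geom (K : SSet.{u}) : C(Realisation (disc (under K)), SSet.toTop.obj K) :=
  (exists_fromThin K).choose.comp (toThin K)

lemma geom_fat {K : SSet.{u}} {n : ℕ} (x : Sx K n) (t : stdSimplex ℝ (Fin (n + 1))) :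
    geom K (fat x t) = charMap x t := (exists_fromThin K).choose_spec x t

lemma geom_map {K L : SSet.{u}} (g : K ⟶ L) (z : Realisation (disc (under K))) :
    geom L (Realisation.map (discMap (Functor.whiskerLeft _ g)) z) = SSet.toTop.map g (geom K z) := by
  obtain ⟨n, x, t, rfl⟩ := exists_fat z
  rw [geom_fat, map_charMap]
  exact geom_fat (g.app _ x) t

/-- Degeneracies can be collapsed in the realisation of a simplicial set. -/
theorem weakEq_geom (K : SSet.{u}) : WeakEq (geom K) := by
  let F := (exists_fromThin K).choose
  have hF : ∀ {n : ℕ} (x : Sx K n) t, F (toThin K (fat x t)) = charMap x t :=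
    (exists_fromThin K).choose_spec
  -- the universal property of the geometric realisation gives the inverse of `F`
  obtain ⟨G, hG⟩ := exists_hom (K := K) (T := TopCat.of (Thin K))
    (fun x => ⟨fun t => toThin K (fat x t), by fun_prop⟩) (fun θ x t => toThin_pull θ x t)
  have h1 : ∀ z, F (G z) = z := fun z => by
    have : G ≫ TopCat.ofHom F = 𝟙 _ := hom_ext fun x t => by
      change F (G (charMap x t)) = charMap x t
      rw [hG]
      exact hF x t
    exact ConcreteCategory.congr_hom this z
  have h2 : ∀ z, G (F z) = z := fun z => by
    obtain ⟨w, rfl⟩ := isQuotientMap_toThin.surjective z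
    obtain ⟨n, x, t, rfl⟩ := exists_fat w
    rw [hF, hG]
    rfl
  let e : Thin K ≃ₜ SSet.toTop.obj K :=
    { toFun := F, invFun := G, left_inv := h2, right_inv := h1,
      continuous_toFun := F.continuous, continuous_invFun := G.hom.continuous }
  exact (WeakEq.of_homeo e).comp (weakEq_toThin K)

/-! ### Rows and columns of the bar construction -/

section Strings

variable {X : SemiSSet.{u}} {M : SemiMon.{u}} (A : Action X M)

/-- The bi-semi-simplicial set underlying `p ↦ B(X_p, M_p, *)`. -/
def barBi : BiSSet.{u} :=
  levelBar A ⋙ (Functor.whiskeringLeft _ _ _).obj SemiSimplexCategory.toSimplexCategory.op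

/-- The bi-semi-simplicial set whose `q`-th level is `p ↦ X_p × M_p^q`. -/
def strings : BiSSet.{u} := (barBi A).flip

/-- The map of bar constructions induced by `X → *`. -/
def levelBarToB : levelBar A ⟶ levelBar (trivialAction M) where
  app n := barMap (A.level n) ((trivialAction M).level n) (fun x => (toPoint X).app n x)
    (MonoidHom.id _) (fun _ _ => rfl)
  naturality := fun _ _ _ => rfl

/-- The map `B(X_p, M_p, *) → B(*, M_p, *)` in bidegree `(p, q)`. -/
def barBiToB : barBi A ⟶ barBi (trivialAction M) := Functor.whiskerRight (levelBarToB A) _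

/-- The projections `X_p × M_p^q → M_p^q`. -/
def stringsToB : strings A ⟶ strings (trivialAction M) := (flipFunctor _ _ _).map (barBiToB A)

/-- The map of levelwise realisations induced by a map of bi-semi-simplicial sets. -/
def levelsMap {Z Z' : BiSSet.{u}} (g : Z ⟶ Z') : levels Z ⟶ levels Z' := Functor.whiskerRight g _

/-- The semi-simplicial set `p ↦ M_p^q`. -/
abbrev powers (M : SemiMon.{u}) (q : ℕ) : SemiSSet.{u} := (strings (trivialAction M)).obj (op (.mk q))

/-- Entrywise degeneracies of strings. -/
def Degeneracies.powers (D : Degeneracies M.under) (q : ℕ) : Degeneracies (powers M q) where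
  pull f z := ((PUnit.unit, fun i => D.pull f (z.2 i)) : PUnit × (Fin q → _))
  pull_pull f g z := Prod.ext rfl (funext fun i => D.pull_pull f g (z.2 i))
  pull_map f z := Prod.ext rfl (funext fun i => D.pull_map f (z.2 i))

variable {A} {q : ℕ}

/-- The semi-simplicial map `x ↦ (x, e)`. -/
def stringAt (A : Action X M) (e : point ⟶ powers M q) : X ⟶ (strings A).obj (op (.mk q)) where
  app p := ↾(fun x => ((x, (e.app p PUnit.unit).2) : X.obj p × (Fin q → M.obj p)))
  naturality p p' f := by
    have h := ConcreteCategory.congr_hom (e.naturality f) PUnit.unit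
    ext x
    exact Prod.ext (α := X.obj p') (β := Fin q → M.obj p') rfl
      (congrArg (fun z : PUnit × (Fin q → M.obj p') => z.2) h)

/-- The product of the first `a` entries of a semi-simplicial point of `M^q`. It is a semi-simplicial
point of `M` which need not consist of degenerate simplices. -/
def prodAt (e : point ⟶ powers M q) (a : ℕ) : point ⟶ M.under where
  app p := ↾(fun _ => seg (M := M.obj p) (e.app p PUnit.unit).2 0 a)
  naturality p p' f := by
    have h := ConcreteCategory.congr_hom (e.naturality f) PUnit.unit
    ext x
    refine Eq.trans ?_ (seg_map (M.map f).hom (e.app p PUnit.unit).2 0 a)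
    exact congrArg (fun z : PUnit × (Fin q → M.obj p') => seg z.2 0 a) h

/-- The action of a semi-simplicial point of `M`. -/
def actBy (A : Action X M) (e : point ⟶ M.under) : X ⟶ X := inclAt X e ≫ A.hom

open Realisation

/-- Up to homotopy, the action of a semi-simplicial point of `M` is the action of a point of `|M|`. -/
lemma weakEq_actBy (hA : A.ByEquivalences) (e : point ⟶ M.under) :
    WeakEq (Realisation.map (discMap (actBy A e))) := by
  obtain ⟨μ, hμ, h⟩ := hA
  have h1 : (Realisation.map (discMap A.hom)).comp (Realisation.map (discMap (inclAt X e))) =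
      Realisation.map (discMap (actBy A e)) := Realisation.map_comp _ _
  rw [← h1]
  refine (h (Realisation.map (discMap e) base)).weakEq.of_homotopic ?_
  refine .trans ?_ (hμ.comp (.refl (Realisation.map (discMap (inclAt X e)))))
  -- contract the second coordinate to the base point
  refine .symm ⟨⟨⟨fun w => μ (w.2, Realisation.map (discMap e) (contraction (collapse X w.2, w.1))),
    by fun_prop⟩, fun z => ?_, fun z => ?_⟩⟩
  · change μ (z, Realisation.map (discMap e) (contraction _)) = _
    rw [contraction_zero]
    obtain ⟨z, rfl⟩ := Quot.exists_rep z
    rfl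
  · change μ (z, Realisation.map (discMap e) (contraction _)) = _
    rw [contraction_one]
    rfl

/-- The map from `‖X‖` to the homotopy fibre of the projection `‖X × M^q‖ → ‖M^q‖` given by a
semi-simplicial point of `M^q`. -/
noncomputable def stringFibre (A : Action X M) (e : point ⟶ powers M q)
    {b : (levels (strings (trivialAction M))).obj (op (.mk q))}
    (hb : Realisation.map (discMap e) base = b) :
    C(Realisation (disc X), HoFibre ((levelsMap (stringsToB A)).app (op (.mk q))).hom b) :=
  HoFibre.mk (Realisation.map (discMap (stringAt A e)))
    (show C(_, Realisation (disc (powers M q))) from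
      ⟨fun w => Realisation.map (discMap e) (contraction (collapse X w.1, w.2)), by fun_prop⟩)
    (fun z => by
      change Realisation.map _ (contraction _) = _
      rw [contraction_zero]
      obtain ⟨z, rfl⟩ := Quot.exists_rep z
      rfl)
    (fun z => (congrArg (Realisation.map (discMap e)) (contraction_one _)).trans hb)

/-- The identification of pairs of an element of `X_p` and a string with elements of `X_p × M_p^q`. -/
def unpair (A : Action X M) (q : ℕ) : prod X (powers M q) ⟶ (strings A).obj (op (.mk q)) where
  app p := ↾(fun z : X.obj p × (PUnit × (Fin q → M.obj p)) => ((z.1, z.2.2) : X.obj p × (Fin q → M.obj p)))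
  naturality _ _ _ := by
    ext z
    rfl

lemma weakEq_unpair (A : Action X M) (q : ℕ) : WeakEq (Realisation.map (discMap (unpair A q))) := by
  let ψ : (strings A).obj (op (.mk q)) ⟶ prod X (powers M q) :=
    { app := fun p => ↾(fun z : X.obj p × (Fin q → M.obj p) =>
        ((z.1, (PUnit.unit, z.2)) : X.obj p × (PUnit × (Fin q → M.obj p))))
      naturality := fun _ _ _ => by
        ext z
        rfl }
  let e : Realisation (disc (prod X (powers M q))) ≃ₜ Realisation (disc ((strings A).obj (op (.mk q)))) :=
    { toFun := Realisation.map (discMap (unpair A q))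
      invFun := Realisation.map (discMap ψ)
      left_inv := fun z => by
        obtain ⟨z, rfl⟩ := Quot.exists_rep z
        rfl
      right_inv := fun z => by
        obtain ⟨z, rfl⟩ := Quot.exists_rep z
        rfl
      continuous_toFun := ContinuousMap.continuous _
      continuous_invFun := ContinuousMap.continuous _ }
  exact .of_homeo e

lemma weakEq_stringFibre (D : Degeneracies X) (D' : Degeneracies M.under) (A : Action X M)
    (e : point ⟶ powers M q) {b : (levels (strings (trivialAction M))).obj (op (.mk q))}
    (hb : Realisation.map (discMap e) base = b) : WeakEq (stringFibre A e hb) := by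
  have h := HoFibre.weakEq_map (p := Realisation.map (discMap (snd X (powers M q))))
    (p' := ((levelsMap (stringsToB A)).app (op (.mk q))).hom) (b := Realisation.map (discMap e) base)
    (s := .id _) (weakEq_unpair A q) .id (fun z => by
      obtain ⟨z, rfl⟩ := Quot.exists_rep z
      rfl) hb
  have hc := h.comp (weakEq_prodFibre D (D'.powers q) e)
  refine (congrArg WeakEq ?_).mp hc
  ext z
  · obtain ⟨z, rfl⟩ := Quot.exists_rep z
    rfl
  · rfl

/-- Faces of strings act on the fibre by the product of the entries which are dropped at the front. -/
lemma fibreMap_stringFibre (e : point ⟶ powers M q) {b : (levels (strings (trivialAction M))).obj (op (.mk q))}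
    (hb : Realisation.map (discMap e) base = b) {r : ℕ} (f : SemiSimplexCategory.mk r ⟶ .mk q)
    (hb' : Realisation.map (discMap (e ≫ (strings (trivialAction M)).map f.op)) base =
      (levels (strings (trivialAction M))).map f.op b) :
    (fibreMap (levelsMap (stringsToB A)) f b).comp (stringFibre A e hb) =
      (stringFibre A (e ≫ (strings (trivialAction M)).map f.op) hb').comp
        (Realisation.map (discMap (actBy A (prodAt e
          ((SemiSimplexCategory.toSimplexCategory.map f).toOrderHom 0))))) := by
  subst hb
  ext z
  · obtain ⟨z, rfl⟩ := Quot.exists_rep z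
    rfl
  · obtain ⟨z, rfl⟩ := Quot.exists_rep z
    have h : ∀ w, ((levels (strings (trivialAction M))).map f.op).hom (Realisation.map (discMap e) w) =
        Realisation.map (discMap (e ≫ (strings (trivialAction M)).map f.op)) w := fun w => by
      obtain ⟨w, rfl⟩ := Quot.exists_rep w
      rfl
    exact h _

/-- The semi-simplicial point of degenerate simplices on a vertex. -/
def Degeneracies.point {Y : SemiSSet.{u}} (D : Degeneracies Y) (v : Y.obj (op (.mk 0))) : point ⟶ Y where
  app p := ↾(fun _ => D.pull (n := 0) (m := p.unop.len) ⟨fun _ => 0, monotone_const⟩ v)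
  naturality p p' f := by
    ext x
    exact (D.pull_pull (SemiSimplexCategory.homEquiv f.unop).toOrderHom ⟨fun _ => 0, monotone_const⟩
      v).symm.trans
      (D.pull_map f.unop _)

/-- The inclusion of the initial vertex of a simplex. -/
def initialVertex (n : ℕ) : SemiSimplexCategory.mk 0 ⟶ .mk n := SemiSimplexCategory.homEquiv.symm
  (OrderEmbedding.ofStrictMono (fun _ => (0 : Fin (n + 1))) fun i j h => absurd h (by
    rw [Subsingleton.elim (α := Fin 1) i j]
    exact lt_irrefl _))

/-- Every point of a realisation is joined by a path to a vertex. -/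
lemma exists_path_vertex {Y : SemiSSet.{u}} (b : Realisation (disc Y)) :
    ∃ (v : Y.obj (op (.mk 0))) (ω : C(I, Realisation (disc Y))),
      ω 0 = mk (S := disc Y) (n := .mk 0) v (stdSimplex.vertex 0) ∧ ω 1 = b := by
  obtain ⟨⟨n⟩, y, t, rfl⟩ := exists_rep b
  let s₀ : stdSimplex ℝ (Fin (n + 1)) :=
    stdSimplex.map (SemiSimplexCategory.homEquiv (initialVertex n)) (stdSimplex.vertex 0)
  refine ⟨Y.map (initialVertex n).op y, ⟨fun s => mk (S := disc Y) (n := .mk n) y (mix s s₀ t), ?_⟩, ?_, ?_⟩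
  · exact continuous_mk (S := disc Y) (n := .mk n) continuous_const (by fun_prop)
  · refine Eq.trans ?_ (mk_map (S := disc Y) (initialVertex n) y (stdSimplex.vertex 0)).symm
    exact congrArg (mk (S := disc Y) (n := .mk n) y) (mix_zero _ _)
  · exact congrArg (mk (S := disc Y) (n := .mk n) y) (mix_one _ _)

/-- The faces of strings act by weak equivalences on the homotopy fibres of the projections
`‖X × M^q‖ → ‖M^q‖`. -/
theorem weakEq_fibreMap_strings (D : Degeneracies X) (D' : Degeneracies M.under)
    (hA : A.ByEquivalences) {m n : SemiSimplexCategory} (f : m ⟶ n)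
    (b : (levels (strings (trivialAction M))).obj (op n)) :
    WeakEq (fibreMap (levelsMap (stringsToB A)) f b) := by
  obtain ⟨r⟩ := m
  obtain ⟨q⟩ := n
  obtain ⟨v, ω, h0, h1⟩ := exists_path_vertex (Y := powers M q) b
  let e := (D'.powers q).point v
  have he : Realisation.map (discMap e) base = ω 0 := by
    refine Eq.trans ?_ h0.symm
    have h : (D'.powers q).pull ⟨fun _ => 0, monotone_const⟩ v = v := by
      refine Eq.trans ?_ ((D'.powers q).pull_id v)
      exact congrArg (fun f => (D'.powers q).pull f v)
        (OrderHom.ext _ _ (funext fun i => Subsingleton.elim (α := Fin 1) _ _))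
    exact congrArg (fun y => mk (S := disc (powers M q)) (n := .mk 0) y (stdSimplex.vertex 0)) h
  obtain ⟨b₀, hb₀⟩ : ∃ b₀ : (levels (strings (trivialAction M))).obj (op (.mk q)), b₀ = ω 0 := ⟨_, rfl⟩
  replace he := he.trans hb₀.symm
  refine HoFibre.weakEq_map_of_path (b := b₀) _ ω hb₀.symm h1 rfl _ ?_
  change WeakEq (fibreMap (levelsMap (stringsToB A)) f b₀)
  refine (weakEq_stringFibre D D' A e he).of_comp_left ?_
  have hb' : Realisation.map (discMap (e ≫ (strings (trivialAction M)).map f.op)) base =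
      (levels (strings (trivialAction M))).map f.op b₀ := by
    rw [← he]
    rfl
  refine (congrArg WeakEq (fibreMap_stringFibre e he f hb')).mpr ?_
  exact (weakEq_stringFibre D D' A _ hb').comp (weakEq_actBy hA _)

end Strings

/-! ### The homotopy fibre of the projection to the classifying space -/

section Quotient

open Realisation Thin

variable {X : SemiSSet.{u}} {M : SemiMon.{u}}

/-- The levelwise comparison of semi-simplicial and simplicial realisations of the bar construction. -/
noncomputable def geomLevel (A : Action X M) : levels (barBi A) ⟶ hoQuot A where
  app n := TopCat.ofHom (geom ((levelBar A).obj n))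
  naturality n m f := by
    ext z
    exact geom_map ((levelBar A).map f) z

/-- The comparison of the iterated realisation of `(q, p) ↦ X_p × M_p^q` with `|X // M|`. -/
noncomputable def realign (A : Action X M) : C(Realisation (levels (strings A)), Realisation (hoQuot A)) :=
  (Realisation.map (geomLevel A)).comp ⟨swap (strings A), (swap (strings A)).continuous⟩

lemma realign_mk₂ (A : Action X M) {p q : ℕ} (z : ((strings A).obj (op (.mk q))).obj (op (.mk p)))
    (s : stdSimplex ℝ (Fin (p + 1))) (t : stdSimplex ℝ (Fin (q + 1))) :
    realign A (mk₂ z s t) = mk (S := hoQuot A) (n := .mk p)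
      (charMap (K := (levelBar A).obj (op (.mk p))) (n := q) z t) s := by
  change Realisation.map (geomLevel A) (swap (strings A) (mk₂ z s t)) = _
  rw [swap_mk₂]
  exact congrArg (fun y => mk (S := hoQuot A) (n := .mk p) y s)
    (geom_fat (K := (levelBar A).obj (op (.mk p))) (n := q) z t)

lemma weakEq_realign (A : Action X M) : WeakEq (realign A) :=
  (Realisation.weakEq_map _ fun _ => weakEq_geom _).comp (.of_homeo (swap (strings A)))

lemma quotProj_realign (A : Action X M) (w : Realisation (levels (strings A))) :
    quotProj A (realign A w) =
      realign (trivialAction M) (Realisation.map (levelsMap (stringsToB A)) w) := by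
  obtain ⟨p, q, z, s, t, rfl⟩ := exists_rep₂ w
  rw [realign_mk₂]
  refine Eq.trans ?_ (realign_mk₂ (trivialAction M) (((stringsToB A).app _).app _ z) s t).symm
  exact congrArg (fun y => mk (S := B M) (n := .mk p) y s) (map_charMap _ _ _)

/-- The semi-simplicial point of empty strings. -/
def noString (M : SemiMon.{u}) : point ⟶ powers M 0 where
  app p := ↾(fun _ => ((PUnit.unit, Fin.elim0) : PUnit × (Fin 0 → M.obj p)))
  naturality p p' f := by
    ext x
    exact Prod.ext (β := Fin 0 → M.obj p') rfl (Subsingleton.elim _ _)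

lemma realign_slice (A : Action X M) (z : Realisation (disc X)) :
    realign A (slice (levels (strings A)) (n := .mk 0) (stdSimplex.vertex 0)
      (Realisation.map (discMap (stringAt A (noString M))) z)) = fibreIncl A z := by
  obtain ⟨⟨p⟩, x, s, rfl⟩ := exists_rep z
  refine (realign_mk₂ A (p := p) (q := 0) _ s (stdSimplex.vertex 0)).trans ?_
  exact congrArg (fun y => mk (S := hoQuot A) (n := .mk p) y s)
    (vertex_eq (K := (levelBar A).obj (op (.mk p))) _ (stdSimplex.vertex 0)).symm

/-- The case of the trivial action in `realign_slice`. -/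
lemma pointIncl_eq (z : Realisation (disc point.{u})) :
    realign (trivialAction M) (slice (levels (strings (trivialAction M))) (n := .mk 0)
      (stdSimplex.vertex 0) (Realisation.map (discMap (noString M)) z)) = pointIncl M z :=
  realign_slice (trivialAction M) z

/-- The map from `|X|` to the homotopy fibre of `|X // M| → |BM|` given by the contraction of the
realisation of the semi-simplicial point. -/
noncomputable def quotFibre (A : Action X M) :
    C(Realisation (disc X), HoFibre (quotProj A) (pointIncl M base)) :=
  HoFibre.mk (fibreIncl A) ⟨fun w => pointIncl M (contraction (collapse X w.1, w.2)), by fun_prop⟩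
    (fun z => by
      change pointIncl M (contraction _) = _
      rw [contraction_zero]
      exact (DFunLike.congr_fun (square_comm A) z).symm)
    (fun z => congrArg (pointIncl M) (contraction_one _))

theorem weakEq_quotFibre (D : Degeneracies X) (D' : Degeneracies M.under) {A : Action X M}
    (hA : A.ByEquivalences) : WeakEq (quotFibre A) := by
  obtain ⟨b, hb⟩ : ∃ b : (levels (strings (trivialAction M))).obj (op (.mk 0)),
    Realisation.map (discMap (noString M)) base = b := ⟨_, rfl⟩
  have h0 := weakEq_stringFibre D D' A (noString M) hb
  have h1 := weakEq_map_slice (levelsMap (stringsToB A)) (weakEq_fibreMap_strings D D' hA) b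
    (stdSimplex.vertex 0)
  have h2 := HoFibre.weakEq_map (b := mk b (stdSimplex.vertex 0)) (b' := pointIncl M base)
    (weakEq_realign A) (weakEq_realign (trivialAction M)) (quotProj_realign A) (by
      rw [← pointIncl_eq, hb]
      rfl)
  refine (congrArg WeakEq ?_).mp (h2.comp (h1.comp h0))
  ext z
  · exact realign_slice A z
  · exact pointIncl_eq _

end Quotient

/-! ### Varying the null-homotopy -/

section Comparison

open Realisation

variable {X : SemiSSet.{u}} {M : SemiMon.{u}}

lemma joined_pointIncl_base (b : Realisation (B M)) : Joined (pointIncl M base) b := by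
  obtain ⟨w, ω, h0, h1⟩ := (weakEq_realign (trivialAction M)).exists_path b
  obtain ⟨p, q, z, s, t, rfl⟩ := exists_rep₂ w
  have h2 : Joined b (realign (trivialAction M) (mk₂ z s t)) := ⟨⟨ω, h0, h1⟩⟩
  -- move both sets of barycentric coordinates to the initial vertex
  let s₀ := stdSimplex.map (SemiSimplexCategory.homEquiv (initialVertex p)) (stdSimplex.vertex (S := ℝ) 0)
  let t₀ := stdSimplex.map (SemiSimplexCategory.homEquiv (initialVertex q)) (stdSimplex.vertex (S := ℝ) 0)
  have h3 : Joined (mk₂ z s t) (mk₂ z s₀ t₀) :=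
    ⟨⟨⟨fun u => mk₂ z (mix u s s₀) (mix u t t₀), by fun_prop⟩, by simp, by simp⟩⟩
  have h4 : mk₂ z s₀ t₀ = slice (levels (strings (trivialAction M))) (n := .mk 0)
      (stdSimplex.vertex 0) (Realisation.map (discMap (noString M)) base) := by
    refine ((mk₂_map_left (initialVertex p) z _ _).symm.trans
      (mk₂_map_right (initialVertex q) _ _ _).symm).trans ?_
    exact congrArg (fun y => mk₂ (Z := strings (trivialAction M)) y (stdSimplex.vertex 0) (stdSimplex.vertex 0))
      (Prod.ext (β := Fin 0 → M.obj (op (.mk 0))) rfl (Subsingleton.elim _ _))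
  have h5 := (h3.map (realign (trivialAction M)).continuous)
  rw [h4, pointIncl_eq] at h5
  exact (h2.trans h5).symm

lemma pointIncl_homotopic_const (b : Realisation (B M)) :
    (pointIncl M).Homotopic (ContinuousMap.const _ b) := by
  obtain ⟨ω⟩ := joined_pointIncl_base b
  refine .trans (g := .const _ (pointIncl M base))
    ⟨⟨⟨fun w => pointIncl M (contraction (w.2, w.1)), by fun_prop⟩,
    fun z => congrArg (pointIncl M) (contraction_zero z),
    fun z => congrArg (pointIncl M) (contraction_one z)⟩⟩ ?_
  exact ⟨⟨⟨fun w => ω w.1, by fun_prop⟩, fun z => ω.source, fun z => ω.target⟩⟩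

/-- Every null-homotopy of `|*| → |BM|` is, up to homotopy, the one given by the contraction of `|*|`
followed by a path; hence it induces a weak equivalence if the latter does. -/
lemma weakEq_fibreComparison {A : Action X M} (hA : WeakEq (quotFibre A)) (b : Realisation (B M))
    (H : (pointIncl M).Homotopy (ContinuousMap.const _ b)) : WeakEq (fibreComparison A b H) := by
  let ω : C(I, Realisation (B M)) := ⟨fun t => H (t, base), by fun_prop⟩
  have h0 : ω 0 = pointIncl M base := H.apply_zero _
  have h1 : ω 1 = b := H.apply_one _
  refine ((HoFibre.weakEq_trans (p := quotProj A) ω h0 h1).comp hA).of_homotopic ?_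
  -- interpolate in the square `(s, t) ↦ H (t, contraction s)` between its edge `s = 0` and the path
  -- which follows the edges `t = 0` and `s = 1`
  let P : ℝ → I := Set.projIcc 0 1 zero_le_one
  have hP : Continuous P := continuous_projIcc
  have hP0 : ∀ {r : ℝ}, r ≤ 0 → P r = 0 := fun h => Set.projIcc_of_le_left _ h
  have hP1 : ∀ {r : ℝ}, 1 ≤ r → P r = 1 := fun h => Set.projIcc_of_right_le _ h
  refine .symm ⟨⟨HoFibre.mk ((fibreIncl A).comp .snd)
    ⟨fun w => H (P ((1 - w.1.1) * w.2 + w.1.1 * P (w.2 * (1 + 1) - 1)),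
      contraction (collapse X w.1.2, w.1.1 * P (w.2 * (1 + 1)))), by fun_prop⟩
    (fun z => ?_) (fun z => ?_), fun z => ?_, fun z => ?_⟩⟩
  · have e1 : P ((1 - z.1) * (0 : I) + z.1 * P ((0 : I) * (1 + 1) - 1)) = 0 := by
      rw [hP0 (r := (0 : I) * (1 + 1) - 1) (by norm_num)]
      exact hP0 (by simp)
    have e2 : z.1 * P ((0 : I) * (1 + 1)) = 0 := by
      rw [hP0 (by simp), mul_zero]
    change H (_, contraction (_, _)) = _
    rw [e1, e2, contraction_zero, H.apply_zero]
    exact (DFunLike.congr_fun (square_comm A) z.2).symm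
  · have e1 : P ((1 - z.1) * (1 : I) + z.1 * P ((1 : I) * (1 + 1) - 1)) = 1 := by
      rw [hP1 (r := (1 : I) * (1 + 1) - 1) (by norm_num)]
      exact hP1 (by simp)
    change H (_, contraction (_, _)) = _
    rw [e1, H.apply_one]
    rfl
  · refine HoFibre.ext rfl fun t => ?_
    have e1 : P ((1 - ((0 : I) : ℝ)) * t + ((0 : I) : ℝ) * P (t * (1 + 1) - 1)) = t := by
      simp [P]
    change H (P ((1 - ((0 : I) : ℝ)) * t + ((0 : I) : ℝ) * P (t * (1 + 1) - 1)),
      contraction (collapse X z, 0 * P (t * (1 + 1)))) = H (t, collapse X z)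
    rw [e1, zero_mul, contraction_zero]
  · refine HoFibre.ext rfl fun t => ?_
    have e1 : P ((1 - ((1 : I) : ℝ)) * t + ((1 : I) : ℝ) * P (t * (1 + 1) - 1)) = P (t * (1 + 1) - 1) := by
      simp [P]
    change H (P ((1 - ((1 : I) : ℝ)) * t + ((1 : I) : ℝ) * P (t * (1 + 1) - 1)),
      contraction (collapse X z, 1 * P (t * (1 + 1)))) =
        concFun (fun t => pointIncl M (contraction (collapse X z, t))) ω 1 t
    rw [e1, one_mul, concFun]
    split_ifs with h
    · rw [hP0 (by simpa using h), H.apply_zero]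
      rfl
    · rw [hP1 (r := t * (1 + 1)) (le_of_not_ge (by simpa using h)), contraction_one]
      rfl

end Comparison

end SemiSimp

theorem mainTheorem12 (M : SemiSimp.SemiMon.{u}) (X : SemiSimp.SemiSSet.{u})
    (A : SemiSimp.Action X M)
    (hM : SemiSimp.AdmitsDegeneracies M.under) (hX : SemiSimp.AdmitsDegeneracies X)
    (hA : A.ByEquivalences) :
    ContractibleSpace (SemiSimp.Realisation (SemiSimp.disc SemiSimp.point.{u})) ∧
    ∀ b : SemiSimp.Realisation (SemiSimp.B M),
      (SemiSimp.pointIncl M).Homotopic (ContinuousMap.const _ b) ∧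
      ∀ H : (SemiSimp.pointIncl M).Homotopy (ContinuousMap.const _ b),
        SemiSimp.IsWeakEquiv (SemiSimp.fibreComparison A b H) := by
  obtain ⟨D⟩ := hX.exists_degeneracies
  obtain ⟨D'⟩ := hM.exists_degeneracies
  exact ⟨SemiSimp.Realisation.contractibleSpace_point, fun b =>
    ⟨SemiSimp.pointIncl_homotopic_const b, fun H =>
      (SemiSimp.weakEq_fibreComparison (SemiSimp.weakEq_quotFibre D D' hA) b H).isWeakEquiv⟩⟩
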